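/- **Setting.** Minkowski metric $\eta=\mathrm{diag}(1,-1,-1,-1)$; repeated Lorentz indices and repeated internal indices are summed. Let $I=I_1\sqcup I_2\sqcup I_3$ and $I_4$ be finite index sets. For $a\in I$ take free fields $v_a^\mu,u_a,\tilde u_a$ (null for $a\in I_3$) and $\Phi_a$ (null for $a\in I_1$), where $v_a^\mu,\Phi_a$ are Bose and $u_a,\tilde u_a$ are Fermi; all have mass $m_a$, with $m_a=0$ for $a\in I_1$, $m_a>0$ for $a\in I_2$; for $a\in I_3$ put $m_a=0$ and let $\Phi_a$ have mass $m^H_a\ge 0$. For $A\in I_4$ let $\psi_A$ be Dirac fields of mass $M_A\ge0$, $M=\mathrm{diag}(M_A)$. With $D_m$ the Pauli–Jordan distribution, the non-zero (anti)commutators at $x_1,x_2$ are $[v_a^\mu,v_b^\nu]=i\eta^{\mu\nu}\delta_{ab}D_{m_a}$, $[\Phi_a,\Phi_b]=-i\delta_{ab}D$, $\{u_a,\tilde u_b\}=-i\delta_{ab}D_{m_a}$, $\{\psi_A,\overline\psi_B\}=-i\delta_{AB}(i\gamma\cdot\partial+M_A)D_{M_A}$, evaluated at $x_1-x_2$. Let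 $d_Q$ and $d_Q^{\rm anti}$ be the odd derivations commuting with derivatives, zero on $\psi,\overline\psi$, with $d_Qv_a^\mu=i\partial^\mu u_a,\ d_Qu_a=0,\ d_Q\tilde u_a=-i(\partial_\mu v_a^\mu+m_a\Phi_a),\ d_Q\Phi_a=im_au_a$ and $d_Q^{\rm anti}v_a^\mu=i\partial^\mu\tilde u_a,\ d_Q^{\rm anti}u_a=i(\partial_\mu v_a^\mu+m_a\Phi_a),\ d_Q^{\rm anti}\tilde u_a=0,\ d_Q^{\rm anti}\Phi_a=im_a\tilde u_a$. With $F_a^{\mu\nu}=\partial^\mu v_a^\nu-\partial^\nu v_a^\mu$, chiral projectors $\gamma_\epsilon=\frac12(1+\epsilon\gamma_5)$, $j_a^\mu=\sum_\epsilon\overline\psi\,t_a^\epsilon\otimes\gamma^\mu\gamma_\epsilon\psi$, $j_a=\sum_\epsilon\overline\psi\,s_a^\epsilon\otimes\gamma_\epsilon\psi$, put $$T=f_{abc}(\tfrac12v_{a\mu}v_{b\nu}F_c^{\nu\mu}+u_av_b^\mu\partial_\mu\tilde u_c)+f'_{abc}(\Phi_a\partial_\mu\Phi_bv_c^\mu-m_b\Phi_av_b^\mu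 v_{c\mu}+m_b\Phi_a\tilde u_bu_c)+\tfrac1{3!}f''_{abc}\Phi_a\Phi_b\Phi_c+j_a^\mu v_{a\mu}+j_a\Phi_a,$$ $$T^\mu=f_{abc}(u_av_{b\nu}F_c^{\nu\mu}-\tfrac12u_au_b\partial^\mu\tilde u_c)+f'_{abc}(\Phi_a\partial^\mu\Phi_bu_c-m_b\Phi_av_b^\mu u_c)+j_a^\mu u_a,\qquad T^{\mu\nu}=\tfrac12f_{abc}u_au_bF_c^{\mu\nu},$$ $$T^\mu_{\rm anti}=f_{abc}(\tilde u_av_{b\nu}F_c^{\nu\mu}+\tilde u_a\,\partial_\nu v_b^\nu\,v_c^\mu-u_a\tilde u_b\partial^\mu\tilde u_c+\tfrac12\partial^\mu u_a\tilde u_b\tilde u_c-m_c\tilde u_av_b^\mu\Phi_c)+f'_{abc}(\Phi_a\partial^\mu\Phi_b\tilde u_c-m_b\Phi_av_b^\mu\tilde u_c)+j_a^\mu\tilde u_a,$$ $T_{\rm anti}^{\mu\nu}=\tfrac12f_{abc}\tilde u_a\tilde u_bF_c^{\mu\nu}$, $T_{\rm anti}=T$; write $T^I,T^I_{\rm anti}$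 for $I=\emptyset,[\mu],[\mu\nu]$, and $T^I=T^I_{\rm anti}=0$ for $|I|\ge3$. The tree product $T_{(0)}(A(x_1),B(x_2))$ is obtained from the one-contraction part of the graded commutator $[A(x_1),B(x_2)]=\sum p_j(\partial)D(x_1-x_2)W_j(x_1,x_2)$ by $D\to D^F$, where $D^F_m$ is the Feynman propagator, $(\square+m^2)D^F_m=\delta$; here the commutator of $\partial_\mu v_a^\mu$ with itself is written as $-i\square D_{m_a}=im_a^2D_{m_a}$ before the substitution. **Hypotheses** (on complex constants). *Linear:* $f_{abc}$ is completely antisymmetric and zero if an index is in $I_3$; $f'_{abc}=-f'_{bac}$, zero if $c\in I_3$ or $a\in I_1$ or $b\in I_1$; $f_{abc}m_c=f'_{cab}m_a-f'_{cba}m_b$; $f''_{abc}$ is completely symmetric, zero if an index is in $I_1$, and $f''_{abc}m_c=f'_{abc}(\mu_a^2-\mu_b^2)$ for all $a,b,c$, where $\mu_a=m_a^H$ on $I_3$ and $\mu_a=0$ elsewhere; $t_a^\epsilon=0$ for $a\in I_3$, $s_a^\epsilon=0$ for $a\in I_1$, $m_as_a^\epsilon=i(Mt_a^\epsilon-t_a^{-\epsilon}M)$.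 *Bilinear:* $f_{abc}f_{dec}+f_{bdc}f_{aec}+f_{dac}f_{bec}=0$; $f'_{dca}f'_{ceb}-f'_{dcb}f'_{cea}=-f_{abc}f'_{dec}$ for $a,b\in I_1\cup I_2$, $d,e\in I_2\cup I_3$; $[t_a^\epsilon,t_b^\epsilon]=if_{abc}t_c^\epsilon$; $t_a^{-\epsilon}s_b^\epsilon-s_b^\epsilon t_a^\epsilon=if'_{bca}s_c^\epsilon$. **Renormalizations.** Put $$N^{[\mu\nu]\emptyset}=\tfrac i2f_{abe}f_{cde}\tilde u_a\tilde u_bv_c^\mu v_d^\nu,\quad N^{[\mu][\nu]}=-N^{[\mu\nu]\emptyset},\quad N^{[\mu]\emptyset}=g^{(1)}_{abcd}\tilde u_av_b^\mu v_c^\nu v_{d\nu}+g^{(2)}_{abcd}u_a\tilde u_b\tilde u_cv_d^\mu+g^{(3)}_{abcd}\tilde u_av_b^\mu\Phi_c\Phi_d,$$ $$N^{\emptyset\emptyset}=h^{(1)}_{abcd}v_{a\mu}v_b^\mu v_c^\nu v_{d\nu}+h^{(2)}_{abcd}v_a^\mu v_{b\mu}\Phi_c\Phi_d+\tfrac1{4!}h^{(3)}_{abcd}\Phi_a\Phi_b\Phi_c\Phi_d,$$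 $g^{(1)}_{abcd}=-\frac i2(f_{ace}f_{bde}+f_{ade}f_{bce})$, $g^{(2)}_{abcd}=-\frac i2f_{ade}f_{bce}$, $g^{(3)}_{abcd}=-\frac i2(f'_{cea}f'_{edb}+f'_{dea}f'_{ecb})$, $h^{(1)}_{abcd}=-\frac i4(f_{ade}f_{bce}+f_{ace}f_{bde})$, $h^{(2)}_{abcd}=-\frac i2(f'_{dea}f'_{ecb}+f'_{cea}f'_{edb})$, with $h^{(3)}$ completely symmetric and $$h^{(3)}_{abcd}m_a=-2i(f'_{eba}f''_{ecd}+f'_{eca}f''_{ebd}+f'_{eda}f''_{ebc})\quad\text{for all }a,b,c,d;\qquad(*)$$ $N^{JI}=(-1)^{|I||J|}N^{IJ}$, and all other $N^{IJ}$ vanish. Let $N_Q^{IJ}$ be given by the same formulas with $\tilde u$ replaced by $u$ in $N^{[\mu\nu]\emptyset}$, $N^{[\mu][\nu]}$ and in the $g^{(1)},g^{(3)}$ terms, without the $g^{(2)}$ term, and with the same $N_Q^{\emptyset\emptyset}=N^{\emptyset\emptyset}$. **Theorem.** Put $R^{IJ}=T_{(0)}(T^I_{\rm anti}(x_1),T^J_{\rm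 anti}(x_2))-\delta(x_1-x_2)N^{IJ}(x_1)$. (1) For all $(I,J)\ne(\emptyset,\emptyset)$, $$d_Q^{\rm anti}R^{I,J}-i\frac{\partial}{\partial x_1^\mu}R^{I\mu,J}-i(-1)^{|I|}\frac{\partial}{\partial x_2^\mu}R^{I,J\mu}=0,$$ and the same identity holds with $d_Q$ and $R_Q^{IJ}=T_{(0)}(T^I(x_1),T^J(x_2))-\delta(x_1-x_2)N_Q^{IJ}(x_1)$ in place of $d_Q^{\rm anti}$ and $R^{IJ}$. (2) For every completely symmetric $h^{(3)}$ with $(*)$ both identities hold also for $I=J=\emptyset$, with one and the same $N^{\emptyset\emptyset}$. (3) A completely symmetric $h^{(3)}$ with $(*)$ exists if and only if the right-hand side of $(*)$ vanishes for all $a\in I_1$ and all $b,c,d$. -/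

import Mathlib

open MeasureTheory SchwartzMap TensorProduct LineDeriv

noncomputable section

namespace CausalYM

/-! ### Minkowski space, the Feynman propagator -/

/-- Minkowski space; `x 0` is the time coordinate. -/
abbrev Spacetime := EuclideanSpace ℝ (Fin 4)
/-- Three-momenta. -/
abbrev Momentum := EuclideanSpace ℝ (Fin 3)
/-- Scalar distributions in the relative coordinate `x₁ - x₂`. -/
abbrev Distr := 𝓢'(Spacetime, ℂ)

/-- The unit vector of the coordinate `x^μ`. -/
def basisVec (μ : Fin 4) : Spacetime := EuclideanSpace.single μ 1

/-- `ω(p) = √(p² + m²)`. -/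
def energy (m : ℝ) (p : Momentum) : ℝ := Real.sqrt (‖p‖ ^ 2 + m ^ 2)

/-- `exp(i p·x - i ω(p) |t|)` with `x = (t, x)`. -/
def planeWave (m : ℝ) (p : Momentum) (x : Spacetime) : ℂ :=
  Complex.exp (Complex.I * ((∑ j : Fin 3, p j * x j.succ - energy m p * |x 0| : ℝ) : ℂ))

/-- The Feynman propagator
`D^F_m(x) = ∫ d³p / (2π)³ · i / (2 ω(p)) · exp(i p·x - i ω(p) |t|)` applied to a test function;
with this normalisation `(□ + m²) D^F_m = δ`. -/
def feynmanFun (m : ℝ) (φ : 𝓢(Spacetime, ℂ)) : ℂ :=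
  ∫ p : Momentum, (((2 * Real.pi) ^ 3)⁻¹ : ℂ) * (Complex.I / (2 * energy m p)) *
    ∫ x : Spacetime, planeWave m p x * φ x

lemma planeWave_norm (m : ℝ) (p : Momentum) (x : Spacetime) : ‖planeWave m p x‖ = 1 := by
  rw [planeWave, mul_comm, Complex.norm_exp_ofReal_mul_I]

lemma planeWave_continuous (m : ℝ) :
    Continuous (fun q : Momentum × Spacetime => planeWave m q.1 q.2) := by
  unfold planeWave energy
  fun_prop

lemma planeWave_integrable (m : ℝ) (p : Momentum) (φ : 𝓢(Spacetime, ℂ)) :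
    Integrable (fun x => planeWave m p x * φ x) := by
  refine (φ.integrable (μ := volume)).bdd_mul (c := 1) ?_ ?_
  · exact ((planeWave_continuous m).comp (Continuous.prodMk_right p)).aestronglyMeasurable
  · exact Filter.Eventually.of_forall fun x => (planeWave_norm m p x).le

lemma planeWave_hasLineDerivAt (m : ℝ) (p : Momentum) (x : Spacetime) (k : Fin 3) :
    HasLineDerivAt ℝ (planeWave m p) (Complex.I * p k * planeWave m p x) x (basisVec k.succ) := by
  unfold HasLineDerivAt
  have h : (fun t : ℝ => planeWave m p (x + t • basisVec k.succ)) =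
      fun t : ℝ => planeWave m p x * Complex.exp (Complex.I * p k * t) := by
    funext t
    unfold planeWave
    rw [← Complex.exp_add]
    congr 1
    have h1 : ∀ j : Fin 3, p j * (x + t • basisVec k.succ) j.succ =
        p j * x j.succ + if j = k then p k * t else 0 := by
      intro j
      by_cases hj : j = k
      · subst hj; simp [basisVec]; ring
      · simp [basisVec, hj]
    have h0 : (x + t • basisVec k.succ) 0 = x 0 := by
      simp [basisVec, (Fin.succ_ne_zero k).symm]
    rw [Finset.sum_congr rfl (fun j _ => h1 j), h0, Finset.sum_add_distrib]
    simp
    ring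
  rw [h]
  have h2 : HasDerivAt (fun t : ℝ => Complex.exp (Complex.I * p k * t)) (Complex.I * p k) 0 := by
    have := ((hasDerivAt_id (0 : ℝ)).ofReal_comp.const_mul (Complex.I * p k)).cexp
    simpa using this
  have h3 := h2.const_mul (planeWave m p x)
  rwa [mul_comm (planeWave m p x) (Complex.I * p k)] at h3

lemma planeWave_lineDeriv (m : ℝ) (p : Momentum) (φ : 𝓢(Spacetime, ℂ)) (k : Fin 3) :
    ∫ x, planeWave m p x * (∂_{basisVec k.succ} φ) x =
      -(Complex.I * p k) * ∫ x, planeWave m p x * φ x := by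
  have := integral_bilinear_hasLineDerivAt_right_eq_neg_left_of_integrable
    (μ := (volume : Measure Spacetime)) (B := ContinuousLinearMap.mul ℝ ℂ)
    (f := planeWave m p) (f' := fun x => Complex.I * p k * planeWave m p x)
    (g := φ) (g' := ⇑(∂_{basisVec k.succ} φ : 𝓢(Spacetime, ℂ))) (v := basisVec k.succ)
    (by simpa [mul_assoc] using (planeWave_integrable m p φ).const_mul (Complex.I * p k))
    (planeWave_integrable m p (∂_{basisVec k.succ} φ)) (planeWave_integrable m p φ)
    (fun x _ => planeWave_hasLineDerivAt m p x k)
    (fun x _ => by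
      have := (φ.differentiableAt (x := x)).hasFDerivAt.hasLineDerivAt (basisVec k.succ)
      simpa [SchwartzMap.lineDerivOp_apply_eq_fderiv] using this)
  simp only [ContinuousLinearMap.mul_apply'] at this
  rw [this, ← integral_const_mul, ← integral_neg]
  congr 1; funext x; ring

/-- `1` minus the Laplace operator in the space variables. -/
def spaceOp : 𝓢(Spacetime, ℂ) →L[ℂ] 𝓢(Spacetime, ℂ) :=
  ContinuousLinearMap.id ℂ _ - ∑ k : Fin 3,
    (lineDerivOpCLM ℂ 𝓢(Spacetime, ℂ) (basisVec k.succ)) ∘L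
      (lineDerivOpCLM ℂ 𝓢(Spacetime, ℂ) (basisVec k.succ))

lemma planeWave_spaceOp (m : ℝ) (p : Momentum) (φ : 𝓢(Spacetime, ℂ)) :
    ∫ x, planeWave m p x * spaceOp φ x =
      (1 + ‖p‖ ^ 2 : ℝ) * ∫ x, planeWave m p x * φ x := by
  have h : ∀ x, planeWave m p x * spaceOp φ x = planeWave m p x * φ x -
      ∑ k : Fin 3, planeWave m p x * (∂_{basisVec k.succ} (∂_{basisVec k.succ} φ)) x := by
    intro x
    simp [spaceOp, mul_sub, Finset.mul_sum]
  simp_rw [h]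
  rw [integral_sub (planeWave_integrable m p φ)
    (integrable_finsetSum _ fun k _ => planeWave_integrable m p _),
    integral_finsetSum _ fun k _ => planeWave_integrable m p _]
  simp_rw [planeWave_lineDeriv]
  rw [EuclideanSpace.norm_sq_eq]
  push_cast
  rw [add_mul, Finset.sum_mul, one_mul, sub_eq_add_neg, ← Finset.sum_neg_distrib]
  congr 1
  refine Finset.sum_congr rfl fun k _ => ?_
  have : ((‖p k‖ : ℝ) : ℂ) ^ 2 = (p k : ℂ) ^ 2 := by
    rw [Real.norm_eq_abs]; exact_mod_cast congrArg (fun r : ℝ => (r : ℂ)) (sq_abs (p k))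
  rw [this]
  linear_combination (-(p k : ℂ) ^ 2 * ∫ x, planeWave m p x * φ x) * Complex.I_sq

lemma planeWave_bound (m : ℝ) (p : Momentum) (φ : 𝓢(Spacetime, ℂ)) :
    ‖∫ x, planeWave m p x * φ x‖ ≤
      ((1 + ‖p‖ ^ 2) ^ 2)⁻¹ * ∫ x, ‖spaceOp (spaceOp φ) x‖ := by
  have hpos : (0 : ℝ) < 1 + ‖p‖ ^ 2 := by positivity
  have h := planeWave_spaceOp m p (spaceOp φ)
  rw [planeWave_spaceOp m p φ] at h
  have h2 : ‖∫ x, planeWave m p x * spaceOp (spaceOp φ) x‖ ≤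
      ∫ x, ‖spaceOp (spaceOp φ) x‖ := by
    refine (norm_integral_le_integral_norm _).trans (le_of_eq ?_)
    simp [planeWave_norm]
  rw [h, norm_mul, norm_mul, Complex.norm_real, Real.norm_of_nonneg hpos.le] at h2
  rw [inv_mul_eq_div, le_div_iff₀ (by positivity)]
  linarith

lemma energy_weight_integrable (m : ℝ) :
    Integrable (fun p : Momentum => (energy m p)⁻¹ * ((1 + ‖p‖ ^ 2) ^ 2)⁻¹) := by
  have := integrable_fun_norm_addHaar (volume : Measure Momentum)
    (f := fun r : ℝ => (Real.sqrt (r ^ 2 + m ^ 2))⁻¹ * ((1 + r ^ 2) ^ 2)⁻¹)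
  unfold energy
  rw [this]
  have hd : Module.finrank ℝ Momentum - 1 = 2 := by simp
  rw [hd]
  refine Integrable.mono' (g := fun r : ℝ => (1 + r ^ 2)⁻¹)
    integrable_inv_one_add_sq.integrableOn ?_ ?_
  · refine Measurable.aestronglyMeasurable ?_
    simp only [smul_eq_mul]
    fun_prop
  · refine (ae_restrict_iff' measurableSet_Ioi).mpr (Filter.Eventually.of_forall fun r hr => ?_)
    have hr' : (0 : ℝ) < r := hr
    have h1 : (Real.sqrt (r ^ 2 + m ^ 2))⁻¹ ≤ r⁻¹ := by
      apply inv_anti₀ hr'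
      exact Real.le_sqrt_of_sq_le (by nlinarith [sq_nonneg m])
    rw [smul_eq_mul, Real.norm_of_nonneg (by positivity)]
    calc r ^ 2 * ((Real.sqrt (r ^ 2 + m ^ 2))⁻¹ * ((1 + r ^ 2) ^ 2)⁻¹)
        ≤ r ^ 2 * (r⁻¹ * ((1 + r ^ 2) ^ 2)⁻¹) := by gcongr
      _ = r * ((1 + r ^ 2) ^ 2)⁻¹ := by field_simp
      _ ≤ (1 + r ^ 2) * ((1 + r ^ 2) ^ 2)⁻¹ := by
          gcongr; nlinarith [sq_nonneg (r - 1)]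
      _ = (1 + r ^ 2)⁻¹ := by field_simp

/-- The constant in the continuity bound of the Feynman propagator. -/
def feynmanConst (m : ℝ) : ℝ :=
  ∫ p : Momentum, ((2 * Real.pi) ^ 3)⁻¹ * 2⁻¹ * ((energy m p)⁻¹ * ((1 + ‖p‖ ^ 2) ^ 2)⁻¹)

lemma feynman_pointwise_bound (m : ℝ) (φ : 𝓢(Spacetime, ℂ)) (p : Momentum) :
    ‖(((2 * Real.pi) ^ 3)⁻¹ : ℂ) * (Complex.I / (2 * energy m p)) *
      ∫ x : Spacetime, planeWave m p x * φ x‖ ≤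
    ((2 * Real.pi) ^ 3)⁻¹ * 2⁻¹ * ((energy m p)⁻¹ * ((1 + ‖p‖ ^ 2) ^ 2)⁻¹) *
      ∫ x, ‖spaceOp (spaceOp φ) x‖ := by
  have he : 0 ≤ energy m p := Real.sqrt_nonneg _
  have hpi := Real.pi_pos
  have : ‖(((2 * Real.pi) ^ 3)⁻¹ : ℂ) * (Complex.I / (2 * energy m p))‖ =
      ((2 * Real.pi) ^ 3)⁻¹ * 2⁻¹ * (energy m p)⁻¹ := by
    simp [abs_of_nonneg he, abs_of_pos hpi]
    ring
  rw [norm_mul, this]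
  calc _ ≤ ((2 * Real.pi) ^ 3)⁻¹ * 2⁻¹ * (energy m p)⁻¹ *
      (((1 + ‖p‖ ^ 2) ^ 2)⁻¹ * ∫ x, ‖spaceOp (spaceOp φ) x‖) := by
        gcongr
        exact planeWave_bound m p φ
    _ = _ := by ring

lemma feynman_integrable (m : ℝ) (φ : 𝓢(Spacetime, ℂ)) :
    Integrable (fun p : Momentum => (((2 * Real.pi) ^ 3)⁻¹ : ℂ) *
      (Complex.I / (2 * energy m p)) * ∫ x : Spacetime, planeWave m p x * φ x) := by
  refine Integrable.mono' (((energy_weight_integrable m).const_mul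
    (((2 * Real.pi) ^ 3)⁻¹ * 2⁻¹)).mul_const (∫ x, ‖spaceOp (spaceOp φ) x‖)) ?_
    (Filter.Eventually.of_forall (feynman_pointwise_bound m φ))
  refine AEStronglyMeasurable.mul ?_ ?_
  · refine Measurable.aestronglyMeasurable ?_
    unfold energy
    fun_prop
  · refine StronglyMeasurable.aestronglyMeasurable ?_
    refine StronglyMeasurable.integral_prod_right ?_
    refine Continuous.stronglyMeasurable ?_
    exact (planeWave_continuous m).mul (φ.continuous.comp continuous_snd)

lemma feynmanFun_add (m : ℝ) (φ ψ : 𝓢(Spacetime, ℂ)) :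
    feynmanFun m (φ + ψ) = feynmanFun m φ + feynmanFun m ψ := by
  unfold feynmanFun
  rw [← integral_add (feynman_integrable m φ) (feynman_integrable m ψ)]
  congr 1; funext p
  rw [← mul_add, ← integral_add (planeWave_integrable m p φ) (planeWave_integrable m p ψ)]
  simp [mul_add]

lemma feynmanFun_smul (m : ℝ) (c : ℂ) (φ : 𝓢(Spacetime, ℂ)) :
    feynmanFun m (c • φ) = c • feynmanFun m φ := by
  unfold feynmanFun
  rw [← integral_smul]
  congr 1; funext p
  have : ∫ x, planeWave m p x * (c • φ) x = c * ∫ x, planeWave m p x * φ x := by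
    rw [← integral_const_mul]
    congr 1; funext x; simp; ring
  rw [this, smul_eq_mul]; ring

lemma feynmanFun_bound (m : ℝ) (φ : 𝓢(Spacetime, ℂ)) :
    ‖feynmanFun m φ‖ ≤ feynmanConst m * ∫ x, ‖spaceOp (spaceOp φ) x‖ := by
  unfold feynmanFun feynmanConst
  rw [← integral_mul_const]
  refine (norm_integral_le_integral_norm _).trans ?_
  exact integral_mono (feynman_integrable m φ).norm
    (((energy_weight_integrable m).const_mul _).mul_const _) (feynman_pointwise_bound m φ)

lemma feynmanFun_continuous (m : ℝ) : Continuous (feynmanFun m) := by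
  have hB : Continuous fun φ : 𝓢(Spacetime, ℂ) =>
      feynmanConst m * ‖(spaceOp (spaceOp φ)).toLp 1 (volume : Measure Spacetime)‖ :=
    continuous_const.mul ((SchwartzMap.continuous_toLp.comp
      (spaceOp.continuous.comp spaceOp.continuous)).norm)
  let L : 𝓢(Spacetime, ℂ) →ₗ[ℂ] ℂ :=
    { toFun := feynmanFun m, map_add' := feynmanFun_add m, map_smul' := feynmanFun_smul m }
  refine continuous_of_continuousAt_zero L ?_
  have h0 : L 0 = 0 := map_zero L
  unfold ContinuousAt
  rw [h0]
  refine squeeze_zero_norm (a := fun φ : 𝓢(Spacetime, ℂ) =>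
      feynmanConst m * ‖(spaceOp (spaceOp φ)).toLp 1 (volume : Measure Spacetime)‖) ?_ ?_
  · intro φ
    rw [SchwartzMap.norm_toLp_one]
    exact feynmanFun_bound m φ
  · have h := hB.tendsto 0
    have : ‖(spaceOp (spaceOp (0 : 𝓢(Spacetime, ℂ)))).toLp 1 (volume : Measure Spacetime)‖ = 0 := by
      rw [SchwartzMap.norm_toLp_one]; simp
    rwa [this, mul_zero] at h

/-- The Feynman propagator `D^F_m` as a tempered distribution. -/
def feynman (m : ℝ) : Distr :=
  ContinuousLinearMap.toPointwiseConvergenceCLM ℂ (RingHom.id ℂ) _ _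
    { toFun := feynmanFun m
      map_add' := feynmanFun_add m
      map_smul' := feynmanFun_smul m
      cont := feynmanFun_continuous m }

/-- The Minkowski metric is `diag(1, -1, -1, -1)`; `η μ` is its diagonal entry. -/
def η (μ : Fin 4) : ℂ := if μ = 0 then 1 else -1

/-- `∂_μ` on distributions. -/
def distD (μ : Fin 4) : Distr →ₗ[ℂ] Distr :=
  (lineDerivOpCLM ℂ Distr (basisVec μ)).toLinearMap

/-- `∂^α` on distributions, for a multi-index `α`. -/
def distPartials (α : Fin 4 → ℕ) : Module.End ℂ Distr :=
  (distD 0) ^ (α 0) * (distD 1) ^ (α 1) * (distD 2) ^ (α 2) * (distD 3) ^ (α 3)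

/-! ### Words and (graded) derivations of a free algebra -/

section Words

variable {X : Type*}

/-- The monomial `x₁ x₂ ⋯ x_n`. -/
def word (w : List X) : FreeAlgebra ℂ X := (w.map (FreeAlgebra.ι ℂ)).prod

/-- `x₁ ⋯ x_n ↦ ∑_k σ(x₁) ⋯ σ(x_{k-1}) x₁ ⋯ x_{k-1} D(x_k) x_{k+1} ⋯ x_n`. -/
def wordDer (σ : X → ℂ) (D : X → FreeAlgebra ℂ X) : List X → FreeAlgebra ℂ X
  | [] => 0
  | x :: w => D x * word w + σ x • (FreeAlgebra.ι ℂ x * wordDer σ D w)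

/-- The linear extension of `wordDer`: the derivation (`σ = 1`), or the odd derivation
(`σ` the parity sign), with the values `D` on the letters. -/
def derExt (σ : X → ℂ) (D : X → FreeAlgebra ℂ X) : FreeAlgebra ℂ X →ₗ[ℂ] FreeAlgebra ℂ X :=
  (FreeAlgebra.basisFreeMonoid ℂ X).constr ℂ fun w => wordDer σ D w.toList

end Words

/-! ### Fields, jets, Wick polynomials -/

/-- The three sorts of indices: `I₁`, `I₂`, `I₃`. -/
inductive Kind
  | massless
  | massive
  | higgs
  deriving DecidableEq

/-- The basic fields: `v_a^μ`, the scalar field `∂_μ v_a^μ`, the ghosts `u_a`, the anti-ghosts `ũ_a`,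
`Φ_a`, and the components of the Dirac fields `ψ_A` and of their adjoints. -/
inductive BasicField (ι τ : Type*)
  | vec (a : ι) (μ : Fin 4)
  | divVec (a : ι)
  | ghost (a : ι)
  | anti (a : ι)
  | scal (a : ι)
  | psi (A : τ) (r : Fin 4)
  | psiBar (A : τ) (r : Fin 4)

/-- Statistics of the basic fields: `true` for Fermi. -/
def BasicField.odd {ι τ : Type*} : BasicField ι τ → Bool
  | .vec _ _ => false
  | .divVec _ => false
  | .ghost _ => true
  | .anti _ => true
  | .scal _ => false
  | .psi _ _ => true
  | .psiBar _ _ => true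

/-- A derivative `∂^α φ` of a basic field. -/
structure Jet (ι τ : Type*) where
  field : BasicField ι τ
  idx : Fin 4 → ℕ

/-- Polynomials in the jets at one point. They represent Wick (normally ordered) polynomials; the
(anti)commutation of the factors and the free field equations are imposed in `nullSpace` below. -/
abbrev Wick (ι τ : Type*) := FreeAlgebra ℂ (Jet ι τ)

/-- Polynomials in the jets at the two points `x₁` (label `0`) and `x₂` (label `1`). -/
abbrev Wick₂ (ι τ : Type*) := FreeAlgebra ℂ (Fin 2 × Jet ι τ)

/-- Expressions `∑_j d_j(x₁ - x₂) W_j(x₁, x₂)` with distributions `d_j` and Wick polynomials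
`W_j`. -/
abbrev TwoPoint (ι τ : Type*) := Distr ⊗[ℂ] Wick₂ ι τ

section Jets

variable {ι τ : Type*}

/-- The sign `-1` for two Fermi fields, `1` otherwise. -/
def exchSign (j k : Jet ι τ) : ℂ := if (j.field.odd && k.field.odd) = true then -1 else 1

/-- The parity sign of a jet. -/
def paritySign (j : Jet ι τ) : ℂ := if j.field.odd = true then -1 else 1

/-- `∂_μ` of a jet. -/
def Jet.shift (μ : Fin 4) (j : Jet ι τ) : Jet ι τ := ⟨j.field, j.idx + Pi.single μ 1⟩

/-- An underived field. -/
def fieldWick (φ : BasicField ι τ) : Wick ι τ := FreeAlgebra.ι ℂ ⟨φ, 0⟩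

/-- `∂_μ` on Wick polynomials. -/
def wickD (μ : Fin 4) : Wick ι τ →ₗ[ℂ] Wick ι τ :=
  derExt (fun _ => 1) fun j => FreeAlgebra.ι ℂ (j.shift μ)

/-- `∂^α` on Wick polynomials. -/
def wickPartials (α : Fin 4 → ℕ) : Module.End ℂ (Wick ι τ) :=
  (wickD 0) ^ (α 0) * (wickD 1) ^ (α 1) * (wickD 2) ^ (α 2) * (wickD 3) ^ (α 3)

/-- The Wick polynomial `W(x_k)`, as a polynomial at two points. -/
def at₂ (k : Fin 2) : Wick ι τ →ₐ[ℂ] Wick₂ ι τ :=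
  FreeAlgebra.lift ℂ fun j => FreeAlgebra.ι ℂ (k, j)

/-- `∂/∂x_k^μ` on Wick polynomials at two points. -/
def wick₂D (k : Fin 2) (μ : Fin 4) : Wick₂ ι τ →ₗ[ℂ] Wick₂ ι τ :=
  derExt (fun _ => 1) fun x =>
    if x.1 = k then FreeAlgebra.ι ℂ (x.1, x.2.shift μ) else 0

/-- `∂/∂x_k^μ` of `d(x₁ - x₂) W(x₁, x₂)`. -/
def pd (k : Fin 2) (μ : Fin 4) : TwoPoint ι τ →ₗ[ℂ] TwoPoint ι τ :=
  (if k = 0 then (1 : ℂ) else -1) • LinearMap.rTensor (Wick₂ ι τ) (distD μ) +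
    LinearMap.lTensor Distr (wick₂D k μ)

/-- The odd derivation of the two-point expressions induced by an odd derivation which is given on
the jets; it does not act on the numerical distributions. -/
def oddDer₂ (D : Jet ι τ → Wick ι τ) : TwoPoint ι τ →ₗ[ℂ] TwoPoint ι τ :=
  LinearMap.lTensor Distr (derExt (fun x => paritySign x.2) fun x => at₂ x.1 (D x.2))

/-- `δ(x₁ - x₂) N(x₁)`. -/
def quasiLocal (N : Wick ι τ) : TwoPoint ι τ :=
  TemperedDistribution.delta (0 : Spacetime) ⊗ₜ[ℂ] at₂ 0 N

end Jets

/-! ### The Yang-Mills models -/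

/-- The data of a Yang-Mills model: the index set `ι = I₁ ∪ I₂ ∪ I₃` (through `kind`), the index set
`τ = I₄` of the Dirac fields, the masses, the constants of the interaction Lagrangian, and the Dirac
matrices. The chirality `ε = ±` is a Boolean. -/
structure YangMills (ι τ : Type*) where
  kind : ι → Kind
  /-- the masses `m_a`; zero on `I₁` and `I₃` -/
  m : ι → ℝ
  /-- the masses `m^H_a` of the Higgs fields -/
  mH : ι → ℝ
  /-- the masses `M_A` of the Dirac fields -/
  mF : τ → ℝ
  f : ι → ι → ι → ℂ
  f' : ι → ι → ι → ℂ
  f'' : ι → ι → ι → ℂ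
  t : ι → Bool → Matrix τ τ ℂ
  s : ι → Bool → Matrix τ τ ℂ
  γ : Fin 4 → Matrix (Fin 4) (Fin 4) ℂ
  m_pos : ∀ a, kind a = Kind.massive → 0 < m a
  m_zero : ∀ a, kind a ≠ Kind.massive → m a = 0
  mH_nonneg : ∀ a, kind a = Kind.higgs → 0 ≤ mH a
  mF_nonneg : ∀ A, 0 ≤ mF A
  clifford : ∀ μ ν, γ μ * γ ν + γ ν * γ μ = (if μ = ν then 2 * η μ else 0) • 1

namespace YangMills

section Basic

variable {ι τ : Type*} (M : YangMills ι τ)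

/-- `m^H_a` on `I₃`, extended by zero. -/
def higgsMass (a : ι) : ℝ := if M.kind a = Kind.higgs then M.mH a else 0

/-- The mass of the field `Φ_a`. -/
def scalMass (a : ι) : ℝ := if M.kind a = Kind.higgs then M.mH a else M.m a

/-- `v_a^μ`; null for `a ∈ I₃`. -/
def v (a : ι) (μ : Fin 4) : Wick ι τ := if M.kind a = Kind.higgs then 0 else fieldWick (.vec a μ)

/-- `v_{aμ}`. -/
def vLow (a : ι) (μ : Fin 4) : Wick ι τ := η μ • M.v a μ

/-- `∂_μ v_a^μ`. -/
def divv (a : ι) : Wick ι τ := if M.kind a = Kind.higgs then 0 else fieldWick (.divVec a)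

/-- `F_a^{μν} = ∂^μ v_a^ν - ∂^ν v_a^μ`. -/
def F (a : ι) (μ ν : Fin 4) : Wick ι τ := η μ • wickD μ (M.v a ν) - η ν • wickD ν (M.v a μ)

/-- `u_a`; null for `a ∈ I₃`. -/
def u (a : ι) : Wick ι τ := if M.kind a = Kind.higgs then 0 else fieldWick (.ghost a)

/-- `ũ_a`; null for `a ∈ I₃`. -/
def uBar (a : ι) : Wick ι τ := if M.kind a = Kind.higgs then 0 else fieldWick (.anti a)

/-- `Φ_a`; null for `a ∈ I₁`. -/
def Φ (a : ι) : Wick ι τ := if M.kind a = Kind.massless then 0 else fieldWick (.scal a)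

/-- The values of `d_Q` on the basic fields. -/
def brstField : BasicField ι τ → Wick ι τ
  | .vec a μ => (Complex.I * η μ) • wickD μ (M.u a)
  | .divVec a => ∑ μ, wickD μ ((Complex.I * η μ) • wickD μ (M.u a))
  | .ghost _ => 0
  | .anti a => (-Complex.I) • (M.divv a + (M.m a : ℂ) • M.Φ a)
  | .scal a => (Complex.I * M.m a) • M.u a
  | .psi _ _ => 0
  | .psiBar _ _ => 0

/-- The values of `d_Q^anti` on the basic fields. -/
def antiBrstField : BasicField ι τ → Wick ι τ
  | .vec a μ => (Complex.I * η μ) • wickD μ (M.uBar a)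
  | .divVec a => ∑ μ, wickD μ ((Complex.I * η μ) • wickD μ (M.uBar a))
  | .ghost a => Complex.I • (M.divv a + (M.m a : ℂ) • M.Φ a)
  | .anti _ => 0
  | .scal a => (Complex.I * M.m a) • M.uBar a
  | .psi _ _ => 0
  | .psiBar _ _ => 0

/-- `d_Q` on two-point expressions; `d_Q` commutes with derivatives. -/
def dQ : TwoPoint ι τ →ₗ[ℂ] TwoPoint ι τ :=
  oddDer₂ fun j => wickPartials j.idx (M.brstField j.field)

/-- `d_Q^anti` on two-point expressions. -/
def dQAnti : TwoPoint ι τ →ₗ[ℂ] TwoPoint ι τ :=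
  oddDer₂ fun j => wickPartials j.idx (M.antiBrstField j.field)

/-- The free field equations, in the form `p = 0`, together with the definition of `∂_μ v_a^μ`. -/
inductive FieldEq : Wick ι τ → Prop
  | vec (a : ι) (ν : Fin 4) : FieldEq (∑ μ, η μ • wickD μ (wickD μ (fieldWick (.vec a ν))) +
      ((M.m a : ℂ) ^ 2) • fieldWick (.vec a ν))
  | ghost (a : ι) : FieldEq (∑ μ, η μ • wickD μ (wickD μ (fieldWick (.ghost a))) +
      ((M.m a : ℂ) ^ 2) • fieldWick (.ghost a))
  | anti (a : ι) : FieldEq (∑ μ, η μ • wickD μ (wickD μ (fieldWick (.anti a))) +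
      ((M.m a : ℂ) ^ 2) • fieldWick (.anti a))
  | scal (a : ι) : FieldEq (∑ μ, η μ • wickD μ (wickD μ (fieldWick (.scal a))) +
      ((M.scalMass a : ℂ) ^ 2) • fieldWick (.scal a))
  | divVec (a : ι) : FieldEq (fieldWick (.divVec a) - ∑ μ, wickD μ (fieldWick (.vec a μ)))
  | dirac (A : τ) (r : Fin 4) : FieldEq
      (∑ μ, ∑ q, (Complex.I * M.γ μ r q) • wickD μ (fieldWick (.psi A q)) -
        (M.mF A : ℂ) • fieldWick (.psi A r))
  | diracBar (A : τ) (q : Fin 4) : FieldEq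
      (∑ μ, ∑ r, (Complex.I * M.γ μ r q) • wickD μ (fieldWick (.psiBar A r)) +
        (M.mF A : ℂ) • fieldWick (.psiBar A q))
  | deriv (μ : Fin 4) (p : Wick ι τ) : FieldEq p → FieldEq (wickD μ p)

/-- The elementary two-point expressions that vanish as distribution-valued operators: graded
commutation inside normal products, free field equations, `δ(x₁ - x₂) (φ(x₁) - φ(x₂)) = 0`, and the
derivatives of such expressions. -/
inductive NullRel : TwoPoint ι τ → Prop
  | exch (d : Distr) (p q : Wick₂ ι τ) (x y : Fin 2 × Jet ι τ) :
      NullRel (d ⊗ₜ[ℂ] (p * (FreeAlgebra.ι ℂ x * FreeAlgebra.ι ℂ y -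
        exchSign x.2 y.2 • (FreeAlgebra.ι ℂ y * FreeAlgebra.ι ℂ x)) * q))
  | fieldEq (d : Distr) (p q : Wick₂ ι τ) (k : Fin 2) (e : Wick ι τ) :
      M.FieldEq e → NullRel (d ⊗ₜ[ℂ] (p * at₂ k e * q))
  | diag (p q : Wick₂ ι τ) (j : Jet ι τ) :
      NullRel (TemperedDistribution.delta (0 : Spacetime) ⊗ₜ[ℂ]
        (p * (FreeAlgebra.ι ℂ (0, j) - FreeAlgebra.ι ℂ (1, j)) * q))
  | deriv (k : Fin 2) (μ : Fin 4) (X : TwoPoint ι τ) : NullRel X → NullRel (pd k μ X)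

/-- The two-point expressions that vanish. -/
def nullSpace : Submodule ℂ (TwoPoint ι τ) := Submodule.span ℂ {X | M.NullRel X}

/-- Operator-valued distributions in `x₁, x₂`: two-point expressions modulo `nullSpace`. -/
abbrev OpDistr := TwoPoint ι τ ⧸ M.nullSpace

end Basic

/-! ### Tree contributions -/

section Tree

variable {ι τ : Type*} [DecidableEq ι] [DecidableEq τ] (M : YangMills ι τ)

/-- The graded commutators of the basic fields at `x₁` and `x₂`, written with derivatives of `Δ_m`
but without d'Alembertians, as distributions in `x₁ - x₂`. For `Δ_m` the Pauli-Jordan distribution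
`D_m` these are the causal (anti)commutators `[v_a^μ, v_b^ν] = i η^{μν} δ_{ab} D_{m_a}`,
`[Φ_a, Φ_b] = - i δ_{ab} D`, `[u_a, ũ_b] = - i δ_{ab} D_{m_a}`, `[ũ_a, u_b] = i δ_{ab} D_{m_a}`,
`[ψ_A, ψ̄_B] = - i δ_{AB} (i γ·∂ + M_A) D_{M_A}`; in particular
`[∂_μ v_a^μ, ∂_ν v_a^ν] = - i □ D_{m_a} = i m_a² D_{m_a}`. -/
def fieldContr (Δ : ℝ → Distr) : BasicField ι τ → BasicField ι τ → Distr
  | .vec a μ, .vec b ν => if a = b ∧ μ = ν then (Complex.I * η μ) • Δ (M.m a) else 0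
  | .vec a μ, .divVec b => if a = b then (-(Complex.I * η μ)) • distD μ (Δ (M.m a)) else 0
  | .divVec a, .vec b ν => if a = b then (Complex.I * η ν) • distD ν (Δ (M.m a)) else 0
  | .divVec a, .divVec b => if a = b then (Complex.I * (M.m a : ℂ) ^ 2) • Δ (M.m a) else 0
  | .scal a, .scal b => if a = b then (-Complex.I) • Δ (M.scalMass a) else 0
  | .ghost a, .anti b => if a = b then (-Complex.I) • Δ (M.m a) else 0
  | .anti a, .ghost b => if a = b then Complex.I • Δ (M.m a) else 0
  | .psi A r, .psiBar B q => if A = B then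
      (-Complex.I) • (∑ μ, (Complex.I * M.γ μ r q) • distD μ (Δ (M.mF A)) +
        (if r = q then (M.mF A : ℂ) else 0) • Δ (M.mF A)) else 0
  | .psiBar A q, .psi B r => if A = B then
      (-Complex.I) • (∑ μ, (Complex.I * M.γ μ r q) • distD μ (Δ (M.mF A)) -
        (if r = q then (M.mF A : ℂ) else 0) • Δ (M.mF A)) else 0
  | _, _ => 0

/-- The same for jets: `∂^α` at `x₁` and `∂^β` at `x₂` act as `∂^α (-∂)^β` on functions of
`x₁ - x₂`. -/
def contr (Δ : ℝ → Distr) (j k : Jet ι τ) : Distr :=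
  ((-1 : ℂ) ^ (∑ μ, k.idx μ)) • distPartials (j.idx + k.idx) (M.fieldContr Δ j.field k.field)

/-- Sum over all single contractions of a factor of the first monomial (at `x₁`) with a factor of
the second one (at `x₂`). -/
def treeWord (Δ : ℝ → Distr) (w₁ w₂ : List (Jet ι τ)) : TwoPoint ι τ :=
  ∑ i : Fin w₁.length, ∑ k : Fin w₂.length,
    (((w₁.drop (i.val + 1)).map (exchSign (w₁.get i))).prod *
      ((w₂.take k.val).map (exchSign (w₂.get k))).prod) •
    (M.contr Δ (w₁.get i) (w₂.get k) ⊗ₜ[ℂ]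
      (at₂ 0 (word (w₁.eraseIdx i.val)) * at₂ 1 (word (w₂.eraseIdx k.val))))

/-- Bilinear extension of `treeWord`. For `Δ = D` it is the tree part of the causal graded
commutator `[A(x₁), B(x₂)]`. -/
def tree (Δ : ℝ → Distr) : Wick ι τ →ₗ[ℂ] Wick ι τ →ₗ[ℂ] TwoPoint ι τ :=
  (FreeAlgebra.basisFreeMonoid ℂ (Jet ι τ)).constr ℂ fun w₁ =>
    (FreeAlgebra.basisFreeMonoid ℂ (Jet ι τ)).constr ℂ fun w₂ =>
      M.treeWord Δ w₁.toList w₂.toList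

/-- The tree contribution `T_(0)(A(x₁), B(x₂))` of the chronological product: the substitution
`D → D^F` in the tree part of the causal commutator. -/
def T₀ (A B : Wick ι τ) : TwoPoint ι τ := M.tree feynman A B

end Tree

/-! ### The interaction Lagrangian and its descendants -/

section Lagrangian

variable {ι τ : Type*} [Fintype ι] [Fintype τ] (M : YangMills ι τ)

/-- `γ₅`. -/
def γ5 : Matrix (Fin 4) (Fin 4) ℂ := Complex.I • (M.γ 0 * M.γ 1 * M.γ 2 * M.γ 3)

/-- The chiral projectors `γ_ε = (1 + ε γ₅) / 2`. -/
def γε (ε : Bool) : Matrix (Fin 4) (Fin 4) ℂ :=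
  (1 / 2 : ℂ) • (1 + (if ε = true then (1 : ℂ) else -1) • M.γ5)

/-- `ψ̄ (x ⊗ G) ψ`. -/
def bilin (x : Matrix τ τ ℂ) (G : Matrix (Fin 4) (Fin 4) ℂ) : Wick ι τ :=
  ∑ A, ∑ B, ∑ r, ∑ q, (x A B * G r q) • (fieldWick (.psiBar A r) * fieldWick (.psi B q))

/-- `j_a^μ`. -/
def jVec (a : ι) (μ : Fin 4) : Wick ι τ := ∑ ε : Bool, bilin (M.t a ε) (M.γ μ * M.γε ε)

/-- `j_a`. -/
def jScal (a : ι) : Wick ι τ := ∑ ε : Bool, bilin (M.s a ε) (M.γε ε)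

/-- The interaction Lagrangian `T`. -/
def lagr : Wick ι τ :=
  (∑ a, ∑ b, ∑ c, M.f a b c •
    ((1 / 2 : ℂ) • (∑ μ, ∑ ν, M.vLow a μ * M.vLow b ν * M.F c ν μ) +
      ∑ μ, M.u a * M.v b μ * wickD μ (M.uBar c))) +
  (∑ a, ∑ b, ∑ c, M.f' a b c •
    ((∑ μ, M.Φ a * wickD μ (M.Φ b) * M.v c μ) -
      (M.m b : ℂ) • (∑ μ, M.Φ a * M.v b μ * M.vLow c μ) +
      (M.m b : ℂ) • (M.Φ a * M.uBar b * M.u c))) +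
  (1 / 6 : ℂ) • (∑ a, ∑ b, ∑ c, M.f'' a b c • (M.Φ a * M.Φ b * M.Φ c)) +
  (∑ a, ∑ μ, M.jVec a μ * M.vLow a μ) + ∑ a, M.jScal a * M.Φ a

/-- `T^μ`. -/
def lagr1 (μ : Fin 4) : Wick ι τ :=
  (∑ a, ∑ b, ∑ c, M.f a b c •
    ((∑ ν, M.u a * M.vLow b ν * M.F c ν μ) -
      (1 / 2 : ℂ) • (M.u a * M.u b * η μ • wickD μ (M.uBar c)))) +
  (∑ a, ∑ b, ∑ c, M.f' a b c •
    (M.Φ a * η μ • wickD μ (M.Φ b) * M.u c - (M.m b : ℂ) • (M.Φ a * M.v b μ * M.u c))) +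
  ∑ a, M.jVec a μ * M.u a

/-- `T^{μν}`. -/
def lagr2 (μ ν : Fin 4) : Wick ι τ :=
  (1 / 2 : ℂ) • ∑ a, ∑ b, ∑ c, M.f a b c • (M.u a * M.u b * M.F c μ ν)

/-- `T_anti^μ`. -/
def lagrAnti1 (μ : Fin 4) : Wick ι τ :=
  (∑ a, ∑ b, ∑ c, M.f a b c •
    ((∑ ν, M.uBar a * M.vLow b ν * M.F c ν μ) + M.uBar a * M.divv b * M.v c μ -
      M.u a * M.uBar b * η μ • wickD μ (M.uBar c) +
      (1 / 2 : ℂ) • (η μ • wickD μ (M.u a) * M.uBar b * M.uBar c) -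
      (M.m c : ℂ) • (M.uBar a * M.v b μ * M.Φ c))) +
  (∑ a, ∑ b, ∑ c, M.f' a b c •
    (M.Φ a * η μ • wickD μ (M.Φ b) * M.uBar c - (M.m b : ℂ) • (M.Φ a * M.v b μ * M.uBar c))) +
  ∑ a, M.jVec a μ * M.uBar a

/-- `T_anti^{μν}`. -/
def lagrAnti2 (μ ν : Fin 4) : Wick ι τ :=
  (1 / 2 : ℂ) • ∑ a, ∑ b, ∑ c, M.f a b c • (M.uBar a * M.uBar b * M.F c μ ν)

/-- The chain `T^I`; multi-indices `I` are lists. -/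
def TI : List (Fin 4) → Wick ι τ
  | [] => M.lagr
  | [μ] => M.lagr1 μ
  | [μ, ν] => M.lagr2 μ ν
  | _ => 0

/-- The chain `T_anti^I`. -/
def TAnti : List (Fin 4) → Wick ι τ
  | [] => M.lagr
  | [μ] => M.lagrAnti1 μ
  | [μ, ν] => M.lagrAnti2 μ ν
  | _ => 0

/-! ### The constraints on the constants -/

/-- The linear relations (first order gauge invariance), with the conventions on vanishing
constants. -/
structure LinearRelations : Prop where
  f_antisymm₁ : ∀ a b c, M.f b a c = -M.f a b c
  f_antisymm₂ : ∀ a b c, M.f a c b = -M.f a b c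
  f_higgs : ∀ a b c, M.kind a = Kind.higgs → M.f a b c = 0
  f'_antisymm : ∀ a b c, M.f' a b c = -M.f' b a c
  f'_higgs : ∀ a b c, M.kind c = Kind.higgs → M.f' a b c = 0
  f'_massless : ∀ a b c, M.kind a = Kind.massless → M.f' a b c = 0
  f_f' : ∀ a b c, M.f a b c * M.m c = M.f' c a b * M.m a - M.f' c b a * M.m b
  f''_symm₁ : ∀ a b c, M.f'' b a c = M.f'' a b c
  f''_symm₂ : ∀ a b c, M.f'' a c b = M.f'' a b c
  f''_massless : ∀ a b c, M.kind a = Kind.massless → M.f'' a b c = 0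
  f'_f'' : ∀ a b c, M.f'' a b c * M.m c =
    M.f' a b c * ((M.higgsMass a : ℂ) ^ 2 - (M.higgsMass b : ℂ) ^ 2)
  t_higgs : ∀ a ε, M.kind a = Kind.higgs → M.t a ε = 0
  s_massless : ∀ a ε, M.kind a = Kind.massless → M.s a ε = 0

/-- Conservation of the currents, `∂_μ j_a^μ = m_a j_a`, in terms of the matrices. -/
def CurrentRelation [DecidableEq τ] : Prop :=
  ∀ a ε, (M.m a : ℂ) • M.s a ε =
    Complex.I • (Matrix.diagonal (fun A => (M.mF A : ℂ)) * M.t a ε -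
      M.t a (!ε) * Matrix.diagonal (fun A => (M.mF A : ℂ)))

/-- The bilinear relations: Jacobi identity, representation properties for the Bose and Fermi
sectors, tensor property of the `s_a`. -/
structure BilinearRelations : Prop where
  jacobi : ∀ a b d e, ∑ c, (M.f a b c * M.f d e c + M.f b d c * M.f a e c +
    M.f d a c * M.f b e c) = 0
  reps_bose : ∀ a b d e, M.kind a ≠ Kind.higgs → M.kind b ≠ Kind.higgs →
    M.kind d ≠ Kind.massless → M.kind e ≠ Kind.massless →
    ∑ c, (M.f' d c a * M.f' c e b - M.f' d c b * M.f' c e a) = -∑ c, M.f a b c * M.f' d e c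
  reps_fermi : ∀ a b ε, M.t a ε * M.t b ε - M.t b ε * M.t a ε =
    ∑ c, (Complex.I * M.f a b c) • M.t c ε
  tensor : ∀ a b ε, M.t a (!ε) * M.s b ε - M.s b ε * M.t a ε =
    ∑ c, (Complex.I * M.f' b c a) • M.s c ε

/-! ### The finite renormalizations -/

/-- `∑_e (f'_{eba} f''_{ecd} + f'_{eca} f''_{ebd} + f'_{eda} f''_{ebc})`. -/
def cubicVariation (a b c d : ι) : ℂ :=
  ∑ e, (M.f' e b a * M.f'' e c d + M.f' e c a * M.f'' e b d + M.f' e d a * M.f'' e b c)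

/-- `h = h^{(3)}` is completely symmetric and
`h_{abcd} m_a = - 2 i (f'_{eba} f''_{ecd} + f'_{eca} f''_{ebd} + f'_{eda} f''_{ebc})`. -/
structure IsQuarticCoupling (h : ι → ι → ι → ι → ℂ) : Prop where
  symm₁ : ∀ a b c d, h b a c d = h a b c d
  symm₂ : ∀ a b c d, h a c b d = h a b c d
  symm₃ : ∀ a b c d, h a b d c = h a b c d
  eq : ∀ a b c d, h a b c d * M.m a = -2 * Complex.I * M.cubicVariation a b c d

def g1 (a b c d : ι) : ℂ :=
  -(Complex.I / 2) * ∑ e, (M.f a c e * M.f b d e + M.f a d e * M.f b c e)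

def g2 (a b c d : ι) : ℂ := -(Complex.I / 2) * ∑ e, M.f a d e * M.f b c e

def g3 (a b c d : ι) : ℂ :=
  -(Complex.I / 2) * ∑ e, (M.f' c e a * M.f' e d b + M.f' d e a * M.f' e c b)

def h1 (a b c d : ι) : ℂ :=
  -(Complex.I / 4) * ∑ e, (M.f a d e * M.f b c e + M.f a c e * M.f b d e)

def h2 (a b c d : ι) : ℂ :=
  -(Complex.I / 2) * ∑ e, (M.f' d e a * M.f' e c b + M.f' c e a * M.f' e d b)

/-- `N^{[μν]∅}` with the ghost fields `w` (`w = ũ` for anti-BRST, `w = u` for BRST). -/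
def N2 (w : ι → Wick ι τ) (μ ν : Fin 4) : Wick ι τ :=
  (Complex.I / 2) • ∑ a, ∑ b, ∑ c, ∑ d,
    (∑ e, M.f a b e * M.f c d e) • (w a * w b * M.v c μ * M.v d ν)

/-- `g^{(1)} w v^μ v^ν v_ν + g^{(3)} w v^μ Φ Φ`. -/
def N1 (w : ι → Wick ι τ) (μ : Fin 4) : Wick ι τ :=
  (∑ a, ∑ b, ∑ c, ∑ d, M.g1 a b c d • ∑ ν, w a * M.v b μ * M.v c ν * M.vLow d ν) +
  ∑ a, ∑ b, ∑ c, ∑ d, M.g3 a b c d • (w a * M.v b μ * M.Φ c * M.Φ d)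

/-- `g^{(2)} u ũ ũ v^μ`. -/
def N1Ghost (μ : Fin 4) : Wick ι τ :=
  ∑ a, ∑ b, ∑ c, ∑ d, M.g2 a b c d • (M.u a * M.uBar b * M.uBar c * M.v d μ)

/-- `N^{∅∅}`. -/
def N0 (h : ι → ι → ι → ι → ℂ) : Wick ι τ :=
  (∑ a, ∑ b, ∑ c, ∑ d, M.h1 a b c d • ∑ μ, ∑ ν, M.vLow a μ * M.v b μ * M.v c ν * M.vLow d ν) +
  (∑ a, ∑ b, ∑ c, ∑ d, M.h2 a b c d • ∑ μ, M.v a μ * M.vLow b μ * M.Φ c * M.Φ d) +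
  (1 / 24 : ℂ) • ∑ a, ∑ b, ∑ c, ∑ d, h a b c d • (M.Φ a * M.Φ b * M.Φ c * M.Φ d)

/-- The finite renormalizations `N^{IJ}` for anti-BRST; `N^{JI} = (-1)^{|I||J|} N^{IJ}`. -/
def NAnti (h : ι → ι → ι → ι → ℂ) : List (Fin 4) → List (Fin 4) → Wick ι τ
  | [μ, ν], [] => M.N2 M.uBar μ ν
  | [], [μ, ν] => M.N2 M.uBar μ ν
  | [μ], [ν] => -M.N2 M.uBar μ ν
  | [μ], [] => M.N1 M.uBar μ + M.N1Ghost μ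
  | [], [μ] => M.N1 M.uBar μ + M.N1Ghost μ
  | [], [] => M.N0 h
  | _, _ => 0

/-- The finite renormalizations for BRST: `ũ` is replaced by `u` and the term `u ũ ũ v` is absent;
`N^{∅∅}` is unchanged. -/
def NBrst (h : ι → ι → ι → ι → ℂ) : List (Fin 4) → List (Fin 4) → Wick ι τ
  | [μ, ν], [] => M.N2 M.u μ ν
  | [], [μ, ν] => M.N2 M.u μ ν
  | [μ], [ν] => -M.N2 M.u μ ν
  | [μ], [] => M.N1 M.u μ
  | [], [μ] => M.N1 M.u μ
  | [], [] => M.N0 h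
  | _, _ => 0

variable [DecidableEq ι] [DecidableEq τ]

/-- `T_(0)(T_anti^I(x₁), T_anti^J(x₂)) - δ(x₁ - x₂) N^{IJ}(x₁)`. -/
def renAnti (h : ι → ι → ι → ι → ℂ) (I J : List (Fin 4)) : TwoPoint ι τ :=
  M.T₀ (M.TAnti I) (M.TAnti J) - quasiLocal (M.NAnti h I J)

/-- `T_(0)(T^I(x₁), T^J(x₂)) - δ(x₁ - x₂) N^{IJ}(x₁)` with the renormalizations for BRST. -/
def renBrst (h : ι → ι → ι → ι → ℂ) (I J : List (Fin 4)) : TwoPoint ι τ :=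
  M.T₀ (M.TI I) (M.TI J) - quasiLocal (M.NBrst h I J)

/-- The second order gauge invariance identity for `(I, J)`:
`d R^{I,J} - i ∂/∂x₁^μ R^{Iμ,J} - i (-1)^{|I|} ∂/∂x₂^μ R^{I,Jμ} = 0`. -/
def GaugeIdentity (d : TwoPoint ι τ →ₗ[ℂ] TwoPoint ι τ)
    (R : List (Fin 4) → List (Fin 4) → TwoPoint ι τ) (I J : List (Fin 4)) : Prop :=
  (Submodule.Quotient.mk (d (R I J) - Complex.I • ∑ μ, pd 0 μ (R (I ++ [μ]) J) -
    (Complex.I * (-1) ^ I.length) • ∑ μ, pd 1 μ (R I (J ++ [μ]))) : M.OpDistr) = 0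

end Lagrangian

end YangMills

end CausalYM

end

noncomputable section

namespace CausalYM

open Finset (sum_congr smul_sum sum_add_distrib sum_comm sum_sub_distrib mul_sum sum_neg_distrib mem_univ sum_mul sum_ite_eq' sum_ite_eq sum_eq_single sum_const_zero sum_smul sum_eq_zero sum_insert)
open LinearMap (compLeft_apply id_apply)
open Submodule (smul_mem span_induction sum_mem mkQ_surjective subset_span)
open Complex (I I_mul_I)
local notation "ιℂ" => FreeAlgebra.ι ℂ

section

variable {V V' W : Type*} [AddCommMonoid V] [Module ℂ V] [AddCommMonoid V'] [Module ℂ V']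
  [AddCommGroup W] [Module ℂ W]

lemma add_apply (f g : V →ₗ[ℂ] V') (x : V) : (f + g) x = f x + g x := rfl
lemma sub_apply (f g : V →ₗ[ℂ] W) (x : V) : (f - g) x = f x - g x := rfl
lemma neg_apply (f : V →ₗ[ℂ] W) (x : V) : (-f) x = -f x := rfl
lemma zero_apply (x : V) : (0 : V →ₗ[ℂ] V') x = 0 := rfl
lemma smul_apply (c : ℂ) (f : V →ₗ[ℂ] V') (x : V) : (c • f) x = c • f x := rfl
lemma sum_apply {κ : Type*} (s : Finset κ) (f : κ → V →ₗ[ℂ] V') (x : V) :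
    (∑ i ∈ s, f i) x = ∑ i ∈ s, f i x := LinearMap.sum_apply s f x

end

section FreeAlg

variable {X : Type*}

lemma word_nil : word ([] : List X) = 1 := rfl

lemma word_cons (x : X) (w : List X) : word (x :: w) = ιℂ x * word w := by
  simp [word]

lemma basisFreeMonoid_apply (w : FreeMonoid X) :
    FreeAlgebra.basisFreeMonoid ℂ X w = word w.toList := by
  induction w using FreeMonoid.inductionOn' with
  | one =>
    simp [FreeAlgebra.basisFreeMonoid, FreeAlgebra.equivMonoidAlgebraFreeMonoid, word,
      MonoidAlgebra.coeffLinearEquiv]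
  | of_mul x w ih =>
    have h : FreeAlgebra.basisFreeMonoid ℂ X (FreeMonoid.of x * w) =
        FreeAlgebra.basisFreeMonoid ℂ X (FreeMonoid.of x) * FreeAlgebra.basisFreeMonoid ℂ X w := by
      have := map_mul (FreeAlgebra.equivMonoidAlgebraFreeMonoid (R := ℂ) (X := X)).symm
        (MonoidAlgebra.single (FreeMonoid.of x) 1) (MonoidAlgebra.single w 1)
      rw [MonoidAlgebra.single_mul_single, one_mul] at this
      exact this
    have h1 : FreeAlgebra.basisFreeMonoid ℂ X (FreeMonoid.of x) = ιℂ x := by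
      change (FreeAlgebra.equivMonoidAlgebraFreeMonoid (R := ℂ) (X := X)).symm
        (MonoidAlgebra.single (FreeMonoid.of x) 1) = _
      simp [FreeAlgebra.equivMonoidAlgebraFreeMonoid]
    rw [h, h1, ih]
    simp [word]

/-- Two linear maps on a free algebra agree if they agree on all monomials. -/
lemma freeAlgebra_induction {P : FreeAlgebra ℂ X → Prop} (h1 : P 1)
    (hmul : ∀ x p, P p → P (ιℂ x * p)) (hadd : ∀ p q, P p → P q → P (p + q))
    (hsmul : ∀ (c : ℂ) p, P p → P (c • p)) (p : FreeAlgebra ℂ X) : P p := by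
  have hw : ∀ w : List X, P (word w) := by
    intro w
    induction w with
    | nil => exact h1
    | cons x w ih => rw [word_cons]; exact hmul x _ ih
  have h0 : P 0 := by simpa using hsmul 0 1 h1
  have hp : p ∈ Submodule.span ℂ (Set.range (FreeAlgebra.basisFreeMonoid ℂ X)) := by
    rw [Module.Basis.span_eq]; trivial
  induction hp using span_induction with
  | mem x hx => obtain ⟨w, rfl⟩ := hx; rw [basisFreeMonoid_apply]; exact hw _
  | zero => exact h0
  | add x y _ _ hx hy => exact hadd x y hx hy
  | smul c x _ hx => exact hsmul c x hx

lemma constr_word {V : Type*} [AddCommGroup V] [Module ℂ V] (g : FreeMonoid X → V) (w : List X) :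
    (FreeAlgebra.basisFreeMonoid ℂ X).constr ℂ g (word w) = g (FreeMonoid.ofList w) := by
  have := Module.Basis.constr_basis (FreeAlgebra.basisFreeMonoid ℂ X) ℂ g (FreeMonoid.ofList w)
  rwa [basisFreeMonoid_apply, FreeMonoid.toList_ofList] at this

/-- Rescaling of the letters. -/
def twist (σ : X → ℂ) : FreeAlgebra ℂ X →ₐ[ℂ] FreeAlgebra ℂ X :=
  FreeAlgebra.lift ℂ fun x => σ x • ιℂ x

@[simp] lemma twist_ι (σ : X → ℂ) (x : X) :
    twist σ (ιℂ x) = σ x • ιℂ x := by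
  simp [twist]

lemma twist_one_fun : twist (fun _ : X => 1) = AlgHom.id ℂ _ := by
  ext x; simp

lemma twist_twist (σ σ' : X → ℂ) (p : FreeAlgebra ℂ X) :
    twist σ (twist σ' p) = twist (fun x => σ x * σ' x) p := by
  have : (twist σ).comp (twist σ') = twist (fun x => σ x * σ' x) := by
    ext x; simp [smul_smul, mul_comm]
  exact DFunLike.congr_fun this p

lemma derExt_word (σ : X → ℂ) (D : X → FreeAlgebra ℂ X) (w : List X) :
    derExt σ D (word w) = wordDer σ D w := by
  rw [derExt, constr_word]; rfl

@[simp] lemma derExt_one (σ : X → ℂ) (D : X → FreeAlgebra ℂ X) : derExt σ D 1 = 0 :=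
  derExt_word σ D []

lemma derExt_ι_mul (σ : X → ℂ) (D : X → FreeAlgebra ℂ X) (x : X) (p : FreeAlgebra ℂ X) :
    derExt σ D (ιℂ x * p) =
      D x * p + σ x • (ιℂ x * derExt σ D p) := by
  have hp : p ∈ Submodule.span ℂ (Set.range (FreeAlgebra.basisFreeMonoid ℂ X)) := by
    rw [Module.Basis.span_eq]; trivial
  induction hp using span_induction with
  | mem p hp =>
    obtain ⟨w, rfl⟩ := hp
    rw [basisFreeMonoid_apply, ← word_cons, derExt_word, derExt_word, wordDer]
  | zero => simp
  | add p q _ _ hp hq => simp only [mul_add, map_add, hp, hq, smul_add]; abel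
  | smul c p _ hp =>
    simp only [mul_smul_comm, map_smul, hp, smul_add, smul_comm c]

@[simp] lemma derExt_ι (σ : X → ℂ) (D : X → FreeAlgebra ℂ X) (x : X) :
    derExt σ D (ιℂ x) = D x := by
  simpa using derExt_ι_mul σ D x 1

lemma derExt_mul (σ : X → ℂ) (D : X → FreeAlgebra ℂ X) (p q : FreeAlgebra ℂ X) :
    derExt σ D (p * q) = derExt σ D p * q + twist σ p * derExt σ D q := by
  induction p using freeAlgebra_induction with
  | hmul x p ih =>
    simp only [mul_assoc, derExt_ι_mul, ih, map_mul, twist_ι]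
    simp only [add_mul, smul_mul_assoc, mul_add, smul_add, mul_assoc]
    abel
  | hadd p p' h h' => simp only [add_mul, map_add, h, h']; abel
  | _ => simp [smul_mul_assoc, smul_add, *]

lemma derExt_comp_hom {Y : Type*} (f : FreeAlgebra ℂ X →ₐ[ℂ] FreeAlgebra ℂ Y)
    (σ : X → ℂ) (τ : Y → ℂ) (D : X → FreeAlgebra ℂ X) (E : Y → FreeAlgebra ℂ Y)
    (ht : ∀ x, twist τ (f (ιℂ x)) = σ x • f (ιℂ x))
    (hD : ∀ x, derExt τ E (f (ιℂ x)) = f (D x)) (p : FreeAlgebra ℂ X) :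
    derExt τ E (f p) = f (derExt σ D p) := by
  induction p using freeAlgebra_induction with
  | hmul x p ih => simp [derExt_mul, ht, hD, ih]
  | _ => simp [*]

/-- Graded derivations commute with an even derivation if they do so on the letters. -/
lemma derExt_comm (σ : X → ℂ) (D E : X → FreeAlgebra ℂ X)
    (hE : ∀ x, twist σ (E x) = σ x • E x)
    (h : ∀ x, derExt σ D (E x) = derExt (fun _ => 1) E (D x)) (p : FreeAlgebra ℂ X) :
    derExt σ D (derExt (fun _ => 1) E p) = derExt (fun _ => 1) E (derExt σ D p) := by
  induction p using freeAlgebra_induction with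
  | hmul x p ih =>
    simp only [derExt_mul, map_add, derExt_ι, h, twist_one_fun, AlgHom.id_apply, ih,
      hE, twist_ι, map_smul, smul_mul_assoc, smul_add]
    abel
  | _ => simp [*]

lemma derExt_twist (σ : X → ℂ) (D : X → FreeAlgebra ℂ X) (τ : X → ℂ) (c : ℂ)
    (hD : ∀ x, twist τ (D x) = (c * τ x) • D x) (p : FreeAlgebra ℂ X) :
    twist τ (derExt σ D p) = c • derExt σ D (twist τ p) := by
  induction p using freeAlgebra_induction with
  | hmul x p ih =>
    simp only [derExt_ι_mul, map_add, map_mul, hD, map_smul, ih, twist_ι, smul_mul_assoc,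
      mul_smul_comm, smul_add, smul_smul]
    congr 2; ring
  | hsmul a p h => simp only [map_smul, h, smul_comm a]
  | _ => simp [*]

lemma derExt_add_fun (σ : X → ℂ) (D E : X → FreeAlgebra ℂ X) (p : FreeAlgebra ℂ X) :
    derExt σ (fun x => D x + E x) p = derExt σ D p + derExt σ E p := by
  induction p using freeAlgebra_induction with
  | hmul x p ih => simp only [derExt_ι_mul, ih, add_mul, mul_add, smul_add]; abel
  | hadd p p' h h' => simp only [map_add, h, h']; abel
  | _ => simp [*]

lemma derExt_smul_fun (σ : X → ℂ) (D : X → FreeAlgebra ℂ X) (c : ℂ) (p : FreeAlgebra ℂ X) :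
    derExt σ (fun x => c • D x) p = c • derExt σ D p := by
  induction p using freeAlgebra_induction with
  | hmul x p ih =>
    simp only [derExt_ι_mul, ih, smul_mul_assoc, mul_smul_comm, smul_add, smul_comm c]
  | hsmul a p h => simp only [map_smul, h, smul_comm c]
  | _ => simp [*]

lemma derExt_zero_fun (σ : X → ℂ) (p : FreeAlgebra ℂ X) :
    derExt σ (fun _ => (0 : FreeAlgebra ℂ X)) p = 0 := by
  simpa using derExt_smul_fun σ (fun _ => (0 : FreeAlgebra ℂ X)) 0 p

end FreeAlg

section RelAlg

variable {R : Type*} [Ring R] [Algebra ℂ R]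

/-- The quotient of an algebra by the relations `x = 0`, `x ∈ s`. -/
abbrev RelAlg (s : Set R) := (TwoSidedIdeal.span s).ringCon.Quotient

/-- The quotient map. -/
def toRel (s : Set R) : R →ₐ[ℂ] RelAlg s := (TwoSidedIdeal.span s).ringCon.mkₐ ℂ

lemma toRel_eq_iff (s : Set R) (p q : R) :
    toRel s p = toRel s q ↔ p - q ∈ TwoSidedIdeal.span s := by
  rw [← TwoSidedIdeal.rel_iff]
  exact RingCon.eq _

lemma toRel_eq_zero (s : Set R) {x : R} (hx : x ∈ s) : toRel s x = 0 := by
  rw [← map_zero (toRel s), toRel_eq_iff, sub_zero]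
  exact TwoSidedIdeal.subset_span hx

lemma toRel_factor {V : Type*} [AddCommGroup V] [Module ℂ V] {s : Set R} (g : R →ₗ[ℂ] V)
    (hg : ∀ a b, ∀ x ∈ s, g (a * x * b) = 0) {p q : R} (h : toRel s p = toRel s q) :
    g p = g q := by
  rw [toRel_eq_iff] at h
  have key : ∀ x ∈ TwoSidedIdeal.span s, ∀ a b, g (a * x * b) = 0 := by
    intro x hx
    induction hx using TwoSidedIdeal.span_induction with
    | mem x hx => exact fun a b => hg a b x hx
    | zero => simp
    | add x y _ _ hx hy => intro a b; simp [mul_add, add_mul, hx, hy]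
    | neg x _ hx => intro a b; simp [hx]
    | left_absorb c x _ hx => intro a b; rw [← mul_assoc]; exact hx _ _
    | right_absorb c x _ hx => intro a b; rw [← mul_assoc, mul_assoc]; exact hx _ _
  have := key _ h 1 1
  rwa [one_mul, mul_one, map_sub, sub_eq_zero] at this

end RelAlg

section TwoPointLemmas

variable {ι τ : Type*}

@[simp] lemma at₂_ι (k : Fin 2) (j : Jet ι τ) :
    at₂ k (ιℂ j) = ιℂ (k, j) := by simp [at₂]

/-- Multiplication of the operator part from the left. -/
def lm : Wick₂ ι τ →ₐ[ℂ] Module.End ℂ (TwoPoint ι τ) :=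
  (Module.End.lTensorAlgHom ℂ (Wick₂ ι τ) Distr).comp (Algebra.lmul ℂ (Wick₂ ι τ))

@[simp] lemma lm_tmul (W : Wick₂ ι τ) (d : Distr) (V : Wick₂ ι τ) :
    lm W (d ⊗ₜ[ℂ] V) = d ⊗ₜ (W * V) := rfl

lemma wick₂D_mul (k : Fin 2) (μ : Fin 4) (p q : Wick₂ ι τ) :
    wick₂D k μ (p * q) = wick₂D k μ p * q + p * wick₂D k μ q := by
  simp [wick₂D, derExt_mul, twist_one_fun]

lemma wickD_mul (μ : Fin 4) (p q : Wick ι τ) :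
    wickD μ (p * q) = wickD μ p * q + p * wickD μ q := by
  simp [wickD, derExt_mul, twist_one_fun]

@[simp] lemma wickD_ι (μ : Fin 4) (j : Jet ι τ) :
    wickD μ (ιℂ j) = ιℂ (j.shift μ) := by simp [wickD]

@[simp] lemma wickD_one (μ : Fin 4) : wickD μ (1 : Wick ι τ) = 0 := by simp [wickD]

lemma wick₂D_ι (k : Fin 2) (μ : Fin 4) (x : Fin 2 × Jet ι τ) :
    wick₂D k μ (ιℂ x) =
      if x.1 = k then ιℂ (x.1, x.2.shift μ) else 0 := by simp [wick₂D]

@[simp] lemma wick₂D_at₂ (k : Fin 2) (μ : Fin 4) (p : Wick ι τ) :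
    wick₂D k μ (at₂ k p) = at₂ k (wickD μ p) := by
  rw [wick₂D, wickD]
  exact derExt_comp_hom _ _ _ _ _ (by simp) (by simp) p

lemma wick₂D_at₂_ne {k l : Fin 2} (h : l ≠ k) (μ : Fin 4) (p : Wick ι τ) :
    wick₂D k μ (at₂ l p) = 0 := by
  have := derExt_comp_hom (at₂ l) (fun _ => 1) (fun _ => 1) (fun _ : Jet ι τ => 0)
    (fun x : Fin 2 × Jet ι τ => if x.1 = k then ιℂ (x.1, x.2.shift μ) else 0)
    (by simp) (by simp [h]) p
  rw [derExt_zero_fun, map_zero] at this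
  exact this

@[simp] lemma pd_tmul (k : Fin 2) (μ : Fin 4) (d : Distr) (W : Wick₂ ι τ) :
    pd k μ (d ⊗ₜ[ℂ] W) = (if k = 0 then (1 : ℂ) else -1) • (distD μ d ⊗ₜ[ℂ] W) +
      d ⊗ₜ[ℂ] wick₂D k μ W := rfl

lemma pd_lm (k : Fin 2) (μ : Fin 4) (W : Wick₂ ι τ) (X : TwoPoint ι τ) :
    pd k μ (lm W X) = lm (wick₂D k μ W) X + lm W (pd k μ X) := by
  induction X using TensorProduct.induction_on with
  | zero => simp
  | tmul d V =>
    simp only [pd_tmul, lm_tmul, wick₂D_mul, tmul_add, map_add, map_smul]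
    abel
  | add x y hx hy => simp only [map_add, hx, hy]; abel

/-- The parity sign of a letter at two points. -/
def paritySign₂ (x : Fin 2 × Jet ι τ) : ℂ := paritySign x.2

lemma oddDer₂_tmul (D : Jet ι τ → Wick ι τ) (d : Distr) (W : Wick₂ ι τ) :
    oddDer₂ D (d ⊗ₜ[ℂ] W) = d ⊗ₜ derExt paritySign₂ (fun x => at₂ x.1 (D x.2)) W := by
  simp [oddDer₂]; rfl

lemma derExt_at₂ (D : Jet ι τ → Wick ι τ) (k : Fin 2) (p : Wick ι τ) :
    derExt paritySign₂ (fun x => at₂ x.1 (D x.2)) (at₂ k p) =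
      at₂ k (derExt paritySign D p) :=
  derExt_comp_hom _ _ _ _ _ (by simp [paritySign₂]) (by simp) p

lemma twist_at₂ (σ : Jet ι τ → ℂ) (k : Fin 2) (p : Wick ι τ) :
    twist (fun x => σ x.2) (at₂ k p) = at₂ k (twist σ p) := by
  have : (twist fun x : Fin 2 × Jet ι τ => σ x.2).comp (at₂ k) = (at₂ k).comp (twist σ) := by
    ext x; simp
  exact DFunLike.congr_fun this p

lemma oddDer₂_lm (D : Jet ι τ → Wick ι τ) (W : Wick₂ ι τ) (X : TwoPoint ι τ) :
    oddDer₂ D (lm W X) = lm (derExt paritySign₂ (fun x => at₂ x.1 (D x.2)) W) X +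
      lm (twist paritySign₂ W) (oddDer₂ D X) := by
  induction X using TensorProduct.induction_on with
  | zero => simp
  | tmul d V => simp [oddDer₂_tmul, derExt_mul, tmul_add]
  | add x y hx hy => simp only [map_add, hx, hy]; abel

lemma exchSign_comm (j k : Jet ι τ) : exchSign j k = exchSign k j := by
  simp [exchSign, Bool.and_comm]

lemma exchSign_mul_self (j k : Jet ι τ) : exchSign j k * exchSign j k = 1 := by
  unfold exchSign; split_ifs <;> simp

lemma paritySign_mul_self (j : Jet ι τ) : paritySign j * paritySign j = 1 := by
  unfold paritySign; split_ifs <;> simp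

/-- The sign of a letter with respect to a parity. -/
def gsign (ε : Bool) (j : Jet ι τ) : ℂ := if ε = true then paritySign j else 1

lemma exchSign_eq_gsign (j k : Jet ι τ) : exchSign j k = gsign j.field.odd k := by
  unfold exchSign gsign paritySign
  cases j.field.odd <;> simp

lemma gsign_mul_self (ε : Bool) (j : Jet ι τ) : gsign ε j * gsign ε j = 1 := by
  unfold gsign; split_ifs <;> simp [paritySign_mul_self]

lemma gsign_mul_gsign (ε ε' : Bool) (j : Jet ι τ) :
    gsign ε j * gsign ε' j = gsign (xor ε ε') j := by
  cases ε <;> cases ε' <;> simp [gsign, paritySign_mul_self]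

lemma gsign_true : (gsign true : Jet ι τ → ℂ) = paritySign := by ext; simp [gsign]

lemma gsign_false : (gsign false : Jet ι τ → ℂ) = fun _ => 1 := by ext; simp [gsign]

/-- `p` is homogeneous of parity `ε`. -/
def HasParity (ε : Bool) (p : Wick ι τ) : Prop :=
  twist paritySign p = (if ε = true then (-1 : ℂ) else 1) • p

/-- The sign `(-1)^{ε ε'}`. -/
def bsign (ε ε' : Bool) : ℂ := if (ε && ε') = true then -1 else 1

lemma HasParity.twist_gsign {ε : Bool} {p : Wick ι τ} (h : HasParity ε p) (ε' : Bool) :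
    twist (gsign ε') p = bsign ε' ε • p := by
  cases ε' with
  | false => simp [gsign_false, twist_one_fun, bsign]
  | true => rw [gsign_true, h]; cases ε <;> simp [bsign]

lemma gsign_eq_bsign (ε : Bool) (j : Jet ι τ) : gsign ε j = bsign ε j.field.odd := by
  cases ε <;> simp [gsign, bsign, paritySign]

lemma HasParity.letter (j : Jet ι τ) : HasParity j.field.odd (ιℂ j) := by
  simp [HasParity, paritySign]

lemma HasParity.add {ε : Bool} {p q : Wick ι τ} (hp : HasParity ε p) (hq : HasParity ε q) :
    HasParity ε (p + q) := by
  unfold HasParity at *; simp [hp, hq]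

lemma HasParity.smul {ε : Bool} {p : Wick ι τ} (hp : HasParity ε p) (c : ℂ) :
    HasParity ε (c • p) := by
  unfold HasParity at *; simp only [map_smul, hp]; rw [smul_comm]

lemma HasParity.zero {ε : Bool} : HasParity ε (0 : Wick ι τ) := by
  simp [HasParity]

lemma HasParity.sum {ε : Bool} {α : Type*} {s : Finset α} {p : α → Wick ι τ}
    (hp : ∀ i ∈ s, HasParity ε (p i)) : HasParity ε (∑ i ∈ s, p i) := by
  unfold HasParity at *
  rw [map_sum, smul_sum]
  exact sum_congr rfl hp

lemma HasParity.mul {ε ε' : Bool} {p q : Wick ι τ} (hp : HasParity ε p) (hq : HasParity ε' q) :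
    HasParity (xor ε ε') (p * q) := by
  unfold HasParity at *
  rw [map_mul, hp, hq]
  cases ε <;> cases ε' <;> simp

lemma HasParity.wickD {ε : Bool} {p : Wick ι τ} (hp : HasParity ε p) (μ : Fin 4) :
    HasParity ε (wickD μ p) := by
  have h := derExt_twist (fun _ => 1) (fun j : Jet ι τ => ιℂ (j.shift μ))
    paritySign 1 (by intro x; simp [paritySign, Jet.shift]) p
  unfold HasParity at *
  rw [CausalYM.wickD, h, hp, map_smul, one_smul]

end TwoPointLemmas

namespace YangMills

variable {ι τ : Type*} (M : YangMills ι τ)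

/-- The class of a two-point expression. -/
def cl : TwoPoint ι τ →ₗ[ℂ] M.OpDistr := M.nullSpace.mkQ

lemma cl_eq_zero {X : TwoPoint ι τ} : M.cl X = 0 ↔ X ∈ M.nullSpace :=
  Submodule.Quotient.mk_eq_zero _

lemma cl_eq_zero_of_rel {X : TwoPoint ι τ} (h : M.NullRel X) : M.cl X = 0 :=
  M.cl_eq_zero.mpr (subset_span h)

lemma cl_map_eq_zero (g : TwoPoint ι τ →ₗ[ℂ] TwoPoint ι τ)
    (hg : ∀ X, M.NullRel X → M.cl (g X) = 0) {X : TwoPoint ι τ} (hX : M.cl X = 0) :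
    M.cl (g X) = 0 := by
  rw [cl_eq_zero] at hX
  induction hX using span_induction with
  | mem x hx => exact hg x hx
  | _ => simp [*]

lemma cl_pd_eq_zero (k : Fin 2) (μ : Fin 4) {X : TwoPoint ι τ} (hX : M.cl X = 0) :
    M.cl (pd k μ X) = 0 :=
  M.cl_map_eq_zero (pd k μ) (fun _ h => M.cl_eq_zero_of_rel (.deriv k μ _ h)) hX

lemma cl_lm_eq_zero (W : Wick₂ ι τ) {X : TwoPoint ι τ} (hX : M.cl X = 0) :
    M.cl (lm W X) = 0 := by
  refine M.cl_map_eq_zero (lm W) (fun Y h => ?_) hX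
  clear hX
  induction h generalizing W with
  | exch d p q x y =>
    rw [lm_tmul, ← mul_assoc, ← mul_assoc]
    exact M.cl_eq_zero_of_rel (.exch d _ q x y)
  | fieldEq d p q k e he =>
    rw [lm_tmul, ← mul_assoc, ← mul_assoc]
    exact M.cl_eq_zero_of_rel (.fieldEq d _ q k e he)
  | diag p q j =>
    rw [lm_tmul, ← mul_assoc, ← mul_assoc]
    exact M.cl_eq_zero_of_rel (.diag _ q j)
  | deriv k μ X hX ih =>
    have h1 := pd_lm k μ W X
    have h2 := M.cl_pd_eq_zero k μ (ih W)
    rw [h1, map_add, ih, zero_add] at h2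
    exact h2

lemma cl_congr {X Y : TwoPoint ι τ} : M.cl X = M.cl Y ↔ M.cl (X - Y) = 0 := by
  rw [map_sub, sub_eq_zero]

lemma cl_lm_congr (W : Wick₂ ι τ) {X Y : TwoPoint ι τ} (h : M.cl X = M.cl Y) :
    M.cl (lm W X) = M.cl (lm W Y) := by
  rw [cl_congr] at h ⊢
  rw [← map_sub]; exact M.cl_lm_eq_zero W h

/-- `∂/∂x_k^μ` on operator-valued distributions. -/
def pdq (k : Fin 2) (μ : Fin 4) : M.OpDistr →ₗ[ℂ] M.OpDistr :=
  M.nullSpace.mapQ M.nullSpace (pd k μ) fun X hX => by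
    rw [Submodule.mem_comap, ← cl_eq_zero]
    exact M.cl_pd_eq_zero k μ (M.cl_eq_zero.mpr hX)

lemma pdq_cl (k : Fin 2) (μ : Fin 4) (X : TwoPoint ι τ) :
    M.pdq k μ (M.cl X) = M.cl (pd k μ X) := rfl

/-- Left multiplication on operator-valued distributions. -/
def lmq (W : Wick₂ ι τ) : M.OpDistr →ₗ[ℂ] M.OpDistr :=
  M.nullSpace.mapQ M.nullSpace (lm W) fun X hX => by
    rw [Submodule.mem_comap, ← cl_eq_zero]
    exact M.cl_lm_eq_zero W (M.cl_eq_zero.mpr hX)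

lemma lmq_cl (W : Wick₂ ι τ) (X : TwoPoint ι τ) : M.lmq W (M.cl X) = M.cl (lm W X) := rfl

lemma lmq_mul (W V : Wick₂ ι τ) (X : M.OpDistr) : M.lmq (W * V) X = M.lmq W (M.lmq V X) := by
  obtain ⟨X, rfl⟩ := mkQ_surjective _ X
  change M.cl (lm (W * V) X) = M.cl (lm W (lm V X))
  rw [map_mul]; rfl

lemma pdq_lmq (k : Fin 2) (μ : Fin 4) (W : Wick₂ ι τ) (X : M.OpDistr) :
    M.pdq k μ (M.lmq W X) = M.lmq (wick₂D k μ W) X + M.lmq W (M.pdq k μ X) := by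
  obtain ⟨X, rfl⟩ := mkQ_surjective _ X
  change M.cl (pd k μ (lm W X)) = M.cl (lm (wick₂D k μ W) X) + M.cl (lm W (pd k μ X))
  rw [pd_lm, map_add]

lemma lmq_cl_tmul (W : Wick₂ ι τ) (d : Distr) (V : Wick₂ ι τ) :
    M.lmq W (M.cl (d ⊗ₜ V)) = M.cl (d ⊗ₜ (W * V)) := by rw [lmq_cl, lm_tmul]

/-- The exchange relations at two points. -/
def exchRel₂ (ι τ : Type*) : Set (Wick₂ ι τ) :=
  {X | ∃ x y : Fin 2 × Jet ι τ, X = ιℂ x * ιℂ y -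
    exchSign x.2 y.2 • (ιℂ y * ιℂ x)}

/-- The exchange relations at one point. -/
def exchRel (ι τ : Type*) : Set (Wick ι τ) :=
  {X | ∃ x y : Jet ι τ, X = ιℂ x * ιℂ y -
    exchSign x y • (ιℂ y * ιℂ x)}

lemma cl_tmul_congr (d : Distr) {V W : Wick₂ ι τ}
    (h : toRel (exchRel₂ ι τ) V = toRel (exchRel₂ ι τ) W) :
    M.cl (d ⊗ₜ V) = M.cl (d ⊗ₜ W) := by
  refine toRel_factor (M.cl ∘ₗ TensorProduct.mk ℂ Distr (Wick₂ ι τ) d) ?_ h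
  rintro a b x ⟨y, z, rfl⟩
  exact M.cl_eq_zero_of_rel (.exch d a b y z)

lemma toRel₂_exch (x y : Fin 2 × Jet ι τ) :
    toRel (exchRel₂ ι τ) (ιℂ x) * toRel (exchRel₂ ι τ) (ιℂ y) =
      exchSign x.2 y.2 •
        (toRel (exchRel₂ ι τ) (ιℂ y) * toRel (exchRel₂ ι τ) (ιℂ x)) := by
  have := toRel_eq_zero (exchRel₂ ι τ) ⟨x, y, rfl⟩
  simpa [sub_eq_zero] using this

/-- A letter can be moved through any polynomial. -/
lemma toRel₂_ι_mul (x : Fin 2 × Jet ι τ) (W : Wick₂ ι τ) :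
    toRel (exchRel₂ ι τ) (ιℂ x * W) =
      toRel (exchRel₂ ι τ) (twist (fun y => gsign x.2.field.odd y.2) W * ιℂ x) := by
  induction W using freeAlgebra_induction with
  | h1 => simp
  | hmul y p ih =>
    rw [map_mul, map_mul, ← mul_assoc, toRel₂_exch, smul_mul_assoc, mul_assoc, ← map_mul, ih,
      map_mul (twist _), twist_ι, exchSign_eq_gsign]
    simp [mul_assoc]
  | hadd p q h h' => simp only [map_add, add_mul, mul_add] at *; rw [h, h']
  | hsmul c p h => simp only [map_smul, smul_mul_assoc, mul_smul_comm] at *; rw [h]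

lemma toRel₂_mul_ι (x : Fin 2 × Jet ι τ) (W : Wick₂ ι τ) :
    toRel (exchRel₂ ι τ) (W * ιℂ x) =
      toRel (exchRel₂ ι τ) (ιℂ x * twist (fun y => gsign x.2.field.odd y.2) W) := by
  rw [toRel₂_ι_mul, twist_twist]
  simp only [gsign_mul_self]
  rw [twist_one_fun]; rfl

end YangMills

section Contraction

variable {ι τ : Type*}

/-- Contraction of a monomial at `x₂` with a letter of parity `ε`, on words. -/
def contractWord (ε : Bool) (c : Jet ι τ → Distr) : List (Jet ι τ) → TwoPoint ι τ
  | [] => 0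
  | x :: w => c x ⊗ₜ at₂ 1 (word w) +
      gsign ε x • lm (ιℂ (1, x)) (contractWord ε c w)

/-- Contraction of a polynomial at `x₂` with a letter of parity `ε`; `c` lists the contractions of
this letter. -/
def contract (ε : Bool) (c : Jet ι τ → Distr) : Wick ι τ →ₗ[ℂ] TwoPoint ι τ :=
  (FreeAlgebra.basisFreeMonoid ℂ (Jet ι τ)).constr ℂ fun w => contractWord ε c w.toList

lemma contract_word (ε : Bool) (c : Jet ι τ → Distr) (w : List (Jet ι τ)) :
    contract ε c (word w) = contractWord ε c w := by
  rw [contract, constr_word]; rfl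

@[simp] lemma contract_one (ε : Bool) (c : Jet ι τ → Distr) : contract ε c 1 = 0 :=
  contract_word ε c []

lemma contract_ι_mul (ε : Bool) (c : Jet ι τ → Distr) (x : Jet ι τ) (p : Wick ι τ) :
    contract ε c (ιℂ x * p) = c x ⊗ₜ at₂ 1 p +
      gsign ε x • lm (ιℂ (1, x)) (contract ε c p) := by
  have hp : p ∈ Submodule.span ℂ (Set.range (FreeAlgebra.basisFreeMonoid ℂ (Jet ι τ))) := by
    rw [Module.Basis.span_eq]; trivial
  induction hp using span_induction with
  | mem p hp =>
    obtain ⟨w, rfl⟩ := hp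
    rw [basisFreeMonoid_apply, ← word_cons, contract_word, contract_word, contractWord]
  | zero => simp
  | add p q _ _ hp hq =>
    simp only [mul_add, map_add, hp, hq, smul_add, tmul_add]; abel
  | smul a p _ hp =>
    simp only [mul_smul_comm, map_smul, hp, smul_add, smul_comm a, tmul_smul]

lemma contract_add_fun (ε : Bool) (c c' : Jet ι τ → Distr) (p : Wick ι τ) :
    contract ε (c + c') p = contract ε c p + contract ε c' p := by
  induction p using freeAlgebra_induction with
  | hmul x p ih =>
    simp only [contract_ι_mul, ih, Pi.add_apply, add_tmul, map_add, smul_add]; abel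
  | hadd p q h h' => simp only [map_add, h, h']; abel
  | _ => simp [smul_add, *]

lemma contract_smul_fun (ε : Bool) (a : ℂ) (c : Jet ι τ → Distr) (p : Wick ι τ) :
    contract ε (a • c) p = a • contract ε c p := by
  induction p using freeAlgebra_induction with
  | hmul x p ih =>
    simp only [contract_ι_mul, ih, Pi.smul_apply, map_smul, smul_add, smul_comm a,
      ← smul_tmul']
  | hsmul b p h => simp only [map_smul, h, smul_comm a]
  | _ => simp [smul_add, *]

/-- The tree product on words in the first argument, for a matrix `C` of contractions. -/
def treeCWord (C : Jet ι τ → Jet ι τ → Distr) : List (Jet ι τ) → Wick ι τ →ₗ[ℂ] TwoPoint ι τ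
  | [] => 0
  | x :: w => lm (ιℂ (0, x)) ∘ₗ treeCWord C w +
      lm (at₂ 0 (twist (gsign x.field.odd) (word w))) ∘ₗ contract x.field.odd (C x)

/-- The tree product for a matrix `C` of contractions. -/
def treeC (C : Jet ι τ → Jet ι τ → Distr) : Wick ι τ →ₗ[ℂ] Wick ι τ →ₗ[ℂ] TwoPoint ι τ :=
  (FreeAlgebra.basisFreeMonoid ℂ (Jet ι τ)).constr ℂ fun w => treeCWord C w.toList

lemma treeC_word (C : Jet ι τ → Jet ι τ → Distr) (w : List (Jet ι τ)) :
    treeC C (word w) = treeCWord C w := by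
  rw [treeC, constr_word]; rfl

@[simp] lemma treeC_one (C : Jet ι τ → Jet ι τ → Distr) : treeC C 1 = 0 := treeC_word C []

lemma treeC_ι_mul (C : Jet ι τ → Jet ι τ → Distr) (x : Jet ι τ) (p B : Wick ι τ) :
    treeC C (ιℂ x * p) B = lm (ιℂ (0, x)) (treeC C p B) +
      lm (at₂ 0 (twist (gsign x.field.odd) p)) (contract x.field.odd (C x) B) := by
  have hp : p ∈ Submodule.span ℂ (Set.range (FreeAlgebra.basisFreeMonoid ℂ (Jet ι τ))) := by
    rw [Module.Basis.span_eq]; trivial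
  induction hp using span_induction with
  | mem p hp =>
    obtain ⟨w, rfl⟩ := hp
    rw [basisFreeMonoid_apply, ← word_cons, treeC_word, treeC_word, treeCWord]
    rfl
  | add p q _ _ hp hq =>
    simp only [mul_add, map_add, add_apply, hp, hq]; abel
  | _ => simp [mul_smul_comm, smul_add, *]

lemma treeC_add_fun (C C' : Jet ι τ → Jet ι τ → Distr) (A B : Wick ι τ) :
    treeC (C + C') A B = treeC C A B + treeC C' A B := by
  induction A using freeAlgebra_induction with
  | hmul x p ih => simp only [treeC_ι_mul, ih, Pi.add_apply, contract_add_fun, map_add]; abel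
  | hadd p q h h' => simp only [map_add, add_apply, h, h']; abel
  | _ => simp [smul_add, *]

/-- Contractions vanish between letters of different parity. -/
def ParityMatrix (C : Jet ι τ → Jet ι τ → Distr) : Prop :=
  ∀ x y, x.field.odd ≠ y.field.odd → C x y = 0

lemma twist_word {X : Type*} (σ : X → ℂ) (w : List X) :
    twist σ (word w) = (w.map σ).prod • word w := by
  induction w with
  | nil => simp [word_nil]
  | cons x w ih => rw [word_cons, map_mul, ih]; simp [smul_smul, mul_comm]

lemma contractWord_eq_sum {C : Jet ι τ → Jet ι τ → Distr} (hC : ParityMatrix C) (x : Jet ι τ)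
    (w : List (Jet ι τ)) :
    contractWord x.field.odd (C x) w = ∑ k : Fin w.length,
      ((w.take k.val).map (exchSign (w.get k))).prod •
        (C x (w.get k) ⊗ₜ[ℂ] at₂ 1 (word (w.eraseIdx k.val))) := by
  induction w with
  | nil => simp [contractWord]
  | cons y w ih =>
    rw [contractWord, ih, map_sum, smul_sum]
    refine Eq.trans ?_ (Fin.sum_univ_succ (n := w.length) _).symm
    congr 1
    · simp
    · refine sum_congr rfl fun k _ => ?_
      simp only [List.get_eq_getElem, Fin.val_succ, List.getElem_cons_succ, List.take_succ_cons,
        List.map_cons, List.prod_cons, List.eraseIdx_cons_succ, word_cons, map_mul, at₂_ι,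
        map_smul, lm_tmul, smul_smul]
      by_cases h : x.field.odd = (w[(k : ℕ)]).field.odd
      · rw [exchSign_eq_gsign, h]
      · rw [hC _ _ h]; simp

lemma tree_eq_treeC {M : YangMills ι τ} [DecidableEq ι] [DecidableEq τ] (Δ : ℝ → Distr)
    (hC : ParityMatrix (M.contr Δ)) (A B : Wick ι τ) :
    M.tree Δ A B = treeC (M.contr Δ) A B := by
  have hw : ∀ w₁ w₂, M.treeWord Δ w₁ w₂ = treeC (M.contr Δ) (word w₁) (word w₂) := by
    intro w₁ w₂
    induction w₁ with
    | nil => simp [YangMills.treeWord, word_nil]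
    | cons x w ih =>
      rw [word_cons, treeC_ι_mul, ← ih, YangMills.treeWord, add_comm]
      refine (Fin.sum_univ_succ (n := w.length) _).trans ?_
      congr 1
      · rw [contract_word, contractWord_eq_sum hC, map_sum]
        refine sum_congr rfl fun k _ => ?_
        have : exchSign x = gsign x.field.odd := by ext y; exact exchSign_eq_gsign x y
        simp [twist_word, smul_smul, mul_comm, this]
      · rw [YangMills.treeWord, map_sum]
        refine sum_congr rfl fun i _ => ?_
        rw [map_sum]
        refine sum_congr rfl fun k _ => ?_
        simp [word_cons, mul_assoc]
  have h1 : ∀ p : Wick ι τ,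
      p ∈ Submodule.span ℂ (Set.range (FreeAlgebra.basisFreeMonoid ℂ (Jet ι τ))) := by
    intro p; rw [Module.Basis.span_eq]; trivial
  have hA := h1 A
  induction hA using span_induction with
  | mem A hA =>
    obtain ⟨w₁, rfl⟩ := hA
    have hB := h1 B
    induction hB using span_induction with
    | mem B hB =>
      obtain ⟨w₂, rfl⟩ := hB
      rw [basisFreeMonoid_apply, basisFreeMonoid_apply, ← hw, YangMills.tree, constr_word,
        constr_word]
      rfl
    | _ => simp [*]
  | _ => simp [*]

end Contraction

section Derivatives

variable {ι τ : Type*} {C : Jet ι τ → Jet ι τ → Distr}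

/-- Contractions are compatible with translations. -/
structure Covariant (C : Jet ι τ → Jet ι τ → Distr) : Prop where
  left : ∀ x y μ, C (x.shift μ) y = distD μ (C x y)
  right : ∀ x y μ, C x (y.shift μ) = -distD μ (C x y)

lemma pd_zero_contract (ε : Bool) (c : Jet ι τ → Distr) (μ : Fin 4) (B : Wick ι τ) :
    pd 0 μ (contract ε c B) = contract ε (fun y => distD μ (c y)) B := by
  induction B using freeAlgebra_induction with
  | hmul x p ih =>
    simp only [contract_ι_mul, map_add, pd_tmul, if_true, one_smul,
      wick₂D_at₂_ne (show (1 : Fin 2) ≠ 0 by decide), tmul_zero, add_zero, map_smul,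
      pd_lm, wick₂D_ι, ih]
    simp
  | _ => simp [*]

lemma pd_one_contract (hC : Covariant C) (ε : Bool) (x : Jet ι τ) (μ : Fin 4) (B : Wick ι τ) :
    pd 1 μ (contract ε (C x) B) = contract ε (C x) (wickD μ B) := by
  induction B using freeAlgebra_induction with
  | hmul y p ih =>
    have hg : gsign ε (y.shift μ) = gsign ε y := rfl
    simp only [contract_ι_mul, map_add, pd_tmul, map_smul, pd_lm, wick₂D_ι, ih, wickD_mul,
      wickD_ι, hC.right, wick₂D_at₂, hg]
    simp only [one_ne_zero, if_false, if_true, neg_tmul, smul_add, neg_smul, one_smul]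
    abel
  | _ => simp [*]

lemma twist_gsign_wickD (ε : Bool) (μ : Fin 4) (p : Wick ι τ) :
    twist (gsign ε) (wickD μ p) = wickD μ (twist (gsign ε) p) := by
  have h := derExt_twist (fun _ => 1) (fun j : Jet ι τ => ιℂ (j.shift μ))
    (gsign ε) 1 (by intro x; simp [paritySign, Jet.shift, gsign]) p
  rw [wickD, h, one_smul]

lemma pd_zero_treeC (hC : Covariant C) (μ : Fin 4) (A B : Wick ι τ) :
    pd 0 μ (treeC C A B) = treeC C (wickD μ A) B := by
  induction A using freeAlgebra_induction with
  | hmul x p ih =>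
    have hl : C (x.shift μ) = fun y => distD μ (C x y) := by ext1 y; exact hC.left x y μ
    have ho : (x.shift μ).field.odd = x.field.odd := rfl
    simp only [treeC_ι_mul, map_add, pd_lm, ih, wickD_mul, wickD_ι, wick₂D_ι, if_true, wick₂D_at₂,
      pd_zero_contract, add_apply, twist_gsign_wickD, hl, ho]
    abel
  | _ => simp [*]

lemma pd_one_treeC (hC : Covariant C) (μ : Fin 4) (A B : Wick ι τ) :
    pd 1 μ (treeC C A B) = treeC C A (wickD μ B) := by
  induction A using freeAlgebra_induction with
  | hmul x p ih =>
    simp only [treeC_ι_mul, map_add, pd_lm, ih, wick₂D_ι, pd_one_contract hC,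
      wick₂D_at₂_ne (show (0 : Fin 2) ≠ 1 by decide)]
    simp
  | _ => simp [*]

/-- The bilinear extension of the contractions to linear combinations of letters. -/
def pair (C : Jet ι τ → Jet ι τ → Distr) : Wick ι τ →ₗ[ℂ] Wick ι τ →ₗ[ℂ] Distr :=
  (FreeAlgebra.basisFreeMonoid ℂ (Jet ι τ)).constr ℂ fun w =>
    (FreeAlgebra.basisFreeMonoid ℂ (Jet ι τ)).constr ℂ fun w' =>
      match w.toList, w'.toList with
      | [x], [y] => C x y
      | _, _ => 0

lemma ι_eq_word {X : Type*} (x : X) : ιℂ x = word [x] := by simp [word]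

@[simp] lemma pair_ι (C : Jet ι τ → Jet ι τ → Distr) (x y : Jet ι τ) :
    pair C (ιℂ x) (ιℂ y) = C x y := by
  rw [ι_eq_word, ι_eq_word, pair, constr_word, constr_word]; rfl

/-- Linear combinations of letters. -/
def letters (ι τ : Type*) : Submodule ℂ (Wick ι τ) :=
  Submodule.span ℂ (Set.range (ιℂ))

lemma ι_mem_letters (x : Jet ι τ) : ιℂ x ∈ letters ι τ :=
  subset_span ⟨x, rfl⟩

lemma wickD_mem_letters {p : Wick ι τ} (hp : p ∈ letters ι τ) (μ : Fin 4) :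
    wickD μ p ∈ letters ι τ := by
  induction hp using span_induction with
  | mem x hx => obtain ⟨y, rfl⟩ := hx; rw [wickD_ι]; exact ι_mem_letters _
  | zero => simp
  | add p q _ _ hp hq => rw [map_add]; exact add_mem hp hq
  | smul a p _ hp => rw [map_smul]; exact smul_mem _ _ hp

lemma pair_wickD_left (hC : Covariant C) {p q : Wick ι τ} (hp : p ∈ letters ι τ)
    (hq : q ∈ letters ι τ) (μ : Fin 4) : pair C (wickD μ p) q = distD μ (pair C p q) := by
  induction hp using span_induction with
  | mem x hx =>
    obtain ⟨x, rfl⟩ := hx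
    induction hq using span_induction with
    | mem y hy => obtain ⟨y, rfl⟩ := hy; simp [hC.left]
    | zero => simp
    | add p q _ _ hp hq => simp only [map_add, hp, hq]
    | smul a p _ hp => simp only [map_smul, hp]
  | _ => simp [*]

lemma pair_wickD_right (hC : Covariant C) {p q : Wick ι τ} (hp : p ∈ letters ι τ)
    (hq : q ∈ letters ι τ) (μ : Fin 4) : pair C p (wickD μ q) = -distD μ (pair C p q) := by
  induction hp using span_induction with
  | mem x hx =>
    obtain ⟨x, rfl⟩ := hx
    induction hq using span_induction with
    | mem y hy => obtain ⟨y, rfl⟩ := hy; simp [hC.right]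
    | zero => simp
    | add p q _ _ hp hq => simp only [map_add, hp, hq, neg_add]
    | smul a p _ hp => simp only [map_smul, hp, smul_neg]
  | zero => simp
  | add p q _ _ hp hq => simp only [map_add, add_apply, hp, hq, neg_add]
  | smul a p _ hp => simp only [map_smul, smul_apply, hp, smul_neg]

/-- The contractions of a linear combination of letters with the letters. -/
def ctr (C : Jet ι τ → Jet ι τ → Distr) (e : Wick ι τ) (y : Jet ι τ) : Distr :=
  pair C e (ιℂ y)

lemma ctr_ι (x : Jet ι τ) : ctr C (ιℂ x) = C x := by ext1 y; simp [ctr]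

lemma ctr_add (e e' : Wick ι τ) : ctr C (e + e') = ctr C e + ctr C e' := by
  ext1 y; simp [ctr]

lemma ctr_smul (a : ℂ) (e : Wick ι τ) : ctr C (a • e) = a • ctr C e := by
  ext1 y; simp [ctr]

/-- Linear combinations of letters of parity `ε`. -/
def plets (ε : Bool) : Submodule ℂ (Wick ι τ) :=
  Submodule.span ℂ {p | ∃ x : Jet ι τ, x.field.odd = ε ∧ p = ιℂ x}

lemma plets_le_letters (ε : Bool) : plets ε ≤ letters ι τ := by
  refine Submodule.span_mono ?_
  rintro _ ⟨x, _, rfl⟩; exact ⟨x, rfl⟩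

lemma ι_mem_plets (x : Jet ι τ) : ιℂ x ∈ plets (ι := ι) (τ := τ) x.field.odd :=
  subset_span ⟨x, rfl, rfl⟩

lemma wickD_mem_plets {ε : Bool} {p : Wick ι τ} (hp : p ∈ plets ε) (μ : Fin 4) :
    wickD μ p ∈ plets ε := by
  induction hp using span_induction with
  | mem x hx =>
    obtain ⟨y, rfl, rfl⟩ := hx; rw [wickD_ι]; exact ι_mem_plets (y.shift μ)
  | zero => simp
  | add p q _ _ hp hq => rw [map_add]; exact add_mem hp hq
  | smul a p _ hp => rw [map_smul]; exact smul_mem _ _ hp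

lemma treeC_plets_mul (C : Jet ι τ → Jet ι τ → Distr) {ε : Bool} {e : Wick ι τ} (he : e ∈ plets ε)
    (p B : Wick ι τ) :
    treeC C (e * p) B = lm (at₂ 0 e) (treeC C p B) +
      lm (at₂ 0 (twist (gsign ε) p)) (contract ε (ctr C e) B) := by
  induction he using span_induction with
  | mem x hx => obtain ⟨y, rfl, rfl⟩ := hx; rw [treeC_ι_mul, ctr_ι, at₂_ι]
  | zero =>
    have : ctr C (0 : Wick ι τ) = (0 : ℂ) • ctr C 0 := by rw [← ctr_smul, smul_zero]
    rw [this, contract_smul_fun]; simp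
  | add p q _ _ hp hq =>
    simp only [add_mul, map_add, add_apply, hp, hq, ctr_add, contract_add_fun]; abel
  | smul a p _ hp =>
    simp only [smul_mul_assoc, map_smul, smul_apply, hp, ctr_smul, contract_smul_fun,
      smul_add]

lemma contract_plets_mul (c : Wick ι τ →ₗ[ℂ] Distr) {ε ε' : Bool} {e : Wick ι τ}
    (he : e ∈ plets ε') (p : Wick ι τ) :
    contract ε (fun y => c (ιℂ y)) (e * p) = c e ⊗ₜ at₂ 1 p +
      bsign ε ε' • lm (at₂ 1 e) (contract ε (fun y => c (ιℂ y)) p) := by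
  induction he using span_induction with
  | mem x hx => obtain ⟨y, rfl, rfl⟩ := hx; rw [contract_ι_mul, at₂_ι, gsign_eq_bsign]
  | zero => simp
  | add p q _ _ hp hq =>
    simp only [add_mul, map_add, add_apply, hp, hq, add_tmul, smul_add]
    abel
  | smul a p _ hp =>
    simp only [smul_mul_assoc, map_smul, smul_apply, hp, smul_add, smul_comm a,
      ← smul_tmul']

/-- Compatibility of the contractions with an odd derivation. -/
structure DerivInvariant (C : Jet ι τ → Jet ι τ → Distr) (D : Jet ι τ → Wick ι τ) : Prop where
  parity : ParityMatrix C
  mem : ∀ x, D x ∈ plets (ι := ι) (τ := τ) (!x.field.odd)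
  inv : ∀ x y, pair C (D x) (ιℂ y) +
    paritySign x • pair C (ιℂ x) (D y) = 0

lemma ctr_eq_pair (x : Jet ι τ) :
    C x = fun y => (pair C (ιℂ x)) (ιℂ y) := by
  ext1 y; simp

lemma twist_gsign_derExt (ε : Bool) {D : Jet ι τ → Wick ι τ}
    (hD : ∀ x, D x ∈ plets (ι := ι) (τ := τ) (!x.field.odd)) (p : Wick ι τ) :
    twist (gsign ε) (derExt paritySign D p) =
      (if ε = true then (-1 : ℂ) else 1) • derExt paritySign D (twist (gsign ε) p) := by
  refine derExt_twist _ _ _ _ (fun x => ?_) p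
  have := hD x
  generalize D x = q at this
  induction this using span_induction with
  | mem y hy =>
    obtain ⟨y, hy, rfl⟩ := hy
    rw [twist_ι]
    congr 1
    unfold gsign paritySign
    rw [hy]
    cases ε <;> cases x.field.odd <;> simp
  | smul a p _ hp => simp only [map_smul, hp]; rw [smul_comm]
  | _ => simp [smul_add, *]

lemma oddDer₂_contract {D : Jet ι τ → Wick ι τ} (hD : DerivInvariant C D) (x : Jet ι τ)
    (B : Wick ι τ) :
    oddDer₂ D (contract x.field.odd (C x) B) = contract (!x.field.odd) (ctr C (D x)) B +
      paritySign x • contract x.field.odd (C x) (derExt paritySign D B) := by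
  induction B using freeAlgebra_induction with
  | h1 => simp
  | hmul y p ih =>
    have h1 : contract x.field.odd (C x) (D y * p) =
        pair C (ιℂ x) (D y) ⊗ₜ at₂ 1 p + bsign x.field.odd (!y.field.odd) •
        lm (at₂ 1 (D y)) (contract x.field.odd (C x) p) := by
      rw [ctr_eq_pair (C := C)]
      exact contract_plets_mul _ (hD.mem y) p
    have h2 : ctr C (D x) y = -(paritySign x • pair C (ιℂ x) (D y)) :=
      eq_neg_of_add_eq_zero_left (hD.inv x y)
    have hs1 : gsign x.field.odd y = paritySign x * bsign x.field.odd (!y.field.odd) := by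
      unfold gsign bsign paritySign; cases x.field.odd <;> cases y.field.odd <;> simp
    have hs2 : gsign (!x.field.odd) y = gsign x.field.odd y * paritySign y := by
      unfold gsign paritySign; cases x.field.odd <;> cases y.field.odd <;> simp
    have ht : twist paritySign₂ (ιℂ ((1 : Fin 2), y)) =
      paritySign y • ιℂ ((1 : Fin 2), y) := by rw [twist_ι]; rfl
    have h3 : C x y ⊗ₜ[ℂ] at₂ 1 (derExt paritySign D p) =
        (paritySign x * paritySign y) • (C x y ⊗ₜ[ℂ] at₂ 1 (derExt paritySign D p)) := by
      by_cases h : x.field.odd = y.field.odd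
      · have : paritySign x = paritySign y := by simp [paritySign, h]
        rw [this, paritySign_mul_self, one_smul]
      · rw [hD.parity _ _ h]; simp
    simp only [contract_ι_mul, map_add, oddDer₂_tmul, derExt_at₂, map_smul, oddDer₂_lm, derExt_ι,
      ih, derExt_ι_mul, h1, h2, ht, smul_add, smul_smul, hs2, smul_apply]
    rw [hs1]
    simp only [neg_tmul, ← smul_tmul']
    linear_combination (norm := module) h3
  | hadd p q h h' => simp only [map_add, h, h', smul_add]; abel
  | hsmul b p h => simp only [map_smul, h, smul_add, smul_comm b]

/-- The odd derivation acts on tree products by the graded Leibniz rule. -/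
lemma oddDer₂_treeC {D : Jet ι τ → Wick ι τ} (hD : DerivInvariant C D) (A B : Wick ι τ) :
    oddDer₂ D (treeC C A B) = treeC C (derExt paritySign D A) B +
      treeC C (twist paritySign A) (derExt paritySign D B) := by
  induction A using freeAlgebra_induction with
  | hmul x p ih =>
    have ht : twist paritySign₂ (ιℂ ((0 : Fin 2), x)) =
      paritySign x • ιℂ ((0 : Fin 2), x) := by rw [twist_ι]; rfl
    have ht2 : ∀ q : Wick ι τ, twist paritySign₂ (at₂ 0 q) = at₂ 0 (twist paritySign q) :=
      fun q => twist_at₂ paritySign 0 q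
    have h1 : twist (gsign (!x.field.odd)) p =
        twist paritySign (twist (gsign x.field.odd) p) := by
      rw [← gsign_true, twist_twist]
      congr 2; ext y; rw [gsign_mul_gsign]; simp
    have h2 := twist_gsign_derExt x.field.odd hD.mem p
    have h3 : twist (gsign x.field.odd) (twist paritySign p) =
        twist paritySign (twist (gsign x.field.odd) p) := by
      rw [twist_twist, twist_twist]; congr 2; ext y; ring
    have h4 : paritySign x = if x.field.odd = true then (-1 : ℂ) else 1 := rfl
    have h5 := paritySign_mul_self x
    simp only [treeC_ι_mul, map_add, oddDer₂_lm, derExt_ι, ih, derExt_at₂, ht, ht2,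
      oddDer₂_contract hD, derExt_ι_mul, map_smul, add_apply, smul_apply,
      treeC_plets_mul C (hD.mem x), h1, h2, map_mul, twist_ι, smul_mul_assoc, h3, smul_add,
      ← h4, smul_smul, h5, one_smul]
    abel
  | hadd p q h h' => simp only [map_add, add_apply, h, h']; abel
  | _ => simp [smul_add, *]

end Derivatives

/-- Induction on the elements of the subalgebra generated by a set of letters. -/
lemma adjoin_letters_induction {X : Type*} {s : Set X} {P : FreeAlgebra ℂ X → Prop} (h1 : P 1)
    (hmul : ∀ x ∈ s, ∀ p, P p → P (ιℂ x * p))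
    (hadd : ∀ p q, P p → P q → P (p + q)) (hsmul : ∀ (c : ℂ) p, P p → P (c • p))
    {p : FreeAlgebra ℂ X} (hp : p ∈ Algebra.adjoin ℂ (ιℂ '' s)) : P p := by
  rw [Algebra.adjoin_eq_range_freeAlgebra_lift] at hp
  obtain ⟨q, rfl⟩ := hp
  simp only [AlgHom.toRingHom_eq_coe, RingHom.coe_coe]
  induction q using freeAlgebra_induction with
  | h1 => simpa using h1
  | hmul x q ih =>
    obtain ⟨_, y, hy, rfl⟩ := x
    rw [map_mul]
    simpa using hmul y hy _ ih
  | hadd p q hp hq => rw [map_add]; exact hadd _ _ hp hq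
  | hsmul c p hp => rw [map_smul]; exact hsmul c _ hp

lemma hasParity_of_mem_plets {ι τ : Type*} {ε : Bool} {e : Wick ι τ} (he : e ∈ plets ε) :
    HasParity ε e := by
  induction he using span_induction with
  | mem y hy => obtain ⟨y, rfl, rfl⟩ := hy; exact .letter y
  | zero => exact .zero
  | add p q _ _ hp hq => exact hp.add hq
  | smul a p _ hp => exact hp.smul a

lemma Distr.smul_zero' (a : ℂ) : a • (0 : Distr) = 0 := smul_zero (A := Distr) a

lemma Distr.zero_smul' (d : Distr) : (0 : ℂ) • d = 0 := zero_smul ℂ d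

namespace YangMills

variable {ι τ : Type*} (M : YangMills ι τ)

/-- The distribution `δ`. -/
abbrev dirac : Distr := TemperedDistribution.delta (0 : Spacetime)

/-- The class of `δ(x₁ - x₂) N(x₁)`. -/
def loc : Wick ι τ →ₗ[ℂ] M.OpDistr :=
  M.cl ∘ₗ TensorProduct.mk ℂ Distr (Wick₂ ι τ) dirac ∘ₗ (at₂ 0).toLinearMap

lemma loc_apply (p : Wick ι τ) : M.loc p = M.cl (quasiLocal p) := rfl

lemma loc_apply' (p : Wick ι τ) : M.loc p = M.cl (dirac ⊗ₜ at₂ 0 p) := rfl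

lemma cl_diag (k : Fin 2) (p : Wick ι τ) (P Q : Wick₂ ι τ) :
    M.cl (dirac ⊗ₜ (P * at₂ k p * Q)) = M.cl (dirac ⊗ₜ (P * at₂ 0 p * Q)) := by
  induction p using freeAlgebra_induction generalizing P with
  | hmul x p ih =>
    have h : M.cl (dirac ⊗ₜ (P * ιℂ (k, x) * (at₂ 0 p * Q))) =
        M.cl (dirac ⊗ₜ (P * ιℂ (0, x) * (at₂ 0 p * Q))) := by
      have := M.cl_eq_zero_of_rel (.diag P (at₂ 0 p * Q) x)
      rw [mul_sub, sub_mul, tmul_sub, map_sub, sub_eq_zero] at this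
      fin_cases k
      · rfl
      · exact this.symm
    have h2 := ih (P * ιℂ (k, x))
    simp only [map_mul, at₂_ι, mul_assoc] at *
    rw [h2, h]
  | _ => simp [mul_add, add_mul, tmul_add, mul_smul_comm, smul_mul_assoc, tmul_smul, *]

lemma cl_dirac_mul (k l : Fin 2) (p q : Wick ι τ) :
    M.cl (dirac ⊗ₜ (at₂ k p * at₂ l q)) = M.loc (p * q) := by
  have h1 := M.cl_diag k p 1 (at₂ l q)
  have h2 := M.cl_diag l q (at₂ 0 p) 1
  rw [one_mul, one_mul] at h1
  rw [mul_one, mul_one] at h2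
  rw [h1, h2, loc_apply', map_mul]

lemma lmq_loc (k : Fin 2) (p q : Wick ι τ) : M.lmq (at₂ k p) (M.loc q) = M.loc (p * q) := by
  rw [loc_apply', lmq_cl_tmul, cl_dirac_mul]

lemma loc_fieldEq {e : Wick ι τ} (he : M.FieldEq e) (p q : Wick ι τ) : M.loc (p * e * q) = 0 := by
  rw [loc_apply', map_mul, map_mul]
  exact M.cl_eq_zero_of_rel (.fieldEq _ _ _ 0 e he)

lemma loc_exch (p q : Wick ι τ) {x : Wick ι τ} (hx : x ∈ exchRel ι τ) :
    M.loc (p * x * q) = 0 := by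
  obtain ⟨y, z, rfl⟩ := hx
  rw [loc_apply', map_mul, map_mul]
  have := M.cl_eq_zero_of_rel (.exch dirac (at₂ 0 p) (at₂ 0 q) (0, y) (0, z))
  simpa using this

lemma cl_distD_dirac (μ : Fin 4) (p q : Wick ι τ) :
    M.cl (distD μ dirac ⊗ₜ (at₂ 0 p * at₂ 1 q)) =
      M.pdq 0 μ (M.loc (p * q)) - M.loc (wickD μ p * q) := by
  rw [← M.cl_dirac_mul 0 1 p q, ← M.cl_dirac_mul 0 1 (wickD μ p) q, pdq_cl, pd_tmul, wick₂D_mul,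
    wick₂D_at₂, wick₂D_at₂_ne (show (1 : Fin 2) ≠ 0 by decide)]
  simp

lemma cl_distD_dirac' (μ : Fin 4) (p q : Wick ι τ) :
    M.cl (distD μ dirac ⊗ₜ (at₂ 0 p * at₂ 1 q)) =
      M.loc (p * wickD μ q) - M.pdq 1 μ (M.loc (p * q)) := by
  rw [← M.cl_dirac_mul 0 1 p q, ← M.cl_dirac_mul 0 1 p, pdq_cl, pd_tmul, wick₂D_mul,
    wick₂D_at₂, wick₂D_at₂_ne (show (0 : Fin 2) ≠ 1 by decide)]
  simp

lemma cl_lm_exch (x y : Fin 2 × Jet ι τ) (X : TwoPoint ι τ) :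
    M.cl (lm (ιℂ x * ιℂ y -
      exchSign x.2 y.2 • (ιℂ y * ιℂ x)) X) = 0 := by
  induction X using TensorProduct.induction_on with
  | zero => simp
  | tmul d V =>
    rw [lm_tmul]
    have := M.cl_eq_zero_of_rel (.exch d 1 V x y)
    rwa [one_mul] at this
  | add X Y hX hY => rw [map_add, map_add, hX, hY, add_zero]

lemma cl_lm_fieldEq (k : Fin 2) {e : Wick ι τ} (he : M.FieldEq e) (X : TwoPoint ι τ) :
    M.cl (lm (at₂ k e) X) = 0 := by
  induction X using TensorProduct.induction_on with
  | zero => simp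
  | tmul d V =>
    rw [lm_tmul]
    have := M.cl_eq_zero_of_rel (.fieldEq d 1 V k e he)
    rwa [one_mul] at this
  | add X Y hX hY => rw [map_add, map_add, hX, hY, add_zero]

lemma lmq_congr {V W : Wick₂ ι τ} (h : toRel (exchRel₂ ι τ) V = toRel (exchRel₂ ι τ) W)
    (X : M.OpDistr) : M.lmq V X = M.lmq W X := by
  obtain ⟨X, rfl⟩ := mkQ_surjective _ X
  change M.cl (lm V X) = M.cl (lm W X)
  induction X using TensorProduct.induction_on with
  | zero => simp
  | tmul d U =>
    rw [lm_tmul, lm_tmul]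
    apply M.cl_tmul_congr
    rw [map_mul, map_mul, h]
  | add X Y hX hY => rw [map_add, map_add, map_add, map_add, hX, hY]

lemma lmq_zero : M.lmq (0 : Wick₂ ι τ) = 0 := by
  refine LinearMap.ext fun X => ?_
  obtain ⟨X, rfl⟩ := mkQ_surjective _ X
  change M.cl (lm 0 X) = 0
  simp

section Exchange

variable {C : Jet ι τ → Jet ι τ → Distr}

lemma cl_contract_exch {ε : Bool} {c : Jet ι τ → Distr}
    (hc : ∀ y, y.field.odd ≠ ε → c y = 0) (a b : Wick ι τ) {x : Wick ι τ}
    (hx : x ∈ exchRel ι τ) : M.cl (contract ε c (a * x * b)) = 0 := by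
  obtain ⟨y, z, rfl⟩ := hx
  induction a using freeAlgebra_induction with
  | h1 =>
    have h1 : c y ⊗ₜ[ℂ] at₂ 1 (ιℂ z * b) =
        (exchSign y z * gsign ε z) • (c y ⊗ₜ[ℂ] at₂ 1 (ιℂ z * b)) := by
      by_cases h : y.field.odd = ε
      · rw [exchSign_eq_gsign, h, gsign_mul_self, one_smul]
      · rw [hc y h]; simp
    have h2 : exchSign y z • c z ⊗ₜ[ℂ] at₂ 1 (ιℂ y * b) =
        gsign ε y • (c z ⊗ₜ[ℂ] at₂ 1 (ιℂ y * b)) := by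
      by_cases h : z.field.odd = ε
      · rw [exchSign_comm, exchSign_eq_gsign, h]
      · rw [hc z h]; simp
    have h3 := M.cl_lm_exch (1, y) (1, z) (contract ε c b)
    have h4 : contract ε c (1 * (ιℂ y * ιℂ z -
        exchSign y z • (ιℂ z * ιℂ y)) * b) =
        (gsign ε y * gsign ε z) • lm (ιℂ (1, y) * ιℂ (1, z) -
          exchSign y z • (ιℂ (1, z) * ιℂ (1, y))) (contract ε c b) := by
      simp only [one_mul, sub_mul, smul_mul_assoc, mul_assoc, map_sub, map_smul, contract_ι_mul,
        map_add, lm_tmul, sub_apply, smul_apply, map_mul, at₂_ι,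
        Module.End.mul_apply] at h1 h2 ⊢
      linear_combination (norm := module) h1 - h2
    rw [h4, map_smul, h3, smul_zero]
  | hmul w p ih =>
    simp only [mul_assoc] at ih ⊢
    rw [contract_ι_mul, map_add, map_smul, M.cl_lm_eq_zero _ ih, smul_zero, add_zero]
    have := M.cl_eq_zero_of_rel (.exch (c w) (at₂ 1 p) (at₂ 1 b) (1, y) (1, z))
    simpa [mul_assoc] using this
  | _ => simp [add_mul, smul_mul_assoc, *]

lemma cl_treeC_exch_left (a b B : Wick ι τ) {x : Wick ι τ} (hx : x ∈ exchRel ι τ) :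
    M.cl (treeC C (a * x * b) B) = 0 := by
  obtain ⟨y, z, rfl⟩ := hx
  induction a using freeAlgebra_induction with
  | h1 =>
    have h3 := M.cl_lm_exch (0, y) (0, z) (treeC C b B)
    have hs := exchSign_mul_self y z
    have h1 : gsign y.field.odd z = exchSign y z := (exchSign_eq_gsign _ _).symm
    have h2 : gsign z.field.odd y = exchSign y z := by rw [← exchSign_eq_gsign, exchSign_comm]
    have h4 : treeC C (1 * (ιℂ y * ιℂ z -
        exchSign y z • (ιℂ z * ιℂ y)) * b) B =
        lm (ιℂ (0, y) * ιℂ (0, z) -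
          exchSign y z • (ιℂ (0, z) * ιℂ (0, y))) (treeC C b B) := by
      simp only [one_mul, sub_mul, smul_mul_assoc, mul_assoc, map_sub, map_smul, treeC_ι_mul,
        map_add, sub_apply, smul_apply, map_mul, at₂_ι, twist_ι, h1, h2,
        Module.End.mul_apply, smul_add, smul_smul, hs, one_smul]
      abel
    rw [h4, h3]
  | hmul w p ih =>
    simp only [mul_assoc] at ih ⊢
    rw [treeC_ι_mul, map_add, M.cl_lm_eq_zero _ ih, zero_add]
    have h5 : ∀ σ : Jet ι τ → ℂ, twist σ (p * ((ιℂ y * ιℂ z -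
        exchSign y z • (ιℂ z * ιℂ y)) * b)) =
        (σ y * σ z) • (twist σ p * ((ιℂ y * ιℂ z -
        exchSign y z • (ιℂ z * ιℂ y)) * twist σ b)) := by
      intro σ
      simp only [map_mul, map_sub, map_smul, twist_ι, smul_mul_assoc, mul_smul_comm, smul_smul,
        smul_sub, mul_sub, sub_mul]
      module
    rw [h5, map_smul, map_smul, smul_apply, map_smul, map_mul, map_mul, map_mul, map_mul,
      Module.End.mul_apply, Module.End.mul_apply]
    have h6 := M.cl_lm_exch (0, y) (0, z)
      (lm (at₂ 0 (twist (gsign w.field.odd) b)) (contract w.field.odd (C w) B))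
    have h7 := M.cl_lm_eq_zero (at₂ 0 (twist (gsign w.field.odd) p)) h6
    simp only [map_sub, map_mul, map_smul, at₂_ι] at h7 ⊢
    rw [h7, smul_zero]
  | _ => simp [add_mul, smul_mul_assoc, *]

lemma cl_treeC_exch_right (hC : ParityMatrix C) (A a b : Wick ι τ) {x : Wick ι τ}
    (hx : x ∈ exchRel ι τ) : M.cl (treeC C A (a * x * b)) = 0 := by
  induction A using freeAlgebra_induction with
  | hmul y p ih =>
    rw [treeC_ι_mul, map_add, M.cl_lm_eq_zero _ ih, zero_add]
    exact M.cl_lm_eq_zero _ (M.cl_contract_exch (fun z hz => hC _ _ (Ne.symm hz)) a b hx)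
  | _ => simp [*]

lemma cl_treeC_congr_left {A A' : Wick ι τ}
    (h : toRel (exchRel ι τ) A = toRel (exchRel ι τ) A') (B : Wick ι τ) :
    M.cl (treeC C A B) = M.cl (treeC C A' B) :=
  toRel_factor (V := M.OpDistr)
    { toFun := fun A => M.cl (treeC C A B)
      map_add' := fun x y => by rw [map_add, add_apply, map_add]
      map_smul' := fun c x => by rw [map_smul, smul_apply, map_smul]; rfl }
    (fun a b _ hx => M.cl_treeC_exch_left a b B hx) h

lemma cl_treeC_congr_right (hC : ParityMatrix C) (A : Wick ι τ) {B B' : Wick ι τ}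
    (h : toRel (exchRel ι τ) B = toRel (exchRel ι τ) B') :
    M.cl (treeC C A B) = M.cl (treeC C A B') :=
  toRel_factor (V := M.OpDistr)
    { toFun := fun B => M.cl (treeC C A B)
      map_add' := fun x y => by rw [map_add, map_add]
      map_smul' := fun c x => by rw [map_smul, map_smul]; rfl }
    (fun a b _ hx => M.cl_treeC_exch_right hC A a b hx) h

end Exchange

section Variation

variable {C : Jet ι τ → Jet ι τ → Distr} {𝒜 : Set (Jet ι τ)}

lemma cl_treeC_mul_fieldEq {ε : Bool} {e : Wick ι τ} (he : e ∈ plets ε) (hf : M.FieldEq e)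
    (p B : Wick ι τ) :
    M.cl (treeC C (p * e) B) = M.cl (lm (at₂ 0 p) (contract ε (ctr C e) B)) := by
  induction p using freeAlgebra_induction with
  | h1 =>
    have := treeC_plets_mul C he 1 B
    rw [mul_one] at this
    rw [one_mul, this]
    simp
  | hmul x p ih =>
    have he' := (hasParity_of_mem_plets he).twist_gsign
    rw [mul_assoc, treeC_ι_mul, map_add, M.cl_lm_congr _ ih, map_mul (twist _), he', map_mul,
      map_smul, map_mul (at₂ 0), map_mul lm, map_mul lm, at₂_ι]
    have := M.cl_lm_eq_zero (at₂ 0 (twist (gsign x.field.odd) p))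
      (M.cl_lm_fieldEq 0 hf (contract x.field.odd (C x) B))
    simp only [map_smul, Module.End.mul_apply, smul_apply, this]
    simp
  | _ => simp [add_mul, smul_mul_assoc, *]

/-- Move a letter at `x₂` to the left through a homogeneous polynomial at `x₁`. -/
lemma lmq_at_swap {ε : Bool} {p : Wick ι τ} (hp : HasParity ε p) (x : Jet ι τ) (X : M.OpDistr) :
    M.lmq (at₂ 0 p) (M.lmq (ιℂ (1, x)) X) =
      gsign ε x • M.lmq (ιℂ (1, x)) (M.lmq (at₂ 0 p) X) := by
  rw [← lmq_mul, M.lmq_congr (toRel₂_mul_ι (1, x) (at₂ 0 p)), lmq_mul]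
  have h := twist_at₂ (gsign x.field.odd) 0 p
  simp only at h ⊢
  rw [h, hp.twist_gsign]
  have : bsign x.field.odd ε = gsign ε x := by
    rw [gsign_eq_bsign]; simp [bsign, Bool.and_comm]
  obtain ⟨X, rfl⟩ := mkQ_surjective _ X
  change M.cl (lm _ (lm _ X)) = _ • M.cl (lm _ (lm _ X))
  rw [this, map_smul, map_smul, smul_apply, map_smul, map_smul]

/-- `K` acts under the tree product, up to total derivatives, as minus the derivation of parity `ε`
with the values `s` on the letters in `𝒜`; `y ρ` describes the total derivatives. -/
structure IsVariation (C : Jet ι τ → Jet ι τ → Distr) (𝒜 : Set (Jet ι τ)) (ε : Bool) (K : Wick ι τ)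
    (s : Jet ι τ → Wick ι τ) (y : Fin 4 → Jet ι τ → Wick ι τ) : Prop where
  left : ∀ B ∈ Algebra.adjoin ℂ (ιℂ '' 𝒜),
    M.cl (treeC C K B) = -M.loc (derExt (gsign ε) s B) +
      ∑ ρ, M.pdq 0 ρ (M.loc (derExt (gsign ε) (y ρ) B))
  right : ∀ B ∈ Algebra.adjoin ℂ (ιℂ '' 𝒜),
    M.cl (treeC C B K) = -M.loc (derExt (gsign ε) s (twist (gsign ε) B)) +
      ∑ ρ, M.pdq 1 ρ (M.loc (derExt (gsign ε) (y ρ) (twist (gsign ε) B)))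

lemma IsVariation.zero {ε : Bool} :
    M.IsVariation C 𝒜 ε 0 (fun _ => 0) (fun _ _ => 0) where
  left B _ := by simp [derExt_zero_fun]
  right B _ := by simp [derExt_zero_fun]

variable {M}

lemma IsVariation.add {ε : Bool} {K K' : Wick ι τ} {s s' : Jet ι τ → Wick ι τ}
    {y y' : Fin 4 → Jet ι τ → Wick ι τ} (h : M.IsVariation C 𝒜 ε K s y)
    (h' : M.IsVariation C 𝒜 ε K' s' y') :
    M.IsVariation C 𝒜 ε (K + K') (fun x => s x + s' x) (fun ρ x => y ρ x + y' ρ x) where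
  left B hB := by
    simp only [map_add, add_apply, h.left B hB, h'.left B hB, derExt_add_fun, neg_add,
      sum_add_distrib]
    abel
  right B hB := by
    simp only [map_add, h.right B hB, h'.right B hB, derExt_add_fun, neg_add,
      sum_add_distrib]
    abel

lemma IsVariation.smul {ε : Bool} {K : Wick ι τ} {s : Jet ι τ → Wick ι τ}
    {y : Fin 4 → Jet ι τ → Wick ι τ} (h : M.IsVariation C 𝒜 ε K s y) (c : ℂ) :
    M.IsVariation C 𝒜 ε (c • K) (fun x => c • s x) (fun ρ x => c • y ρ x) where
  left B hB := by
    simp only [map_smul, smul_apply, h.left B hB, derExt_smul_fun, smul_add,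
      smul_sum, smul_neg]
  right B hB := by
    simp only [map_smul, h.right B hB, derExt_smul_fun, smul_add, smul_sum, smul_neg]

lemma IsVariation.congr {ε : Bool} {K K' : Wick ι τ} {s s' : Jet ι τ → Wick ι τ}
    {y y' : Fin 4 → Jet ι τ → Wick ι τ} (h : M.IsVariation C 𝒜 ε K s y) (hC : ParityMatrix C)
    (hK : toRel (exchRel ι τ) K' = toRel (exchRel ι τ) K) (hs : s' = s)
    (hy : y' = y) : M.IsVariation C 𝒜 ε K' s' y' := by
  subst hs hy
  exact ⟨fun B hB => by rw [M.cl_treeC_congr_left hK, h.left B hB],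
    fun B hB => by rw [M.cl_treeC_congr_right hC B hK, h.right B hB]⟩

lemma cl_contract_mul_fieldEq {ε : Bool} {e : Wick ι τ} (c : Wick ι τ →ₗ[ℂ] Distr)
    (he : e ∈ plets ε) (hf : M.FieldEq e) (ε' : Bool) (q : Wick ι τ) :
    M.cl (contract ε' (fun y => c (ιℂ y)) (q * e)) =
      M.cl (c e ⊗ₜ at₂ 1 (twist (gsign ε') q)) := by
  induction q using freeAlgebra_induction with
  | h1 =>
    have h := contract_plets_mul c (ε := ε') he 1
    rw [mul_one] at h
    rw [one_mul, h]; simp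
  | hmul x q ih =>
    rw [mul_assoc, contract_ι_mul, map_add, map_smul, M.cl_lm_congr _ ih, lm_tmul, map_mul,
      map_mul (twist _), twist_ι, smul_mul_assoc, map_smul, map_mul, at₂_ι,
      tmul_smul, map_smul]
    have := M.cl_eq_zero_of_rel (.fieldEq (c (ιℂ x)) (at₂ 1 q) 1 1 e hf)
    rw [mul_one] at this
    rw [this, zero_add]
  | _ => simp [add_mul, tmul_add, smul_mul_assoc, tmul_smul, *]

lemma loc_mul_swap {ε : Bool} {q : Wick ι τ} (hq : HasParity ε q) (p : Wick ι τ) :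
    M.loc (p * q) = M.loc (q * twist (gsign ε) p) := by
  induction p using freeAlgebra_induction generalizing q with
  | h1 => simp
  | hmul x p ih =>
    have h1 : M.loc (ιℂ x * (p * q)) =
        M.loc (ιℂ x * (q * twist (gsign ε) p)) := by
      have := congrArg (M.lmq (at₂ 0 (ιℂ x))) (ih hq)
      rwa [lmq_loc, lmq_loc] at this
    have h2 : M.loc (q * (ιℂ x * twist (gsign ε) p)) =
        gsign ε x • M.loc (ιℂ x * (q * twist (gsign ε) p)) := by
      have := M.lmq_at_swap hq x (M.loc (twist (gsign ε) p))
      rw [← at₂_ι, lmq_loc, lmq_loc, lmq_loc, lmq_loc] at this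
      exact this
    rw [mul_assoc, h1, map_mul (twist _), twist_ι, smul_mul_assoc, mul_smul_comm, map_smul, h2,
      smul_smul, gsign_mul_self, one_smul]
  | hadd p p' h h' => simp only [add_mul, mul_add, map_add, h hq, h' hq]
  | hsmul c p h => simp only [smul_mul_assoc, mul_smul_comm, map_smul, h hq]

/-- A field equation, multiplied by a polynomial, acts under the tree product as a variation. -/
lemma IsVariation.mul_fieldEq {ε ε' : Bool} {e p : Wick ι τ}
    (he : e ∈ plets ε) (hf : M.FieldEq e) (hp : HasParity ε' p) (a : Jet ι τ → ℂ)
    (b : Fin 4 → Jet ι τ → ℂ) (hzero : ∀ x, x.field.odd ≠ ε → a x = 0 ∧ ∀ ρ, b ρ x = 0)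
    (hl : ∀ x ∈ 𝒜, pair C e (ιℂ x) = -(a x • dirac) + ∑ ρ, b ρ x • distD ρ dirac)
    (hr : ∀ x ∈ 𝒜, pair C (ιℂ x) e =
      bsign ε ε • (-(a x • dirac) - ∑ ρ, b ρ x • distD ρ dirac)) :
    M.IsVariation C 𝒜 (xor ε' ε) (p * e) (fun x => a x • p + ∑ ρ, b ρ x • wickD ρ p)
      (fun ρ x => b ρ x • p) where
  left B hB := by
    rw [M.cl_treeC_mul_fieldEq he hf]
    refine adjoin_letters_induction (P := fun B => M.cl (lm (at₂ 0 p) (contract ε (ctr C e) B)) =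
      -M.loc (derExt (gsign (xor ε' ε)) (fun x => a x • p + ∑ ρ, b ρ x • wickD ρ p) B) +
        ∑ ρ, M.pdq 0 ρ (M.loc (derExt (gsign (xor ε' ε)) (fun x => b ρ x • p) B)))
      ?_ ?_ ?_ ?_ hB
    · simp
    · intro x hx B ih
      have hs : gsign (xor ε' ε) x = gsign ε x * gsign ε' x := by
        rw [gsign_mul_gsign, Bool.xor_comm]
      have h1 : M.cl (lm (at₂ 0 p) (contract ε (ctr C e) (ιℂ x * B))) =
          M.cl (pair C e (ιℂ x) ⊗ₜ (at₂ 0 p * at₂ 1 B)) +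
          gsign (xor ε' ε) x • M.lmq (at₂ 1 (ιℂ x))
            (M.cl (lm (at₂ 0 p) (contract ε (ctr C e) B))) := by
        have := M.lmq_at_swap hp x (M.cl (contract ε (ctr C e) B))
        simp only [lmq_cl] at this ⊢
        rw [contract_ι_mul, map_add, map_add, lm_tmul, map_smul, map_smul, this, hs, smul_smul,
          at₂_ι]
        rfl
      rw [h1, ih]
      simp only [map_add, map_neg, map_sum, lmq_loc, hl x hx, add_tmul,
        neg_tmul, sum_tmul, ← smul_tmul', map_smul,
        cl_dirac_mul, cl_distD_dirac, derExt_ι_mul, add_mul, smul_mul_assoc, sum_mul,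
        smul_add, smul_neg, smul_sum, smul_sub, sum_add_distrib,
        sum_sub_distrib]
      have h2 : ∀ ρ, M.lmq (at₂ 1 (ιℂ x)) (M.pdq 0 ρ (M.loc
          (derExt (gsign (xor ε' ε)) (fun x => b ρ x • p) B))) = M.pdq 0 ρ (M.loc
          (ιℂ x * derExt (gsign (xor ε' ε)) (fun x => b ρ x • p) B)) := by
        intro ρ
        rw [← lmq_loc M 1, pdq_lmq, wick₂D_at₂_ne (show (1 : Fin 2) ≠ 0 by decide)]
        simp [lmq_zero]
      simp only [h2]
      abel
    · intro p q hp hq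
      simp only [map_add, sum_add_distrib, hp, hq]; abel
    · intro c p hp
      simp only [map_smul, smul_add, smul_neg, smul_sum, hp]
  right B hB := by
    refine adjoin_letters_induction (P := fun B => M.cl (treeC C B (p * e)) =
      -M.loc (derExt (gsign (xor ε' ε)) (fun x => a x • p + ∑ ρ, b ρ x • wickD ρ p)
          (twist (gsign (xor ε' ε)) B)) +
        ∑ ρ, M.pdq 1 ρ (M.loc (derExt (gsign (xor ε' ε)) (fun x => b ρ x • p)
          (twist (gsign (xor ε' ε)) B)))) ?_ ?_ ?_ ?_ hB
    · simp
    · intro x hx B ih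
      have h1 : M.cl (treeC C (ιℂ x * B) (p * e)) =
          M.lmq (at₂ 0 (ιℂ x)) (M.cl (treeC C B (p * e))) +
          bsign x.field.odd ε' • M.cl (pair C (ιℂ x) e ⊗ₜ
            (at₂ 0 (twist (gsign x.field.odd) B) * at₂ 1 p)) := by
        rw [treeC_ι_mul, map_add, at₂_ι]
        congr 1
        have := cl_contract_mul_fieldEq (M := M) (pair C (ιℂ x)) he hf x.field.odd p
        rw [← ctr_eq_pair] at this
        rw [M.cl_lm_congr _ this, lm_tmul, hp.twist_gsign, map_smul, mul_smul_comm,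
          tmul_smul, map_smul]
      have h2 : ∀ ρ (Z : Wick ι τ), M.lmq (at₂ 0 (ιℂ x)) (M.pdq 1 ρ (M.loc Z)) =
          M.pdq 1 ρ (M.loc (ιℂ x * Z)) := by
        intro ρ Z
        rw [← lmq_loc M 0, pdq_lmq, wick₂D_at₂_ne (show (0 : Fin 2) ≠ 1 by decide)]
        simp [lmq_zero]
      have h3 : bsign x.field.odd ε' • M.cl (pair C (ιℂ x) e ⊗ₜ
            (at₂ 0 (twist (gsign x.field.odd) B) * at₂ 1 p)) =
          gsign (xor ε' ε) x • (-M.loc ((a x • p + ∑ ρ, b ρ x • wickD ρ p) *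
            twist (gsign (xor ε' ε)) B) +
            ∑ ρ, M.pdq 1 ρ (M.loc ((b ρ x • p) * twist (gsign (xor ε' ε)) B))) := by
        by_cases hxe : x.field.odd = ε
        · have h4 : ∀ q : Wick ι τ, HasParity ε' q → M.loc (twist (gsign ε) B * q) =
              M.loc (q * twist (gsign (xor ε' ε)) B) := by
            intro q hq
            rw [loc_mul_swap hq, twist_twist]
            simp only [gsign_mul_gsign]
          have hs : gsign (xor ε' ε) x = bsign ε ε' * bsign ε ε := by
            rw [gsign_eq_bsign, hxe]; cases ε <;> cases ε' <;> simp [bsign]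
          rw [hr x hx, hs, hxe]
          simp only [sub_tmul, neg_tmul, sum_tmul,
            ← smul_tmul', map_smul, map_sub, map_neg, map_sum, cl_dirac_mul,
            cl_distD_dirac', h4 p hp, h4 _ (hp.wickD _), add_mul, smul_mul_assoc, map_add,
            sum_mul, smul_smul, smul_sub, sum_sub_distrib]
          module
        · obtain ⟨h5, h6⟩ := hzero x hxe
          have h7 : pair C (ιℂ x) e = 0 := by
            rw [hr x hx]
            simp only [h5, h6, Distr.zero_smul', sum_const_zero, neg_zero, sub_zero,
              Distr.smul_zero']
          rw [h7]
          simp [h5, h6]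
      rw [h1, ih, h3]
      simp only [map_add, map_neg, map_sum, lmq_loc, h2, map_mul, twist_ι, smul_mul_assoc,
        map_smul, derExt_ι_mul, smul_add, smul_neg, smul_sum, sum_add_distrib,
        smul_smul, gsign_mul_self, one_smul]
      abel
    · intro p q hp hq
      simp only [map_add, add_apply, sum_add_distrib, hp, hq]; abel
    · intro c p hp
      simp only [map_smul, smul_apply, smul_add, smul_neg, smul_sum, hp]

/-- A field equation without contractions does not contribute. -/
lemma IsVariation.mul_fieldEq_zero {ε ε' : Bool} {e p : Wick ι τ}
    (he : e ∈ plets ε) (hf : M.FieldEq e) (hp : HasParity ε' p)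
    (hl : ∀ x, pair C e (ιℂ x) = 0)
    (hr : ∀ x, pair C (ιℂ x) e = 0) :
    M.IsVariation C 𝒜 (xor ε' ε) (p * e) (fun _ => 0) (fun _ _ => 0) := by
  have := IsVariation.mul_fieldEq (𝒜 := 𝒜) he hf hp (fun _ => 0) (fun _ _ => 0) (by simp)
    (fun x _ => by
      rw [hl]; simp only [Distr.zero_smul', sum_const_zero, neg_zero, add_zero]) (fun x _ => by
      rw [hr]; simp only [Distr.zero_smul', sum_const_zero, neg_zero, sub_zero, Distr.smul_zero'])
  simpa using this

end Variation

end YangMills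

open scoped FourierTransform

/-- The embedding of space into spacetime at time zero. -/
def spaceEmb : Momentum →ₗᵢ[ℝ] Spacetime where
  toFun y := WithLp.toLp 2 (Fin.cons 0 y : Fin 4 → ℝ)
  map_add' y z := by ext i; refine Fin.cases ?_ (fun j => ?_) i <;> simp
  map_smul' c y := by ext i; refine Fin.cases ?_ (fun j => ?_) i <;> simp
  norm_map' y := by
    simp [EuclideanSpace.norm_eq, Fin.sum_univ_succ]

@[simp] lemma spaceEmb_zero_apply (y : Momentum) : spaceEmb y 0 = 0 := rfl

@[simp] lemma spaceEmb_succ_apply (y : Momentum) (j : Fin 3) : spaceEmb y j.succ = y j := rfl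

/-- The splitting of spacetime into time and space. -/
def timeSpaceEquiv : ℝ × Momentum ≃ᵐ Spacetime :=
  ((MeasurableEquiv.refl ℝ).prodCongr (MeasurableEquiv.toLp 2 (Fin 3 → ℝ)).symm).trans
    ((MeasurableEquiv.piFinSuccAbove (fun _ : Fin 4 => ℝ) 0).symm.trans
      (MeasurableEquiv.toLp 2 (Fin 4 → ℝ)))

lemma timeSpaceEquiv_apply (t : ℝ) (y : Momentum) :
    timeSpaceEquiv (t, y) = t • basisVec 0 + spaceEmb y := by
  ext i
  have h : timeSpaceEquiv (t, y) = WithLp.toLp 2 (Fin.cons t y : Fin 4 → ℝ) := by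
    ext i; refine Fin.cases ?_ (fun j => ?_) i <;> rfl
  rw [h]
  refine Fin.cases ?_ (fun j => ?_) i <;> simp [basisVec]

lemma timeSpaceEquiv_measurePreserving : MeasurePreserving timeSpaceEquiv := by
  have h1 : MeasurePreserving (MeasurableEquiv.toLp 2 (Fin 4 → ℝ)) :=
    PiLp.volume_preserving_toLp (Fin 4)
  have h2 : MeasurePreserving (MeasurableEquiv.toLp 2 (Fin 3 → ℝ)).symm :=
    PiLp.volume_preserving_ofLp (Fin 3)
  have h3 := (volume_preserving_piFinSuccAbove (fun _ : Fin 4 => ℝ) 0).symm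
  have h4 := (MeasurePreserving.id (volume : Measure ℝ)).prod h2
  exact h1.comp (h3.comp h4)

/-- The restriction of a test function to a line in the time direction. -/
def timeLine (y : Momentum) : 𝓢(Spacetime, ℂ) →L[ℂ] 𝓢(ℝ, ℂ) :=
  compCLMOfAntilipschitz ℂ (g := fun t : ℝ => t • basisVec 0 + spaceEmb y) (K := 1)
    (by fun_prop) (AntilipschitzWith.of_le_mul_dist fun s t => by
      simp [dist_eq_norm, ← sub_smul, norm_smul, basisVec])

lemma timeLine_apply (y : Momentum) (φ : 𝓢(Spacetime, ℂ)) (t : ℝ) :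
    timeLine y φ t = φ (t • basisVec 0 + spaceEmb y) := rfl

/-- The restriction of a test function to time zero. -/
def spaceSlice : 𝓢(Spacetime, ℂ) →L[ℂ] 𝓢(Momentum, ℂ) :=
  compCLMOfAntilipschitz ℂ (g := spaceEmb) (K := 1)
    (spaceEmb.toContinuousLinearMap.hasTemperateGrowth) spaceEmb.antilipschitz

lemma spaceSlice_apply (φ : 𝓢(Spacetime, ℂ)) (y : Momentum) :
    spaceSlice φ y = φ (spaceEmb y) := rfl

lemma hasDerivAt_timeLine (y : Momentum) (φ : 𝓢(Spacetime, ℂ)) (t : ℝ) :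
    HasDerivAt (timeLine y φ) (timeLine y (∂_{basisVec 0} φ) t) t := by
  have h1 := (φ.differentiableAt (x := t • basisVec 0 + spaceEmb y)).hasFDerivAt
  have h2 : HasDerivAt (fun t : ℝ => t • basisVec 0 + spaceEmb y) (basisVec 0) t := by
    simpa using ((hasDerivAt_id t).smul_const (basisVec 0)).add_const (spaceEmb y)
  have := h1.comp_hasDerivAt t h2
  rw [timeLine_apply, SchwartzMap.lineDerivOp_apply_eq_fderiv]
  exact this

/-- `e^{-iω|t|}` is a fundamental solution of `d²/dt² + ω²`, up to a factor. -/
lemma integral_exp_abs_mul (ω : ℝ) (g g' g'' : 𝓢(ℝ, ℂ)) (h : ∀ t, HasDerivAt g (g' t) t)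
    (h' : ∀ t, HasDerivAt g' (g'' t) t) :
    ∫ t : ℝ, Complex.exp (-(I * (ω * |t| : ℝ))) * (g'' t + ω ^ 2 * g t) =
      -2 * I * ω * g 0 := by
  have hb : ∀ (f : 𝓢(ℝ, ℂ)) (c : ℝ), Integrable fun t : ℝ =>
      Complex.exp (I * (c * t : ℝ)) * f t := by
    intro f c
    refine (f.integrable (μ := volume)).bdd_mul (c := 1) ?_ ?_
    · exact Continuous.aestronglyMeasurable (by fun_prop)
    · exact Filter.Eventually.of_forall fun t => by
        rw [mul_comm, Complex.norm_exp_ofReal_mul_I]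
  have ht : ∀ (f : 𝓢(ℝ, ℂ)) (c : ℝ) (l : Filter ℝ), l ≤ Filter.cocompact ℝ →
      Filter.Tendsto (fun t : ℝ => Complex.exp (I * (c * t : ℝ)) * f t) l (nhds 0) := by
    intro f c l hl
    rw [tendsto_zero_iff_norm_tendsto_zero]
    have : (fun t : ℝ => ‖Complex.exp (I * (c * t : ℝ)) * f t‖) = fun t => ‖f t‖ := by
      funext t
      rw [norm_mul, mul_comm I, Complex.norm_exp_ofReal_mul_I, one_mul]
    rw [this]
    exact tendsto_zero_iff_norm_tendsto_zero.mp (f.tendsto_cocompact.mono_left hl)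
  have hd : ∀ (c : ℝ), c ^ 2 = ω ^ 2 → ∀ t : ℝ, HasDerivAt
      (fun t : ℝ => Complex.exp (I * (c * t : ℝ)) * g' t -
        I * c * (Complex.exp (I * (c * t : ℝ)) * g t))
      (Complex.exp (I * (c * t : ℝ)) * (g'' t + ω ^ 2 * g t)) t := by
    intro c hc t
    have he : HasDerivAt (fun t : ℝ => Complex.exp (I * (c * t : ℝ)))
        (I * c * Complex.exp (I * (c * t : ℝ))) t := by
      have := (((hasDerivAt_id t).const_mul c).ofReal_comp.const_mul I).cexp
      simpa [mul_comm, mul_assoc, mul_left_comm] using this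
    have := (he.mul (h' t)).sub ((he.mul (h t)).const_mul (I * c))
    refine HasDerivAt.congr_deriv (f := fun t : ℝ => Complex.exp (I * (c * t : ℝ)) * g' t -
        I * c * (Complex.exp (I * (c * t : ℝ)) * g t)) this ?_
    have hc' : (c : ℂ) ^ 2 = (ω : ℂ) ^ 2 := by exact_mod_cast hc
    linear_combination (Complex.exp (I * (c * t : ℝ)) * g t) * hc' -
      (Complex.exp (I * (c * t : ℝ)) * g t * (c : ℂ) ^ 2) * Complex.I_sq
  have hi : ∀ c : ℝ, Integrable fun t : ℝ =>
      Complex.exp (I * (c * t : ℝ)) * (g'' t + ω ^ 2 * g t) := by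
    intro c
    have := (hb g'' c).add ((hb g c).const_mul ((ω : ℂ) ^ 2))
    refine this.congr (Filter.Eventually.of_forall fun t => ?_)
    simp only [Pi.add_apply]
    ring
  have hlim : ∀ (c : ℝ) (l : Filter ℝ), l ≤ Filter.cocompact ℝ → Filter.Tendsto
      (fun t : ℝ => Complex.exp (I * (c * t : ℝ)) * g' t -
        I * c * (Complex.exp (I * (c * t : ℝ)) * g t)) l (nhds 0) := by
    intro c l hl
    simpa using (ht g' c l hl).sub ((ht g c l hl).const_mul (I * c))
  have h1 := integral_Ioi_of_hasDerivAt_of_tendsto' (a := 0)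
    (fun t _ => hd (-ω) (by ring) t) (hi (-ω)).integrableOn
    (hlim (-ω) _ atTop_le_cocompact)
  have h2 := integral_Iic_of_hasDerivAt_of_tendsto' (a := 0)
    (fun t _ => hd ω rfl t) (hi ω).integrableOn (hlim ω _ atBot_le_cocompact)
  have e1 : ∫ t in Set.Ioi (0 : ℝ), Complex.exp (-(I * (ω * |t| : ℝ))) *
      (g'' t + ω ^ 2 * g t) = ∫ t in Set.Ioi (0 : ℝ),
        Complex.exp (I * ((-ω : ℝ) * t : ℝ)) * (g'' t + ω ^ 2 * g t) := by
    refine setIntegral_congr_fun measurableSet_Ioi fun t ht => ?_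
    simp only [abs_of_pos (show 0 < t from ht)]
    push_cast
    ring_nf
  have e2 : ∫ t in Set.Iic (0 : ℝ), Complex.exp (-(I * (ω * |t| : ℝ))) *
      (g'' t + ω ^ 2 * g t) = ∫ t in Set.Iic (0 : ℝ),
        Complex.exp (I * (ω * t : ℝ)) * (g'' t + ω ^ 2 * g t) := by
    refine setIntegral_congr_fun measurableSet_Iic fun t ht => ?_
    simp only [abs_of_nonpos (show t ≤ 0 from ht)]
    push_cast
    ring_nf
  have hint : Integrable fun t : ℝ => Complex.exp (-(I * (ω * |t| : ℝ))) *
      (g'' t + ω ^ 2 * g t) := by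
    have h0 := hi 0
    simp only [zero_mul, Complex.ofReal_zero, mul_zero, Complex.exp_zero, one_mul] at h0
    refine h0.bdd_mul (c := 1) ?_ ?_
    · exact Continuous.aestronglyMeasurable (by fun_prop)
    · refine Filter.Eventually.of_forall fun t => ?_
      rw [← mul_neg, ← Complex.ofReal_neg, mul_comm, Complex.norm_exp_ofReal_mul_I]
  rw [← integral_add_compl (measurableSet_Iic (a := (0 : ℝ))) hint, Set.compl_Iic, e1, e2, h1, h2]
  simp
  ring

lemma planeWave_timeSpaceEquiv (m : ℝ) (p : Momentum) (t : ℝ) (y : Momentum) :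
    planeWave m p (t • basisVec 0 + spaceEmb y) = Complex.exp (I * (∑ j, p j * y j : ℝ)) *
      Complex.exp (-(I * (energy m p * |t| : ℝ))) := by
  rw [planeWave, ← Complex.exp_add]
  congr 1
  simp [basisVec]
  ring

lemma integral_planeWave_time (m : ℝ) (p : Momentum) (φ : 𝓢(Spacetime, ℂ)) :
    ∫ x, planeWave m p x * (∂_{basisVec 0} (∂_{basisVec 0} φ) + (energy m p : ℂ) ^ 2 • φ) x =
      -2 * I * energy m p *
        ∫ y, Complex.exp (I * (∑ j, p j * y j : ℝ)) * spaceSlice φ y := by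
  have hi := planeWave_integrable m p (∂_{basisVec 0} (∂_{basisVec 0} φ) + (energy m p : ℂ) ^ 2 • φ)
  have hmp := timeSpaceEquiv_measurePreserving
  rw [← hmp.integral_comp timeSpaceEquiv.measurableEmbedding,
    show (volume : Measure (ℝ × Momentum)) = (volume : Measure ℝ).prod volume from rfl,
    integral_prod_symm, ← integral_const_mul]
  · refine integral_congr_ae (Filter.Eventually.of_forall fun y => ?_)
    have := integral_exp_abs_mul (energy m p) (timeLine y φ) _ _ (hasDerivAt_timeLine y φ)
      (hasDerivAt_timeLine y (∂_{basisVec 0} φ))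
    simp only [timeSpaceEquiv_apply, planeWave_timeSpaceEquiv, mul_assoc, integral_const_mul]
    simp only [timeLine_apply] at this
    have h0 : spaceSlice φ y = φ ((0 : ℝ) • basisVec 0 + spaceEmb y) := by
      rw [zero_smul, zero_add]; rfl
    simp only [SchwartzMap.add_apply, SchwartzMap.smul_apply, smul_eq_mul, this, h0]
    ring
  · exact (hmp.integrable_comp_emb timeSpaceEquiv.measurableEmbedding).mpr hi

lemma integral_fourier_inversion (χ : 𝓢(Momentum, ℂ)) :
    ∫ p : Momentum, (((2 * Real.pi) ^ 3)⁻¹ : ℂ) *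
      ∫ y : Momentum, Complex.exp (I * (∑ j, p j * y j : ℝ)) * χ y = χ 0 := by
  have h1 : ∀ p : Momentum, ∫ y : Momentum, Complex.exp (I * (∑ j, p j * y j : ℝ)) * χ y =
      (𝓕 χ) ((-(2 * Real.pi)⁻¹) • p) := by
    intro p
    rw [SchwartzMap.fourier_coe, Real.fourier_eq']
    refine integral_congr_ae (Filter.Eventually.of_forall fun y => ?_)
    simp only [smul_eq_mul]
    congr 2
    rw [inner_smul_right, PiLp.inner_apply]
    simp only [RCLike.inner_apply, conj_trivial]
    push_cast
    have : (Real.pi : ℂ) ≠ 0 := by exact_mod_cast Real.pi_ne_zero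
    field_simp
  have h2 : (𝓕⁻ (𝓕 χ)) 0 = χ 0 := by rw [FourierPair.fourierInv_fourier_eq]
  rw [SchwartzMap.fourierInv_coe, Real.fourierInv_eq'] at h2
  simp only [h1]
  rw [integral_const_mul, Measure.integral_comp_smul, ← h2]
  have : (0 : ℝ) < Real.pi := Real.pi_pos
  simp [abs_of_pos this]
  field_simp

lemma energy_sq (m : ℝ) (p : Momentum) : energy m p ^ 2 = ‖p‖ ^ 2 + m ^ 2 :=
  Real.sq_sqrt (by positivity)

lemma ae_energy_ne_zero (m : ℝ) : ∀ᵐ p : Momentum, energy m p ≠ 0 := by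
  have : ∀ᵐ p : Momentum, p ≠ 0 := by
    rw [ae_iff]; simp
  filter_upwards [this] with p hp h
  have h1 := energy_sq m p
  rw [h] at h1
  have : 0 < ‖p‖ := norm_pos_iff.mpr hp
  nlinarith [sq_nonneg m]

lemma integral_planeWave_kleinGordon (m : ℝ) (p : Momentum) (φ : 𝓢(Spacetime, ℂ)) :
    ∫ x, planeWave m p x * (∑ μ, η μ • ∂_{basisVec μ} (∂_{basisVec μ} φ) + (m : ℂ) ^ 2 • φ) x =
      -2 * I * energy m p *
        ∫ y, Complex.exp (I * (∑ j, p j * y j : ℝ)) * spaceSlice φ y := by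
  rw [← integral_planeWave_time]
  have e : ∀ x, planeWave m p x *
      (∑ μ, η μ • ∂_{basisVec μ} (∂_{basisVec μ} φ) + (m : ℂ) ^ 2 • φ) x =
      planeWave m p x * (∂_{basisVec 0} (∂_{basisVec 0} φ)) x +
      (m : ℂ) ^ 2 * (planeWave m p x * φ x) -
      ∑ k : Fin 3, planeWave m p x * (∂_{basisVec k.succ} (∂_{basisVec k.succ} φ)) x := by
    intro x
    simp [Fin.sum_univ_succ, η]
    ring
  have e' : ∀ x, planeWave m p x *
      (∂_{basisVec 0} (∂_{basisVec 0} φ) + (energy m p : ℂ) ^ 2 • φ) x =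
      planeWave m p x * (∂_{basisVec 0} (∂_{basisVec 0} φ)) x +
      (energy m p : ℂ) ^ 2 * (planeWave m p x * φ x) := by
    intro x
    simp
    ring
  simp_rw [e, e']
  have i1 := planeWave_integrable m p
  have i2 : Integrable fun x => planeWave m p x * (∂_{basisVec 0} (∂_{basisVec 0} φ)) x +
      (m : ℂ) ^ 2 * (planeWave m p x * φ x) := (i1 _).add ((i1 _).const_mul _)
  rw [integral_sub i2 (integrable_finsetSum _ fun k _ => i1 _),
    integral_add (i1 _) ((i1 _).const_mul _), integral_add (i1 _) ((i1 _).const_mul _),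
    integral_finsetSum _ fun k _ => i1 _]
  simp_rw [planeWave_lineDeriv, integral_const_mul]
  have hE : (energy m p : ℂ) ^ 2 = ∑ k, (p k : ℂ) ^ 2 + (m : ℂ) ^ 2 := by
    have := energy_sq m p
    rw [EuclideanSpace.norm_sq_eq] at this
    simp only [Real.norm_eq_abs, sq_abs] at this
    exact_mod_cast this
  rw [hE]
  simp only [Fin.sum_univ_three]
  linear_combination (-((p 0 : ℂ) ^ 2 + (p 1 : ℂ) ^ 2 + (p 2 : ℂ) ^ 2) *
    ∫ x, planeWave m p x * φ x) * Complex.I_sq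

lemma feynmanFun_kleinGordon (m : ℝ) (φ : 𝓢(Spacetime, ℂ)) :
    feynmanFun m (∑ μ, η μ • ∂_{basisVec μ} (∂_{basisVec μ} φ) + (m : ℂ) ^ 2 • φ) = φ 0 := by
  have h := integral_fourier_inversion (spaceSlice φ)
  rw [spaceSlice_apply, map_zero] at h
  rw [← h]
  unfold feynmanFun
  refine integral_congr_ae ?_
  filter_upwards [ae_energy_ne_zero m] with p hp
  rw [integral_planeWave_kleinGordon]
  have hp' : (energy m p : ℂ) ≠ 0 := by exact_mod_cast hp
  field_simp
  linear_combination (-∫ y, Complex.exp (I * (∑ j, p j * y j : ℝ)) * spaceSlice φ y) *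
    Complex.I_sq

/-- The Feynman propagator is a Green's function of the Klein-Gordon operator. -/
lemma feynman_kleinGordon (m : ℝ) :
    ∑ μ, η μ • distD μ (distD μ (feynman m)) + ((m : ℂ) ^ 2) • feynman m =
      TemperedDistribution.delta (0 : Spacetime) := by
  ext φ
  rw [TemperedDistribution.delta_apply, ← feynmanFun_kleinGordon m φ]
  have h : ∀ μ, distD μ (distD μ (feynman m)) φ =
      feynman m (∂_{basisVec μ} (∂_{basisVec μ} φ)) := by
    intro μ
    change (∂_{basisVec μ} (∂_{basisVec μ} (feynman m) : Distr) : Distr) φ = _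
    rw [TemperedDistribution.lineDerivOp_apply_apply, TemperedDistribution.lineDerivOp_apply_apply]
    simp
  have h' : feynmanFun m (∑ μ, η μ • ∂_{basisVec μ} (∂_{basisVec μ} φ) + (m : ℂ) ^ 2 • φ) =
      feynman m (∑ μ, η μ • ∂_{basisVec μ} (∂_{basisVec μ} φ) + (m : ℂ) ^ 2 • φ) := rfl
  rw [h', map_add, map_sum, map_smul]
  simp only [map_smul, ← h]
  simp

lemma schwartz_lineDeriv_comm (v w : Spacetime) (φ : 𝓢(Spacetime, ℂ)) :
    ∂_{v} (∂_{w} φ) = ∂_{w} (∂_{v} φ) := by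
  have h : ∀ v w : Spacetime, ∀ x, (∂_{v} (∂_{w} φ)) x = fderiv ℝ (fderiv ℝ φ) x v w := by
    intro v w x
    rw [SchwartzMap.lineDerivOp_apply_eq_fderiv]
    have h1 : ⇑(∂_{w} φ : 𝓢(Spacetime, ℂ)) = fun y => fderiv ℝ φ y w := by
      funext y; rw [SchwartzMap.lineDerivOp_apply_eq_fderiv]
    have h2 : DifferentiableAt ℝ (fderiv ℝ φ) x :=
      (((φ.smooth 2).fderiv_right (m := 1) (by norm_num)).differentiable (by norm_num)) x
    rw [h1, fderiv_clm_apply h2 (differentiableAt_const w)]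
    simp
  ext x
  rw [h, h]
  exact ((φ.smooth 2).contDiffAt.isSymmSndFDerivAt (by simp)).eq v w

lemma distD_comm (μ ν : Fin 4) (T : Distr) : distD μ (distD ν T) = distD ν (distD μ T) := by
  change (∂_{basisVec μ} (∂_{basisVec ν} T : Distr) : Distr) =
    ∂_{basisVec ν} (∂_{basisVec μ} T : Distr)
  ext φ
  simp only [TemperedDistribution.lineDerivOp_apply_apply]
  have h : ∀ (v : Spacetime) (ψ : 𝓢(Spacetime, ℂ)), ∂_{v} (-ψ) = -∂_{v} ψ :=
    fun v ψ => (lineDerivOpCLM ℂ 𝓢(Spacetime, ℂ) v).map_neg ψ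
  rw [h, h, schwartz_lineDeriv_comm]

lemma prod_pow_add_single {R : Type*} [Monoid R] {D : Fin 4 → R} (h : ∀ i j, Commute (D i) (D j))
    {α β : Fin 4 → ℕ} {μ : Fin 4} (hβ : β = α + Pi.single μ 1) :
    D 0 ^ β 0 * D 1 ^ β 1 * D 2 ^ β 2 * D 3 ^ β 3 =
      D μ * (D 0 ^ α 0 * D 1 ^ α 1 * D 2 ^ α 2 * D 3 ^ α 3) := by
  have h (i j) : D i ^ α i * D j = D j * D i ^ α i := ((h i j).pow_left _).eq
  have h' (i j X) : D i ^ α i * (D j * X) = D j * (D i ^ α i * X) := by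
    rw [← mul_assoc, h, mul_assoc]
  subst hβ
  fin_cases μ <;> simp [pow_succ', mul_assoc, h' _ 1, h' _ 2, h' _ 3]

lemma distPartials_add_single (α : Fin 4 → ℕ) (μ : Fin 4) :
    distPartials (α + Pi.single μ 1) = distD μ * distPartials α :=
  prod_pow_add_single (fun i j => LinearMap.ext fun T => distD_comm i j T) rfl

@[simp] lemma distPartials_zero : distPartials 0 = 1 := by simp [distPartials]

section Matrices

variable {ι τ : Type*}

/-- The contractions of jets which correspond to the contractions `G` of the basic fields. -/
def jetContr (G : BasicField ι τ → BasicField ι τ → Distr) (j k : Jet ι τ) : Distr :=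
  ((-1 : ℂ) ^ (∑ μ, k.idx μ)) • distPartials (j.idx + k.idx) (G j.field k.field)

lemma jetContr_covariant (G : BasicField ι τ → BasicField ι τ → Distr) :
    Covariant (jetContr G) where
  left x y μ := by
    simp only [jetContr, Jet.shift, add_right_comm x.idx _ y.idx, distPartials_add_single,
      Module.End.mul_apply, map_smul]
  right x y μ := by
    simp only [jetContr, Jet.shift, ← add_assoc x.idx y.idx, distPartials_add_single,
      Module.End.mul_apply, map_smul, Pi.add_apply, sum_add_distrib, pow_add]
    simp only [Finset.sum_pi_single', mem_univ, if_true, pow_one]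
    module

lemma jetContr_parity {G : BasicField ι τ → BasicField ι τ → Distr}
    (hG : ∀ φ χ, φ.odd ≠ χ.odd → G φ χ = 0) : ParityMatrix (jetContr G) := by
  intro x y h
  rw [jetContr, hG _ _ h, map_zero]
  exact Distr.smul_zero' _

lemma fieldWick_mem_letters (φ : BasicField ι τ) : fieldWick φ ∈ letters ι τ := ι_mem_letters _

lemma fieldWick_mem_plets (φ : BasicField ι τ) : fieldWick φ ∈ plets (ι := ι) (τ := τ) φ.odd :=
  ι_mem_plets (⟨φ, 0⟩ : Jet ι τ)

@[simp] lemma pair_fieldWick (G : BasicField ι τ → BasicField ι τ → Distr)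
    (φ χ : BasicField ι τ) : pair (jetContr G) (fieldWick φ) (fieldWick χ) = G φ χ := by
  simp [fieldWick, jetContr]

lemma pow_wickD_mem {S : Submodule ℂ (Wick ι τ)} (hS : ∀ p μ, p ∈ S → wickD μ p ∈ S) (μ : Fin 4)
    (n : ℕ) {p : Wick ι τ} (hp : p ∈ S) : (wickD μ ^ n) p ∈ S := by
  induction n with
  | zero => simpa
  | succ n ih => rw [pow_succ', Module.End.mul_apply]; exact hS _ _ ih

lemma wickPartials_mem {S : Submodule ℂ (Wick ι τ)} (hS : ∀ p μ, p ∈ S → wickD μ p ∈ S)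
    (α : Fin 4 → ℕ) {p : Wick ι τ} (hp : p ∈ S) : wickPartials α p ∈ S := by
  simp only [wickPartials, Module.End.mul_apply]
  exact pow_wickD_mem hS _ _ (pow_wickD_mem hS _ _ (pow_wickD_mem hS _ _
    (pow_wickD_mem hS _ _ hp)))

lemma pow_wickD_fieldWick (φ : BasicField ι τ) (β : Fin 4 → ℕ) (μ : Fin 4) (n : ℕ) :
    (wickD μ ^ n) (ιℂ (⟨φ, β⟩ : Jet ι τ)) =
      ιℂ ⟨φ, β + Pi.single μ n⟩ := by
  induction n with
  | zero => simp
  | succ n ih =>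
    rw [pow_succ', Module.End.mul_apply, ih, wickD_ι, Jet.shift, add_assoc, ← Pi.single_add]

lemma wickPartials_fieldWick (φ : BasicField ι τ) (α : Fin 4 → ℕ) :
    wickPartials α (fieldWick φ) = ιℂ (⟨φ, α⟩ : Jet ι τ) := by
  simp only [wickPartials, fieldWick, Module.End.mul_apply, pow_wickD_fieldWick]
  congr 2
  funext i
  fin_cases i <;> simp

lemma pair_pow_wickD_left {C : Jet ι τ → Jet ι τ → Distr} (hC : Covariant C) {p q : Wick ι τ}
    (hp : p ∈ letters ι τ) (hq : q ∈ letters ι τ) (μ : Fin 4) (n : ℕ) :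
    pair C ((wickD μ ^ n) p) q = (distD μ ^ n) (pair C p q) := by
  induction n with
  | zero => simp
  | succ n ih =>
    rw [pow_succ', Module.End.mul_apply, pow_succ', Module.End.mul_apply, ← ih,
      pair_wickD_left hC (pow_wickD_mem (fun p μ h => wickD_mem_letters h μ) μ n hp) hq]

lemma pair_pow_wickD_right {C : Jet ι τ → Jet ι τ → Distr} (hC : Covariant C) {p q : Wick ι τ}
    (hp : p ∈ letters ι τ) (hq : q ∈ letters ι τ) (μ : Fin 4) (n : ℕ) :
    pair C p ((wickD μ ^ n) q) = (-1 : ℂ) ^ n • (distD μ ^ n) (pair C p q) := by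
  induction n with
  | zero => simp
  | succ n ih =>
    rw [pow_succ' (wickD μ), Module.End.mul_apply, pow_succ' (distD μ), Module.End.mul_apply,
      pair_wickD_right hC hp (pow_wickD_mem (fun p μ h => wickD_mem_letters h μ) μ n hq), ih,
      map_smul, pow_succ']
    module

lemma pair_wickPartials_left {C : Jet ι τ → Jet ι τ → Distr} (hC : Covariant C) {p q : Wick ι τ}
    (hp : p ∈ letters ι τ) (hq : q ∈ letters ι τ) (α : Fin 4 → ℕ) :
    pair C (wickPartials α p) q = distPartials α (pair C p q) := by
  have h : ∀ {p : Wick ι τ} (μ n), p ∈ letters ι τ → (wickD μ ^ n) p ∈ letters ι τ :=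
    fun μ n hp => pow_wickD_mem (fun p μ h => wickD_mem_letters h μ) μ n hp
  simp only [wickPartials, distPartials, Module.End.mul_apply]
  rw [pair_pow_wickD_left hC (h _ _ (h _ _ (h _ _ hp))) hq,
    pair_pow_wickD_left hC (h _ _ (h _ _ hp)) hq, pair_pow_wickD_left hC (h _ _ hp) hq,
    pair_pow_wickD_left hC hp hq]

lemma pair_wickPartials_right {C : Jet ι τ → Jet ι τ → Distr} (hC : Covariant C) {p q : Wick ι τ}
    (hp : p ∈ letters ι τ) (hq : q ∈ letters ι τ) (α : Fin 4 → ℕ) :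
    pair C p (wickPartials α q) = (-1 : ℂ) ^ (∑ μ, α μ) • distPartials α (pair C p q) := by
  have h : ∀ {p : Wick ι τ} (μ n), p ∈ letters ι τ → (wickD μ ^ n) p ∈ letters ι τ :=
    fun μ n hp => pow_wickD_mem (fun p μ h => wickD_mem_letters h μ) μ n hp
  simp only [wickPartials, distPartials, Module.End.mul_apply]
  rw [pair_pow_wickD_right hC hp (h _ _ (h _ _ (h _ _ hq))),
    pair_pow_wickD_right hC hp (h _ _ (h _ _ hq)), pair_pow_wickD_right hC hp (h _ _ hq),
    pair_pow_wickD_right hC hp hq]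
  simp only [map_smul, smul_smul, Fin.sum_univ_four, pow_add, mul_assoc]

/-- The odd derivation with the values `d` on the basic fields, on jets. -/
abbrev jetDer (d : BasicField ι τ → Wick ι τ) (j : Jet ι τ) : Wick ι τ :=
  wickPartials j.idx (d j.field)

lemma jetContr_derivInvariant {G : BasicField ι τ → BasicField ι τ → Distr}
    (hG : ∀ φ χ, φ.odd ≠ χ.odd → G φ χ = 0) {d : BasicField ι τ → Wick ι τ}
    (hd : ∀ φ, d φ ∈ plets (ι := ι) (τ := τ) (!φ.odd))
    (h : ∀ φ χ, pair (jetContr G) (d φ) (fieldWick χ) +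
      (if φ.odd = true then (-1 : ℂ) else 1) • pair (jetContr G) (fieldWick φ) (d χ) = 0) :
    DerivInvariant (jetContr G) (jetDer d) where
  parity := jetContr_parity hG
  mem x := wickPartials_mem (fun p μ hp => wickD_mem_plets hp μ) _ (hd x.field)
  inv x y := by
    have hC := jetContr_covariant G
    have hm : ∀ {p : Wick ι τ} α, p ∈ letters ι τ → wickPartials α p ∈ letters ι τ :=
      fun α hp => wickPartials_mem (fun p μ h => wickD_mem_letters h μ) α hp
    have hl : ∀ φ, d φ ∈ letters ι τ := fun φ => plets_le_letters _ (hd φ)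
    have hf := fieldWick_mem_letters (ι := ι) (τ := τ)
    obtain ⟨φ, α⟩ := x
    obtain ⟨χ, β⟩ := y
    rw [← wickPartials_fieldWick, ← wickPartials_fieldWick]
    simp only [jetDer]
    rw [pair_wickPartials_left hC (hl φ) (hm _ (hf χ)), pair_wickPartials_right hC (hl φ) (hf χ),
      pair_wickPartials_left hC (hf φ) (hm _ (hl χ)), pair_wickPartials_right hC (hf φ) (hl χ),
      eq_neg_of_add_eq_zero_left (h φ χ), paritySign]
    simp only [map_smul, map_neg]
    module

end Matrices

@[simp] lemma Distr.neg_smul' (a : ℂ) (d : Distr) : (-a) • d = -(a • d) := neg_smul a d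

@[simp] lemma Distr.smul_neg' (a : ℂ) (d : Distr) : a • (-d) = -(a • d) :=
  smul_neg (A := Distr) a d

lemma Distr.smul_smul' (a b : ℂ) (d : Distr) : a • b • d = (a * b) • d := smul_smul a b d

attribute [simp] Distr.zero_smul' Distr.smul_zero'

/-- The Klein-Gordon operator on distributions. -/
def kleinGordon (m : ℝ) : Distr →ₗ[ℂ] Distr :=
  ∑ μ, η μ • (distD μ ∘ₗ distD μ) + ((m : ℂ) ^ 2) • LinearMap.id

lemma kleinGordon_apply (m : ℝ) (T : Distr) :
    kleinGordon m T = ∑ μ, η μ • distD μ (distD μ T) + ((m : ℂ) ^ 2) • T := by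
  simp [kleinGordon]

@[simp] lemma kleinGordon_feynman (m : ℝ) : kleinGordon m (feynman m) = YangMills.dirac := by
  rw [kleinGordon_apply, feynman_kleinGordon]

lemma kleinGordon_distD (m : ℝ) (μ : Fin 4) (T : Distr) :
    kleinGordon m (distD μ T) = distD μ (kleinGordon m T) := by
  simp only [kleinGordon_apply, map_add, map_sum, map_smul, distD_comm _ μ]

section Green

variable {ι τ : Type*}

/-- The Klein-Gordon operator on Wick polynomials. -/
abbrev wickKG (m : ℝ) (p : Wick ι τ) : Wick ι τ :=
  ∑ μ, η μ • wickD μ (wickD μ p) + ((m : ℂ) ^ 2) • p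

lemma wickKG_mem_plets (m : ℝ) {ε : Bool} {p : Wick ι τ} (hp : p ∈ plets ε) :
    wickKG m p ∈ plets ε :=
  add_mem (sum_mem _ fun μ _ => smul_mem _ _
    (wickD_mem_plets (wickD_mem_plets hp μ) μ)) (smul_mem _ _ hp)

lemma pair_wickKG_left {C : Jet ι τ → Jet ι τ → Distr} (hC : Covariant C) (m : ℝ) {p q : Wick ι τ}
    (hp : p ∈ letters ι τ) (hq : q ∈ letters ι τ) :
    pair C (wickKG m p) q = kleinGordon m (pair C p q) := by
  simp only [wickKG, map_add, map_sum, map_smul, add_apply, sum_apply,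
    smul_apply, pair_wickD_left hC (wickD_mem_letters hp _) hq,
    pair_wickD_left hC hp hq, kleinGordon_apply]

lemma pair_wickKG_right {C : Jet ι τ → Jet ι τ → Distr} (hC : Covariant C) (m : ℝ) {p q : Wick ι τ}
    (hp : p ∈ letters ι τ) (hq : q ∈ letters ι τ) :
    pair C p (wickKG m q) = kleinGordon m (pair C p q) := by
  simp only [wickKG, map_add, map_sum, map_smul, pair_wickD_right hC hp (wickD_mem_letters hq _),
    pair_wickD_right hC hp hq, kleinGordon_apply, map_neg, neg_neg]

namespace YangMills

section Clifford

variable {γ : Fin 4 → Matrix (Fin 4) (Fin 4) ℂ}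
  (hγ : ∀ μ ν, γ μ * γ ν + γ ν * γ μ = (if μ = ν then 2 * η μ else 0) • 1)
include hγ

lemma sum_clifford {V : Type*} [AddCommGroup V] [Module ℂ V] (D : Fin 4 → V →ₗ[ℂ] V)
    (hD : ∀ μ ν T, D μ (D ν T) = D ν (D μ T)) (T : V) (r q : Fin 4) :
    ∑ μ, ∑ ν, (γ μ * γ ν) r q • D μ (D ν T) =
      (1 : Matrix (Fin 4) (Fin 4) ℂ) r q • ∑ μ, η μ • D μ (D μ T) := by
  have h1 : ∑ μ, ∑ ν, (γ μ * γ ν) r q • D μ (D ν T) =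
      ∑ μ, ∑ ν, (γ ν * γ μ) r q • D μ (D ν T) := by
    rw [sum_comm]
    exact sum_congr rfl fun μ _ => sum_congr rfl fun ν _ => by rw [hD]
  have h2 : (2 : ℂ) • ∑ μ, ∑ ν, (γ μ * γ ν) r q • D μ (D ν T) =
      (2 : ℂ) • (1 : Matrix (Fin 4) (Fin 4) ℂ) r q • ∑ μ, η μ • D μ (D μ T) := by
    rw [two_smul]
    nth_rewrite 2 [h1]
    simp only [← sum_add_distrib, ← add_smul, ← Matrix.add_apply, hγ,
      Matrix.smul_apply, smul_eq_mul, ite_mul, zero_mul, ite_smul, zero_smul, sum_ite_eq,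
      mem_univ, if_true, smul_sum, smul_smul]
    refine sum_congr rfl fun μ _ => ?_
    congr 1
    ring
  exact smul_right_injective _ (two_ne_zero (α := ℂ)) h2

lemma dirac_mul_dirac {V : Type*} [AddCommGroup V] [Module ℂ V] (D : Fin 4 → V →ₗ[ℂ] V)
    (hD : ∀ μ ν T, D μ (D ν T) = D ν (D μ T)) (T : V) (m : ℂ) (r q : Fin 4) :
    ∑ μ, ∑ p, (I * γ μ r p) • D μ (-I • (∑ ν, (I * γ ν p q) • D ν T +
      (if p = q then m else 0) • T)) - m • -I • (∑ ν, (I * γ ν r q) • D ν T +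
      (if r = q then m else 0) • T) =
    (I * (1 : Matrix (Fin 4) (Fin 4) ℂ) r q) •
      (∑ μ, η μ • D μ (D μ T) + m ^ 2 • T) := by
  have h := sum_clifford hγ D hD T r q
  have h1 : ∑ μ, ∑ p, (I * γ μ r p) • D μ (-I • (∑ ν,
      (I * γ ν p q) • D ν T + (if p = q then m else 0) • T)) =
      I • (∑ μ, ∑ ν, (γ μ * γ ν) r q • D μ (D ν T)) +
        m • ∑ μ, γ μ r q • D μ T := by
    simp only [smul_sum]
    rw [← sum_add_distrib]
    refine sum_congr rfl fun μ _ => ?_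
    simp only [map_smul, map_add, map_sum, smul_add, sum_add_distrib, Matrix.mul_apply,
      sum_smul, smul_sum, smul_smul]
    congr 1
    · rw [sum_comm]
      refine sum_congr rfl fun ν _ => sum_congr rfl fun p _ => ?_
      congr 1
      linear_combination (-(I * γ μ r p * γ ν p q)) * Complex.I_sq
    · simp only [mul_ite, mul_zero, ite_smul, zero_smul, sum_ite_eq', mem_univ,
        if_true]
      congr 1
      linear_combination (-(γ μ r q * m)) * Complex.I_sq
  have h2 : ∑ ν, (I * γ ν r q) • D ν T = I • ∑ ν, γ ν r q • D ν T := by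
    simp only [smul_sum, smul_smul]
  rw [h1, h, h2, Matrix.one_apply]
  split_ifs
  · linear_combination (norm := module) Complex.I_sq • (m • ∑ ν, γ ν r q • D ν T)
  · linear_combination (norm := module) Complex.I_sq • (m • ∑ ν, γ ν r q • D ν T)

omit hγ in
lemma diracBar_mul_diracBar (M : YangMills ι τ) {V : Type*} [AddCommGroup V] [Module ℂ V]
    (D : Fin 4 → V →ₗ[ℂ] V) (hD : ∀ μ ν T, D μ (D ν T) = D ν (D μ T)) (T : V) (m : ℂ)
    (r q : Fin 4) :
    ∑ μ, ∑ p, (I * M.γ μ p q) • D μ (-I • (∑ ν, (I * M.γ ν r p) • D ν T -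
      (if r = p then m else 0) • T)) + m • -I • (∑ ν, (I * M.γ ν r q) • D ν T -
      (if r = q then m else 0) • T) =
    (I * (1 : Matrix (Fin 4) (Fin 4) ℂ) r q) •
      (∑ μ, η μ • D μ (D μ T) + m ^ 2 • T) := by
  have h := dirac_mul_dirac (γ := fun μ => (M.γ μ).transpose) (fun μ ν => by
    rw [← Matrix.transpose_mul, ← Matrix.transpose_mul, ← Matrix.transpose_add, add_comm,
      M.clifford, Matrix.transpose_smul, Matrix.transpose_one]) D hD T (-m) q r
  have e (p s : Fin 4) : (if p = s then -m else 0) = -if s = p then m else 0 := by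
    simp only [eq_comm (a := p)]; split_ifs <;> simp
  simpa only [Matrix.transpose_apply, e, neg_smul, ← sub_eq_add_neg, sub_neg_eq_add, neg_sq,
    Matrix.one_apply, eq_comm (a := q) (b := r)] using h

end Clifford

variable [DecidableEq ι] [DecidableEq τ] (M : YangMills ι τ)

/-- The contractions of the basic fields, with `[∂_μ v^μ, ∂_ν v^ν]` contracted to `- i □ D^F`. -/
def regContr : BasicField ι τ → BasicField ι τ → Distr
  | .divVec a, .divVec b => if a = b then
      (-I) • ∑ μ, η μ • distD μ (distD μ (feynman (M.m a))) else 0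
  | φ, χ => M.fieldContr feynman φ χ

lemma fieldContr_parity (Δ : ℝ → Distr) (φ χ : BasicField ι τ) (h : φ.odd ≠ χ.odd) :
    M.fieldContr Δ φ χ = 0 := by
  cases φ <;> cases χ <;> simp_all [BasicField.odd, fieldContr]

lemma regContr_parity (φ χ : BasicField ι τ) (h : φ.odd ≠ χ.odd) :
    M.regContr φ χ = 0 := by
  cases φ <;> cases χ <;> simp_all [BasicField.odd, regContr, fieldContr]

/-- The regularized contractions of jets. -/
abbrev regC : Jet ι τ → Jet ι τ → Distr := jetContr M.regContr

lemma regC_covariant : Covariant M.regC := jetContr_covariant _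

/-- The contraction of a field equation with `∂_μ v^μ` in terms of the contractions with `v^μ`. -/
def divPart (k : BasicField ι τ → ℂ) : BasicField ι τ → Distr
  | .divVec c => ∑ ρ, k (.vec c ρ) • distD ρ dirac
  | _ => 0

/-- The contractions of `e` with the basic fields are `δ`-distributions. -/
structure IsGreen (ε : Bool) (e : Wick ι τ) (k : BasicField ι τ → ℂ) : Prop where
  mem : e ∈ plets ε
  eq : M.FieldEq e
  parity : ∀ φ, φ.odd ≠ ε → k φ = 0
  div : ∀ c, k (.divVec c) = 0
  left : ∀ φ, pair M.regC e (fieldWick φ) = -(k φ • dirac) + divPart k φ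
  right : ∀ φ, pair M.regC (fieldWick φ) e = bsign ε ε • (-(k φ • dirac) - divPart k φ)

/-- The field equation of `v_c^ν`. -/
def eVec (c : ι) (ν : Fin 4) : Wick ι τ := wickKG (M.m c) (fieldWick (.vec c ν))
/-- The field equation of `u_c`. -/
def eGhost (c : ι) : Wick ι τ := wickKG (M.m c) (fieldWick (.ghost c))
/-- The field equation of `ũ_c`. -/
def eAnti (c : ι) : Wick ι τ := wickKG (M.m c) (fieldWick (.anti c))
/-- The field equation of `Φ_c`. -/
def eScal (c : ι) : Wick ι τ := wickKG (M.scalMass c) (fieldWick (.scal c))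
/-- The difference of `∂_μ v_c^μ` and the divergence of `v_c^μ`. -/
def eDiv (c : ι) : Wick ι τ := fieldWick (.divVec c) - ∑ μ, wickD μ (fieldWick (.vec c μ))
/-- The Dirac equation. -/
def ePsi (A : τ) (r : Fin 4) : Wick ι τ :=
  ∑ μ, ∑ q, (I * M.γ μ r q) • wickD μ (fieldWick (.psi A q)) -
    (M.mF A : ℂ) • fieldWick (.psi A r)
/-- The adjoint Dirac equation. -/
def ePsiBar (A : τ) (q : Fin 4) : Wick ι τ :=
  ∑ μ, ∑ r, (I * M.γ μ r q) • wickD μ (fieldWick (.psiBar A r)) +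
    (M.mF A : ℂ) • fieldWick (.psiBar A q)

/-- The strength of the contractions of the field equation of `v_c^ν`. -/
def kVec (c : ι) (ν : Fin 4) : BasicField ι τ → ℂ
  | .vec b μ => if b = c ∧ μ = ν then -(I * η ν) else 0
  | _ => 0
/-- The strength of the contractions of the field equation of `u_c`. -/
def kGhost (c : ι) : BasicField ι τ → ℂ
  | .anti b => if b = c then I else 0
  | _ => 0
/-- The strength of the contractions of the field equation of `ũ_c`. -/
def kAnti (c : ι) : BasicField ι τ → ℂ
  | .ghost b => if b = c then -I else 0
  | _ => 0
/-- The strength of the contractions of the field equation of `Φ_c`. -/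
def kScal (c : ι) : BasicField ι τ → ℂ
  | .scal b => if b = c then I else 0
  | _ => 0
/-- The strength of the contractions of the Dirac equation. -/
def kPsi (A : τ) (r : Fin 4) : BasicField ι τ → ℂ
  | .psiBar B q => if B = A ∧ q = r then -I else 0
  | _ => 0
/-- The strength of the contractions of the adjoint Dirac equation. -/
def kPsiBar (A : τ) (q : Fin 4) : BasicField ι τ → ℂ
  | .psi B r => if B = A ∧ r = q then -I else 0
  | _ => 0

variable {M} in
lemma isGreen_wickKG {m : ℝ} {χ : BasicField ι τ} {k : BasicField ι τ → ℂ}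
    (eq : M.FieldEq (wickKG m (fieldWick χ))) (parity : ∀ φ, φ.odd ≠ χ.odd → k φ = 0)
    (div : ∀ c, k (.divVec c) = 0)
    (left : ∀ φ, kleinGordon m (M.regContr χ φ) = -(k φ • dirac) + divPart k φ)
    (right : ∀ φ, kleinGordon m (M.regContr φ χ) =
      bsign χ.odd χ.odd • (-(k φ • dirac) - divPart k φ)) :
    M.IsGreen χ.odd (wickKG m (fieldWick χ)) k where
  mem := wickKG_mem_plets _ (fieldWick_mem_plets _)
  eq := eq
  parity := parity
  div := div
  left φ := by
    rw [pair_wickKG_left M.regC_covariant _ (fieldWick_mem_letters _)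
      (fieldWick_mem_letters _), pair_fieldWick, left]
  right φ := by
    rw [pair_wickKG_right M.regC_covariant _ (fieldWick_mem_letters _)
      (fieldWick_mem_letters _), pair_fieldWick, right]

lemma isGreen_eVec (c : ι) (ν : Fin 4) : M.IsGreen false (M.eVec c ν) (kVec c ν) :=
  isGreen_wickKG (χ := .vec c ν) (.vec c ν)
    (fun φ h => by cases φ <;> first | rfl | exact absurd rfl h) (fun _ => rfl)
    (fun φ => by cases φ <;> simp only [regContr, fieldContr, kVec, divPart] <;>
      (try split_ifs) <;> simp_all [kleinGordon_distD, ite_smul, eq_comm (b := c)])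
    (fun φ => by cases φ <;> simp only [regContr, fieldContr, kVec, divPart] <;>
      (try split_ifs) <;> simp_all [kleinGordon_distD, ite_smul, bsign, BasicField.odd])

lemma isGreen_eGhost (c : ι) : M.IsGreen true (M.eGhost c) (kGhost c) :=
  isGreen_wickKG (χ := .ghost c) (.ghost c)
    (fun φ h => by cases φ <;> first | rfl | exact absurd rfl h) (fun _ => rfl)
    (fun φ => by cases φ <;> simp only [regContr, fieldContr, kGhost, divPart] <;>
      (try split_ifs) <;> simp_all [kleinGordon_distD, ite_smul])
    (fun φ => by cases φ <;> simp only [regContr, fieldContr, kGhost, divPart] <;>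
      (try split_ifs) <;> simp_all [kleinGordon_distD, ite_smul, bsign, BasicField.odd])

lemma isGreen_eAnti (c : ι) : M.IsGreen true (M.eAnti c) (kAnti c) :=
  isGreen_wickKG (χ := .anti c) (.anti c)
    (fun φ h => by cases φ <;> first | rfl | exact absurd rfl h) (fun _ => rfl)
    (fun φ => by cases φ <;> simp only [regContr, fieldContr, kAnti, divPart] <;>
      (try split_ifs) <;> simp_all [kleinGordon_distD, ite_smul])
    (fun φ => by cases φ <;> simp only [regContr, fieldContr, kAnti, divPart] <;>
      (try split_ifs) <;> simp_all [kleinGordon_distD, ite_smul, bsign, BasicField.odd])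

lemma isGreen_eScal (c : ι) : M.IsGreen false (M.eScal c) (kScal c) :=
  isGreen_wickKG (χ := .scal c) (.scal c)
    (fun φ h => by cases φ <;> first | rfl | exact absurd rfl h) (fun _ => rfl)
    (fun φ => by cases φ <;> simp only [regContr, fieldContr, kScal, divPart] <;>
      (try split_ifs) <;> simp_all [kleinGordon_distD, ite_smul])
    (fun φ => by cases φ <;> simp only [regContr, fieldContr, kScal, divPart] <;>
      (try split_ifs) <;> simp_all [kleinGordon_distD, ite_smul, bsign, BasicField.odd])

lemma pair_ePsi_left (A : τ) (r : Fin 4) (φ : BasicField ι τ) :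
    pair M.regC (M.ePsi A r) (fieldWick φ) =
      ∑ μ, ∑ q, (I * M.γ μ r q) • distD μ (M.regContr (.psi A q) φ) -
        (M.mF A : ℂ) • M.regContr (.psi A r) φ := by
  simp only [ePsi, map_sub, map_sum, map_smul, sub_apply, sum_apply,
    smul_apply, pair_wickD_left M.regC_covariant (fieldWick_mem_letters _)
    (fieldWick_mem_letters _), pair_fieldWick]

lemma pair_ePsi_right (A : τ) (r : Fin 4) (φ : BasicField ι τ) :
    pair M.regC (fieldWick φ) (M.ePsi A r) =
      ∑ μ, ∑ q, (I * M.γ μ r q) • (-distD μ) (M.regContr φ (.psi A q)) -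
        (M.mF A : ℂ) • M.regContr φ (.psi A r) := by
  simp only [ePsi, map_sub, map_sum, map_smul, pair_wickD_right M.regC_covariant
    (fieldWick_mem_letters _) (fieldWick_mem_letters _), pair_fieldWick, neg_apply]

lemma pair_ePsiBar_left (A : τ) (r : Fin 4) (φ : BasicField ι τ) :
    pair M.regC (M.ePsiBar A r) (fieldWick φ) =
      ∑ μ, ∑ q, (I * M.γ μ q r) • distD μ (M.regContr (.psiBar A q) φ) +
        (M.mF A : ℂ) • M.regContr (.psiBar A r) φ := by
  simp only [ePsiBar, map_add, map_sum, map_smul, add_apply, sum_apply,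
    smul_apply, pair_wickD_left M.regC_covariant (fieldWick_mem_letters _)
    (fieldWick_mem_letters _), pair_fieldWick]

lemma pair_ePsiBar_right (A : τ) (r : Fin 4) (φ : BasicField ι τ) :
    pair M.regC (fieldWick φ) (M.ePsiBar A r) =
      ∑ μ, ∑ q, (I * M.γ μ q r) • (-distD μ) (M.regContr φ (.psiBar A q)) +
        (M.mF A : ℂ) • M.regContr φ (.psiBar A r) := by
  simp only [ePsiBar, map_add, map_sum, map_smul, pair_wickD_right M.regC_covariant
    (fieldWick_mem_letters _) (fieldWick_mem_letters _), pair_fieldWick, neg_apply]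

lemma neg_distD_comm (μ ν : Fin 4) (T : Distr) :
    (-distD μ) ((-distD ν) T) = (-distD ν) ((-distD μ) T) := by
  simp only [neg_apply, map_neg, distD_comm μ ν]

lemma neg_distD_feynman (m : ℝ) : ∑ μ, η μ • (-distD μ) ((-distD μ) (feynman m)) +
    ((m : ℂ) ^ 2) • feynman m = dirac := by
  rw [dirac, ← feynman_kleinGordon m]
  simp only [neg_apply, map_neg, neg_neg]

lemma isGreen_ePsi (A : τ) (r : Fin 4) : M.IsGreen true (M.ePsi A r) (kPsi A r) where
  mem := sub_mem (sum_mem _ fun μ _ => sum_mem _ fun q _ =>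
    smul_mem _ _ (wickD_mem_plets (fieldWick_mem_plets (.psi A q)) μ))
    (smul_mem _ _ (fieldWick_mem_plets (.psi A r)))
  eq := .dirac A r
  parity φ h := by cases φ <;> first | rfl | exact absurd rfl h
  div _ := rfl
  left φ := by
    rw [pair_ePsi_left]
    cases φ with
    | psiBar B q =>
      by_cases h : A = B
      · subst h
        have := dirac_mul_dirac M.clifford distD distD_comm (feynman (M.mF A)) (M.mF A) r q
        rw [feynman_kleinGordon] at this
        simp only [regContr, fieldContr, if_true]
        refine this.trans ?_
        simp only [kPsi, divPart, Matrix.one_apply, true_and, eq_comm (a := q)]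
        split_ifs <;> simp
      · simp [regContr, fieldContr, kPsi, divPart, h, Ne.symm h]
    | _ => simp [regContr, fieldContr, kPsi, divPart]
  right φ := by
    rw [pair_ePsi_right]
    cases φ with
    | psiBar B q =>
      by_cases h : B = A
      · subst h
        have := dirac_mul_dirac M.clifford (fun μ => -distD μ) neg_distD_comm (feynman (M.mF B)) (M.mF B) r q
        have e : ∀ p, M.regContr (.psiBar B q) (.psi B p) = -(-I • (∑ ν,
            (I * M.γ ν p q) • (-distD ν) (feynman (M.mF B)) +
            (if p = q then (M.mF B : ℂ) else 0) • feynman (M.mF B))) := by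
          intro p
          simp only [regContr, fieldContr, if_true, neg_apply, Distr.smul_neg',
            sum_neg_distrib]
          module
        rw [neg_distD_feynman] at this
        simp only [e, map_neg _ (-I • _), Distr.smul_neg', sum_neg_distrib]
        rw [← neg_sub', this]
        simp only [kPsi, divPart, Matrix.one_apply, true_and, eq_comm (a := q)]
        split_ifs <;> simp [bsign]
      · simp [regContr, fieldContr, kPsi, divPart, h]
    | _ => simp [regContr, fieldContr, kPsi, divPart]

lemma isGreen_ePsiBar (A : τ) (q : Fin 4) : M.IsGreen true (M.ePsiBar A q) (kPsiBar A q) where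
  mem := add_mem (sum_mem _ fun μ _ => sum_mem _ fun r _ =>
    smul_mem _ _ (wickD_mem_plets (fieldWick_mem_plets (.psiBar A r)) μ))
    (smul_mem _ _ (fieldWick_mem_plets (.psiBar A q)))
  eq := .diracBar A q
  parity φ h := by cases φ <;> first | rfl | exact absurd rfl h
  div _ := rfl
  left φ := by
    rw [pair_ePsiBar_left]
    cases φ with
    | psi B r =>
      by_cases h : A = B
      · subst h
        have := M.diracBar_mul_diracBar distD distD_comm (feynman (M.mF A)) (M.mF A) r q
        rw [feynman_kleinGordon] at this
        simp only [regContr, fieldContr, if_true]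
        refine this.trans ?_
        simp only [kPsiBar, divPart, Matrix.one_apply, true_and]
        split_ifs <;> simp
      · simp [regContr, fieldContr, kPsiBar, divPart, h, Ne.symm h]
    | _ => simp [regContr, fieldContr, kPsiBar, divPart]
  right φ := by
    rw [pair_ePsiBar_right]
    cases φ with
    | psi B r =>
      by_cases h : B = A
      · subst h
        have := M.diracBar_mul_diracBar (fun μ => -distD μ) neg_distD_comm (feynman (M.mF B))
          (M.mF B) r q
        have e : ∀ p, M.regContr (.psi B r) (.psiBar B p) = -(-I • (∑ ν,
            (I * M.γ ν r p) • (-distD ν) (feynman (M.mF B)) -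
            (if r = p then (M.mF B : ℂ) else 0) • feynman (M.mF B))) := by
          intro p
          simp only [regContr, fieldContr, if_true, neg_apply, Distr.smul_neg',
            sum_neg_distrib]
          module
        rw [neg_distD_feynman] at this
        simp only [e, map_neg _ (-I • _), Distr.smul_neg', sum_neg_distrib]
        rw [← neg_add, this]
        simp only [kPsiBar, divPart, Matrix.one_apply, true_and]
        split_ifs <;> simp [bsign]
      · simp [regContr, fieldContr, kPsiBar, divPart, h]
    | _ => simp [regContr, fieldContr, kPsiBar, divPart]

lemma pair_eDiv_left (c : ι) (φ : BasicField ι τ) :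
    pair M.regC (eDiv c) (fieldWick φ) = 0 := by
  have h : pair M.regC (eDiv c) (fieldWick φ) = M.regContr (.divVec c) φ -
      ∑ μ, distD μ (M.regContr (.vec c μ) φ) := by
    simp only [eDiv, map_sub, map_sum, sub_apply, sum_apply,
      pair_wickD_left M.regC_covariant (fieldWick_mem_letters _) (fieldWick_mem_letters _),
      pair_fieldWick]
  rw [h]
  cases φ with
  | vec b ν =>
    by_cases hb : c = b
    · subst hb
      simp only [regContr, fieldContr, true_and, if_true]
      rw [sum_eq_single ν (fun μ _ hμ => by rw [if_neg hμ, map_zero]) (by simp)]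
      simp
    · simp [regContr, fieldContr, hb]
  | divVec b =>
    by_cases hb : c = b
    · subst hb
      simp [regContr, fieldContr, smul_sum, Distr.smul_smul']
    · simp [regContr, fieldContr, hb]
  | _ => simp [regContr, fieldContr]

lemma pair_eDiv_right (c : ι) (φ : BasicField ι τ) :
    pair M.regC (fieldWick φ) (eDiv c) = 0 := by
  have h : pair M.regC (fieldWick φ) (eDiv c) = M.regContr φ (.divVec c) +
      ∑ μ, distD μ (M.regContr φ (.vec c μ)) := by
    simp only [eDiv, map_sub, map_sum, pair_wickD_right M.regC_covariant (fieldWick_mem_letters _)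
      (fieldWick_mem_letters _), pair_fieldWick, sum_neg_distrib, sub_neg_eq_add]
  rw [h]
  cases φ with
  | vec b ν =>
    by_cases hb : b = c
    · subst hb
      simp only [regContr, fieldContr, true_and, if_true]
      rw [sum_eq_single ν (fun μ _ hμ => by rw [if_neg (Ne.symm hμ), map_zero]) (by simp)]
      simp
    · simp [regContr, fieldContr, hb]
  | divVec b =>
    by_cases hb : b = c
    · subst hb
      simp [regContr, fieldContr, smul_sum, Distr.smul_smul']
    · simp [regContr, fieldContr, hb]
  | _ => simp [regContr, fieldContr]

end YangMills

end Green

namespace YangMills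

section FieldVariation

variable {ι τ : Type*}

/-- The jets of order zero and the first derivatives of the fields other than `∂_μ v^μ`. -/
def lowJets (ι τ : Type*) : Set (Jet ι τ) :=
  {j | j.idx = 0 ∨ ((∃ ρ, j.idx = Pi.single ρ 1) ∧ ∀ c, j.field ≠ .divVec c)}

/-- The extension of a variation of the fields to `∂_μ v^μ`. -/
def undiffVar (S : BasicField ι τ → Wick ι τ) : BasicField ι τ → Wick ι τ
  | .divVec c => ∑ ρ, wickD ρ (S (.vec c ρ))
  | φ => S φ

/-- The boundary term of the variation of `∂_μ v^μ`. -/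
def undiffTot (S : BasicField ι τ → Wick ι τ) (ρ : Fin 4) : BasicField ι τ → Wick ι τ
  | .divVec c => S (.vec c ρ)
  | _ => 0

/-- The variation of jets induced by a variation of the fields. -/
def jetVar (S : BasicField ι τ → Wick ι τ) (j : Jet ι τ) : Wick ι τ :=
  (if j.idx = 0 then undiffVar S j.field else 0) +
    ∑ ρ, if j.idx = Pi.single ρ 1 then wickD ρ (S j.field) else 0

/-- The boundary terms of the variation of jets. -/
def jetTot (S : BasicField ι τ → Wick ι τ) (ρ : Fin 4) (j : Jet ι τ) : Wick ι τ :=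
  (if j.idx = 0 then undiffTot S ρ j.field else 0) +
    if j.idx = Pi.single ρ 1 then S j.field else 0

lemma single_one_ne_zero (ρ : Fin 4) : (Pi.single ρ 1 : Fin 4 → ℕ) ≠ 0 := by simp

lemma undiffVar_add (S S' : BasicField ι τ → Wick ι τ) (φ : BasicField ι τ) :
    undiffVar (S + S') φ = undiffVar S φ + undiffVar S' φ := by
  cases φ <;> simp [undiffVar, sum_add_distrib]

lemma undiffVar_smul (c : ℂ) (S : BasicField ι τ → Wick ι τ) (φ : BasicField ι τ) :
    undiffVar (c • S) φ = c • undiffVar S φ := by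
  cases φ <;> simp [undiffVar, smul_sum]

lemma undiffTot_add (S S' : BasicField ι τ → Wick ι τ) (ρ : Fin 4) (φ : BasicField ι τ) :
    undiffTot (S + S') ρ φ = undiffTot S ρ φ + undiffTot S' ρ φ := by
  cases φ <;> simp [undiffTot]

lemma undiffTot_smul (c : ℂ) (S : BasicField ι τ → Wick ι τ) (ρ : Fin 4) (φ : BasicField ι τ) :
    undiffTot (c • S) ρ φ = c • undiffTot S ρ φ := by
  cases φ <;> simp [undiffTot]

lemma jetVar_add (S S' : BasicField ι τ → Wick ι τ) :
    jetVar (S + S') = fun j => jetVar S j + jetVar S' j := by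
  funext j
  simp only [jetVar, undiffVar_add, Pi.add_apply, map_add]
  rw [add_add_add_comm, ← sum_add_distrib]
  congr 1
  · split_ifs <;> simp
  · exact sum_congr rfl fun ρ _ => by split_ifs <;> simp

lemma jetVar_smul (c : ℂ) (S : BasicField ι τ → Wick ι τ) :
    jetVar (c • S) = fun j => c • jetVar S j := by
  funext j
  simp [jetVar, undiffVar_smul, smul_add, smul_sum, smul_ite]

lemma jetTot_add (S S' : BasicField ι τ → Wick ι τ) :
    jetTot (S + S') = fun ρ j => jetTot S ρ j + jetTot S' ρ j := by
  funext ρ j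
  simp only [jetTot, undiffTot_add, Pi.add_apply]
  rw [add_add_add_comm]
  congr 1 <;> split_ifs <;> simp

lemma jetTot_smul (c : ℂ) (S : BasicField ι τ → Wick ι τ) :
    jetTot (c • S) = fun ρ j => c • jetTot S ρ j := by
  funext ρ j
  simp [jetTot, undiffTot_smul, smul_add, smul_ite]

variable [DecidableEq ι] [DecidableEq τ] (M : YangMills ι τ)

/-- `K` acts as minus the variation `S` of the fields. -/
def IsFieldVariation (ε : Bool) (K : Wick ι τ) (S : BasicField ι τ → Wick ι τ) : Prop :=
  M.IsVariation M.regC (lowJets ι τ) ε K (jetVar S) (jetTot S)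

variable {M}

lemma IsFieldVariation.add {ε : Bool} {K K' : Wick ι τ} {S S' : BasicField ι τ → Wick ι τ}
    (h : M.IsFieldVariation ε K S) (h' : M.IsFieldVariation ε K' S') :
    M.IsFieldVariation ε (K + K') (S + S') := by
  have := IsVariation.add h h'
  rwa [← jetVar_add, ← jetTot_add] at this

lemma IsFieldVariation.smul {ε : Bool} {K : Wick ι τ} {S : BasicField ι τ → Wick ι τ}
    (h : M.IsFieldVariation ε K S) (c : ℂ) : M.IsFieldVariation ε (c • K) (c • S) := by
  have := IsVariation.smul h c
  rwa [← jetVar_smul, ← jetTot_smul] at this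

lemma IsFieldVariation.zero {ε : Bool} :
    M.IsFieldVariation ε 0 (0 : BasicField ι τ → Wick ι τ) := by
  have h : M.IsVariation M.regC (lowJets ι τ) ε 0 (fun _ => 0) (fun _ _ => 0) := IsVariation.zero M
  have h1 : jetVar (0 : BasicField ι τ → Wick ι τ) = fun _ => 0 := by
    simpa using jetVar_smul (0 : ℂ) (0 : BasicField ι τ → Wick ι τ)
  have h2 : jetTot (0 : BasicField ι τ → Wick ι τ) = fun _ _ => 0 := by
    simpa using jetTot_smul (0 : ℂ) (0 : BasicField ι τ → Wick ι τ)
  unfold IsFieldVariation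
  rw [h1, h2]
  exact h

lemma IsFieldVariation.sum {ε : Bool} {α : Type*} (t : Finset α) {K : α → Wick ι τ}
    {S : α → BasicField ι τ → Wick ι τ} (h : ∀ i ∈ t, M.IsFieldVariation ε (K i) (S i)) :
    M.IsFieldVariation ε (∑ i ∈ t, K i) (∑ i ∈ t, S i) := by
  classical
  induction t using Finset.induction_on with
  | empty => simpa using IsFieldVariation.zero
  | insert i t hi ih =>
    rw [sum_insert hi, sum_insert hi]
    exact (h i (Finset.mem_insert_self _ _)).add
      (ih fun j hj => h j (Finset.mem_insert_of_mem hj))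

/-- `divPart` as a sum. -/
def divCoeff (k : BasicField ι τ → ℂ) (ρ : Fin 4) : BasicField ι τ → ℂ
  | .divVec c => k (.vec c ρ)
  | _ => 0

lemma divPart_eq_sum (k : BasicField ι τ → ℂ) (φ : BasicField ι τ) :
    divPart k φ = ∑ ρ, divCoeff k ρ φ • distD ρ dirac := by
  cases φ <;> simp [divPart, divCoeff]

lemma IsGreen.isFieldVariation {ε ε' : Bool} {e p : Wick ι τ} {k : BasicField ι τ → ℂ}
    (hG : M.IsGreen ε e k) (hp : HasParity ε' p) :
    M.IsFieldVariation (xor ε' ε) (p * e) (fun φ => k φ • p) := by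
  have hpar : ∀ φ : BasicField ι τ, φ.odd ≠ ε → ∀ ρ, divCoeff k ρ φ = 0 := by
    intro φ h ρ
    cases φ with
    | divVec c => exact hG.parity _ h
    | _ => rfl
  have hcov := M.regC_covariant
  have hs : ∀ σ ρ : Fin 4, (Pi.single σ 1 : Fin 4 → ℕ) = Pi.single ρ 1 ↔ ρ = σ := by
    intro σ ρ
    constructor
    · intro h
      by_contra hne
      have := congrFun h σ
      simp [Ne.symm hne] at this
    · rintro rfl; rfl
  have hj : ∀ (φ : BasicField ι τ) (σ : Fin 4), ιℂ (⟨φ, Pi.single σ 1⟩ : Jet ι τ) =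
      wickD σ (fieldWick φ) := by
    intro φ σ; simp [fieldWick, wickD_ι, Jet.shift]
  have hdiv : ∀ φ : BasicField ι τ, (∀ c, φ ≠ .divVec c) → divPart k φ = 0 := by
    intro φ h
    cases φ with
    | divVec c => exact absurd rfl (h c)
    | _ => rfl
  have main := IsVariation.mul_fieldEq (M := M) (C := M.regC) (𝒜 := lowJets ι τ) hG.mem hG.eq hp
    (fun j => if j.idx = 0 then k j.field else 0)
    (fun ρ j => (if j.idx = 0 then divCoeff k ρ j.field else 0) +
      if j.idx = Pi.single ρ 1 then k j.field else 0)
    (fun x hx => ⟨by simp [hG.parity _ hx], fun ρ => by simp [hG.parity _ hx, hpar _ hx]⟩)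
    (by
      rintro ⟨φ, β⟩ (h | ⟨⟨σ, h⟩, hd⟩)
      · simp only at h
        subst h
        have := hG.left φ
        simp only [if_true, (single_one_ne_zero _).symm, if_false, add_zero]
        rw [← divPart_eq_sum]
        exact this
      · simp only at h hd
        subst h
        rw [hj, pair_wickD_right hcov (plets_le_letters _ hG.mem) (fieldWick_mem_letters _),
          hG.left, hdiv φ hd]
        simp only [single_one_ne_zero, if_false, zero_add, hs, ite_smul, Distr.zero_smul',
          sum_ite_eq', mem_univ, if_true, add_zero, map_neg, map_smul, neg_neg,
          neg_zero])
    (by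
      rintro ⟨φ, β⟩ (h | ⟨⟨σ, h⟩, hd⟩)
      · simp only at h
        subst h
        have := hG.right φ
        simp only [if_true, (single_one_ne_zero _).symm, if_false, add_zero]
        rw [← divPart_eq_sum]
        exact this
      · simp only at h hd
        subst h
        rw [hj, pair_wickD_left hcov (fieldWick_mem_letters _) (plets_le_letters _ hG.mem),
          hG.right, hdiv φ hd]
        simp only [single_one_ne_zero, if_false, zero_add, hs, ite_smul, Distr.zero_smul',
          sum_ite_eq', mem_univ, if_true, sub_zero, map_neg, map_smul,
          neg_zero, zero_sub])
  have e1 : jetVar (fun φ => k φ • p) = fun j : Jet ι τ => (if j.idx = 0 then k j.field else 0) • p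
      + ∑ ρ, ((if j.idx = 0 then divCoeff k ρ j.field else 0) +
        if j.idx = Pi.single ρ 1 then k j.field else 0) • wickD ρ p := by
    funext ⟨φ, β⟩
    simp only [jetVar, add_smul, sum_add_distrib, ite_smul, zero_smul, map_smul]
    rw [← add_assoc]
    congr 1
    split_ifs with h
    · cases φ <;> simp [undiffVar, divCoeff, hG.div]
    · simp
  have e2 : jetTot (fun φ => k φ • p) = fun ρ (j : Jet ι τ) =>
      ((if j.idx = 0 then divCoeff k ρ j.field else 0) +
        if j.idx = Pi.single ρ 1 then k j.field else 0) • p := by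
    funext ρ ⟨φ, β⟩
    simp only [jetTot, add_smul, ite_smul, zero_smul]
    congr 1
    split_ifs with h
    · cases φ <;> simp [undiffTot, divCoeff]
    · rfl
  unfold IsFieldVariation
  rw [e1, e2]
  exact main

lemma isFieldVariation_mul_null {ε ε' : Bool} {e p : Wick ι τ} (he : e ∈ plets ε)
    (hf : M.FieldEq e) (hp : HasParity ε' p) (hl : ∀ φ, pair M.regC e (fieldWick φ) = 0)
    (hr : ∀ φ, pair M.regC (fieldWick φ) e = 0) : M.IsFieldVariation (xor ε' ε) (p * e) 0 := by
  have hcov := M.regC_covariant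
  have := IsVariation.mul_fieldEq_zero (M := M) (C := M.regC) (𝒜 := lowJets ι τ) he hf hp
    (fun x => by
      rw [← wickPartials_fieldWick x.field x.idx, pair_wickPartials_right hcov
        (plets_le_letters _ he) (fieldWick_mem_letters _), hl, map_zero]
      exact Distr.smul_zero' _)
    (fun x => by
      rw [← wickPartials_fieldWick x.field x.idx, pair_wickPartials_left hcov
        (fieldWick_mem_letters _) (plets_le_letters _ he), hr, map_zero])
  have h1 : jetVar (0 : BasicField ι τ → Wick ι τ) = fun _ => 0 := by
    simpa using jetVar_smul (0 : ℂ) (0 : BasicField ι τ → Wick ι τ)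
  have h2 : jetTot (0 : BasicField ι τ → Wick ι τ) = fun _ _ => 0 := by
    simpa using jetTot_smul (0 : ℂ) (0 : BasicField ι τ → Wick ι τ)
  unfold IsFieldVariation
  rw [h1, h2]
  exact this

lemma eDiv_mem_plets (c : ι) : (eDiv c : Wick ι τ) ∈ plets false :=
  sub_mem (fieldWick_mem_plets (.divVec c)) (sum_mem _ fun μ _ =>
    wickD_mem_plets (fieldWick_mem_plets (.vec c μ)) μ)

lemma isFieldVariation_mul_eDiv {ε : Bool} {p : Wick ι τ} (hp : HasParity ε p) (c : ι) :
    M.IsFieldVariation ε (p * eDiv c) 0 := by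
  have := isFieldVariation_mul_null (M := M) (eDiv_mem_plets c) (.divVec c) hp
    (M.pair_eDiv_left c) (M.pair_eDiv_right c)
  rwa [Bool.xor_false] at this

lemma isFieldVariation_mul_wickD_eDiv {ε : Bool} {p : Wick ι τ} (hp : HasParity ε p) (μ : Fin 4)
    (c : ι) : M.IsFieldVariation ε (p * wickD μ (eDiv c)) 0 := by
  have hl : eDiv c ∈ letters ι τ := plets_le_letters _ (eDiv_mem_plets c)
  have := isFieldVariation_mul_null (M := M) (wickD_mem_plets (eDiv_mem_plets c) μ)
    (.deriv μ _ (.divVec c)) hp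
    (fun φ => by
      have := pair_wickD_left M.regC_covariant hl (fieldWick_mem_letters φ) μ
      rw [M.pair_eDiv_left, map_zero] at this; exact this)
    (fun φ => by
      have := pair_wickD_right M.regC_covariant (fieldWick_mem_letters φ) hl μ
      rw [M.pair_eDiv_right, map_zero, neg_zero] at this; exact this)
  rwa [Bool.xor_false] at this

end FieldVariation

end YangMills

namespace YangMills

section Invariance

variable {ι τ : Type*} (M : YangMills ι τ)

lemma v_mem (a : ι) (μ : Fin 4) : (M.v a μ : Wick ι τ) ∈ plets false := by
  unfold v; split_ifs
  exacts [zero_mem _, fieldWick_mem_plets (.vec a μ)]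
lemma divv_mem (a : ι) : (M.divv a : Wick ι τ) ∈ plets false := by
  unfold divv; split_ifs
  exacts [zero_mem _, fieldWick_mem_plets (.divVec a)]
lemma u_mem (a : ι) : (M.u a : Wick ι τ) ∈ plets true := by
  unfold u; split_ifs
  exacts [zero_mem _, fieldWick_mem_plets (.ghost a)]
lemma uBar_mem (a : ι) : (M.uBar a : Wick ι τ) ∈ plets true := by
  unfold uBar; split_ifs
  exacts [zero_mem _, fieldWick_mem_plets (.anti a)]
lemma Φ_mem (a : ι) : (M.Φ a : Wick ι τ) ∈ plets false := by
  unfold Φ; split_ifs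
  exacts [zero_mem _, fieldWick_mem_plets (.scal a)]

lemma brstField_mem (φ : BasicField ι τ) : M.brstField φ ∈ plets (!φ.odd) := by
  cases φ with
  | vec a μ => exact smul_mem _ _ (wickD_mem_plets (M.u_mem a) μ)
  | divVec a =>
    exact sum_mem _ fun μ _ => wickD_mem_plets
      (smul_mem _ _ (wickD_mem_plets (M.u_mem a) μ)) μ
  | anti a =>
    exact smul_mem _ _ (add_mem (M.divv_mem a)
      (smul_mem _ _ (M.Φ_mem a)))
  | scal a => exact smul_mem _ _ (M.u_mem a)
  | _ => exact zero_mem _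

lemma antiBrstField_mem (φ : BasicField ι τ) : M.antiBrstField φ ∈ plets (!φ.odd) := by
  cases φ with
  | vec a μ => exact smul_mem _ _ (wickD_mem_plets (M.uBar_mem a) μ)
  | divVec a =>
    exact sum_mem _ fun μ _ => wickD_mem_plets
      (smul_mem _ _ (wickD_mem_plets (M.uBar_mem a) μ)) μ
  | ghost a =>
    exact smul_mem _ _ (add_mem (M.divv_mem a)
      (smul_mem _ _ (M.Φ_mem a)))
  | scal a => exact smul_mem _ _ (M.uBar_mem a)
  | _ => exact zero_mem _

lemma m_eq_zero_of_higgs {a : ι} (h : M.kind a = .higgs) : (M.m a : ℂ) = 0 := by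
  rw [M.m_zero a (by rw [h]; decide)]; simp

lemma u_mem_letters (a : ι) : M.u a ∈ letters ι τ := plets_le_letters _ (M.u_mem a)
lemma uBar_mem_letters (a : ι) : M.uBar a ∈ letters ι τ := plets_le_letters _ (M.uBar_mem a)

lemma m_smul_feynman (a : ι) :
    (M.m a : ℂ) • feynman (M.scalMass a) = (M.m a : ℂ) • feynman (M.m a) := by
  by_cases h : M.kind a = Kind.higgs
  · rw [M.m_zero a (by rw [h]; decide)]; simp
  · rw [scalMass, if_neg h]

variable [DecidableEq ι] [DecidableEq τ]

/-- The contractions of `d_Q φ` with the basic fields. -/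
def brstLeft : BasicField ι τ → BasicField ι τ → Distr
  | .vec a μ, .anti b => if a = b ∧ M.kind a ≠ .higgs then η μ • distD μ (feynman (M.m a)) else 0
  | .divVec a, .anti b => if a = b ∧ M.kind a ≠ .higgs then
      ∑ μ, η μ • distD μ (distD μ (feynman (M.m a))) else 0
  | .scal a, .anti b => if a = b ∧ M.kind a ≠ .higgs then (M.m a : ℂ) • feynman (M.m a) else 0
  | .anti a, .vec b μ => if a = b ∧ M.kind a ≠ .higgs then η μ • distD μ (feynman (M.m a)) else 0
  | .anti a, .divVec b => if a = b ∧ M.kind a ≠ .higgs then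
      -∑ μ, η μ • distD μ (distD μ (feynman (M.m a))) else 0
  | .anti a, .scal b => if a = b ∧ M.kind a ≠ .higgs then -((M.m a : ℂ) • feynman (M.m a)) else 0
  | _, _ => 0

lemma pair_u_left (a : ι) (φ : BasicField ι τ) : pair M.regC (M.u a) (fieldWick φ) =
    if M.kind a = .higgs then 0 else M.regContr (.ghost a) φ := by
  unfold u; split_ifs <;> simp
lemma pair_uBar_left (a : ι) (φ : BasicField ι τ) : pair M.regC (M.uBar a) (fieldWick φ) =
    if M.kind a = .higgs then 0 else M.regContr (.anti a) φ := by
  unfold uBar; split_ifs <;> simp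
lemma pair_u_right (a : ι) (φ : BasicField ι τ) : pair M.regC (fieldWick φ) (M.u a) =
    if M.kind a = .higgs then 0 else M.regContr φ (.ghost a) := by
  unfold u; split_ifs <;> simp
lemma pair_uBar_right (a : ι) (φ : BasicField ι τ) : pair M.regC (fieldWick φ) (M.uBar a) =
    if M.kind a = .higgs then 0 else M.regContr φ (.anti a) := by
  unfold uBar; split_ifs <;> simp
lemma pair_divv_left (a : ι) (φ : BasicField ι τ) : pair M.regC (M.divv a) (fieldWick φ) =
    if M.kind a = .higgs then 0 else M.regContr (.divVec a) φ := by
  unfold divv; split_ifs <;> simp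
lemma pair_divv_right (a : ι) (φ : BasicField ι τ) : pair M.regC (fieldWick φ) (M.divv a) =
    if M.kind a = .higgs then 0 else M.regContr φ (.divVec a) := by
  unfold divv; split_ifs <;> simp
lemma pair_mΦ_left (a : ι) (φ : BasicField ι τ) :
    pair M.regC ((M.m a : ℂ) • M.Φ a) (fieldWick φ) = (M.m a : ℂ) • M.regContr (.scal a) φ := by
  by_cases h : M.kind a = .massless
  · rw [M.m_zero a (by rw [h]; decide)]; simp
  · unfold Φ; rw [if_neg h, map_smul]; simp [-Complex.coe_smul]
lemma pair_mΦ_right (a : ι) (φ : BasicField ι τ) :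
    pair M.regC (fieldWick φ) ((M.m a : ℂ) • M.Φ a) = (M.m a : ℂ) • M.regContr φ (.scal a) := by
  by_cases h : M.kind a = .massless
  · rw [M.m_zero a (by rw [h]; decide)]; simp
  · unfold Φ; rw [if_neg h, map_smul]; simp [-Complex.coe_smul]

lemma I_mul_mul_I (x : ℂ) : I * x * I = -x := by
  linear_combination x * Complex.I_sq
lemma I_mul_mul_I' (x : ℂ) : I * (x * I) = -x := by
  linear_combination x * Complex.I_sq
lemma I_mul_I_mul (x : ℂ) : I * (I * x) = -x := by
  linear_combination x * Complex.I_sq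

lemma pair_brstField_left (φ χ : BasicField ι τ) :
    pair M.regC (M.brstField φ) (fieldWick χ) = M.brstLeft φ χ := by
  have hC := M.regC_covariant
  have hf := fieldWick_mem_letters χ
  have hm := M.m_smul_feynman
  cases φ
  case' vec a μ =>
    rw [brstField, map_smul, smul_apply, pair_wickD_left hC (M.u_mem_letters a) hf,
      pair_u_left]
  case' divVec a =>
    simp only [brstField, map_smul, map_sum, sum_apply, smul_apply,
      pair_wickD_left hC (wickD_mem_letters (M.u_mem_letters a) _) hf,
      pair_wickD_left hC (M.u_mem_letters a) hf, pair_u_left]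
  case' scal a => rw [brstField, map_smul, smul_apply, pair_u_left]
  case' anti a =>
    rw [brstField, map_smul, smul_apply, map_add, add_apply, pair_divv_left,
      pair_mΦ_left]
  case ghost | psi | psiBar => cases χ <;> simp [brstField, brstLeft]
  all_goals
    by_cases h : M.kind a = .higgs
    · cases χ <;> simp [-Complex.coe_smul, brstLeft, h, M.m_eq_zero_of_higgs h]
    · cases χ <;> first
        | simp [-Complex.coe_smul, brstLeft, h, regContr, fieldContr]; done
        | rcases eq_or_ne a ‹ι› with rfl | hab
          · simp [-Complex.coe_smul, brstLeft, h, regContr, fieldContr, Distr.smul_smul', I_mul_mul_I,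
              I_mul_mul_I', I_mul_I_mul, BasicField.odd, hm]
          · simp [-Complex.coe_smul, brstLeft, hab, hab.symm, regContr, fieldContr]

lemma pair_brstField_right (χ φ : BasicField ι τ) :
    pair M.regC (fieldWick χ) (M.brstField φ) =
      (if χ.odd = true then (1 : ℂ) else -1) • M.brstLeft χ φ := by
  have hC := M.regC_covariant
  have hf := fieldWick_mem_letters χ
  have hm := M.m_smul_feynman
  cases φ
  case' vec a μ => rw [brstField, map_smul, pair_wickD_right hC hf (M.u_mem_letters a), pair_u_right]
  case' divVec a =>
    simp only [brstField, map_smul, map_sum,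
      pair_wickD_right hC hf (wickD_mem_letters (M.u_mem_letters a) _),
      pair_wickD_right hC hf (M.u_mem_letters a), pair_u_right]
  case' scal a => rw [brstField, map_smul, pair_u_right]
  case' anti a => rw [brstField, map_smul, map_add, pair_divv_right, pair_mΦ_right]
  case ghost | psi | psiBar => cases χ <;> simp [brstField, brstLeft]
  all_goals
    by_cases h : M.kind a = .higgs
    · cases χ <;> simp [-Complex.coe_smul, brstLeft, h, M.m_eq_zero_of_higgs h] <;>
        (rintro rfl h'; exact absurd h h')
    · cases χ <;> first
        | simp [-Complex.coe_smul, brstLeft, h, regContr, fieldContr]; done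
        | rcases eq_or_ne a ‹ι› with rfl | hab
          · simp [-Complex.coe_smul, brstLeft, h, regContr, fieldContr, Distr.smul_smul', I_mul_mul_I,
              I_mul_mul_I', I_mul_I_mul, BasicField.odd, hm]
          · simp [-Complex.coe_smul, brstLeft, hab, hab.symm, regContr, fieldContr]

/-- The contractions of `d_Q^anti φ` with the basic fields. -/
def antiLeft : BasicField ι τ → BasicField ι τ → Distr
  | .vec a μ, .ghost b =>
    if a = b ∧ M.kind a ≠ .higgs then -(η μ • distD μ (feynman (M.m a))) else 0
  | .divVec a, .ghost b => if a = b ∧ M.kind a ≠ .higgs then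
      -∑ μ, η μ • distD μ (distD μ (feynman (M.m a))) else 0
  | .scal a, .ghost b => if a = b ∧ M.kind a ≠ .higgs then -((M.m a : ℂ) • feynman (M.m a)) else 0
  | .ghost a, .vec b μ =>
    if a = b ∧ M.kind a ≠ .higgs then -(η μ • distD μ (feynman (M.m a))) else 0
  | .ghost a, .divVec b => if a = b ∧ M.kind a ≠ .higgs then
      ∑ μ, η μ • distD μ (distD μ (feynman (M.m a))) else 0
  | .ghost a, .scal b => if a = b ∧ M.kind a ≠ .higgs then (M.m a : ℂ) • feynman (M.m a) else 0
  | _, _ => 0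

lemma pair_antiBrstField_left (φ χ : BasicField ι τ) :
    pair M.regC (M.antiBrstField φ) (fieldWick χ) = M.antiLeft φ χ := by
  have hC := M.regC_covariant
  have hf := fieldWick_mem_letters χ
  have hm := M.m_smul_feynman
  cases φ
  case' vec a μ =>
    rw [antiBrstField, map_smul, smul_apply, pair_wickD_left hC (M.uBar_mem_letters a) hf,
      pair_uBar_left]
  case' divVec a =>
    simp only [antiBrstField, map_smul, map_sum, sum_apply, smul_apply,
      pair_wickD_left hC (wickD_mem_letters (M.uBar_mem_letters a) _) hf,
      pair_wickD_left hC (M.uBar_mem_letters a) hf, pair_uBar_left]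
  case' scal a => rw [antiBrstField, map_smul, smul_apply, pair_uBar_left]
  case' ghost a =>
    rw [antiBrstField, map_smul, smul_apply, map_add, add_apply, pair_divv_left,
      pair_mΦ_left]
  case anti | psi | psiBar => cases χ <;> simp [antiBrstField, antiLeft]
  all_goals
    by_cases h : M.kind a = .higgs
    · cases χ <;> simp [-Complex.coe_smul, antiLeft, h, M.m_eq_zero_of_higgs h]
    · cases χ <;> first
        | simp [-Complex.coe_smul, antiLeft, h, regContr, fieldContr]; done
        | rcases eq_or_ne a ‹ι› with rfl | hab
          · simp [-Complex.coe_smul, antiLeft, h, regContr, fieldContr, Distr.smul_smul', I_mul_mul_I,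
              I_mul_mul_I', I_mul_I_mul, BasicField.odd, hm]
          · simp [-Complex.coe_smul, antiLeft, hab, hab.symm, regContr, fieldContr]

lemma pair_antiBrstField_right (χ φ : BasicField ι τ) :
    pair M.regC (fieldWick χ) (M.antiBrstField φ) =
      (if χ.odd = true then (1 : ℂ) else -1) • M.antiLeft χ φ := by
  have hC := M.regC_covariant
  have hf := fieldWick_mem_letters χ
  have hm := M.m_smul_feynman
  cases φ
  case' vec a μ => rw [antiBrstField, map_smul, pair_wickD_right hC hf (M.uBar_mem_letters a), pair_uBar_right]
  case' divVec a =>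
    simp only [antiBrstField, map_smul, map_sum,
      pair_wickD_right hC hf (wickD_mem_letters (M.uBar_mem_letters a) _),
      pair_wickD_right hC hf (M.uBar_mem_letters a), pair_uBar_right]
  case' scal a => rw [antiBrstField, map_smul, pair_uBar_right]
  case' ghost a => rw [antiBrstField, map_smul, map_add, pair_divv_right, pair_mΦ_right]
  case anti | psi | psiBar => cases χ <;> simp [antiBrstField, antiLeft]
  all_goals
    by_cases h : M.kind a = .higgs
    · cases χ <;> simp [-Complex.coe_smul, antiLeft, h, M.m_eq_zero_of_higgs h] <;>
        (rintro rfl h'; exact absurd h h')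
    · cases χ <;> first
        | simp [-Complex.coe_smul, antiLeft, h, regContr, fieldContr]; done
        | rcases eq_or_ne a ‹ι› with rfl | hab
          · simp [-Complex.coe_smul, antiLeft, h, regContr, fieldContr, Distr.smul_smul', I_mul_mul_I,
              I_mul_mul_I', I_mul_I_mul, BasicField.odd, hm]
          · simp [-Complex.coe_smul, antiLeft, hab, hab.symm, regContr, fieldContr]

lemma brst_derivInvariant : DerivInvariant M.regC (jetDer M.brstField) :=
  jetContr_derivInvariant M.regContr_parity M.brstField_mem fun φ χ => by
    rw [pair_brstField_left, pair_brstField_right, smul_smul]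
    split_ifs <;> simp

lemma antiBrst_derivInvariant : DerivInvariant M.regC (jetDer M.antiBrstField) :=
  jetContr_derivInvariant M.regContr_parity M.antiBrstField_mem fun φ χ => by
    rw [pair_antiBrstField_left, pair_antiBrstField_right, smul_smul]
    split_ifs <;> simp

end Invariance

end YangMills

section Fold

variable {ι τ : Type*}

/-- Identification of the two points. -/
def fold : Wick₂ ι τ →ₐ[ℂ] Wick ι τ := FreeAlgebra.lift ℂ fun x => ιℂ x.2

@[simp] lemma fold_ι (x : Fin 2 × Jet ι τ) :
    fold (ιℂ x) = (ιℂ x.2 : Wick ι τ) := by simp [fold]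

@[simp] lemma fold_at₂ (k : Fin 2) (p : Wick ι τ) : fold (at₂ k p) = p := by
  have : (fold (ι := ι) (τ := τ)).comp (at₂ k) = AlgHom.id ℂ _ := by ext; simp
  exact DFunLike.congr_fun this p

lemma derExt_fold (D : Jet ι τ → Wick ι τ) (Z : Wick₂ ι τ) :
    derExt paritySign D (fold Z) =
      fold (derExt (fun x => paritySign x.2) (fun x => at₂ x.1 (D x.2)) Z) :=
  derExt_comp_hom fold _ _ _ _ (by simp) (by simp) Z

end Fold

namespace YangMills

variable {ι τ : Type*} (M : YangMills ι τ)

lemma cl_dirac (Z : Wick₂ ι τ) : M.cl (dirac ⊗ₜ Z) = M.loc (fold Z) := by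
  induction Z using freeAlgebra_induction with
  | h1 => simp [loc_apply']
  | hmul x p ih =>
    obtain ⟨k, x⟩ := x
    rw [← M.lmq_cl_tmul, ih, map_mul, fold_ι, ← M.lmq_loc k, at₂_ι]
  | hadd p q h h' => rw [tmul_add, map_add, h, h', map_add, map_add]
  | hsmul c p h => rw [tmul_smul, map_smul, h, map_smul, map_smul]

lemma cl_oddDer₂_dirac (D : Jet ι τ → Wick ι τ) (Z : Wick₂ ι τ) :
    M.cl (oddDer₂ D (dirac ⊗ₜ Z)) = M.loc (derExt paritySign D (fold Z)) := by
  rw [oddDer₂_tmul, cl_dirac, derExt_fold]; rfl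

variable [DecidableEq ι] [DecidableEq τ]

/-- Second order gauge invariance from local identities. -/
theorem gauge_of_local {d : BasicField ι τ → Wick ι τ} (hd : DerivInvariant M.regC (jetDer d))
    {T : List (Fin 4) → Wick ι τ} (hT : ∀ I, HasParity I.length.bodd (T I))
    (hA : ∀ I, T I ∈ Algebra.adjoin ℂ (ιℂ '' lowJets ι τ))
    {S : List (Fin 4) → BasicField ι τ → Wick ι τ}
    (hS : ∀ I, M.IsFieldVariation (!I.length.bodd)
      (derExt paritySign (jetDer d) (T I) - Complex.I • ∑ μ, wickD μ (T (I ++ [μ]))) (S I))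
    {N N' : List (Fin 4) → List (Fin 4) → Wick ι τ} (Z : List (Fin 4) → List (Fin 4) → Wick₂ ι τ)
    (hZ : ∀ I J, M.T₀ (T I) (T J) = treeC M.regC (T I) (T J) + dirac ⊗ₜ Z I J)
    (hN : ∀ I J, N' I J = N I J - fold (Z I J))
    (hsymm : ∀ I J, M.loc (N' J I) = bsign I.length.bodd J.length.bodd • M.loc (N' I J))
    (hy : ∀ I J ρ, M.loc (derExt (gsign (!I.length.bodd)) (jetTot (S I) ρ) (T J)) =
      -(Complex.I • M.loc (N' (I ++ [ρ]) J)))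
    (I J : List (Fin 4))
    (hs : M.loc (derExt (gsign (!I.length.bodd)) (jetVar (S I)) (T J)) +
      bsign I.length.bodd J.length.bodd •
        M.loc (derExt (gsign (!J.length.bodd)) (jetVar (S J)) (T I)) +
      M.loc (derExt paritySign (jetDer d) (N' I J)) = 0) :
    M.GaugeIdentity (oddDer₂ (jetDer d)) (fun I J => M.T₀ (T I) (T J) - quasiLocal (N I J)) I J := by
  have hR : ∀ I J, M.T₀ (T I) (T J) - quasiLocal (N I J) =
      treeC M.regC (T I) (T J) + (dirac ⊗ₜ Z I J - quasiLocal (N I J)) := by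
    intro I J; rw [hZ]; abel
  have hloc : ∀ I J, M.cl (dirac ⊗ₜ Z I J - quasiLocal (N I J)) = -M.loc (N' I J) := by
    intro I J; rw [map_sub, cl_dirac, ← loc_apply, hN, map_sub]; abel
  have hpd : ∀ k μ I J, M.cl (pd k μ (M.T₀ (T I) (T J) - quasiLocal (N I J))) =
      M.cl (pd k μ (treeC M.regC (T I) (T J))) - M.pdq k μ (M.loc (N' I J)) := by
    intro k μ I J
    rw [hR, map_add, map_add, ← pdq_cl, ← pdq_cl, hloc, map_neg]; abel
  have hdd : M.cl (oddDer₂ (jetDer d) (M.T₀ (T I) (T J) - quasiLocal (N I J))) =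
      M.cl (oddDer₂ (jetDer d) (treeC M.regC (T I) (T J))) -
        M.loc (derExt paritySign (jetDer d) (N' I J)) := by
    have h1 : quasiLocal (N I J) = dirac ⊗ₜ at₂ 0 (N I J) := rfl
    rw [hR, map_add, map_add, map_sub, map_sub, h1, cl_oddDer₂_dirac, cl_oddDer₂_dirac, hN,
      fold_at₂, map_sub, map_sub]
    abel
  have hl := (hS I).left (T J) (hA J)
  have hr := (hS J).right (T I) (hA I)
  have hcov := M.regC_covariant
  have h1 := oddDer₂_treeC hd (T I) (T J)
  have ht1 := (hT I).twist_gsign true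
  have ht2 := (hT I).twist_gsign (!J.length.bodd)
  have hpow : (-1 : ℂ) ^ I.length = bsign true I.length.bodd := by
    rw [← Nat.bodd_add_div2 I.length, pow_add, pow_mul]
    cases h : I.length.bodd <;> simp [bsign]
  simp only [hy, map_neg, map_smul] at hl
  simp only [ht2, map_smul, hy, map_neg] at hr
  simp only [map_sub, map_sum, map_smul, sub_apply, sum_apply,
    smul_apply] at hl hr
  rw [gsign_true] at ht1
  unfold GaugeIdentity
  change M.cl _ = 0
  beta_reduce
  rw [map_sub, map_sub, map_smul, map_smul, map_sum, map_sum, hdd]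
  simp only [hpd]
  simp only [h1, ht1, map_add, map_smul, smul_apply, pd_zero_treeC hcov,
    pd_one_treeC hcov, sum_sub_distrib, hpow]
  have hsy : ∀ ρ, M.pdq 1 ρ (M.loc (N' (J ++ [ρ]) I)) =
      bsign I.length.bodd (!J.length.bodd) • M.pdq 1 ρ (M.loc (N' I (J ++ [ρ]))) := by
    intro ρ
    rw [hsymm I (J ++ [ρ]), map_smul]
    simp
  simp only [hsy] at hr
  simp only [sum_neg_distrib, ← smul_sum] at hl hr
  have hx : bsign true I.length.bodd = 1 ∨ bsign true I.length.bodd = -1 := by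
    cases I.length.bodd <;> simp [bsign]
  have hyy : bsign I.length.bodd J.length.bodd = 1 ∨ bsign I.length.bodd J.length.bodd = -1 := by
    cases I.length.bodd <;> cases J.length.bodd <;> simp [bsign]
  have hb2 : bsign (!J.length.bodd) I.length.bodd =
      bsign true I.length.bodd * bsign I.length.bodd J.length.bodd := by
    cases I.length.bodd <;> cases J.length.bodd <;> simp [bsign]
  have hb3 : bsign I.length.bodd (!J.length.bodd) =
      bsign true I.length.bodd * bsign I.length.bodd J.length.bodd := by
    cases I.length.bodd <;> cases J.length.bodd <;> simp [bsign]
  rw [hb2, hb3] at hr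
  rcases hx with hx | hx <;> rcases hyy with hyy | hyy <;> rw [hx, hyy] at hr <;> rw [hyy] at hs <;>
    rw [hx]
  · linear_combination (norm := module) hl + hr - hs
  · linear_combination (norm := module) hl + hr - hs
  · linear_combination (norm := module) hl - hr - hs
  · linear_combination (norm := module) hl - hr - hs

end YangMills

namespace YangMills

section Forms

variable {ι τ : Type*}

/-- A family of Wick polynomials, homogeneous of parity `ε`. -/
class Homog (X : ι → Wick ι τ) (ε : outParam Bool) : Prop where
  parity : ∀ a, HasParity ε (X a)

/-- Derivations of parity `ε`. -/
structure IsDer (ε : Bool) (D : Wick ι τ →ₗ[ℂ] Wick ι τ) : Prop where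
  mul : ∀ p q, D (p * q) = D p * q + twist (gsign ε) p * D q

lemma isDer_derExt (ε : Bool) (s : Jet ι τ → Wick ι τ) : IsDer ε (derExt (gsign ε) s) :=
  ⟨derExt_mul _ _⟩

lemma isDer_derExt_paritySign (s : Jet ι τ → Wick ι τ) : IsDer true (derExt paritySign s) := by
  rw [← gsign_true]; exact isDer_derExt _ _

lemma isDer_wickD (μ : Fin 4) : IsDer false (wickD μ : Wick ι τ →ₗ[ℂ] Wick ι τ) :=
  ⟨fun p q => by rw [wickD_mul, gsign_false, twist_one_fun]; rfl⟩

lemma IsDer.mul_of_parity {ε ε' : Bool} {D : Wick ι τ →ₗ[ℂ] Wick ι τ} (hD : IsDer ε D)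
    {p : Wick ι τ} (hp : HasParity ε' p) (q : Wick ι τ) :
    D (p * q) = D p * q + bsign ε ε' • (p * D q) := by
  rw [hD.mul, hp.twist_gsign, smul_mul_assoc]

@[simp] lemma bsign_false_left (ε : Bool) : bsign false ε = 1 := by simp [bsign]
@[simp] lemma bsign_false_right (ε : Bool) : bsign ε false = 1 := by simp [bsign]
@[simp] lemma bsign_true_true : bsign true true = -1 := by simp [bsign]
lemma bsign_vals : (∀ ε, bsign false ε = 1) ∧ (∀ ε, bsign ε false = 1) ∧ bsign true true = -1 := by
  simp
lemma bsign_mul_self (ε ε' : Bool) : bsign ε ε' * bsign ε ε' = 1 := by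
  cases ε <;> cases ε' <;> simp
lemma bsign_comm (ε ε' : Bool) : bsign ε ε' = bsign ε' ε := by
  cases ε <;> cases ε' <;> simp
section Quotient

variable {R : Type*} [Ring R] [Algebra ℂ R] {π : Wick ι τ →ₐ[ℂ] R}

/-- The homomorphism `π` satisfies the exchange relations. -/
def Graded (π : Wick ι τ →ₐ[ℂ] R) : Prop := ∀ x ∈ exchRel ι τ, π x = 0

lemma Graded.ι_mul (hπ : Graded π) (x : Jet ι τ) (W : Wick ι τ) :
    π (ιℂ x * W) = π (twist (gsign x.field.odd) W * ιℂ x) := by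
  induction W using freeAlgebra_induction with
  | h1 => simp
  | hmul y p ih =>
    have h := hπ _ ⟨x, y, rfl⟩
    rw [map_sub, sub_eq_zero, map_smul, map_mul, map_mul] at h
    rw [map_mul, map_mul, ← mul_assoc, h, smul_mul_assoc, mul_assoc, ← map_mul π, ih,
      map_mul (twist _), twist_ι, exchSign_eq_gsign]
    simp [mul_assoc]
  | hadd p q h h' => simp only [map_add, add_mul, mul_add] at *; rw [h, h']
  | hsmul c p h => simp only [map_smul, smul_mul_assoc, mul_smul_comm] at *; rw [h]

lemma Graded.comm (hπ : Graded π) {ε ε' : Bool} {p q : Wick ι τ} (hp : HasParity ε p)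
    (hq : HasParity ε' q) : π (p * q) = bsign ε ε' • π (q * p) := by
  have key : ∀ p : Wick ι τ, π (p * q) = π (q * twist (gsign ε') p) := by
    intro p
    induction p using freeAlgebra_induction with
    | h1 => simp
    | hmul x p ih =>
      have h1 := hπ.ι_mul x q
      rw [hq.twist_gsign, smul_mul_assoc, map_smul] at h1
      rw [mul_assoc, map_mul, ih, ← map_mul, ← mul_assoc, map_mul, h1, map_mul (twist _), twist_ι,
        smul_mul_assoc, smul_mul_assoc, mul_smul_comm, map_smul, ← map_mul, gsign_eq_bsign,
        bsign_comm, mul_assoc]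
    | hadd p q h h' => simp only [map_add, add_mul, mul_add] at *; rw [h, h']
    | hsmul c p h => simp only [map_smul, smul_mul_assoc, mul_smul_comm] at *; rw [h]
  rw [key, hp.twist_gsign, mul_smul_comm, map_smul, bsign_comm]

/-- Derivations with homogeneous values respect the exchange relations. -/
lemma Graded.der_congr (hπ : Graded π) {ε : Bool} {s : Jet ι τ → Wick ι τ}
    (hs : ∀ x, HasParity (xor ε x.field.odd) (s x)) {p q : Wick ι τ}
    (h : toRel (exchRel ι τ) p = toRel (exchRel ι τ) q) :
    π (derExt (gsign ε) s p) = π (derExt (gsign ε) s q) := by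
  refine toRel_factor (π.toLinearMap ∘ₗ derExt (gsign ε) s) (fun a b x hx => ?_) h
  have h0 := hπ x hx
  obtain ⟨y, z, rfl⟩ := hx
  have h1 : π (twist (gsign ε) (ιℂ y * ιℂ z - exchSign y z •
      (ιℂ z * ιℂ y))) = 0 := by
    rw [map_sub, map_smul, map_mul, map_mul, twist_ι, twist_ι, smul_mul_smul_comm,
      smul_mul_smul_comm, mul_comm (gsign ε z), smul_comm, ← smul_sub, map_smul, h0, smul_zero]
  have h2 : π (derExt (gsign ε) s (ιℂ y * ιℂ z - exchSign y z •
      (ιℂ z * ιℂ y))) = 0 := by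
    have e1 := hπ.comm (hs y) (HasParity.letter z)
    have e2 := hπ.comm (HasParity.letter y) (hs z)
    have e3 : exchSign y z = bsign y.field.odd z.field.odd := by
      rw [exchSign_eq_gsign, gsign_eq_bsign]
    rw [map_sub, map_smul, derExt_ι_mul, derExt_ι_mul, derExt_ι, derExt_ι, e3, gsign_eq_bsign,
      gsign_eq_bsign]
    simp only [map_sub, map_add, map_smul]
    rw [e1, e2]
    generalize y.field.odd = b at *
    generalize z.field.odd = c at *
    cases ε <;> cases b <;> cases c <;> simp <;> abel
  simp only [LinearMap.comp_apply, AlgHom.toLinearMap_apply, derExt_mul, map_add, map_mul, add_mul]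
  rw [h0, h2, ← map_mul π (twist _ a), ← map_mul (twist _), map_mul, map_mul π, h1]
  simp

end Quotient

end Forms

end YangMills

namespace YangMills

section Multilinear

variable {ι τ : Type*} {α β : Type*}

/-- The exterior product of families. -/
def ot : (α → Wick ι τ) →ₗ[ℂ] (β → Wick ι τ) →ₗ[ℂ] (α × β → Wick ι τ) :=
  LinearMap.mk₂ ℂ (fun X Y i => X i.1 * Y i.2) (fun _ _ _ => by ext1; simp [add_mul])
    (fun _ _ _ => by ext1; simp) (fun _ _ _ => by ext1; simp [mul_add]) (fun _ _ _ => by ext1; simp)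

variable [Fintype α] [Fintype β] [Fintype ι]

/-- The bilinear form with the coefficients `k`. -/
def wdot (k : α → β → ℂ) : (α → Wick ι τ) →ₗ[ℂ] (β → Wick ι τ) →ₗ[ℂ] Wick ι τ :=
  LinearMap.mk₂ ℂ (fun X Y => ∑ a, ∑ b, k a b • (X a * Y b))
    (fun _ _ _ => by simp [add_mul, sum_add_distrib])
    (fun _ _ _ => by simp [smul_sum, smul_comm (k _ _)])
    (fun _ _ _ => by simp [mul_add, sum_add_distrib])
    (fun _ _ _ => by simp [smul_sum, smul_comm (k _ _)])

/-- `∑ X_a Y_a`. -/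
def dot : (ι → Wick ι τ) →ₗ[ℂ] (ι → Wick ι τ) →ₗ[ℂ] Wick ι τ :=
  LinearMap.mk₂ ℂ (fun X Y => ∑ a, X a * Y a)
    (fun _ _ _ => by simp [add_mul, sum_add_distrib])
    (fun _ _ _ => by simp [smul_sum])
    (fun _ _ _ => by simp [mul_add, sum_add_distrib])
    (fun _ _ _ => by simp [smul_sum])

/-- `∑ k_{abc} X_a Y_b`. -/
def br (k : ι → ι → ι → ℂ) : (ι → Wick ι τ) →ₗ[ℂ] (ι → Wick ι τ) →ₗ[ℂ] (ι → Wick ι τ) :=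
  LinearMap.mk₂ ℂ (fun X Y c => ∑ a, ∑ b, k a b c • (X a * Y b))
    (fun _ _ _ => by ext1; simp [add_mul, sum_add_distrib])
    (fun _ _ _ => by ext1; simp [smul_sum, smul_comm (k _ _ _)])
    (fun _ _ _ => by ext1; simp [mul_add, sum_add_distrib])
    (fun _ _ _ => by ext1; simp [smul_sum, smul_comm (k _ _ _)])

/-- `∑ k_{abc} X_a Y_b Z_c`. -/
def F3 (k : ι → ι → ι → ℂ) :
    (ι → Wick ι τ) →ₗ[ℂ] (ι → Wick ι τ) →ₗ[ℂ] (ι → Wick ι τ) →ₗ[ℂ] Wick ι τ :=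
  ot.compr₂ (wdot fun i c => k i.1 i.2 c)

/-- `∑ k_{abcd} X_a Y_b Z_c W_d`. -/
def Q4 (k : ι → ι → ι → ι → ℂ) :
    (ι → Wick ι τ) →ₗ[ℂ] (ι → Wick ι τ) →ₗ[ℂ] (ι → Wick ι τ) →ₗ[ℂ] (ι → Wick ι τ) →ₗ[ℂ] Wick ι τ :=
  ot.compr₂ (ot.compr₂ (wdot fun i d => k i.1.1 i.1.2 i.2 d))

lemma dot_apply (X Y : ι → Wick ι τ) : dot X Y = ∑ a, X a * Y a := rfl

lemma br_apply (k : ι → ι → ι → ℂ) (X Y : ι → Wick ι τ) (c : ι) :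
    br k X Y c = ∑ a, ∑ b, k a b c • (X a * Y b) := rfl

lemma F3_apply (k : ι → ι → ι → ℂ) (X Y Z : ι → Wick ι τ) :
    F3 k X Y Z = ∑ a, ∑ b, ∑ c, k a b c • (X a * Y b * Z c) :=
  Fintype.sum_prod_type _

lemma Q4_apply (k : ι → ι → ι → ι → ℂ) (X Y Z W : ι → Wick ι τ) :
    Q4 k X Y Z W = ∑ a, ∑ b, ∑ c, ∑ d, k a b c d • (X a * Y b * Z c * W d) := by
  refine (Fintype.sum_prod_type _).trans ?_
  rw [Fintype.sum_prod_type]; rfl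

/-- Rescaling of a family. -/
def sc (m : ι → ℂ) : (ι → Wick ι τ) →ₗ[ℂ] (ι → Wick ι τ) where
  toFun X a := m a • X a
  map_add' _ _ := by ext1; simp
  map_smul' _ _ := by ext1; simp [smul_comm (m _)]

lemma sc_apply (m : ι → ℂ) (X : ι → Wick ι τ) (a : ι) : sc m X a = m a • X a := rfl

/-- Derivatives of families. -/
abbrev dF (μ : Fin 4) : (ι → Wick ι τ) →ₗ[ℂ] (ι → Wick ι τ) := (wickD μ).compLeft ι

instance (X : ι → Wick ι τ) {ε : Bool} [h : Homog X ε] (μ : Fin 4) : Homog (dF μ X) ε :=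
  ⟨fun a => (h.parity a).wickD μ⟩
instance (X : ι → Wick ι τ) {ε : Bool} [h : Homog X ε] (c : ℂ) : Homog (c • X) ε :=
  ⟨fun a => (h.parity a).smul c⟩
instance (X : ι → Wick ι τ) {ε : Bool} [h : Homog X ε] (m : ι → ℂ) : Homog (sc m X) ε :=
  ⟨fun a => (h.parity a).smul _⟩
instance (X Y : ι → Wick ι τ) {ε ε' : Bool} [h : Homog X ε] [h' : Homog Y ε'] (k : ι → ι → ι → ℂ) :
    Homog (br k X Y) (xor ε ε') :=
  ⟨fun _ => .sum fun a _ => .sum fun b _ => ((h.parity a).mul (h'.parity b)).smul _⟩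

section Coefficients

variable (k l : ι → ι → ι → ℂ) (n n' : ι → ι → ι → ι → ℂ) (X Y Z W P Q : ι → Wick ι τ)

lemma dot_br_left : dot (br k X Y) Z = F3 k X Y Z := by
  simp only [dot_apply, br_apply, F3_apply, sum_mul, smul_mul_assoc]
  rw [sum_comm]
  exact sum_congr rfl fun a _ => sum_comm

lemma dot_br_right : dot X (br k Y Z) = F3 (fun a b c => k b c a) X Y Z := by
  simp only [dot_apply, br_apply, F3_apply, mul_sum, mul_smul_comm, mul_assoc]

lemma F3_br_left : F3 k (br l P Q) Y Z = Q4 (fun p q b c => ∑ a, l p q a * k a b c) P Q Y Z := by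
  simp only [F3_apply, Q4_apply, br_apply, sum_mul, smul_mul_assoc, smul_sum,
    smul_smul, sum_smul, mul_comm (k _ _ _)]
  simp_rw [← Fintype.sum_prod_type']
  exact Fintype.sum_equiv ⟨fun (a, b, c, p, q) => (p, q, b, c, a),
    fun (p, q, b, c, a) => (a, b, c, p, q), fun _ => rfl, fun _ => rfl⟩ _ _ fun _ => rfl

lemma F3_br_mid : F3 k X (br l P Q) Z = Q4 (fun a p q c => ∑ b, l p q b * k a b c) X P Q Z := by
  simp only [F3_apply, Q4_apply, br_apply, sum_mul, mul_sum, smul_mul_assoc,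
    mul_smul_comm, smul_sum, smul_smul, sum_smul, mul_comm (k _ _ _), ← mul_assoc]
  simp_rw [← Fintype.sum_prod_type']
  exact Fintype.sum_equiv ⟨fun (a, b, c, p, q) => (a, p, q, c, b),
    fun (a, p, q, c, b) => (a, b, c, p, q), fun _ => rfl, fun _ => rfl⟩ _ _ fun _ => rfl

lemma F3_br_right : F3 k X Y (br l P Q) = Q4 (fun a b p q => ∑ c, l p q c * k a b c) X Y P Q := by
  simp only [F3_apply, Q4_apply, br_apply, sum_mul, mul_sum, smul_mul_assoc,
    mul_smul_comm, smul_sum, smul_smul, sum_smul, mul_comm (k _ _ _), ← mul_assoc]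
  simp_rw [← Fintype.sum_prod_type']
  exact Fintype.sum_equiv ⟨fun (a, b, c, p, q) => (a, b, p, q, c),
    fun (a, b, p, q, c) => (a, b, c, p, q), fun _ => rfl, fun _ => rfl⟩ _ _ fun _ => rfl

lemma F3_sc_left (m : ι → ℂ) : F3 k (sc m X) Y Z = F3 (fun a b c => m a * k a b c) X Y Z := by
  simp [F3_apply, sc_apply, smul_smul, mul_comm (m _)]

lemma F3_sc_mid (m : ι → ℂ) : F3 k X (sc m Y) Z = F3 (fun a b c => m b * k a b c) X Y Z := by
  simp [F3_apply, sc_apply, smul_smul, mul_comm (m _)]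

lemma F3_sc_right (m : ι → ℂ) : F3 k X Y (sc m Z) = F3 (fun a b c => m c * k a b c) X Y Z := by
  simp [F3_apply, sc_apply, smul_smul, mul_comm (m _)]

lemma Q4_sc₁ (m : ι → ℂ) : Q4 n (sc m X) Y Z W = Q4 (fun a b c d => m a * n a b c d) X Y Z W := by
  simp [Q4_apply, sc_apply, smul_smul, mul_comm (m _)]

lemma Q4_sc₂ (m : ι → ℂ) : Q4 n X (sc m Y) Z W = Q4 (fun a b c d => m b * n a b c d) X Y Z W := by
  simp [Q4_apply, sc_apply, smul_smul, mul_comm (m _)]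

lemma Q4_sc₄ (m : ι → ℂ) : Q4 n X Y Z (sc m W) = Q4 (fun a b c d => m d * n a b c d) X Y Z W := by
  simp [Q4_apply, sc_apply, smul_smul, mul_comm (m _)]

lemma F3_add : F3 k X Y Z + F3 l X Y Z = F3 (fun a b c => k a b c + l a b c) X Y Z := by
  simp [F3_apply, add_smul, sum_add_distrib]

lemma F3_smul (r : ℂ) : r • F3 k X Y Z = F3 (fun a b c => r * k a b c) X Y Z := by
  simp [F3_apply, smul_sum, smul_smul]

lemma F3_zero : F3 (fun _ _ _ => 0) X Y Z = 0 := by simp [F3_apply]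

lemma Q4_add : Q4 n X Y Z W + Q4 n' X Y Z W = Q4 (fun a b c d => n a b c d + n' a b c d) X Y Z W := by
  simp [Q4_apply, add_smul, sum_add_distrib]

lemma Q4_smul (r : ℂ) : r • Q4 n X Y Z W = Q4 (fun a b c d => r * n a b c d) X Y Z W := by
  simp [Q4_apply, smul_sum, smul_smul]

lemma Q4_zero : Q4 (fun _ _ _ _ => 0) X Y Z W = 0 := by simp [Q4_apply]

end Coefficients

section Derivation

variable {ε ε₁ ε₂ ε₃ : Bool} {D : Wick ι τ →ₗ[ℂ] Wick ι τ} (hD : IsDer ε D)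
  (k : ι → ι → ι → ℂ) (n : ι → ι → ι → ι → ℂ) (X Y Z W : ι → Wick ι τ)
include hD

lemma dot_der [h₁ : Homog X ε₁] : D (dot X Y) = dot (D.compLeft ι X) Y +
    bsign ε ε₁ • dot X (D.compLeft ι Y) := by
  simp only [dot_apply, map_sum, hD.mul_of_parity (h₁.parity _), sum_add_distrib,
    smul_sum]
  rfl

lemma br_der [h₁ : Homog X ε₁] : D.compLeft ι (br k X Y) = br k (D.compLeft ι X) Y +
    bsign ε ε₁ • br k X (D.compLeft ι Y) := by
  ext1 c
  simp only [compLeft_apply, Function.comp_apply, Pi.add_apply, Pi.smul_apply, br_apply,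
    map_sum, map_smul, hD.mul_of_parity (h₁.parity _), sum_add_distrib, smul_sum,
    smul_add, smul_comm (bsign _ _)]

lemma F3_der [h₁ : Homog X ε₁] [h₂ : Homog Y ε₂] : D (F3 k X Y Z) = F3 k (D.compLeft ι X) Y Z +
    bsign ε ε₁ • F3 k X (D.compLeft ι Y) Z +
    (bsign ε ε₁ * bsign ε ε₂) • F3 k X Y (D.compLeft ι Z) := by
  simp only [F3_apply, map_sum, map_smul, mul_assoc, hD.mul_of_parity (h₁.parity _),
    hD.mul_of_parity (h₂.parity _), sum_add_distrib, smul_sum, smul_add, mul_add,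
    mul_smul_comm, smul_comm (k _ _ _), smul_smul, compLeft_apply, Function.comp_apply]
  abel

lemma Q4_der [h₁ : Homog X ε₁] [h₂ : Homog Y ε₂] [h₃ : Homog Z ε₃] :
    D (Q4 n X Y Z W) = Q4 n (D.compLeft ι X) Y Z W +
    bsign ε ε₁ • Q4 n X (D.compLeft ι Y) Z W +
    (bsign ε ε₁ * bsign ε ε₂) • Q4 n X Y (D.compLeft ι Z) W +
    (bsign ε ε₁ * bsign ε ε₂ * bsign ε ε₃) • Q4 n X Y Z (D.compLeft ι W) := by
  simp only [Q4_apply, map_sum, map_smul, mul_assoc, hD.mul_of_parity (h₁.parity _),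
    hD.mul_of_parity (h₂.parity _), hD.mul_of_parity (h₃.parity _), sum_add_distrib,
    smul_sum, smul_add, mul_add, mul_smul_comm, smul_comm (n _ _ _ _), smul_smul,
    compLeft_apply, Function.comp_apply]
  abel

end Derivation

section Swap

variable {R : Type*} [Ring R] [Algebra ℂ R] {π : Wick ι τ →ₐ[ℂ] R} (hπ : Graded π)
  {ε ε' : Bool} (k : ι → ι → ι → ℂ) (n : ι → ι → ι → ι → ℂ) (X Y Z W : ι → Wick ι τ)
include hπ

lemma Graded.dot_swap [h₁ : Homog X ε] [h₂ : Homog Y ε'] :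
    π (dot X Y) = bsign ε ε' • π (dot Y X) := by
  simp only [dot_apply, map_sum, smul_sum, hπ.comm (h₁.parity _) (h₂.parity _)]

lemma Graded.F3_swap₁ [h₁ : Homog X ε] [h₂ : Homog Y ε'] :
    π (F3 k X Y Z) = bsign ε ε' • π (F3 (fun b a c => k a b c) Y X Z) := by
  simp only [F3_apply, map_sum, map_smul, smul_sum, map_mul π (_ * _),
    hπ.comm (h₁.parity _) (h₂.parity _), smul_mul_assoc, smul_comm (k _ _ _)]
  exact sum_comm

lemma Graded.F3_swap₂ [h₁ : Homog Y ε] [h₂ : Homog Z ε'] :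
    π (F3 k X Y Z) = bsign ε ε' • π (F3 (fun a c b => k a b c) X Z Y) := by
  simp only [F3_apply, map_sum, map_smul, smul_sum, mul_assoc, map_mul π (X _) (_ * _),
    hπ.comm (h₁.parity _) (h₂.parity _), mul_smul_comm, smul_comm (k _ _ _)]
  exact sum_congr rfl fun a _ => sum_comm

lemma Graded.Q4_swap₁ [h₁ : Homog X ε] [h₂ : Homog Y ε'] :
    π (Q4 n X Y Z W) = bsign ε ε' • π (Q4 (fun b a c d => n a b c d) Y X Z W) := by
  simp only [Q4_apply, map_sum, map_smul, smul_sum, mul_assoc _ (Z _) (W _),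
    map_mul π (X _ * Y _), map_mul π (Y _ * X _),
    hπ.comm (h₁.parity _) (h₂.parity _), smul_mul_assoc, smul_comm (n _ _ _ _)]
  exact sum_comm

lemma Graded.Q4_swap₂ [h₁ : Homog Y ε] [h₂ : Homog Z ε'] :
    π (Q4 n X Y Z W) = bsign ε ε' • π (Q4 (fun a c b d => n a b c d) X Z Y W) := by
  simp only [Q4_apply, map_sum, map_smul, smul_sum, map_mul π _ (W _),
    mul_assoc (X _) (Y _) (Z _), mul_assoc (X _) (Z _) (Y _), map_mul π (X _) (_ * _),
    hπ.comm (h₁.parity _) (h₂.parity _), mul_smul_comm, smul_mul_assoc, smul_comm (n _ _ _ _)]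
  exact sum_congr rfl fun a _ => sum_comm

lemma Graded.Q4_swap₃ [h₁ : Homog Z ε] [h₂ : Homog W ε'] :
    π (Q4 n X Y Z W) = bsign ε ε' • π (Q4 (fun a b d c => n a b c d) X Y W Z) := by
  simp only [Q4_apply, map_sum, map_smul, smul_sum, mul_assoc (_ * _) (Z _) (W _),
    mul_assoc (_ * _) (W _) (Z _), map_mul π (_ * _) (_ * _),
    hπ.comm (h₁.parity _) (h₂.parity _), mul_smul_comm, smul_comm (n _ _ _ _)]
  exact sum_congr rfl fun a _ => sum_congr rfl fun b _ => sum_comm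

variable {k n} {l : ι → ι → ι → ℂ} {n' : ι → ι → ι → ι → ℂ}

lemma Graded.F3_congr₁ [Homog X ε]
    (h : ∀ a b c, k a b c + bsign ε ε * k b a c = l a b c + bsign ε ε * l b a c) :
    π (F3 k X X Z) = π (F3 l X X Z) := by
  have e : ∀ k, π (F3 k X X Z) =
      (1 / 2 : ℂ) • π (F3 (fun a b c => k a b c + bsign ε ε * k b a c) X X Z) := by
    intro k
    rw [← F3_add, ← F3_smul, map_add, map_smul, ← hπ.F3_swap₁]; module
  rw [e k, e l]; simp only [h]

lemma Graded.F3_congr₂ [Homog Y ε]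
    (h : ∀ a b c, k a b c + bsign ε ε * k a c b = l a b c + bsign ε ε * l a c b) :
    π (F3 k X Y Y) = π (F3 l X Y Y) := by
  have e : ∀ k, π (F3 k X Y Y) =
      (1 / 2 : ℂ) • π (F3 (fun a b c => k a b c + bsign ε ε * k a c b) X Y Y) := by
    intro k
    rw [← F3_add, ← F3_smul, map_add, map_smul, ← hπ.F3_swap₂]; module
  rw [e k, e l]; simp only [h]

lemma Graded.Q4_congr₂ [Homog Y ε]
    (h : ∀ a b c d, n a b c d + bsign ε ε * n a c b d = n' a b c d + bsign ε ε * n' a c b d) :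
    π (Q4 n X Y Y W) = π (Q4 n' X Y Y W) := by
  have e : ∀ k, π (Q4 k X Y Y W) =
      (1 / 2 : ℂ) • π (Q4 (fun a b c d => k a b c d + bsign ε ε * k a c b d) X Y Y W) := by
    intro k
    rw [← Q4_add, ← Q4_smul, map_add, map_smul, ← hπ.Q4_swap₂]; module
  rw [e n, e n']; simp only [h]

lemma Graded.Q4_congr₃ [Homog Z ε]
    (h : ∀ a b c d, n a b c d + bsign ε ε * n a b d c = n' a b c d + bsign ε ε * n' a b d c) :
    π (Q4 n X Y Z Z) = π (Q4 n' X Y Z Z) := by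
  have e : ∀ k, π (Q4 k X Y Z Z) =
      (1 / 2 : ℂ) • π (Q4 (fun a b c d => k a b c d + bsign ε ε * k a b d c) X Y Z Z) := by
    intro k
    rw [← Q4_add, ← Q4_smul, map_add, map_smul, ← hπ.Q4_swap₃]; module
  rw [e n, e n']; simp only [h]

lemma Graded.Q4_congr_cyc [Homog X ε]
    (h : ∀ a b c d, n a b c d + n b c a d + n c a b d = n' a b c d + n' b c a d + n' c a b d) :
    π (Q4 n X X X W) = π (Q4 n' X X X W) := by
  have e : ∀ k, π (Q4 k X X X W) = (1 / 3 : ℂ) •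
      π (Q4 (fun a b c d => k a b c d + k b c a d + k c a b d) X X X W) := by
    intro k
    have e1 : π (Q4 k X X X W) = π (Q4 (fun a b c d => k b c a d) X X X W) := by
      rw [hπ.Q4_swap₂, hπ.Q4_swap₁, smul_smul, bsign_mul_self, one_smul]
    have e2 : π (Q4 k X X X W) = π (Q4 (fun a b c d => k c a b d) X X X W) := by
      rw [hπ.Q4_swap₁, hπ.Q4_swap₂, smul_smul, bsign_mul_self, one_smul]
    rw [← Q4_add, ← Q4_add, map_add, map_add, ← e1, ← e2]; module
  rw [e n, e n']; simp only [h]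

end Swap

end Multilinear

end YangMills

namespace YangMills

lemma η_mul_self (μ : Fin 4) : η μ * η μ = 1 := by unfold η; split_ifs <;> simp

lemma η_eq (μ : Fin 4) : η μ = 1 ∨ η μ = -1 := by unfold η; split_ifs <;> simp

lemma wickD_comm {ι τ : Type*} (μ ν : Fin 4) (p : Wick ι τ) :
    wickD μ (wickD ν p) = wickD ν (wickD μ p) := by
  refine derExt_comm _ _ _ (fun x => by simp) (fun x => ?_) p
  simp [Jet.shift, add_right_comm]

lemma wickPartials_add_single {ι τ : Type*} (α : Fin 4 → ℕ) (μ : Fin 4) (p : Wick ι τ) :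
    wickPartials (α + Pi.single μ 1) p = wickD μ (wickPartials α p) := by
  have := prod_pow_add_single (D := fun i => (wickD i : Module.End ℂ (Wick ι τ)))
    (fun i j => LinearMap.ext fun T => wickD_comm i j T) (rfl : _ = α + Pi.single μ 1)
  exact DFunLike.congr_fun this p

section Families

variable {ι τ : Type*}

lemma derExt_jetDer_wickD {d : BasicField ι τ → Wick ι τ} (μ : Fin 4) (p : Wick ι τ) :
    derExt paritySign (jetDer d) (wickD μ p) = wickD μ (derExt paritySign (jetDer d) p) := by
  refine derExt_comm _ _ _ (fun x => by simp [paritySign, Jet.shift]) (fun x => ?_) p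
  rw [derExt_ι]
  exact wickPartials_add_single _ _ _

lemma derExt_jetDer_fieldWick (d : BasicField ι τ → Wick ι τ) (φ : BasicField ι τ) :
    derExt paritySign (jetDer d) (fieldWick φ) = d φ := by
  simp [fieldWick, jetDer, wickPartials]

variable (M : YangMills ι τ)

/-- The components of the vector fields. -/
def A (μ : Fin 4) (a : ι) : Wick ι τ := M.v a μ

/-- The masses as complex numbers. -/
def mc (a : ι) : ℂ := M.m a

lemma homog_of_plets {X : ι → Wick ι τ} {ε : Bool} (h : ∀ a, X a ∈ plets ε) : Homog X ε :=
  ⟨fun a => hasParity_of_mem_plets (h a)⟩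

instance (μ : Fin 4) : Homog (M.A μ) false := homog_of_plets fun a => M.v_mem a μ
instance : Homog M.divv false := homog_of_plets M.divv_mem
instance : Homog M.u true := homog_of_plets M.u_mem
instance : Homog M.uBar true := homog_of_plets M.uBar_mem
instance : Homog M.Φ false := homog_of_plets M.Φ_mem

section Currents

variable [Fintype τ]

/-- The components of the vector currents. -/
def jV (μ : Fin 4) (a : ι) : Wick ι τ := M.jVec a μ

lemma bilin_parity (x : Matrix τ τ ℂ) (G : Matrix (Fin 4) (Fin 4) ℂ) :
    HasParity false (bilin x G : Wick ι τ) :=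
  .sum fun A _ => .sum fun B _ => .sum fun r _ => .sum fun q _ =>
    ((HasParity.letter (⟨.psiBar A r, 0⟩ : Jet ι τ)).mul
      (HasParity.letter (⟨.psi B q, 0⟩ : Jet ι τ))).smul _

instance (μ : Fin 4) : Homog (M.jV μ) false :=
  ⟨fun a => by unfold jV jVec; exact .sum fun _ _ => bilin_parity _ _⟩
instance : Homog M.jScal false := ⟨fun _ => .sum fun _ _ => bilin_parity _ _⟩

end Currents

/-- The common properties of `d_Q` (for `w = u`) and `d_Q^anti` (for `w = ũ`). -/
structure IsGaugeDer [Fintype τ] (D : Wick ι τ →ₗ[ℂ] Wick ι τ) (w : ι → Wick ι τ) : Prop where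
  der : IsDer true D
  comm : ∀ μ (X : ι → Wick ι τ), D.compLeft ι (dF μ X) = dF μ (D.compLeft ι X)
  A : ∀ μ, D.compLeft ι (M.A μ) = (I * η μ) • dF μ w
  Φ : D.compLeft ι M.Φ = I • sc M.mc w
  gh : D.compLeft ι w = 0
  divv : D.compLeft ι M.divv = ∑ μ, (I * η μ) • dF μ (dF μ w)
  jV : ∀ μ, D.compLeft ι (M.jV μ) = 0
  jS : D.compLeft ι M.jScal = 0

lemma m_eq_zero_of_massless {a : ι} (h : M.kind a = .massless) : (M.m a : ℂ) = 0 := by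
  rw [M.m_zero a (by rw [h]; decide)]; simp

lemma derExt_bilin [Fintype τ] {d : BasicField ι τ → Wick ι τ} (h : ∀ A r, d (.psi A r) = 0)
    (h' : ∀ A r, d (.psiBar A r) = 0) (x : Matrix τ τ ℂ) (G : Matrix (Fin 4) (Fin 4) ℂ) :
    derExt paritySign (jetDer d) (bilin x G) = 0 := by
  simp [bilin, derExt_mul, derExt_jetDer_fieldWick, h, h']

lemma isGaugeDer_jetDer [Fintype τ] {d : BasicField ι τ → Wick ι τ} {w : ι → Wick ι τ}
    (hv : ∀ a μ, d (.vec a μ) = (I * η μ) • wickD μ (w a))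
    (hΦ : ∀ a, d (.scal a) = I • (M.m a : ℂ) • w a)
    (hdiv : ∀ a, d (.divVec a) = ∑ μ, (I * η μ) • wickD μ (wickD μ (w a)))
    (hψ : ∀ A r, d (.psi A r) = 0) (hψ' : ∀ A r, d (.psiBar A r) = 0)
    (hw : ∀ a, M.kind a = .higgs → w a = 0) (gh : ∀ a, derExt paritySign (jetDer d) (w a) = 0) :
    M.IsGaugeDer (derExt paritySign (jetDer d)) w where
  der := isDer_derExt_paritySign _
  comm μ X := funext fun a => derExt_jetDer_wickD μ (X a)
  A μ := by
    ext1 a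
    change derExt paritySign (jetDer d) (M.v a μ) = _
    unfold v; split_ifs with h
    · simp [hw a h]
    · rw [derExt_jetDer_fieldWick, hv]; rfl
  Φ := by
    ext1 a
    change derExt paritySign (jetDer d) (M.Φ a) = _
    unfold Φ; split_ifs with h
    · simp [sc_apply, mc, M.m_eq_zero_of_massless h]
    · rw [derExt_jetDer_fieldWick, hΦ]; rfl
  gh := funext gh
  divv := by
    ext1 a
    change derExt paritySign (jetDer d) (M.divv a) = _
    unfold divv; split_ifs with h
    · simp [hw a h]
    · rw [derExt_jetDer_fieldWick, hdiv]; simp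
  jV μ := by
    ext1 a
    change derExt paritySign (jetDer d) (M.jVec a μ) = _
    simp [jVec, derExt_bilin hψ hψ']
  jS := by
    ext1 a
    change derExt paritySign (jetDer d) (M.jScal a) = _
    simp [jScal, derExt_bilin hψ hψ']

lemma brst_isGaugeDer [Fintype τ] :
    M.IsGaugeDer (derExt paritySign (jetDer M.brstField)) M.u :=
  M.isGaugeDer_jetDer (fun _ _ => rfl) (fun _ => mul_smul _ _ _) (fun a => by simp [brstField])
    (fun _ _ => rfl) (fun _ _ => rfl) (fun a h => by simp [u, h])
    fun a => by
      unfold u; split_ifs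
      exacts [map_zero _, derExt_jetDer_fieldWick _ _]

lemma antiBrst_isGaugeDer [Fintype τ] :
    M.IsGaugeDer (derExt paritySign (jetDer M.antiBrstField)) M.uBar :=
  M.isGaugeDer_jetDer (fun _ _ => rfl) (fun _ => mul_smul _ _ _) (fun a => by simp [antiBrstField])
    (fun _ _ => rfl) (fun _ _ => rfl) (fun a h => by simp [uBar, h])
    fun a => by
      unfold uBar; split_ifs
      exacts [map_zero _, derExt_jetDer_fieldWick _ _]

lemma brst_uBar : (derExt paritySign (jetDer M.brstField)).compLeft ι M.uBar =
    (-I) • (M.divv + sc M.mc M.Φ) := by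
  ext1 a
  change derExt paritySign (jetDer M.brstField) (M.uBar a) = _
  unfold uBar; split_ifs with h
  · simp [sc_apply, mc, M.m_eq_zero_of_higgs h, divv, h]
  · rw [derExt_jetDer_fieldWick]; rfl

lemma antiBrst_u : (derExt paritySign (jetDer M.antiBrstField)).compLeft ι M.u =
    I • (M.divv + sc M.mc M.Φ) := by
  ext1 a
  change derExt paritySign (jetDer M.antiBrstField) (M.u a) = _
  unfold u; split_ifs with h
  · simp [sc_apply, mc, M.m_eq_zero_of_higgs h, divv, h]
  · rw [derExt_jetDer_fieldWick]; rfl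

end Families

section NormalForms

variable {ι τ : Type*} [Fintype ι] (M : YangMills ι τ)

/-- The coefficients `m_b f'_{abc}`. -/
def fpm (a b c : ι) : ℂ := M.f' a b c * M.mc b

/-- The coefficients `m_c f_{abc}`. -/
def fm (a b c : ι) : ℂ := M.f a b c * M.mc c

/-- The Yang-Mills vertex. -/
def lagrYM : Wick ι τ := ∑ μ, ∑ ν, η μ • F3 M.f (M.A μ) (M.A ν) (dF ν (M.A μ))

/-- The ghost vertices. -/
def lagrGh : Wick ι τ := ∑ μ, F3 M.f M.u (M.A μ) (dF μ M.uBar) + F3 M.fpm M.Φ M.uBar M.u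

/-- The scalar vertices. -/
def lagrSc : Wick ι τ :=
  ∑ μ, (F3 M.f' M.Φ (dF μ M.Φ) (M.A μ) - η μ • F3 M.fpm M.Φ (M.A μ) (M.A μ)) +
    (1 / 6 : ℂ) • F3 M.f'' M.Φ M.Φ M.Φ

/-- The Dirac vertices. -/
def lagrDi [Fintype τ] : Wick ι τ := ∑ μ, η μ • dot (M.jV μ) (M.A μ) + dot M.jScal M.Φ

/-- The part of `T^μ` with `v, F`. -/
def lagr1YM (w : ι → Wick ι τ) (μ : Fin 4) : Wick ι τ :=
  ∑ ν, (F3 M.f w (M.A ν) (dF ν (M.A μ)) - (η μ * η ν) • F3 M.f w (M.A ν) (dF μ (M.A ν)))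

/-- The part of `T^μ` with `Φ`. -/
def lagr1Sc (w : ι → Wick ι τ) (μ : Fin 4) : Wick ι τ :=
  η μ • F3 M.f' M.Φ (dF μ M.Φ) w - F3 M.fpm M.Φ (M.A μ) w

/-- `T^{μν}` in normal form. -/
def lagr2N (w : ι → Wick ι τ) (μ ν : Fin 4) : Wick ι τ :=
  (1 / 2 : ℂ) • (η μ • F3 M.f w w (dF μ (M.A ν)) - η ν • F3 M.f w w (dF ν (M.A μ)))

/-- The ghost part of `T^μ`. -/
def lagr1Gh (μ : Fin 4) : Wick ι τ := (-(1 / 2) * η μ) • F3 M.f M.u M.u (dF μ M.uBar)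

/-- The ghost part of `T_anti^μ`. -/
def lagrAnti1Gh (μ : Fin 4) : Wick ι τ :=
  F3 M.f M.uBar M.divv (M.A μ) - η μ • F3 M.f M.u M.uBar (dF μ M.uBar) +
    (1 / 2 * η μ) • F3 M.f (dF μ M.u) M.uBar M.uBar - F3 M.fm M.uBar (M.A μ) M.Φ

variable [Fintype τ]

lemma sum_F3 {κ : Type*} [Fintype κ] (k : ι → ι → ι → ℂ) (X Y Z : κ → ι → Wick ι τ) :
    ∑ μ, F3 k (X μ) (Y μ) (Z μ) = ∑ a, ∑ b, ∑ c, k a b c • ∑ μ, X μ a * Y μ b * Z μ c := by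
  simp only [F3_apply, smul_sum]
  rw [sum_comm]
  refine sum_congr rfl fun a _ => ?_
  rw [sum_comm]
  refine sum_congr rfl fun b _ => sum_comm

lemma lagr_expand : M.lagr =
    (1 / 2 : ℂ) • ∑ μ, ∑ ν, F3 M.f (η μ • M.A μ) (η ν • M.A ν)
      (η ν • dF ν (M.A μ) - η μ • dF μ (M.A ν)) + ∑ μ, F3 M.f M.u (M.A μ) (dF μ M.uBar) +
    (∑ μ, F3 M.f' M.Φ (dF μ M.Φ) (M.A μ) - ∑ μ, F3 M.fpm M.Φ (M.A μ) (η μ • M.A μ) +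
      F3 M.fpm M.Φ M.uBar M.u) + (1 / 6 : ℂ) • F3 M.f'' M.Φ M.Φ M.Φ +
    ∑ μ, dot (M.jV μ) (η μ • M.A μ) + dot M.jScal M.Φ := by
  unfold lagr
  have h2 : ∑ μ, dot (M.jV μ) (η μ • M.A μ) = ∑ a, ∑ μ, M.jVec a μ * M.vLow a μ :=
    sum_comm
  rw [h2, dot_apply]
  congr 1
  congr 1
  congr 1
  · congr 1
    · have h := sum_F3 (κ := Fin 4 × Fin 4) M.f (fun x => η x.1 • M.A x.1)
        (fun x => η x.2 • M.A x.2) (fun x => η x.2 • dF x.2 (M.A x.1) - η x.1 • dF x.1 (M.A x.2))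
      rw [Fintype.sum_prod_type] at h
      rw [h, sum_F3, smul_sum, ← sum_add_distrib]
      refine sum_congr rfl fun a _ => ?_
      rw [smul_sum, ← sum_add_distrib]
      refine sum_congr rfl fun b _ => ?_
      rw [smul_sum, ← sum_add_distrib]
      refine sum_congr rfl fun c _ => ?_
      rw [smul_add, smul_comm, Fintype.sum_prod_type]
      rfl
    · rw [sum_F3, sum_F3, F3_apply, ← sum_sub_distrib, ← sum_add_distrib]
      refine sum_congr rfl fun a _ => ?_
      rw [← sum_sub_distrib, ← sum_add_distrib]
      refine sum_congr rfl fun b _ => ?_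
      rw [← sum_sub_distrib, ← sum_add_distrib]
      refine sum_congr rfl fun c _ => ?_
      rw [smul_add, smul_sub, smul_smul, smul_smul]
      rfl
  · rw [F3_apply]

lemma lagr1_expand (μ : Fin 4) : M.lagr1 μ =
    ∑ ν, F3 M.f M.u (η ν • M.A ν) (η ν • dF ν (M.A μ) - η μ • dF μ (M.A ν)) -
      (1 / 2 : ℂ) • F3 M.f M.u M.u (η μ • dF μ M.uBar) +
    (F3 M.f' M.Φ (η μ • dF μ M.Φ) M.u - F3 M.fpm M.Φ (M.A μ) M.u) + dot (M.jV μ) M.u := by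
  unfold lagr1
  rw [dot_apply]
  congr 1
  congr 1
  · rw [sum_F3, F3_apply]
    simp only [smul_sum, ← sum_sub_distrib]
    refine sum_congr rfl fun a _ => sum_congr rfl fun b _ =>
      sum_congr rfl fun c _ => ?_
    rw [smul_sub, smul_comm, smul_sum]
    rfl
  · rw [F3_apply, F3_apply]
    simp only [← sum_sub_distrib]
    refine sum_congr rfl fun a _ => sum_congr rfl fun b _ =>
      sum_congr rfl fun c _ => ?_
    rw [smul_sub, smul_smul]
    rfl

lemma lagrAnti1_expand (μ : Fin 4) : M.lagrAnti1 μ =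
    (∑ ν, F3 M.f M.uBar (η ν • M.A ν) (η ν • dF ν (M.A μ) - η μ • dF μ (M.A ν)) +
      F3 M.f M.uBar M.divv (M.A μ) - F3 M.f M.u M.uBar (η μ • dF μ M.uBar) +
      (1 / 2 : ℂ) • F3 M.f (η μ • dF μ M.u) M.uBar M.uBar - F3 M.fm M.uBar (M.A μ) M.Φ) +
    (F3 M.f' M.Φ (η μ • dF μ M.Φ) M.uBar - F3 M.fpm M.Φ (M.A μ) M.uBar) +
      dot (M.jV μ) M.uBar := by
  unfold lagrAnti1
  rw [dot_apply]
  congr 1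
  congr 1
  · rw [sum_F3, F3_apply, F3_apply, F3_apply, F3_apply]
    simp only [smul_sum, ← sum_sub_distrib, ← sum_add_distrib]
    refine sum_congr rfl fun a _ => sum_congr rfl fun b _ =>
      sum_congr rfl fun c _ => ?_
    rw [smul_sub, smul_add, smul_sub, smul_add, smul_comm (M.f a b c) (1 / 2 : ℂ), smul_sum,
      smul_smul (M.f a b c) (M.m c : ℂ)]
    rfl
  · rw [F3_apply, F3_apply]
    simp only [← sum_sub_distrib]
    refine sum_congr rfl fun a _ => sum_congr rfl fun b _ =>
      sum_congr rfl fun c _ => ?_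
    rw [smul_sub, smul_smul]
    rfl

lemma lagr2_eq (μ ν : Fin 4) : M.lagr2 μ ν = M.lagr2N M.u μ ν := by
  have : M.lagr2 μ ν = (1 / 2 : ℂ) • F3 M.f M.u M.u
      (η μ • dF μ (M.A ν) - η ν • dF ν (M.A μ)) := by rw [F3_apply]; rfl
  rw [this, lagr2N, map_sub, map_smul, map_smul]

lemma lagrAnti2_eq (μ ν : Fin 4) : M.lagrAnti2 μ ν = M.lagr2N M.uBar μ ν := by
  have : M.lagrAnti2 μ ν = (1 / 2 : ℂ) • F3 M.f M.uBar M.uBar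
      (η μ • dF μ (M.A ν) - η ν • dF ν (M.A μ)) := by rw [F3_apply]; rfl
  rw [this, lagr2N, map_sub, map_smul, map_smul]

lemma lagr1_eq (μ : Fin 4) : M.lagr1 μ =
    M.lagr1YM M.u μ + M.lagr1Gh μ + M.lagr1Sc M.u μ + dot (M.jV μ) M.u := by
  rw [lagr1_expand, lagr1YM, lagr1Gh, lagr1Sc]
  congr 1
  congr 1
  · rw [sub_eq_add_neg]
    congr 1
    · refine sum_congr rfl fun ν _ => ?_
      rcases η_eq μ with h | h <;> rcases η_eq ν with h' | h' <;>
        simp only [h, h', map_smul, map_sub, smul_apply] <;> module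
    · rw [map_smul]; module
  · simp only [map_smul, smul_apply]

lemma lagrAnti1_eq (μ : Fin 4) : M.lagrAnti1 μ =
    M.lagr1YM M.uBar μ + M.lagrAnti1Gh μ + M.lagr1Sc M.uBar μ + dot (M.jV μ) M.uBar := by
  rw [lagrAnti1_expand, lagr1YM, lagrAnti1Gh, lagr1Sc]
  have : ∑ ν, F3 M.f M.uBar (η ν • M.A ν) (η ν • dF ν (M.A μ) - η μ • dF μ (M.A ν)) =
      ∑ ν, (F3 M.f M.uBar (M.A ν) (dF ν (M.A μ)) -
        (η μ * η ν) • F3 M.f M.uBar (M.A ν) (dF μ (M.A ν))) := by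
    refine sum_congr rfl fun ν _ => ?_
    rcases η_eq μ with h | h <;> rcases η_eq ν with h' | h' <;>
      simp only [h, h', map_smul, map_sub, smul_apply] <;> module
  rw [this]
  simp only [map_smul, smul_apply]
  module

lemma F3_neg (k : ι → ι → ι → ℂ) (X Y Z : ι → Wick ι τ) :
    F3 (fun a b c => -k a b c) X Y Z = -F3 k X Y Z := by simp [F3_apply]

section

variable {R : Type*} [Ring R] [Algebra ℂ R] {π : Wick ι τ →ₐ[ℂ] R} (hπ : Graded π)
  (hlin : M.LinearRelations) {ε ε' : Bool} (X Y Z : ι → Wick ι τ)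
include hπ hlin

lemma f_swap₁ [Homog X ε] [Homog Y ε'] :
    π (F3 M.f X Y Z) = -(bsign ε ε' • π (F3 M.f Y X Z)) := by
  have : (fun b a c => M.f a b c) = fun b a c => -M.f b a c := by
    funext b a c; exact hlin.f_antisymm₁ _ _ _
  rw [hπ.F3_swap₁, this, F3_neg, map_neg, smul_neg]

lemma f_swap₂ [Homog Y ε] [Homog Z ε'] :
    π (F3 M.f X Y Z) = -(bsign ε ε' • π (F3 M.f X Z Y)) := by
  have : (fun a c b => M.f a b c) = fun a c b => -M.f a c b := by
    funext a c b; exact hlin.f_antisymm₂ _ _ _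
  rw [hπ.F3_swap₂, this, F3_neg, map_neg, smul_neg]

end

lemma lagr_eq {R : Type*} [Ring R] [Algebra ℂ R] {π : Wick ι τ →ₐ[ℂ] R} (hπ : Graded π)
    (hlin : M.LinearRelations) :
    π M.lagr = π (M.lagrYM + M.lagrGh + M.lagrSc + M.lagrDi) := by
  have hA : ∀ μ ν, π (F3 M.f (M.A μ) (M.A ν) (dF μ (M.A ν))) =
      -π (F3 M.f (M.A ν) (M.A μ) (dF μ (M.A ν))) := by
    intro μ ν
    rw [M.f_swap₁ hπ hlin]
    simp
  have h1 : π ((1 / 2 : ℂ) • ∑ μ, ∑ ν, F3 M.f (η μ • M.A μ) (η ν • M.A ν)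
      (η ν • dF ν (M.A μ) - η μ • dF μ (M.A ν))) = π M.lagrYM := by
    have e : ∀ μ ν, π (F3 M.f (η μ • M.A μ) (η ν • M.A ν)
        (η ν • dF ν (M.A μ) - η μ • dF μ (M.A ν))) =
        π (η μ • F3 M.f (M.A μ) (M.A ν) (dF ν (M.A μ))) +
          π (η ν • F3 M.f (M.A ν) (M.A μ) (dF μ (M.A ν))) := by
      intro μ ν
      simp only [map_smul, map_sub, smul_apply, hA]
      rcases η_eq μ with h | h <;> rcases η_eq ν with h' | h' <;> simp only [h, h'] <;> module
    rw [lagrYM]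
    rw [map_smul, map_sum, map_sum]
    simp_rw [map_sum, e, map_smul, sum_add_distrib]
    rw [sum_comm (f := fun μ ν => η ν • π (F3 M.f (M.A ν) (M.A μ) (dF μ (M.A ν))))]
    module
  rw [lagr_expand, lagrGh, lagrSc, lagrDi]
  simp only [map_add, h1]
  simp only [map_add, map_sub, map_sum, map_smul, sum_sub_distrib]
  abel

end NormalForms

end YangMills

namespace YangMills

section Divergence

variable {ι τ : Type*} (M : YangMills ι τ)

lemma dF_comm (μ ν : Fin 4) (X : ι → Wick ι τ) : dF μ (dF ν X) = dF ν (dF μ X) :=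
  funext fun a => wickD_comm μ ν (X a)

lemma compLeft_sc (D : Wick ι τ →ₗ[ℂ] Wick ι τ) (m : ι → ℂ) (X : ι → Wick ι τ) :
    D.compLeft ι (sc m X) = sc m (D.compLeft ι X) :=
  funext fun a => D.map_smul (m a) (X a)

/-- The d'Alembertian of a family. -/
def box (X : ι → Wick ι τ) : ι → Wick ι τ := ∑ ν, η ν • dF ν (dF ν X)

/-- `∂_ρ v^ρ`. -/
def divA : ι → Wick ι τ := ∑ ρ, dF ρ (M.A ρ)

variable [Fintype ι] [Fintype τ] {M} {R : Type*} [Ring R] [Algebra ℂ R] {π : Wick ι τ →ₐ[ℂ] R}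
  (hπ : Graded π) (hlin : M.LinearRelations) {D : Wick ι τ →ₗ[ℂ] Wick ι τ} {w : ι → Wick ι τ}
  [Homog w true] (hD : M.IsGaugeDer D w)
include hπ hlin hD

lemma div_lagr1YM (μ : Fin 4) :
    π (D (M.lagr1YM w μ)) - I • ∑ ν, π (wickD ν (M.lagr2N w μ ν)) =
      (I / 2) • π (F3 M.f w w (box (M.A μ))) -
        (I / 2 * η μ) • π (F3 M.f w w (dF μ M.divA)) := by
  have t : ∀ ν, π (D (F3 M.f w (M.A ν) (dF ν (M.A μ)) -
      (η μ * η ν) • F3 M.f w (M.A ν) (dF μ (M.A ν)))) -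
      I • π (wickD ν (M.lagr2N w μ ν)) =
      (I / 2) • (η ν • π (F3 M.f w w (dF ν (dF ν (M.A μ))))) -
        (I / 2 * η μ) • π (F3 M.f w w (dF μ (dF ν (M.A ν)))) := by
    intro ν
    simp only [lagr2N, map_sub, map_smul, F3_der hD.der, F3_der (isDer_wickD ν), hD.comm, hD.A,
      hD.gh, map_zero, zero_apply, smul_apply, map_add, bsign_vals, dF_comm μ ν]
    rw [M.f_swap₁ hπ hlin (dF ν w) w (dF μ (M.A ν)), M.f_swap₁ hπ hlin (dF ν w) w (dF ν (M.A μ))]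
    rcases η_eq μ with h | h <;> rcases η_eq ν with h' | h' <;>
      simp only [h, h', bsign_vals] <;> module
  simp only [lagr1YM, box, divA, map_sum, map_smul, smul_sum, ← sum_sub_distrib]
  exact sum_congr rfl fun ν _ => by simpa only [map_sub, map_smul] using t ν

omit hD in
lemma f'_skew_mass (Z : ι → Wick ι τ) {ε : Bool} [Homog Z ε] :
    π (F3 (fun a b c => M.mc a * M.f' a b c) w Z w) =
      -(bsign true ε * (1 / 2)) • π (F3 M.fm w w Z) := by
  rw [hπ.F3_swap₂, hπ.F3_congr₁ (l := fun a b c => -(1 / 2) * M.fm a b c) w Z, ← F3_smul, map_smul,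
    smul_smul, bsign_comm]
  · congr 1; ring
  · intro a b c
    have := hlin.f_f' a b c
    have h1 := hlin.f'_antisymm c a b
    have h2 := hlin.f'_antisymm c b a
    have h3 := hlin.f_antisymm₁ a b c
    simp only [fm, mc, h3, bsign_vals]
    linear_combination this + M.m a * h1 - M.m b * h2

omit hD in
lemma f'_skew_mass_sq (Z : ι → Wick ι τ) {ε : Bool} [Homog Z ε] :
    π (F3 (fun a b c => M.mc a * M.fpm a b c) w Z w) =
      -(bsign true ε * (1 / 2)) • π (F3 (fun a b c => M.mc c * M.fm a b c) w w Z) := by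
  have h1 : F3 (fun a b c => M.mc a * M.fpm a b c) w Z w =
      F3 (fun a b c => M.mc a * M.f' a b c) w (sc M.mc Z) w := by
    rw [F3_sc_mid]; congr; funext a b c; rw [fpm]; ring
  rw [h1, M.f'_skew_mass hπ hlin, F3_sc_right]

lemma div_lagr1Sc (μ : Fin 4) :
    π (D (M.lagr1Sc w μ)) =
      (I / 2) • π (F3 (fun a b c => M.mc c * M.fm a b c) w w (M.A μ)) -
        (I / 2 * η μ) • π (F3 M.fm w w (dF μ M.Φ)) := by
  have h1 : (fun a b c => M.mc b * M.f' a b c) = M.fpm := by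
    funext a b c; rw [fpm, mul_comm]
  simp only [lagr1Sc, map_sub, map_smul, F3_der hD.der, hD.comm, hD.A, hD.Φ, hD.gh, map_zero,
    smul_apply, map_add, bsign_vals, compLeft_sc, F3_sc_left, F3_sc_mid, h1,
    M.f'_skew_mass hπ hlin, M.f'_skew_mass_sq hπ hlin]
  rcases η_eq μ with h | h <;> simp only [h] <;> module

lemma div_lagrYM :
    π (D M.lagrYM) - I • ∑ μ, π (wickD μ (M.lagr1YM w μ)) =
      I • ∑ ν, η ν • π (F3 M.f w (M.A ν) (box (M.A ν))) -
        I • ∑ ν, π (F3 M.f w (M.A ν) (dF ν M.divA)) := by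
  have t : ∀ μ ν, π (D (η μ • F3 M.f (M.A μ) (M.A ν) (dF ν (M.A μ)))) - I •
      π (wickD μ (F3 M.f w (M.A ν) (dF ν (M.A μ)) -
        (η μ * η ν) • F3 M.f w (M.A ν) (dF μ (M.A ν)))) =
      I • (η ν • η μ • π (F3 M.f w (M.A ν) (dF μ (dF μ (M.A ν)))) -
        π (F3 M.f w (M.A ν) (dF ν (dF μ (M.A μ))))) +
      (((I * η μ * η ν) • π (F3 M.f (dF μ w) (M.A ν) (dF μ (M.A ν))) +
        (I / 2) • π (F3 M.f (M.A μ) (M.A ν) (dF ν (dF μ w))) -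
        (I / 2) • π (F3 M.f w (dF μ (M.A ν)) (dF ν (M.A μ)))) -
       ((I * η ν * η μ) • π (F3 M.f (dF ν w) (M.A μ) (dF ν (M.A μ))) +
        (I / 2) • π (F3 M.f (M.A ν) (M.A μ) (dF μ (dF ν w))) -
        (I / 2) • π (F3 M.f w (dF ν (M.A μ)) (dF μ (M.A ν))))) := by
    intro μ ν
    have h0 := M.f_swap₂ hπ hlin w (dF μ (M.A ν)) (dF μ (M.A ν))
    have h0' : π (F3 M.f w (dF μ (M.A ν)) (dF μ (M.A ν))) = 0 := by
      rw [bsign_false_left, one_smul] at h0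
      linear_combination (norm := module) (1 / 2 : ℂ) • h0
    simp only [map_sub, map_smul, F3_der hD.der, F3_der (isDer_wickD μ), hD.comm, hD.A, smul_apply,
      map_add, bsign_vals, dF_comm μ ν, h0']
    rw [M.f_swap₁ hπ hlin (M.A μ) (dF ν w), M.f_swap₁ hπ hlin (M.A ν) (M.A μ),
      M.f_swap₂ hπ hlin w (dF ν (M.A μ))]
    rcases η_eq μ with h | h <;> rcases η_eq ν with h' | h' <;>
      simp only [h, h', bsign_vals] <;> module
  have s : ∀ x : Fin 4 → Fin 4 → R, ∑ μ, ∑ ν, (x μ ν - x ν μ) = 0 := by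
    intro x
    simp only [sum_sub_distrib]
    rw [sum_comm (f := fun μ ν => x ν μ), sub_self]
  calc _ = ∑ μ, ∑ ν, (π (D (η μ • F3 M.f (M.A μ) (M.A ν) (dF ν (M.A μ)))) - I •
      π (wickD μ (F3 M.f w (M.A ν) (dF ν (M.A μ)) -
        (η μ * η ν) • F3 M.f w (M.A ν) (dF μ (M.A ν))))) := by
        rw [lagrYM]
        simp only [lagr1YM, map_sum, smul_sum, ← sum_sub_distrib]
    _ = _ := by
        simp only [t, sum_add_distrib, s]
        rw [sum_comm]
        simp only [box, divA, map_sum, map_smul, smul_sum, smul_sub, sum_sub_distrib,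
          add_zero]

lemma div_lagrSc :
    π (D M.lagrSc) - I • ∑ μ, π (wickD μ (M.lagr1Sc w μ)) =
      I • ∑ μ, η μ • π (F3 (fun a b c => M.mc c * M.fm a b c) w (M.A μ) (M.A μ)) -
      I • ∑ μ, π (F3 M.fm w (M.A μ) (dF μ M.Φ)) +
      I • π (F3 M.fpm M.Φ M.divA w) -
      I • π (F3 M.f' M.Φ (box M.Φ + sc (fun a => (M.higgsMass a : ℂ) ^ 2) M.Φ) w) := by
  have h1 : (fun a b c => M.mc b * M.f' a b c) = M.fpm := by
    funext a b c; rw [fpm, mul_comm]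
  have h3 : ∀ X : ι → Wick ι τ, [Homog X false] → π (F3 M.f' X X w) = 0 := by
    intro X _
    rw [hπ.F3_congr₁ (l := fun _ _ _ => 0) X w, F3_zero, map_zero]
    intro a b c
    rw [hlin.f'_antisymm b a c]; simp
  have h4 : ∀ μ, π (F3 (fun a b c => M.mc a * M.f' a b c) w (dF μ M.Φ) (M.A μ)) +
      π (F3 M.fpm (dF μ M.Φ) (M.A μ) w) = -π (F3 M.fm w (M.A μ) (dF μ M.Φ)) := by
    intro μ
    rw [hπ.F3_swap₂, hπ.F3_swap₁ M.fpm, hπ.F3_swap₂ _ _ _ w, hπ.F3_swap₁ _ _ w]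
    simp only [bsign_vals, one_smul]
    rw [← map_add, F3_add, ← map_neg, ← F3_neg]
    congr 2; congr 1; congr 1; congr 1
    funext a b c
    have := hlin.f_f' a b c
    have h1 := hlin.f'_antisymm c a b
    simp only [fm, fpm, mc]
    linear_combination this + M.m a * h1
  have h5 : ∀ μ, π (F3 (fun a b c => M.mc a * M.fpm a b c) w (M.A μ) (M.A μ)) =
      -π (F3 (fun a b c => M.mc c * M.fm a b c) w (M.A μ) (M.A μ)) := by
    intro μ
    rw [← map_neg, ← F3_neg]
    refine hπ.F3_congr₂ _ _ fun a b c => ?_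
    have e1 := hlin.f_f' a b c
    have e2 := hlin.f_f' a c b
    have e3 := hlin.f'_antisymm c a b
    have e4 := hlin.f'_antisymm b a c
    have e5 := hlin.f'_antisymm b c a
    simp only [fm, fpm, mc, bsign_vals, one_mul]
    linear_combination M.m c * e1 + M.m b * e2 + M.m a * M.m c * e3 + M.m a * M.m b * e4 -
      M.m b * M.m c * e5
  have h6 : π (D ((1 / 6 : ℂ) • F3 M.f'' M.Φ M.Φ M.Φ)) = -(I •
      π (F3 M.f' M.Φ (sc (fun a => (M.higgsMass a : ℂ) ^ 2) M.Φ) w)) := by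
    have k1 : (fun b a c => M.f'' a b c) = M.f'' := by
      funext b a c; exact hlin.f''_symm₁ b a c
    have k2 : (fun a c b => M.f'' a b c) = M.f'' := by
      funext a c b; exact hlin.f''_symm₂ a c b
    have e1 : π (F3 M.f'' (sc M.mc w) M.Φ M.Φ) = π (F3 M.f'' M.Φ (sc M.mc w) M.Φ) := by
      rw [hπ.F3_swap₁, k1, bsign_false_right, one_smul]
    have e2 : π (F3 M.f'' M.Φ (sc M.mc w) M.Φ) = π (F3 M.f'' M.Φ M.Φ (sc M.mc w)) := by
      rw [hπ.F3_swap₂, k2, bsign_false_right, one_smul]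
    have e3 : π (F3 M.f'' M.Φ M.Φ (sc M.mc w)) =
        -(2 : ℂ) • π (F3 M.f' M.Φ (sc (fun a => (M.higgsMass a : ℂ) ^ 2) M.Φ) w) := by
      rw [F3_sc_right, F3_sc_mid, ← map_smul, F3_smul]
      refine hπ.F3_congr₁ _ _ fun a b c => ?_
      have i1 := hlin.f'_f'' a b c
      have i2 := hlin.f''_symm₁ a b c
      have i3 := hlin.f'_antisymm a b c
      simp only [bsign_vals, mc]
      linear_combination 2 * i1 + (M.m c : ℂ) * i2 + 2 * (M.higgsMass a : ℂ) ^ 2 * i3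
    simp only [map_smul, F3_der hD.der, hD.Φ, smul_apply, map_add, bsign_vals, e1, e2, e3]
    module
  have t : ∀ μ, π (D (F3 M.f' M.Φ (dF μ M.Φ) (M.A μ) - η μ • F3 M.fpm M.Φ (M.A μ) (M.A μ))) -
      I • π (wickD μ (M.lagr1Sc w μ)) =
      I • η μ • π (F3 (fun a b c => M.mc c * M.fm a b c) w (M.A μ) (M.A μ)) -
      I • π (F3 M.fm w (M.A μ) (dF μ M.Φ)) +
      I • π (F3 M.fpm M.Φ (dF μ (M.A μ)) w) -
      I • η μ • π (F3 M.f' M.Φ (dF μ (dF μ M.Φ)) w) := by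
    intro μ
    have h4 := h4 μ
    simp only [lagr1Sc, map_sub, map_smul, F3_der hD.der, F3_der (isDer_wickD μ), hD.comm, hD.A,
      hD.Φ, smul_apply, map_add, bsign_vals, compLeft_sc, F3_sc_left, F3_sc_mid, h1, h3, h5]
    rcases η_eq μ with h | h <;> simp only [h] <;>
      linear_combination (norm := module) I • h4
  have t' := sum_congr rfl fun μ (_ : μ ∈ Finset.univ) => t μ
  simp only [sum_sub_distrib, sum_add_distrib, ← smul_sum] at t'
  rw [lagrSc, map_add, map_add, h6]
  simp only [map_add, map_sum, map_smul, add_apply, box, divA,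
    sum_apply, smul_apply] at t' ⊢
  linear_combination (norm := module) t'

end Divergence

end YangMills

namespace YangMills

section GhostDivergence

variable {ι τ : Type*} (M : YangMills ι τ)

/-- `d_Q` on Wick polynomials. -/
abbrev brstD : Wick ι τ →ₗ[ℂ] Wick ι τ := derExt paritySign (jetDer M.brstField)

/-- `d_Q^anti` on Wick polynomials. -/
abbrev antiD : Wick ι τ →ₗ[ℂ] Wick ι τ := derExt paritySign (jetDer M.antiBrstField)

/-- The Klein-Gordon operator of the masses `m_a`. -/
def kg (X : ι → Wick ι τ) : ι → Wick ι τ := box X + sc M.mc (sc M.mc X)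

variable [Fintype ι]

lemma fm_eq (X Y Z : ι → Wick ι τ) : F3 M.fm X Y Z = F3 M.f X Y (sc M.mc Z) := by
  rw [F3_sc_right]; congr; funext a b c; rw [fm, mul_comm]

lemma fm_sq_eq (X Y Z : ι → Wick ι τ) :
    F3 (fun a b c => M.mc c * M.fm a b c) X Y Z = F3 M.f X Y (sc M.mc (sc M.mc Z)) := by
  rw [← F3_sc_right, fm_eq]

lemma fpm_eq (X Y Z : ι → Wick ι τ) : F3 M.fpm X Y Z = F3 M.f' X (sc M.mc Y) Z := by
  rw [F3_sc_mid]; congr; funext a b c; rw [fpm, mul_comm]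

lemma fpm_sq_eq (X Y Z : ι → Wick ι τ) :
    F3 (fun a b c => M.mc a * M.fpm a b c) X Y Z = F3 M.f' (sc M.mc X) (sc M.mc Y) Z := by
  rw [← F3_sc_left, fpm_eq]

variable [Fintype τ] {M} {R : Type*} [Ring R] [Algebra ℂ R] {π : Wick ι τ →ₐ[ℂ] R}
  (hπ : Graded π) (hlin : M.LinearRelations)
include hπ hlin

omit hπ hlin in
lemma brst_lagr1Gh (μ : Fin 4) : M.brstD (M.lagr1Gh μ) =
    (I / 2 * η μ) • (F3 M.f M.u M.u (dF μ M.divv) + F3 M.fm M.u M.u (dF μ M.Φ)) := by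
  have hD := M.brst_isGaugeDer
  simp only [lagr1Gh, map_smul, F3_der hD.der, hD.gh, hD.comm, M.brst_uBar, map_zero, map_add,
    zero_apply, bsign_vals, compLeft_sc, fm_eq]
  module

lemma antiBrst_lagrAnti1Gh (μ : Fin 4) : π (M.antiD (M.lagrAnti1Gh μ)) =
    (I / 2 * η μ) • π (F3 M.f M.uBar M.uBar (dF μ M.divv) +
      F3 M.fm M.uBar M.uBar (dF μ M.Φ)) +
    I • π (F3 M.f M.uBar (M.A μ) (M.kg M.uBar)) := by
  have hD := M.antiBrst_isGaugeDer
  have hd : M.antiD.compLeft ι M.divv = I • box M.uBar := by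
    rw [hD.divv, box, smul_sum]; simp only [smul_smul]
  have : Homog (box M.uBar) true := ⟨fun a => by
    simp only [box, Finset.sum_apply]
    exact .sum fun ν _ => (((inferInstance : Homog (dF ν (dF ν M.uBar)) true).parity a).smul _)⟩
  simp only [lagrAnti1Gh, map_smul, map_sub, F3_der hD.der, hD.gh, hD.comm, M.antiBrst_u, hD.A, hd,
    hD.Φ, map_zero, map_add, zero_apply, smul_apply, add_apply, bsign_vals, compLeft_sc, fm_eq, kg]
  rw [M.f_swap₂ hπ hlin _ (box M.uBar), M.f_swap₁ hπ hlin M.divv,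
    M.f_swap₁ hπ hlin (sc M.mc M.Φ), M.f_swap₂ hπ hlin _ (sc M.mc M.Φ),
    M.f_swap₁ hπ hlin (dF μ M.divv), M.f_swap₂ hπ hlin _ (dF μ M.divv),
    M.f_swap₁ hπ hlin (sc M.mc (dF μ M.Φ)), M.f_swap₂ hπ hlin _ (sc M.mc (dF μ M.Φ))]
  simp only [bsign_vals]
  module

lemma brst_lagrGh :
    π (M.brstD M.lagrGh) - I • ∑ μ, π (wickD μ (M.lagr1Gh μ)) =
      I • ∑ μ, π (F3 M.f M.u (M.A μ) (dF μ M.divv)) +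
      I • ∑ μ, π (F3 M.fm M.u (M.A μ) (dF μ M.Φ)) +
      (I / 2) • π (F3 M.f M.u M.u (M.kg M.uBar)) -
      I • π (F3 M.fpm M.Φ M.divv M.u) -
      I • π (F3 M.f' M.Φ (sc M.mc (sc M.mc M.Φ)) M.u) := by
  have hD := M.brst_isGaugeDer
  have t : ∀ μ, π (M.brstD (F3 M.f M.u (M.A μ) (dF μ M.uBar))) -
      I • π (wickD μ (M.lagr1Gh μ)) =
      I • π (F3 M.f M.u (M.A μ) (dF μ M.divv)) +
      I • π (F3 M.fm M.u (M.A μ) (dF μ M.Φ)) +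
      (I / 2) • η μ • π (F3 M.f M.u M.u (dF μ (dF μ M.uBar))) := by
    intro μ
    simp only [lagr1Gh, map_smul, F3_der hD.der, F3_der (isDer_wickD μ), hD.gh, hD.comm,
      M.brst_uBar, hD.A, map_zero, map_add, zero_apply, smul_apply, bsign_vals, compLeft_sc, fm_eq]
    rw [M.f_swap₁ hπ hlin (dF μ M.u)]
    simp only [bsign_vals]
    module
  have t' := sum_congr rfl fun μ (_ : μ ∈ Finset.univ) => t μ
  simp only [sum_sub_distrib, sum_add_distrib, ← smul_sum] at t'
  have h2 : π (M.brstD (F3 M.fpm M.Φ M.uBar M.u)) =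
      (I / 2) • π (F3 M.f M.u M.u (sc M.mc (sc M.mc M.uBar))) -
      I • π (F3 M.fpm M.Φ M.divv M.u) -
      I • π (F3 M.f' M.Φ (sc M.mc (sc M.mc M.Φ)) M.u) := by
    have := M.f'_skew_mass_sq hπ hlin (w := M.u) M.uBar
    rw [fpm_sq_eq, fm_sq_eq] at this
    simp only [fpm_eq, F3_der hD.der, hD.gh, compLeft_sc, M.brst_uBar, hD.Φ, map_zero, map_add,
      map_smul, smul_apply, add_apply, bsign_vals, this]
    module
  rw [lagrGh, map_add, map_add, h2]
  simp only [map_sum, map_add, map_smul, kg, box] at t' ⊢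
  linear_combination (norm := module) t'

lemma antiBrst_lagrGh :
    π (M.antiD M.lagrGh) - I • ∑ μ, π (wickD μ (M.lagrAnti1Gh μ)) =
      I • ∑ μ, π (F3 M.f M.uBar (M.A μ) (dF μ M.divv)) +
      I • ∑ μ, π (F3 M.fm M.uBar (M.A μ) (dF μ M.Φ)) +
      I • π (F3 M.f M.u M.uBar (M.kg M.uBar)) -
      (I / 2) • π (F3 M.f M.uBar M.uBar (M.kg M.u)) -
      I • π (F3 M.f M.uBar M.divv M.divA) +
      I • π (F3 M.fm M.uBar M.divA M.Φ) -
      I • π (F3 M.fpm M.Φ M.uBar M.divv) -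
      I • π (F3 M.f' M.Φ (sc M.mc (sc M.mc M.Φ)) M.uBar) := by
  have hD := M.antiBrst_isGaugeDer
  have t : ∀ μ, π (M.antiD (F3 M.f M.u (M.A μ) (dF μ M.uBar))) -
      I • π (wickD μ (M.lagrAnti1Gh μ)) =
      I • π (F3 M.f M.uBar (M.A μ) (dF μ M.divv)) +
      I • π (F3 M.fm M.uBar (M.A μ) (dF μ M.Φ)) +
      I • η μ • π (F3 M.f M.u M.uBar (dF μ (dF μ M.uBar))) -
      (I / 2) • η μ • π (F3 M.f M.uBar M.uBar (dF μ (dF μ M.u))) -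
      I • π (F3 M.f M.uBar M.divv (dF μ (M.A μ))) +
      I • π (F3 M.fm M.uBar (dF μ (M.A μ)) M.Φ) := by
    intro μ
    simp only [lagrAnti1Gh, map_smul, map_sub, F3_der hD.der, F3_der (isDer_wickD μ), hD.gh,
      hD.comm, M.antiBrst_u, hD.A, map_zero, map_add, smul_apply, add_apply, bsign_vals,
      compLeft_sc, fm_eq]
    rw [M.f_swap₁ hπ hlin M.divv, M.f_swap₂ hπ hlin (M.A μ) M.divv,
      M.f_swap₁ hπ hlin (M.A μ) (dF μ M.uBar), M.f_swap₂ hπ hlin (dF μ M.uBar) (M.A μ),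
      M.f_swap₁ hπ hlin (sc M.mc M.Φ), M.f_swap₂ hπ hlin (M.A μ) (sc M.mc M.Φ),
      M.f_swap₁ hπ hlin (M.A μ) (dF μ M.uBar), M.f_swap₂ hπ hlin (dF μ M.uBar) (M.A μ),
      M.f_swap₂ hπ hlin M.uBar (dF μ M.divv), M.f_swap₂ hπ hlin (dF μ M.u) (dF μ M.uBar),
      M.f_swap₁ hπ hlin (dF μ (dF μ M.u)), M.f_swap₂ hπ hlin M.uBar (dF μ (dF μ M.u))]
    simp only [bsign_vals]
    module
  have t' := sum_congr rfl fun μ (_ : μ ∈ Finset.univ) => t μ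
  simp only [sum_sub_distrib, sum_add_distrib, ← smul_sum] at t'
  have h2 : π (M.antiD (F3 M.fpm M.Φ M.uBar M.u)) =
      I • π (F3 M.f M.u M.uBar (sc M.mc (sc M.mc M.uBar))) -
      (I / 2) • π (F3 M.f M.uBar M.uBar (sc M.mc (sc M.mc M.u))) -
      I • π (F3 M.fpm M.Φ M.uBar M.divv) -
      I • π (F3 M.f' M.Φ (sc M.mc (sc M.mc M.Φ)) M.uBar) := by
    have e1 : π (F3 M.f M.u M.uBar (sc M.mc (sc M.mc M.uBar))) -
        (1 / 2 : ℂ) • π (F3 M.f M.uBar M.uBar (sc M.mc (sc M.mc M.u))) =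
        π (F3 M.f' (sc M.mc M.uBar) (sc M.mc M.uBar) M.u) := by
      rw [M.f_swap₁ hπ hlin M.u, M.f_swap₂ hπ hlin M.uBar M.u, F3_sc_mid, F3_sc_mid, F3_sc_right,
        F3_sc_right, F3_sc_left, F3_sc_mid]
      simp only [bsign_vals, neg_smul, one_smul, neg_neg]
      rw [← map_smul, ← map_sub, F3_smul, sub_eq_add_neg, ← F3_neg, F3_add]
      refine hπ.F3_congr₁ _ _ fun a b c => ?_
      have i1 := hlin.f_f' a b c
      have i2 := hlin.f_f' c a b
      have i3 := hlin.f_f' b c a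
      have j1 := hlin.f_antisymm₁ a b c
      have j2 := hlin.f_antisymm₁ a c b
      have j3 := hlin.f_antisymm₂ a b c
      have j5 := hlin.f_antisymm₂ b a c
      have k2 := hlin.f'_antisymm b c a
      have k3 := hlin.f'_antisymm c a b
      simp only [bsign_vals, mc]
      linear_combination -M.m c * i1 + M.m b * i2 - M.m b ^ 2 * (j2 - j3) + M.m a * i3 -
        M.m a ^ 2 * (j5 - j1) - ((M.m a : ℂ) ^ 2 - M.m c ^ 2 / 2) * j1 - M.m a * M.m c * k3 +
        M.m b * M.m c * k2
    have e2 : π (F3 M.f' M.Φ (sc M.mc M.uBar) (sc M.mc M.Φ)) =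
        π (F3 M.f' M.Φ (sc M.mc (sc M.mc M.Φ)) M.uBar) := by
      rw [hπ.F3_swap₂ M.f', bsign_false_right, one_smul, F3_sc_right, F3_sc_mid, F3_sc_mid,
        F3_sc_mid]
      refine hπ.F3_congr₁ _ _ fun a c b => ?_
      have i1 := hlin.f_f' b c a
      have i2 := hlin.f_f' a b c
      have j1 := hlin.f_antisymm₁ b a c
      have j2 := hlin.f_antisymm₂ b a c
      simp only [bsign_vals, mc]
      linear_combination -M.m c * i1 + M.m a * i2 + M.m a * M.m c * (j2 - j1)
    simp only [F3_der hD.der, hD.gh, compLeft_sc, M.antiBrst_u, hD.Φ, map_zero, map_add, map_smul,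
      smul_apply, bsign_vals, zero_apply, fpm_eq]
    linear_combination (norm := module) (-I) • e1 - I • e2
  rw [lagrGh, map_add, map_add, h2]
  simp only [map_sum, map_add, map_smul, kg, box, divA, sum_apply] at t' ⊢
  linear_combination (norm := module) t'

end GhostDivergence

end YangMills

namespace YangMills

section Spinors

open Kronecker

variable {ι τ : Type*} {α : Type*} [Fintype α]

/-- The action of a matrix on a column of Wick polynomials. -/
def mv (L : Matrix α α ℂ) : (α → Wick ι τ) →ₗ[ℂ] (α → Wick ι τ) where
  toFun Q i := ∑ j, L i j • Q j
  map_add' _ _ := by ext1; simp [sum_add_distrib]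
  map_smul' _ _ := by ext1; simp [smul_sum, smul_comm (L _ _)]

/-- The action of a matrix on a row of Wick polynomials. -/
def vm (L : Matrix α α ℂ) : (α → Wick ι τ) →ₗ[ℂ] (α → Wick ι τ) where
  toFun P j := ∑ i, L i j • P i
  map_add' _ _ := by ext1; simp [sum_add_distrib]
  map_smul' _ _ := by ext1; simp [smul_sum, smul_comm (L _ _)]

lemma mv_apply (L : Matrix α α ℂ) (Q : α → Wick ι τ) (i : α) : mv L Q i = ∑ j, L i j • Q j := rfl

lemma vm_apply (L : Matrix α α ℂ) (P : α → Wick ι τ) (j : α) : vm L P j = ∑ i, L i j • P i := rfl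

/-- `∑ k_{ij} P_i Q_j` for a matrix `k`. -/
def mdot (k : Matrix α α ℂ) : (α → Wick ι τ) →ₗ[ℂ] (α → Wick ι τ) →ₗ[ℂ] Wick ι τ :=
  wdot fun i j => k i j

lemma mdot_apply (k : Matrix α α ℂ) (P Q : α → Wick ι τ) :
    mdot k P Q = ∑ i, ∑ j, k i j • (P i * Q j) := rfl

lemma mdot_mv (k L : Matrix α α ℂ) (P Q : α → Wick ι τ) :
    mdot k P (mv L Q) = mdot (k * L) P Q := by
  simp only [mdot_apply, mv_apply, Matrix.mul_apply, mul_sum, smul_sum,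
    sum_smul, mul_smul_comm, smul_smul]
  exact sum_congr rfl fun i _ => sum_comm

lemma mdot_vm (k L : Matrix α α ℂ) (P Q : α → Wick ι τ) :
    mdot k (vm L P) Q = mdot (L * k) P Q := by
  simp only [mdot_apply, vm_apply, Matrix.mul_apply, sum_mul, smul_sum,
    sum_smul, smul_mul_assoc, smul_smul, mul_comm (k _ _)]
  rw [sum_congr rfl fun i _ => sum_comm, sum_comm]
  refine sum_congr rfl fun i _ => sum_comm

lemma mdot_add (k l : Matrix α α ℂ) (P Q : α → Wick ι τ) :
    mdot (k + l) P Q = mdot k P Q + mdot l P Q := by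
  simp [mdot_apply, add_smul, sum_add_distrib]

lemma mdot_smul (c : ℂ) (k : Matrix α α ℂ) (P Q : α → Wick ι τ) :
    mdot (c • k) P Q = c • mdot k P Q := by
  simp [mdot_apply, smul_sum, smul_smul]

lemma mdot_sub (k l : Matrix α α ℂ) (P Q : α → Wick ι τ) :
    mdot (k - l) P Q = mdot k P Q - mdot l P Q := by
  rw [sub_eq_add_neg, mdot_add, ← neg_one_smul ℂ l, mdot_smul]; module

lemma mdot_sum {κ : Type*} (s : Finset κ) (k : κ → Matrix α α ℂ) (P Q : α → Wick ι τ) :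
    mdot (∑ e ∈ s, k e) P Q = ∑ e ∈ s, mdot (k e) P Q := by
  classical
  induction s using Finset.induction_on with
  | empty => simp [mdot_apply]
  | insert i s hi ih => rw [sum_insert hi, sum_insert hi, ← ih, mdot_add]

lemma mdot_der {ε ε' : Bool} {D : Wick ι τ →ₗ[ℂ] Wick ι τ} (hD : IsDer ε D) (k : Matrix α α ℂ)
    {P : α → Wick ι τ} (hP : ∀ i, HasParity ε' (P i)) (Q : α → Wick ι τ) :
    D (mdot k P Q) = mdot k (D.compLeft α P) Q + bsign ε ε' • mdot k P (D.compLeft α Q) := by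
  simp only [mdot_apply, map_sum, map_smul, hD.mul_of_parity (hP _), sum_add_distrib,
    smul_sum, smul_add, smul_comm (bsign _ _)]
  rfl

/-- The components of `ψ`. -/
def psiF (i : τ × Fin 4) : Wick ι τ := fieldWick (.psi i.1 i.2)

/-- The components of `ψ̄`. -/
def psiBarF (i : τ × Fin 4) : Wick ι τ := fieldWick (.psiBar i.1 i.2)

lemma psiF_parity (i : τ × Fin 4) : HasParity true (psiF i : Wick ι τ) := HasParity.letter _

lemma psiBarF_parity (i : τ × Fin 4) : HasParity true (psiBarF i : Wick ι τ) := HasParity.letter _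

variable (M : YangMills ι τ)

lemma γ_anticomm {μ ν : Fin 4} (h : μ ≠ ν) : M.γ μ * M.γ ν = -(M.γ ν * M.γ μ) := by
  have := M.clifford μ ν
  rw [if_neg h, zero_smul] at this
  exact eq_neg_of_add_eq_zero_left this

lemma γ_mul_self (μ : Fin 4) : M.γ μ * M.γ μ = η μ • 1 := by
  have := M.clifford μ μ
  rw [if_pos rfl, mul_smul] at this
  linear_combination (norm := module) (1 / 2 : ℂ) • this

lemma γ_anticomm_left {μ ν : Fin 4} (h : μ ≠ ν) (X : Matrix (Fin 4) (Fin 4) ℂ) :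
    M.γ μ * (M.γ ν * X) = -(M.γ ν * (M.γ μ * X)) := by
  rw [← mul_assoc, M.γ_anticomm h, neg_mul, mul_assoc]

lemma γ_mul_self_left (μ : Fin 4) (X : Matrix (Fin 4) (Fin 4) ℂ) :
    M.γ μ * (M.γ μ * X) = η μ • X := by
  rw [← mul_assoc, γ_mul_self, smul_mul_assoc, one_mul]

lemma γ5_mul_self : M.γ5 * M.γ5 = 1 := by
  have h := fun μ ν (h : ν < μ) X => M.γ_anticomm_left h.ne' X
  rw [γ5, smul_mul_smul_comm, I_mul_I]
  simp only [Matrix.mul_assoc, h 1 0 (by decide), h 2 0 (by decide), h 3 0 (by decide),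
    h 2 1 (by decide), h 3 1 (by decide), h 3 2 (by decide),
    mul_neg, M.γ_mul_self, mul_smul_comm, mul_one]
  simp [η]

lemma γ_mul_γ5 (μ : Fin 4) : M.γ μ * M.γ5 = -(M.γ5 * M.γ μ) := by
  have h := fun μ ν (h : ν < μ) X => M.γ_anticomm_left h.ne' X
  have k := fun ν (h : ν < 3) => M.γ_anticomm h.ne'
  fin_cases μ <;>
    simp [γ5, Matrix.mul_assoc, h 1 0, h 2 0, h 3 0, h 2 1, h 3 1, h 3 2, k 0, k 1, k 2,
      M.γ_mul_self_left, M.γ_mul_self, η]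

lemma γε_mul_self (ε : Bool) : M.γε ε * M.γε ε = M.γε ε := by
  cases ε <;> simp only [γε, mul_add, add_mul, mul_one, one_mul,
    mul_smul_comm, smul_mul_assoc, M.γ5_mul_self, if_true, Bool.false_eq_true, if_false] <;> module

lemma γε_mul_not (ε : Bool) : M.γε ε * M.γε (!ε) = 0 := by
  cases ε <;> simp only [γε, mul_add, add_mul, mul_one, one_mul,
    mul_smul_comm, smul_mul_assoc, M.γ5_mul_self, if_true, Bool.false_eq_true, if_false,
    Bool.not_true, Bool.not_false] <;> module

lemma γ_mul_γε (μ : Fin 4) (ε : Bool) : M.γ μ * M.γε ε = M.γε (!ε) * M.γ μ := by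
  cases ε <;> simp only [γε, mul_add, add_mul, mul_one, one_mul, mul_smul_comm, smul_mul_assoc,
    M.γ_mul_γ5, if_true, Bool.false_eq_true, if_false, Bool.not_true, Bool.not_false] <;> module

variable [Fintype τ] [DecidableEq τ]

/-- `Γ_a = ∑ t_a^ε ⊗ γ_ε`. -/
def Γ (a : ι) : Matrix (τ × Fin 4) (τ × Fin 4) ℂ := ∑ ε, M.t a ε ⊗ₖ M.γε ε

/-- `∑ t_a^ε ⊗ γ_{-ε}`. -/
def ΓBar (a : ι) : Matrix (τ × Fin 4) (τ × Fin 4) ℂ := ∑ ε, M.t a ε ⊗ₖ M.γε (!ε)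

/-- `∑ s_a^ε ⊗ γ_ε`. -/
def sK (a : ι) : Matrix (τ × Fin 4) (τ × Fin 4) ℂ := ∑ ε, M.s a ε ⊗ₖ M.γε ε

/-- `1 ⊗ γ^μ`. -/
def γK (μ : Fin 4) : Matrix (τ × Fin 4) (τ × Fin 4) ℂ := 1 ⊗ₖ M.γ μ

/-- The mass matrix of the Dirac fields. -/
def massK : Matrix (τ × Fin 4) (τ × Fin 4) ℂ := Matrix.diagonal (fun A => (M.mF A : ℂ)) ⊗ₖ 1

lemma γK_mul_Γ (μ : Fin 4) (a : ι) : M.γK μ * M.Γ a = M.ΓBar a * M.γK μ := by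
  simp only [γK, Γ, ΓBar, mul_sum, sum_mul, ← Matrix.mul_kronecker_mul, one_mul,
    mul_one, γ_mul_γε]

lemma massK_current (h : M.CurrentRelation) (a : ι) :
    (M.m a : ℂ) • M.sK a = I • (M.massK * M.Γ a - M.ΓBar a * M.massK) := by
  have e : M.ΓBar a = ∑ ε, M.t a (!ε) ⊗ₖ M.γε ε := by
    simp [ΓBar, add_comm]
  rw [e]
  simp only [sK, massK, Γ, mul_sum, sum_mul, ← Matrix.mul_kronecker_mul, one_mul,
    mul_one, ← sum_sub_distrib, smul_sum, ← Matrix.smul_kronecker, h a]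
  refine sum_congr rfl fun ε _ => ?_
  ext i j; simp [Matrix.kroneckerMap_apply, sub_mul, mul_assoc]

variable [Fintype ι]

lemma kronecker_lincomb {x y : Matrix τ τ ℂ} {k : ι → ℂ} {z : ι → Matrix τ τ ℂ}
    (h : x - y = ∑ c, k c • z c) (G : Matrix (Fin 4) (Fin 4) ℂ) :
    x ⊗ₖ G - y ⊗ₖ G = ∑ c, k c • z c ⊗ₖ G := by
  ext i j
  have := congrFun (congrFun h i.1) j.1
  simp only [Matrix.sub_apply, Matrix.sum_apply, Matrix.smul_apply, smul_eq_mul,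
    Matrix.kroneckerMap_apply] at this ⊢
  rw [← sub_mul, this, sum_mul]
  exact sum_congr rfl fun c _ => by ring

lemma Γ_commutator (h : M.BilinearRelations) (a b : ι) :
    M.Γ a * M.Γ b - M.Γ b * M.Γ a = ∑ c, (I * M.f a b c) • M.Γ c := by
  have e : ∀ a b, M.Γ a * M.Γ b = ∑ ε, (M.t a ε * M.t b ε) ⊗ₖ M.γε ε := by
    intro a b
    have h1 := M.γε_mul_not true
    have h2 := M.γε_mul_not false
    simp only [Bool.not_true, Bool.not_false] at h1 h2
    simp [Γ, mul_add, add_mul, ← Matrix.mul_kronecker_mul, γε_mul_self, h1, h2]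
  rw [e, e, ← sum_sub_distrib]
  simp only [Γ, smul_sum]
  rw [sum_comm]
  refine sum_congr rfl fun ε _ => ?_
  exact kronecker_lincomb (h.reps_fermi a b ε) _

lemma sK_tensor (h : M.BilinearRelations) (a b : ι) :
    M.ΓBar a * M.sK b - M.sK b * M.Γ a = ∑ c, (I * M.f' b c a) • M.sK c := by
  have h1 := M.γε_mul_not true
  have h2 := M.γε_mul_not false
  simp only [Bool.not_true, Bool.not_false] at h1 h2
  have e : M.ΓBar a * M.sK b = ∑ ε, (M.t a (!ε) * M.s b ε) ⊗ₖ M.γε ε := by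
    simp [ΓBar, sK, mul_add, add_mul, ← Matrix.mul_kronecker_mul, γε_mul_self, h1, h2, add_comm]
  have e' : M.sK b * M.Γ a = ∑ ε, (M.s b ε * M.t a ε) ⊗ₖ M.γε ε := by
    simp [Γ, sK, mul_add, add_mul, ← Matrix.mul_kronecker_mul, γε_mul_self, h1, h2]
  rw [e, e', ← sum_sub_distrib]
  simp only [sK, smul_sum]
  rw [sum_comm]
  refine sum_congr rfl fun ε _ => ?_
  exact kronecker_lincomb (h.tensor a b ε) _

lemma bilin_eq (x : Matrix τ τ ℂ) (G : Matrix (Fin 4) (Fin 4) ℂ) :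
    (bilin x G : Wick ι τ) = mdot (x ⊗ₖ G) psiBarF psiF := by
  simp only [bilin, mdot_apply, Fintype.sum_prod_type, Matrix.kroneckerMap_apply]
  refine sum_congr rfl fun A _ => ?_
  rw [sum_comm]
  rfl

lemma jV_eq (μ : Fin 4) (a : ι) : M.jV μ a = mdot (M.γK μ * M.Γ a) psiBarF psiF := by
  have : M.γK μ * M.Γ a = ∑ ε, M.t a ε ⊗ₖ (M.γ μ * M.γε ε) := by
    simp only [γK, Γ, mul_sum, ← Matrix.mul_kronecker_mul, one_mul]
  rw [this, mdot_sum]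
  simp only [jV, jVec, bilin_eq]

lemma jScal_eq (a : ι) : M.jScal a = mdot (M.sK a) psiBarF psiF := by
  rw [sK, mdot_sum]
  simp only [jScal, bilin_eq]

/-- The Dirac equations. -/
def ePsiF (i : τ × Fin 4) : Wick ι τ := M.ePsi i.1 i.2

/-- The adjoint Dirac equations. -/
def ePsiBarF (i : τ × Fin 4) : Wick ι τ := M.ePsiBar i.1 i.2

lemma ePsiF_eq : M.ePsiF =
    I • ∑ μ, mv (M.γK μ) ((wickD μ).compLeft _ psiF) - mv M.massK (psiF (ι := ι)) := by
  ext1 ⟨A, r⟩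
  have h1 : ∀ μ, mv (M.γK μ) ((wickD μ).compLeft _ psiF) (A, r) =
      ∑ q, M.γ μ r q • wickD μ (fieldWick (.psi A q) : Wick ι τ) := by
    intro μ
    simp only [mv_apply, Fintype.sum_prod_type, γK, Matrix.kroneckerMap_apply, Matrix.one_apply]
    rw [sum_eq_single A (fun B _ hB => by simp [Ne.symm hB]) (by simp)]
    simp [psiF]
  have h2 : mv M.massK psiF (A, r) = (M.mF A : ℂ) • (fieldWick (.psi A r) : Wick ι τ) := by
    simp only [mv_apply, Fintype.sum_prod_type, massK, Matrix.kroneckerMap_apply,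
      Matrix.diagonal_apply, Matrix.one_apply]
    rw [sum_eq_single A (fun B _ hB => by simp [Ne.symm hB]) (by simp)]
    simp [psiF]
  simp only [Pi.sub_apply, Pi.smul_apply, Finset.sum_apply, h1, h2, ePsiF, ePsi, smul_sum,
    smul_smul]

lemma ePsiBarF_eq : M.ePsiBarF = I • ∑ μ, vm (M.γK μ) ((wickD μ).compLeft _ psiBarF) +
    vm M.massK (psiBarF (ι := ι)) := by
  ext1 ⟨A, q⟩
  have h1 : ∀ μ, vm (M.γK μ) ((wickD μ).compLeft _ psiBarF) (A, q) =
      ∑ r, M.γ μ r q • wickD μ (fieldWick (.psiBar A r) : Wick ι τ) := by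
    intro μ
    simp only [vm_apply, Fintype.sum_prod_type, γK, Matrix.kroneckerMap_apply, Matrix.one_apply]
    rw [sum_eq_single A (fun B _ hB => by simp [hB]) (by simp)]
    simp [psiBarF]
  have h2 : vm M.massK psiBarF (A, q) = (M.mF A : ℂ) • (fieldWick (.psiBar A q) : Wick ι τ) := by
    simp only [vm_apply, Fintype.sum_prod_type, massK, Matrix.kroneckerMap_apply,
      Matrix.diagonal_apply, Matrix.one_apply]
    rw [sum_eq_single A (fun B _ hB => by simp [hB]) (by simp)]
    simp [psiBarF]
  simp only [Pi.add_apply, Pi.smul_apply, Finset.sum_apply, h1, h2, ePsiBarF, ePsiBar,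
    smul_sum, smul_smul]

/-- Conservation of the currents up to the Dirac equations. -/
lemma current_divergence (h : M.CurrentRelation) (a : ι) :
    I • ((M.m a : ℂ) • M.jScal a - ∑ μ, wickD μ (M.jV μ a)) =
      -(mdot (M.Γ a) M.ePsiBarF psiF + mdot (M.ΓBar a) psiBarF M.ePsiF) := by
  have h1 : ∀ μ, wickD μ (M.jV μ a) =
      mdot (M.Γ a) (vm (M.γK μ) ((wickD μ).compLeft _ psiBarF)) psiF +
      mdot (M.ΓBar a) psiBarF (mv (M.γK μ) ((wickD μ).compLeft _ psiF)) := by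
    intro μ
    rw [jV_eq, mdot_der (isDer_wickD μ) _ psiBarF_parity, mdot_vm, mdot_mv, bsign_false_left,
      one_smul, ← γK_mul_Γ]
  have h2 : (M.m a : ℂ) • M.jScal a = I • (mdot (M.Γ a) (vm M.massK psiBarF) psiF -
      mdot (M.ΓBar a) psiBarF (mv M.massK psiF)) := by
    rw [jScal_eq, ← mdot_smul, M.massK_current h, mdot_smul, mdot_sub, mdot_vm, mdot_mv]
  rw [h2, ePsiF_eq, ePsiBarF_eq]
  simp only [h1, map_add, map_sub, map_smul, map_sum, add_apply, smul_apply,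
    sum_apply, sum_add_distrib]
  have hI := I_mul_I
  rw [smul_sub, smul_smul, hI]
  module

end Spinors

end YangMills

namespace YangMills

section Variations

variable {ι τ : Type*} (M : YangMills ι τ)

/-- `∂_μ v^μ` minus the divergence of `v^μ`. -/
def eDivF : ι → Wick ι τ := M.divv - M.divA

/-- The Klein-Gordon operator on the scalar fields. -/
def kgΦ : ι → Wick ι τ := box M.Φ + sc (fun a => (M.scalMass a : ℂ) ^ 2) M.Φ

lemma homog_box {X : ι → Wick ι τ} {ε : Bool} [h : Homog X ε] : Homog (box X) ε := ⟨fun a => by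
  simp only [box, Finset.sum_apply]
  exact .sum fun ν _ => (((inferInstance : Homog (dF ν (dF ν X)) ε).parity a).smul _)⟩

lemma homog_add {X Y : ι → Wick ι τ} {ε : Bool} [h : Homog X ε] [h' : Homog Y ε] :
    Homog (X + Y) ε := ⟨fun a => (h.parity a).add (h'.parity a)⟩

instance : Homog M.kgΦ false :=
  have := homog_box (X := M.Φ)
  homog_add

instance : Homog M.divA false := ⟨fun a => by
  simp only [divA, Finset.sum_apply]
  exact .sum fun ν _ => (inferInstance : Homog (dF ν (M.A ν)) false).parity a⟩

lemma kg_A (a : ι) (ν : Fin 4) (h : M.kind a ≠ .higgs) : M.kg (M.A ν) a = M.eVec a ν := by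
  simp [kg, box, sc_apply, mc, A, v, h, eVec, wickKG, smul_smul, pow_two, -Complex.coe_smul]

lemma kg_u (a : ι) (h : M.kind a ≠ .higgs) : M.kg M.u a = M.eGhost a := by
  simp [kg, box, sc_apply, mc, u, h, eGhost, wickKG, smul_smul, pow_two, -Complex.coe_smul]

lemma kg_uBar (a : ι) (h : M.kind a ≠ .higgs) : M.kg M.uBar a = M.eAnti a := by
  simp [kg, box, sc_apply, mc, uBar, h, eAnti, wickKG, smul_smul, pow_two, -Complex.coe_smul]

lemma kgΦ_apply (a : ι) (h : M.kind a ≠ .massless) : M.kgΦ a = M.eScal a := by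
  simp [kgΦ, box, sc_apply, Φ, h, eScal, wickKG]

lemma eDivF_apply (a : ι) (h : M.kind a ≠ .higgs) : M.eDivF a = eDiv a := by
  simp [eDivF, divv, divA, A, v, h, eDiv]

lemma eDivF_higgs (a : ι) (h : M.kind a = .higgs) : M.eDivF a = 0 := by
  simp [eDivF, divv, divA, A, v, h]

variable [Fintype ι]

lemma br_f_higgs (hlin : M.LinearRelations) (X Y : ι → Wick ι τ) {c : ι}
    (h : M.kind c = .higgs) : br M.f X Y c = 0 := by
  refine sum_eq_zero fun a _ => sum_eq_zero fun b _ => ?_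
  rw [hlin.f_antisymm₂, hlin.f_antisymm₁, hlin.f_higgs _ _ _ h]; simp

/-- The variation `f'_{abc} Φ_a w_c` of `Φ_b`. -/
def varΦ (w : ι → Wick ι τ) : ι → Wick ι τ := br (fun a c b => M.f' a b c) M.Φ w

instance (w : ι → Wick ι τ) {ε : Bool} [Homog w ε] : Homog (M.varΦ w) ε := by
  have : Homog (br (fun a c b => M.f' a b c) M.Φ w) (xor false ε) := inferInstance
  rwa [Bool.false_xor] at this

lemma varΦ_massless (hlin : M.LinearRelations) (w : ι → Wick ι τ) {c : ι}
    (h : M.kind c = .massless) : M.varΦ w c = 0 := by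
  refine sum_eq_zero fun a _ => sum_eq_zero fun b _ => ?_
  beta_reduce; rw [hlin.f'_antisymm, hlin.f'_massless _ _ _ h]; simp

variable [DecidableEq ι] [DecidableEq τ] {M}

lemma isFieldVariation_dot {X E e : ι → Wick ι τ} {ε ε' : Bool} [hX : Homog X ε']
    {k : ι → BasicField ι τ → ℂ} (hG : ∀ a, M.IsGreen ε (e a) (k a))
    (h : ∀ a, E a = e a ∨ X a = 0) :
    M.IsFieldVariation (xor ε' ε) (dot X E) (∑ a, fun φ => k a φ • X a) := by
  refine IsFieldVariation.sum _ fun a _ => ?_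
  rcases h a with h | h
  · rw [h]; exact (hG a).isFieldVariation (hX.parity a)
  · have : (fun φ => k a φ • X a) = 0 := by funext φ; simp [h]
    rw [this, h, zero_mul]
    exact IsFieldVariation.zero

lemma isFieldVariation_kg_A {X : ι → Wick ι τ} {ε : Bool} [Homog X ε]
    (h : ∀ a, M.kind a = .higgs → X a = 0) (ν : Fin 4) :
    M.IsFieldVariation ε (dot X (M.kg (M.A ν)))
      (fun | .vec b μ => if μ = ν then -(I * η ν) • X b else 0 | _ => 0) := by
  have := isFieldVariation_dot (X := X) (E := M.kg (M.A ν)) (fun a => M.isGreen_eVec a ν)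
    fun a => by by_cases ha : M.kind a = .higgs; exacts [.inr (h a ha), .inl (M.kg_A a ν ha)]
  rw [Bool.xor_false] at this
  convert this using 1
  funext φ
  rw [Finset.sum_apply]
  cases φ with
  | vec b μ => by_cases hμ : μ = ν <;> simp [kVec, hμ]
  | _ => simp [kVec]

lemma isFieldVariation_kg_u {X : ι → Wick ι τ} {ε : Bool} [Homog X ε]
    (h : ∀ a, M.kind a = .higgs → X a = 0) : M.IsFieldVariation (!ε) (dot X (M.kg M.u))
      (fun | .anti b => I • X b | _ => 0) := by
  have := isFieldVariation_dot (X := X) (E := M.kg M.u) M.isGreen_eGhost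
    fun a => by by_cases ha : M.kind a = .higgs; exacts [.inr (h a ha), .inl (M.kg_u a ha)]
  rw [Bool.xor_true] at this
  convert this using 1
  funext φ
  rw [Finset.sum_apply]
  cases φ <;> simp [kGhost]

lemma isFieldVariation_kg_uBar {X : ι → Wick ι τ} {ε : Bool} [Homog X ε]
    (h : ∀ a, M.kind a = .higgs → X a = 0) : M.IsFieldVariation (!ε) (dot X (M.kg M.uBar))
      (fun | .ghost b => -I • X b | _ => 0) := by
  have := isFieldVariation_dot (X := X) (E := M.kg M.uBar) M.isGreen_eAnti
    fun a => by by_cases ha : M.kind a = .higgs; exacts [.inr (h a ha), .inl (M.kg_uBar a ha)]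
  rw [Bool.xor_true] at this
  convert this using 1
  funext φ
  rw [Finset.sum_apply]
  cases φ <;> simp [kAnti]

lemma isFieldVariation_kgΦ {X : ι → Wick ι τ} {ε : Bool} [Homog X ε]
    (h : ∀ a, M.kind a = .massless → X a = 0) : M.IsFieldVariation ε (dot X M.kgΦ)
      (fun | .scal b => I • X b | _ => 0) := by
  have := isFieldVariation_dot (X := X) (E := M.kgΦ) M.isGreen_eScal
    fun a => by by_cases ha : M.kind a = .massless; exacts [.inr (h a ha), .inl (M.kgΦ_apply a ha)]
  rw [Bool.xor_false] at this
  convert this using 1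
  funext φ
  rw [Finset.sum_apply]
  cases φ <;> simp [kScal]

lemma isFieldVariation_eDivF {X : ι → Wick ι τ} {ε : Bool} [hX : Homog X ε] :
    M.IsFieldVariation ε (dot X M.eDivF) 0 := by
  have : M.IsFieldVariation ε (dot X M.eDivF) (∑ _a : ι, 0) := by
    refine IsFieldVariation.sum _ fun a _ => ?_
    by_cases h : M.kind a = .higgs
    · rw [M.eDivF_higgs a h, mul_zero]; exact IsFieldVariation.zero
    · rw [M.eDivF_apply a h]; exact isFieldVariation_mul_eDiv (hX.parity a) a
  simpa using this

lemma isFieldVariation_dF_eDivF {X : ι → Wick ι τ} {ε : Bool} [hX : Homog X ε] (μ : Fin 4) :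
    M.IsFieldVariation ε (dot X (dF μ M.eDivF)) 0 := by
  have : M.IsFieldVariation ε (dot X (dF μ M.eDivF)) (∑ _a : ι, 0) := by
    refine IsFieldVariation.sum _ fun a _ => ?_
    rw [compLeft_apply, Function.comp_apply]
    by_cases h : M.kind a = .higgs
    · rw [M.eDivF_higgs a h, map_zero, mul_zero]; exact IsFieldVariation.zero
    · rw [M.eDivF_apply a h]; exact isFieldVariation_mul_wickD_eDiv (hX.parity a) μ a
  simpa using this

variable [Fintype τ]

lemma isFieldVariation_ePsi {P : τ × Fin 4 → Wick ι τ} {ε : Bool} (hP : ∀ i, HasParity ε (P i)) :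
    M.IsFieldVariation (!ε) (∑ i, P i * M.ePsiF i)
      (fun | .psiBar A r => -I • P (A, r) | _ => 0) := by
  have : M.IsFieldVariation (!ε) (∑ i, P i * M.ePsiF i)
      (∑ i, fun φ => kPsi i.1 i.2 φ • P i) := by
    rw [← Bool.xor_true]
    exact IsFieldVariation.sum _ fun i _ => (M.isGreen_ePsi i.1 i.2).isFieldVariation (hP i)
  convert this using 1
  funext φ
  rw [Finset.sum_apply]
  cases φ with
  | psiBar B q =>
    rw [sum_eq_single (B, q) (fun i _ hi => ?_) (by simp)]
    · simp [kPsi]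
    · have : ¬(B = i.1 ∧ q = i.2) := fun h => hi (Prod.ext h.1.symm h.2.symm)
      simp [kPsi, this]
  | _ => simp [kPsi]

lemma isFieldVariation_ePsiBar {P : τ × Fin 4 → Wick ι τ} {ε : Bool}
    (hP : ∀ i, HasParity ε (P i)) : M.IsFieldVariation (!ε) (∑ i, P i * M.ePsiBarF i)
      (fun | .psi A r => -I • P (A, r) | _ => 0) := by
  have : M.IsFieldVariation (!ε) (∑ i, P i * M.ePsiBarF i)
      (∑ i, fun φ => kPsiBar i.1 i.2 φ • P i) := by
    rw [← Bool.xor_true]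
    exact IsFieldVariation.sum _ fun i _ => (M.isGreen_ePsiBar i.1 i.2).isFieldVariation (hP i)
  convert this using 1
  funext φ
  rw [Finset.sum_apply]
  cases φ with
  | psi B q =>
    rw [sum_eq_single (B, q) (fun i _ hi => ?_) (by simp)]
    · simp [kPsiBar]
    · have : ¬(B = i.1 ∧ q = i.2) := fun h => hi (Prod.ext h.1.symm h.2.symm)
      simp [kPsiBar, this]
  | _ => simp [kPsiBar]

end Variations

end YangMills

namespace YangMills

section GaugeVariation

variable {ι τ : Type*} (M : YangMills ι τ)

lemma sc_scalMass :
    sc (fun a => (M.scalMass a : ℂ) ^ 2) M.Φ =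
      sc (fun a => (M.higgsMass a : ℂ) ^ 2) M.Φ + sc M.mc (sc M.mc M.Φ) := by
  ext1 a
  simp only [Pi.add_apply, sc_apply, mc, smul_smul, ← add_smul]
  congr 1
  by_cases h : M.kind a = .higgs
  · simp [scalMass, higgsMass, h, M.m_eq_zero_of_higgs h]
  · simp [scalMass, higgsMass, h, pow_two]

lemma mdot_eq_vm {α : Type*} [Fintype α] (k : Matrix α α ℂ) (P Q : α → Wick ι τ) :
    mdot k P Q = ∑ j, vm k P j * Q j := by
  simp only [mdot_apply, vm_apply, sum_mul, smul_mul_assoc]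
  exact sum_comm

lemma mdot_eq_mv {α : Type*} [Fintype α] (k : Matrix α α ℂ) (P Q : α → Wick ι τ) :
    mdot k P Q = ∑ i, P i * mv k Q i := by
  simp only [mdot_apply, mv_apply, mul_sum, mul_smul_comm]

lemma vm_parity {α : Type*} [Fintype α] (k : Matrix α α ℂ) {P : α → Wick ι τ} {ε : Bool}
    (h : ∀ i, HasParity ε (P i)) (i : α) : HasParity ε (vm k P i) :=
  .sum fun _ _ => (h _).smul _

lemma mv_parity {α : Type*} [Fintype α] (k : Matrix α α ℂ) {P : α → Wick ι τ} {ε : Bool}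
    (h : ∀ i, HasParity ε (P i)) (i : α) : HasParity ε (mv k P i) :=
  .sum fun _ _ => (h _).smul _

variable [Fintype ι] [Fintype τ]

/-- The action of `w_a Γ_a` on `ψ`. -/
def repPsi (w : ι → Wick ι τ) (i : τ × Fin 4) : Wick ι τ := ∑ a, w a * mv (M.Γ a) psiF i

/-- The action of `w_a Γ_a` on `ψ̄`. -/
def repPsiBar (w : ι → Wick ι τ) (i : τ × Fin 4) : Wick ι τ := ∑ a, w a * vm (M.ΓBar a) psiBarF i

lemma repPsi_parity (w : ι → Wick ι τ) [h : Homog w true] (i : τ × Fin 4) :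
    HasParity false (M.repPsi w i) := by
  have : HasParity (xor true true) (M.repPsi w i) :=
    .sum fun a _ => (h.parity a).mul (mv_parity _ psiF_parity i)
  exact this

lemma repPsiBar_parity (w : ι → Wick ι τ) [h : Homog w true] (i : τ × Fin 4) :
    HasParity false (M.repPsiBar w i) := by
  have : HasParity (xor true true) (M.repPsiBar w i) :=
    .sum fun a _ => (h.parity a).mul (vm_parity _ psiBarF_parity i)
  exact this

/-- The variation of the fields which belongs to `T`; `w` is the gauge parameter and `G`, `G'` are
the variations of the ghosts. -/
def gaugeVar (w G G' : ι → Wick ι τ) : BasicField ι τ → Wick ι τ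
  | .vec b ν => br M.f w (M.A ν) b
  | .divVec _ => 0
  | .ghost b => G b
  | .anti b => G' b
  | .scal b => M.varΦ w b
  | .psi A r => -I • M.repPsi w (A, r)
  | .psiBar A r => I • M.repPsiBar w (A, r)

/-- The variation of the fields which belongs to `T^μ`. -/
def gaugeVar1 (w G : ι → Wick ι τ) (μ : Fin 4) : BasicField ι τ → Wick ι τ
  | .vec b ν => if ν = μ then (1 / 2 * η μ) • br M.f w w b else 0
  | .ghost b => G b
  | _ => 0

/-- The normal form of `d T - i ∂_μ T^μ`, up to terms with the field equations of the ghosts. -/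
def eomForm (w : ι → Wick ι τ) : Wick ι τ :=
  ∑ ν, (I * η ν) • dot (br M.f w (M.A ν)) (M.kg (M.A ν)) +
    ∑ ν, I • dot (br M.f w (M.A ν)) (dF ν M.eDivF) +
    (-I) • dot (M.varΦ w) M.kgΦ +
    (-1 : ℂ) • ∑ i, M.repPsiBar w i * M.ePsiF i + ∑ i, M.repPsi w i * M.ePsiBarF i

section Divergence

variable {M} {R : Type*} [Ring R] [Algebra ℂ R] {π : Wick ι τ →ₐ[ℂ] R}
  (hπ : Graded π) (hlin : M.LinearRelations)
include hπ

lemma div_lagrDi [DecidableEq ι] [DecidableEq τ] (hcur : M.CurrentRelation) {D : Wick ι τ →ₗ[ℂ] Wick ι τ}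
    {w : ι → Wick ι τ} [hw : Homog w true] (hD : M.IsGaugeDer D w) :
    π (D M.lagrDi) - I • ∑ μ, π (wickD μ (dot (M.jV μ) w)) =
      -π (∑ i, M.repPsiBar w i * M.ePsiF i) + π (∑ i, M.repPsi w i * M.ePsiBarF i) := by
  have h1 : D M.lagrDi - I • ∑ μ, wickD μ (dot (M.jV μ) w) =
      ∑ a, (I • ((M.m a : ℂ) • M.jScal a - ∑ μ, wickD μ (M.jV μ a))) * w a := by
    have e : ∑ a, (I • ((M.m a : ℂ) • M.jScal a - ∑ μ, wickD μ (M.jV μ a))) * w a =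
        I • (dot M.jScal (sc M.mc w) - ∑ μ, dot (dF μ (M.jV μ)) w) := by
      simp only [dot_apply, sc_apply, mc, mul_smul_comm, smul_sum, smul_sub, sub_mul,
        sum_sub_distrib, sum_mul, smul_mul_assoc]
      rw [sum_comm]; rfl
    rw [e]
    simp only [lagrDi, map_add, map_sum, map_smul, dot_der hD.der, dot_der (isDer_wickD _), hD.jV,
      hD.jS, hD.A, hD.Φ, map_zero, zero_apply, zero_add, bsign_vals, one_mul, one_smul, smul_smul]
    have : ∀ μ, η μ * (I * η μ) = I := by
      intro μ; linear_combination I * η_mul_self μ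
    simp only [this, sum_add_distrib, ← smul_sum]
    module
  have h2 : ∀ a, π (mdot (M.ΓBar a) psiBarF M.ePsiF * w a) =
      π (∑ i, w a * vm (M.ΓBar a) psiBarF i * M.ePsiF i) := by
    intro a
    have hp : HasParity false (mdot (M.ΓBar a) psiBarF M.ePsiF) := by
      rw [mdot_eq_vm]
      have he : ∀ i, HasParity true (M.ePsiF i) := fun i =>
        hasParity_of_mem_plets (M.isGreen_ePsi i.1 i.2).mem
      exact .sum fun i _ => (vm_parity _ psiBarF_parity i).mul (he i)
    rw [hπ.comm hp (hw.parity a), bsign_false_left, one_smul, mdot_eq_vm, mul_sum]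
    simp only [mul_assoc]
  have h3 : ∀ a, π (mdot (M.Γ a) M.ePsiBarF psiF * w a) =
      -π (∑ i, w a * mv (M.Γ a) psiF i * M.ePsiBarF i) := by
    intro a
    have he : ∀ i, HasParity true (M.ePsiBarF i) := fun i =>
      hasParity_of_mem_plets (M.isGreen_ePsiBar i.1 i.2).mem
    have hp : HasParity false (mdot (M.Γ a) M.ePsiBarF psiF) := by
      rw [mdot_eq_mv]
      exact .sum fun i _ => (he i).mul (mv_parity _ psiF_parity i)
    rw [hπ.comm hp (hw.parity a), bsign_false_left, one_smul, mdot_eq_mv, mul_sum, map_sum,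
      map_sum, ← sum_neg_distrib]
    refine sum_congr rfl fun i _ => ?_
    rw [map_mul, hπ.comm (he i) (mv_parity _ psiF_parity i), bsign_true_true, mul_assoc, map_mul]
    simp
  have h4 : π (D M.lagrDi) - I • ∑ μ, π (wickD μ (dot (M.jV μ) w)) =
      π (D M.lagrDi - I • ∑ μ, wickD μ (dot (M.jV μ) w)) := by
    simp only [map_sub, map_smul, map_sum]
  rw [h4, h1]
  simp only [M.current_divergence hcur, neg_mul, add_mul, map_sum, map_neg, map_add, h2, h3,
    repPsi, repPsiBar, sum_mul, neg_add, neg_neg, sum_add_distrib,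
    sum_neg_distrib]
  rw [add_comm]
  exact congrArg₂ (· + ·) (congrArg Neg.neg sum_comm) sum_comm

lemma eomForm_eq {w : ι → Wick ι τ} [Homog w true] : π (M.eomForm w) =
    I • ∑ ν, η ν • π (F3 M.f w (M.A ν) (M.kg (M.A ν))) +
    I • ∑ ν, π (F3 M.f w (M.A ν) (dF ν M.divv)) -
    I • ∑ ν, π (F3 M.f w (M.A ν) (dF ν M.divA)) -
    I • π (F3 M.f' M.Φ M.kgΦ w) -
    π (∑ i, M.repPsiBar w i * M.ePsiF i) + π (∑ i, M.repPsi w i * M.ePsiBarF i) := by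
  rw [eomForm, varΦ, dot_br_left]
  simp only [map_add, dot_br_left, map_smul, hπ.F3_swap₂ (fun a c b => M.f' a b c), bsign_vals]
  simp only [map_sum, map_smul, mul_smul, ← smul_sum, eDivF, map_sub,
    sum_sub_distrib]
  module

include hlin

lemma brst_lagr [DecidableEq ι] [DecidableEq τ] (hcur : M.CurrentRelation) :
    π (M.brstD (M.lagrYM + M.lagrGh + M.lagrSc + M.lagrDi)) -
        I • ∑ μ, π (wickD μ (M.lagr1 μ)) =
      π (M.eomForm M.u + (I / 2) • dot (br M.f M.u M.u) (M.kg M.uBar) +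
        (-I) • dot (br (fun a c b => M.fpm a b c) M.Φ M.u) M.eDivF) := by
  have hD := M.brst_isGaugeDer
  have e1 := M.div_lagrYM hπ hlin hD
  have e2 := M.div_lagrSc hπ hlin hD
  have e3 := M.brst_lagrGh hπ hlin
  have e4 := M.div_lagrDi hπ hcur hD
  simp only [map_add, map_smul, eomForm_eq hπ, lagr1_eq, sum_add_distrib, dot_br_left,
    hπ.F3_swap₂ (fun a c b => M.fpm a b c), bsign_vals, fm_sq_eq, kg, kgΦ, eDivF, M.sc_scalMass,
    map_sub, smul_add, add_apply] at *
  linear_combination (norm := module) e1 + e2 + e3 + e4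

lemma antiBrst_lagr [DecidableEq ι] [DecidableEq τ] (hcur : M.CurrentRelation) :
    π (M.antiD (M.lagrYM + M.lagrGh + M.lagrSc + M.lagrDi)) -
        I • ∑ μ, π (wickD μ (M.lagrAnti1 μ)) =
      π (M.eomForm M.uBar + I • dot (br M.f M.u M.uBar) (M.kg M.uBar) +
        (-(I / 2)) • dot (br M.f M.uBar M.uBar) (M.kg M.u) +
        I • dot (br M.f M.uBar M.divv) M.eDivF +
        (-I) • dot (br M.fpm M.Φ M.uBar) M.eDivF) := by
  have hD := M.antiBrst_isGaugeDer
  have e1 := M.div_lagrYM hπ hlin hD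
  have e2 := M.div_lagrSc hπ hlin hD
  have e3 := M.antiBrst_lagrGh hπ hlin
  have e4 := M.div_lagrDi hπ hcur hD
  have e5 : π (F3 M.fm M.uBar M.divA M.Φ) + π (F3 M.fpm M.Φ M.divA M.uBar) =
      π (F3 M.fpm M.Φ M.uBar M.divA) := by
    rw [hπ.F3_swap₂ M.fpm M.Φ M.uBar, hπ.F3_swap₂ M.fm, hπ.F3_swap₁ _ M.uBar, hπ.F3_swap₂ _ _ M.uBar]
    simp only [bsign_vals, one_smul]
    rw [← map_add, F3_add]
    refine congrArg (fun k => π (F3 k _ _ _)) (funext fun a => funext fun b => funext fun c => ?_)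
    simp only [fm, fpm, mc]
    linear_combination hlin.f_f' c b a
  have e6 : π (F3 M.f M.uBar M.divv M.divv) = 0 := by
    rw [hπ.F3_congr₂ (l := fun _ _ _ => 0) M.uBar M.divv, F3_zero, map_zero]
    intro a b c
    rw [hlin.f_antisymm₂ a b c]; simp
  simp only [map_add, map_smul, eomForm_eq hπ, lagrAnti1_eq, sum_add_distrib,
    dot_br_left, fm_sq_eq, kg, kgΦ, eDivF,
    M.sc_scalMass, map_sub, smul_add, add_apply] at *
  linear_combination (norm := module) e1 + e2 + e3 + e4 + I • e5 - I • e6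

lemma brst_lagr1 (μ : Fin 4) :
    π (M.brstD (M.lagr1 μ)) - I • ∑ ν, π (wickD ν (M.lagr2 μ ν)) =
      π ((I / 2) • dot (br M.f M.u M.u) (M.kg (M.A μ)) +
        (I / 2 * η μ) • dot (br M.f M.u M.u) (dF μ M.eDivF)) := by
  have hD := M.brst_isGaugeDer
  have e1 := M.div_lagr1YM hπ hlin hD μ
  have e2 := M.div_lagr1Sc hπ hlin hD μ
  have e3 := congrArg π (M.brst_lagr1Gh μ)
  simp only [map_add, map_smul, lagr1_eq, lagr2_eq, dot_br_left, fm_sq_eq, kg, eDivF, map_sub,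
    smul_add, dot_der hD.der, hD.jV, hD.gh, map_zero, zero_apply] at *
  linear_combination (norm := module) e1 + e2 + e3

lemma antiBrst_lagr1 (μ : Fin 4) :
    π (M.antiD (M.lagrAnti1 μ)) - I • ∑ ν, π (wickD ν (M.lagrAnti2 μ ν)) =
      π ((I / 2) • dot (br M.f M.uBar M.uBar) (M.kg (M.A μ)) +
        (I / 2 * η μ) • dot (br M.f M.uBar M.uBar) (dF μ M.eDivF) +
        I • dot (br M.f M.uBar (M.A μ)) (M.kg M.uBar)) := by
  have hD := M.antiBrst_isGaugeDer
  have e1 := M.div_lagr1YM hπ hlin hD μ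
  have e2 := M.div_lagr1Sc hπ hlin hD μ
  have e3 := M.antiBrst_lagrAnti1Gh hπ hlin μ
  simp only [map_add, map_smul, lagrAnti1_eq, lagrAnti2_eq, dot_br_left, fm_sq_eq, kg, eDivF,
    map_sub, smul_add, dot_der hD.der, hD.jV, hD.gh, map_zero, zero_apply] at *
  linear_combination (norm := module) e1 + e2 + e3

end Divergence

end GaugeVariation

end YangMills

namespace YangMills

lemma graded_toRel (ι τ : Type*) : Graded (toRel (exchRel ι τ)) := fun _ hx => toRel_eq_zero _ hx

section ChainVariation

variable {ι τ : Type*} [Fintype ι] [Fintype τ] (M : YangMills ι τ)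

/-- The variations which belong to the chain `T^I`. -/
def brstVar : List (Fin 4) → BasicField ι τ → Wick ι τ
  | [] => M.gaugeVar M.u ((1 / 2 : ℂ) • br M.f M.u M.u) 0
  | [μ] => M.gaugeVar1 M.u 0 μ
  | _ => 0

/-- The variations which belong to the chain `T_anti^I`. -/
def antiBrstVar : List (Fin 4) → BasicField ι τ → Wick ι τ
  | [] => M.gaugeVar M.uBar (br M.f M.u M.uBar) ((1 / 2 : ℂ) • br M.f M.uBar M.uBar)
  | [μ] => M.gaugeVar1 M.uBar (br M.f M.uBar (M.A μ)) μ
  | _ => 0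

lemma jetDer_parity {d : BasicField ι τ → Wick ι τ} (hd : ∀ φ, d φ ∈ plets (!φ.odd))
    (x : Jet ι τ) : HasParity (xor true x.field.odd) (jetDer d x) := by
  rw [Bool.true_xor]
  exact hasParity_of_mem_plets (wickPartials_mem (S := plets (!x.field.odd))
    (fun p μ hp => wickD_mem_plets hp μ) _ (hd x.field))

lemma gaugeDer_lagr {R : Type*} [Ring R] [Algebra ℂ R] {π : Wick ι τ →ₐ[ℂ] R} (hπ : Graded π)
    (hlin : M.LinearRelations) {d : BasicField ι τ → Wick ι τ} (hd : ∀ φ, d φ ∈ plets (!φ.odd)) :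
    π (derExt paritySign (jetDer d) M.lagr) =
      π (derExt paritySign (jetDer d) (M.lagrYM + M.lagrGh + M.lagrSc + M.lagrDi)) := by
  rw [← gsign_true]
  exact hπ.der_congr (jetDer_parity hd) (M.lagr_eq (graded_toRel ι τ) hlin)

lemma gaugeDer_lagr2N {D : Wick ι τ →ₗ[ℂ] Wick ι τ} {w : ι → Wick ι τ} [Homog w true]
    [Fintype τ] (hD : M.IsGaugeDer D w) (μ ν : Fin 4) : D (M.lagr2N w μ ν) = 0 := by
  simp only [lagr2N, map_smul, map_sub, F3_der hD.der, hD.gh, hD.comm, hD.A, map_zero, zero_apply,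
    dF_comm μ ν, bsign_vals]
  module

variable [DecidableEq ι] [DecidableEq τ] {M}

lemma IsFieldVariation.congr {ε : Bool} {K K' : Wick ι τ} {S S' : BasicField ι τ → Wick ι τ}
    (h : M.IsFieldVariation ε K S) (hK : toRel (exchRel ι τ) K' = toRel (exchRel ι τ) K)
    (hS : ∀ φ, S' φ = S φ) : M.IsFieldVariation ε K' S' := by
  obtain rfl : S' = S := funext hS
  exact IsVariation.congr h (jetContr_parity M.regContr_parity) hK rfl rfl

lemma isFieldVariation_eomForm (hlin : M.LinearRelations) {w : ι → Wick ι τ} [Homog w true] :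
    M.IsFieldVariation true (M.eomForm w) (M.gaugeVar w 0 0) := by
  have h1 : ∀ ν, M.IsFieldVariation true ((I * η ν) • dot (br M.f w (M.A ν)) (M.kg (M.A ν)))
      (fun | .vec b μ => if μ = ν then br M.f w (M.A ν) b else 0 | _ => 0) := by
    intro ν
    refine ((isFieldVariation_kg_A (M := M) (X := br M.f w (M.A ν))
      (fun a ha => M.br_f_higgs hlin _ _ ha) ν).smul (I * η ν)).congr rfl fun φ => ?_
    have h : I * η ν * (I * η ν) = -1 := by
      linear_combination I ^ 2 * η_mul_self ν + I_mul_I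
    cases φ with
    | vec b μ => by_cases hμ : μ = ν <;> simp [hμ, smul_smul, h]
    | _ => simp
  have h2 : ∀ ν, M.IsFieldVariation true
      (I • dot (br M.f w (M.A ν)) (dF ν M.eDivF)) 0 := by
    intro ν
    have := (isFieldVariation_dF_eDivF (M := M) (X := br M.f w (M.A ν)) ν).smul I
    rwa [smul_zero] at this
  have h3 := (isFieldVariation_kgΦ (M := M) (X := M.varΦ w)
    (fun a ha => M.varΦ_massless hlin w ha)).smul (-I)
  have h4 := (isFieldVariation_ePsi (M := M) (M.repPsiBar_parity w)).smul (-1)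
  have h5 := isFieldVariation_ePsiBar (M := M) (M.repPsi_parity w)
  refine (((((IsFieldVariation.sum Finset.univ fun ν _ => h1 ν).add
    (IsFieldVariation.sum Finset.univ fun ν _ => h2 ν)).add h3).add h4).add h5).congr rfl
    fun φ => ?_
  cases φ <;> simp [gaugeVar, smul_smul]

lemma isFieldVariation_brst (hlin : M.LinearRelations) (hcur : M.CurrentRelation)
    (I : List (Fin 4)) : M.IsFieldVariation (!I.length.bodd)
      (derExt paritySign (jetDer M.brstField) (M.TI I) - Complex.I • ∑ μ, wickD μ (M.TI (I ++ [μ])))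
      (M.brstVar I) := by
  have hπ := graded_toRel ι τ
  match I with
  | [] =>
    have h1 := (isFieldVariation_kg_uBar (M := M) (X := br M.f M.u M.u)
      (fun a ha => M.br_f_higgs hlin _ _ ha)).smul (Complex.I / 2)
    have h2 := (isFieldVariation_eDivF (M := M) (X := br (fun a c b => M.fpm a b c) M.Φ M.u)).smul
      (-Complex.I)
    have h := ((isFieldVariation_eomForm hlin (w := M.u)).add h1).add h2
    refine h.congr ((?_ : _ = _).trans (brst_lagr hπ hlin hcur)) fun φ => ?_
    rotate_left
    · cases φ <;> simp [brstVar, gaugeVar, smul_smul]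
      rw [← neg_smul]; congr 1; linear_combination I_mul_I / 2
    · have := M.gaugeDer_lagr hπ hlin M.brstField_mem
      simp only [map_sub, map_smul, map_sum, TI, List.nil_append, this]
  | [μ] =>
    have h1 := (isFieldVariation_kg_A (M := M) (X := br M.f M.u M.u)
      (fun a ha => M.br_f_higgs hlin _ _ ha) μ).smul (Complex.I / 2)
    have h2 := (isFieldVariation_dF_eDivF (M := M) (X := br M.f M.u M.u) μ).smul
      (Complex.I / 2 * η μ)
    rw [List.length_singleton, Nat.bodd_one, Bool.not_true]
    have h : M.IsFieldVariation false _ _ := h1.add h2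
    refine h.congr ((?_ : _ = _).trans (brst_lagr1 hπ hlin μ)) fun φ => ?_
    rotate_left
    · cases φ <;> simp [brstVar, gaugeVar1, smul_smul]
      refine ite_congr rfl (fun _ => ?_) fun _ => rfl
      rw [← neg_smul]; congr 1; linear_combination η μ / 2 * I_mul_I
    · simp only [map_sub, map_smul, map_sum, TI, List.cons_append, List.nil_append]
  | [μ, ν] =>
    have : derExt paritySign (jetDer M.brstField) (M.TI [μ, ν]) -
        Complex.I • ∑ ρ, wickD ρ (M.TI ([μ, ν] ++ [ρ])) = 0 := by
      simp [TI, lagr2_eq, M.gaugeDer_lagr2N M.brst_isGaugeDer]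
    rw [this]
    exact IsFieldVariation.zero
  | μ :: ν :: ρ :: I =>
    have : derExt paritySign (jetDer M.brstField) (M.TI (μ :: ν :: ρ :: I)) -
        Complex.I • ∑ σ, wickD σ (M.TI ((μ :: ν :: ρ :: I) ++ [σ])) = 0 := by
      simp [TI]
    rw [this]
    exact IsFieldVariation.zero

lemma isFieldVariation_antiBrst (hlin : M.LinearRelations) (hcur : M.CurrentRelation)
    (I : List (Fin 4)) : M.IsFieldVariation (!I.length.bodd)
      (derExt paritySign (jetDer M.antiBrstField) (M.TAnti I) -
        Complex.I • ∑ μ, wickD μ (M.TAnti (I ++ [μ]))) (M.antiBrstVar I) := by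
  have hπ := graded_toRel ι τ
  match I with
  | [] =>
    have h1 := (isFieldVariation_kg_uBar (M := M) (X := br M.f M.u M.uBar)
      (fun a ha => M.br_f_higgs hlin _ _ ha)).smul Complex.I
    have h2 := (isFieldVariation_kg_u (M := M) (X := br M.f M.uBar M.uBar)
      (fun a ha => M.br_f_higgs hlin _ _ ha)).smul (-(Complex.I / 2))
    have h3 := (isFieldVariation_eDivF (M := M) (X := br M.f M.uBar M.divv)).smul Complex.I
    have h4 := (isFieldVariation_eDivF (M := M) (X := br M.fpm M.Φ M.uBar)).smul (-Complex.I)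
    have h := ((((isFieldVariation_eomForm hlin (w := M.uBar)).add h1).add h2).add h3).add h4
    refine h.congr ((?_ : _ = _).trans (antiBrst_lagr hπ hlin hcur)) fun φ => ?_
    rotate_left
    · cases φ <;> simp [antiBrstVar, gaugeVar, smul_smul]
      rw [← neg_smul]; congr 1; linear_combination I_mul_I / 2
    · have := M.gaugeDer_lagr hπ hlin M.antiBrstField_mem
      simp only [map_sub, map_smul, map_sum, TAnti, List.nil_append, this]
  | [μ] =>
    have h1 := (isFieldVariation_kg_A (M := M) (X := br M.f M.uBar M.uBar)
      (fun a ha => M.br_f_higgs hlin _ _ ha) μ).smul (Complex.I / 2)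
    have h2 := (isFieldVariation_dF_eDivF (M := M) (X := br M.f M.uBar M.uBar) μ).smul
      (Complex.I / 2 * η μ)
    have h3 := (isFieldVariation_kg_uBar (M := M) (X := br M.f M.uBar (M.A μ))
      (fun a ha => M.br_f_higgs hlin _ _ ha)).smul Complex.I
    rw [List.length_singleton, Nat.bodd_one, Bool.not_true]
    have h : M.IsFieldVariation false _ _ := (h1.add h2).add h3
    refine h.congr ((?_ : _ = _).trans (antiBrst_lagr1 hπ hlin μ)) fun φ => ?_
    rotate_left
    · cases φ <;> simp [antiBrstVar, gaugeVar1, smul_smul]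
      refine ite_congr rfl (fun _ => ?_) fun _ => rfl
      rw [← neg_smul]; congr 1; linear_combination η μ / 2 * I_mul_I
    · simp only [map_sub, map_smul, map_sum, TAnti, List.cons_append, List.nil_append]
  | [μ, ν] =>
    have : derExt paritySign (jetDer M.antiBrstField) (M.TAnti [μ, ν]) -
        Complex.I • ∑ ρ, wickD ρ (M.TAnti ([μ, ν] ++ [ρ])) = 0 := by
      simp [TAnti, lagrAnti2_eq, M.gaugeDer_lagr2N M.antiBrst_isGaugeDer]
    rw [this]
    exact IsFieldVariation.zero
  | μ :: ν :: ρ :: I =>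
    have : derExt paritySign (jetDer M.antiBrstField) (M.TAnti (μ :: ν :: ρ :: I)) -
        Complex.I • ∑ σ, wickD σ (M.TAnti ((μ :: ν :: ρ :: I) ++ [σ])) = 0 := by
      simp [TAnti]
    rw [this]
    exact IsFieldVariation.zero

end ChainVariation

end YangMills

namespace YangMills

section JetDerivations

variable {ι τ : Type*}

lemma jetVar_zero (S : BasicField ι τ → Wick ι τ) (φ : BasicField ι τ) :
    jetVar S ⟨φ, 0⟩ = undiffVar S φ := by
  simp [jetVar, (single_one_ne_zero _).symm]

lemma jetVar_shift (S : BasicField ι τ → Wick ι τ) (φ : BasicField ι τ) (μ : Fin 4) :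
    jetVar S (Jet.shift μ ⟨φ, 0⟩) = wickD μ (S φ) := by
  have h : ∀ ρ : Fin 4, ((Pi.single μ 1 : Fin 4 → ℕ) = Pi.single ρ 1) = (μ = ρ) := fun ρ =>
    propext ⟨fun h => by
      by_contra hne
      have := congrFun h μ
      simp [hne] at this, fun h => by rw [h]⟩
  simp [jetVar, Jet.shift, h]

lemma jetTot_zero (S : BasicField ι τ → Wick ι τ) (ρ : Fin 4) (φ : BasicField ι τ) :
    jetTot S ρ ⟨φ, 0⟩ = undiffTot S ρ φ := by
  simp [jetTot, (single_one_ne_zero _).symm]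

lemma jetTot_shift (S : BasicField ι τ → Wick ι τ) (ρ : Fin 4) (φ : BasicField ι τ) (μ : Fin 4) :
    jetTot S ρ (Jet.shift μ ⟨φ, 0⟩) = if μ = ρ then S φ else 0 := by
  have h : ((Pi.single μ 1 : Fin 4 → ℕ) = Pi.single ρ 1) = (μ = ρ) :=
    propext ⟨fun h => by
      by_contra hne
      have := congrFun h μ
      simp [hne] at this, fun h => by rw [h]⟩
  simp [jetTot, Jet.shift, h]

/-- `∂_μ ↦ δ_{μρ}` on families. -/
def deltaF (ρ μ : Fin 4) : (ι → Wick ι τ) →ₗ[ℂ] (ι → Wick ι τ) := if μ = ρ then LinearMap.id else 0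

variable (M : YangMills ι τ)

/-- A derivation with the values `c • S` on the fields and `P_μ S` on their derivatives. -/
structure IsJetDer (ε : Bool) (c : ℂ) (P : Fin 4 → (ι → Wick ι τ) →ₗ[ℂ] (ι → Wick ι τ))
    (SA : Fin 4 → ι → Wick ι τ) (Su SuBar SΦ : ι → Wick ι τ) (D : Wick ι τ →ₗ[ℂ] Wick ι τ) :
    Prop where
  der : IsDer ε D
  A : ∀ ν, D.compLeft ι (M.A ν) = c • SA ν
  dA : ∀ μ ν, D.compLeft ι (dF μ (M.A ν)) = P μ (SA ν)
  divv : D.compLeft ι M.divv = ∑ μ, P μ (SA μ)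
  u : D.compLeft ι M.u = c • Su
  du : ∀ μ, D.compLeft ι (dF μ M.u) = P μ Su
  uBar : D.compLeft ι M.uBar = c • SuBar
  duBar : ∀ μ, D.compLeft ι (dF μ M.uBar) = P μ SuBar
  Φ : D.compLeft ι M.Φ = c • SΦ
  dΦ : ∀ μ, D.compLeft ι (dF μ M.Φ) = P μ SΦ

variable {M} {S : BasicField ι τ → Wick ι τ}

lemma isJetDer_jetVar (ε : Bool) (hA : ∀ a ν, M.kind a = .higgs → S (.vec a ν) = 0)
    (hu : ∀ a, M.kind a = .higgs → S (.ghost a) = 0)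
    (hb : ∀ a, M.kind a = .higgs → S (.anti a) = 0)
    (hΦ : ∀ a, M.kind a = .massless → S (.scal a) = 0) :
    M.IsJetDer ε 1 dF (fun ν a => S (.vec a ν)) (fun a => S (.ghost a)) (fun a => S (.anti a))
      (fun a => S (.scal a)) (derExt (gsign ε) (jetVar S)) where
  der := isDer_derExt _ _
  A ν := by
    ext1 a
    by_cases h : M.kind a = .higgs
    · simp [A, v, h, hA]
    · simp [A, v, h, fieldWick, jetVar_zero, undiffVar]
  dA μ ν := by
    ext1 a
    by_cases h : M.kind a = .higgs
    · simp [A, v, h, hA]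
    · simp [A, v, h, fieldWick, jetVar_shift]
  divv := by
    ext1 a
    by_cases h : M.kind a = .higgs
    · simp [divv, h, hA]
    · simp [divv, h, fieldWick, jetVar_zero, undiffVar]
  u := by
    ext1 a
    by_cases h : M.kind a = .higgs
    · simp [u, h, hu]
    · simp [u, h, fieldWick, jetVar_zero, undiffVar]
  du μ := by
    ext1 a
    by_cases h : M.kind a = .higgs
    · simp [u, h, hu]
    · simp [u, h, fieldWick, jetVar_shift]
  uBar := by
    ext1 a
    by_cases h : M.kind a = .higgs
    · simp [uBar, h, hb]
    · simp [uBar, h, fieldWick, jetVar_zero, undiffVar]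
  duBar μ := by
    ext1 a
    by_cases h : M.kind a = .higgs
    · simp [uBar, h, hb]
    · simp [uBar, h, fieldWick, jetVar_shift]
  Φ := by
    ext1 a
    by_cases h : M.kind a = .massless
    · simp [Φ, h, hΦ]
    · simp [Φ, h, fieldWick, jetVar_zero, undiffVar]
  dΦ μ := by
    ext1 a
    by_cases h : M.kind a = .massless
    · simp [Φ, h, hΦ]
    · simp [Φ, h, fieldWick, jetVar_shift]

lemma isJetDer_jetTot (ε : Bool) (ρ : Fin 4) (hA : ∀ a ν, M.kind a = .higgs → S (.vec a ν) = 0)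
    (hu : ∀ a, M.kind a = .higgs → S (.ghost a) = 0)
    (hb : ∀ a, M.kind a = .higgs → S (.anti a) = 0)
    (hΦ : ∀ a, M.kind a = .massless → S (.scal a) = 0) :
    M.IsJetDer ε 0 (deltaF ρ) (fun ν a => S (.vec a ν)) (fun a => S (.ghost a))
      (fun a => S (.anti a)) (fun a => S (.scal a)) (derExt (gsign ε) (jetTot S ρ)) where
  der := isDer_derExt _ _
  A ν := by
    ext1 a
    by_cases h : M.kind a = .higgs <;> simp [A, v, h, fieldWick, jetTot_zero, undiffTot]
  dA μ ν := by
    ext1 a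
    by_cases h : M.kind a = .higgs <;> by_cases hμ : μ = ρ <;>
      simp [A, v, h, hA, fieldWick, jetTot_shift, deltaF, hμ]
  divv := by
    ext1 a
    rw [Finset.sum_apply, sum_eq_single ρ (fun b _ hb => by simp [deltaF, hb]) (by simp)]
    by_cases h : M.kind a = .higgs <;>
      simp [divv, h, hA, fieldWick, jetTot_zero, undiffTot, deltaF]
  u := by
    ext1 a
    by_cases h : M.kind a = .higgs <;> simp [u, h, fieldWick, jetTot_zero, undiffTot]
  du μ := by
    ext1 a
    by_cases h : M.kind a = .higgs <;> by_cases hμ : μ = ρ <;>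
      simp [u, h, hu, fieldWick, jetTot_shift, deltaF, hμ]
  uBar := by
    ext1 a
    by_cases h : M.kind a = .higgs <;> simp [uBar, h, fieldWick, jetTot_zero, undiffTot]
  duBar μ := by
    ext1 a
    by_cases h : M.kind a = .higgs <;> by_cases hμ : μ = ρ <;>
      simp [uBar, h, hb, fieldWick, jetTot_shift, deltaF, hμ]
  Φ := by
    ext1 a
    by_cases h : M.kind a = .massless <;> simp [Φ, h, fieldWick, jetTot_zero, undiffTot]
  dΦ μ := by
    ext1 a
    by_cases h : M.kind a = .massless <;> by_cases hμ : μ = ρ <;>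
      simp [Φ, h, hΦ, fieldWick, jetTot_shift, deltaF, hμ]

end JetDerivations

end YangMills

namespace YangMills

section StructureForm

variable {ι τ : Type*} [Fintype ι] (M : YangMills ι τ)

/-- The quadrilinear form `f_{abe} f_{cde} X_a Y_b Z_c W_d`. -/
abbrev B4 : (ι → Wick ι τ) →ₗ[ℂ] (ι → Wick ι τ) →ₗ[ℂ] (ι → Wick ι τ) →ₗ[ℂ] (ι → Wick ι τ) →ₗ[ℂ]
    Wick ι τ := Q4 fun a b c d => ∑ e, M.f a b e * M.f c d e

/-- The Jacobi identity of the `f_{abc}`. -/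
def Jacobi : Prop := ∀ a b d e, ∑ c, (M.f a b c * M.f d e c + M.f b d c * M.f a e c +
    M.f d a c * M.f b e c) = 0

variable {R : Type*} [Ring R] [Algebra ℂ R] {π : Wick ι τ →ₐ[ℂ] R} {x y z t : Bool}

section

variable (X Y Z W : ι → Wick ι τ)

lemma f_br_right : F3 M.f X Y (br M.f Z W) = M.B4 X Y Z W := by
  rw [F3_br_right]; simp only [mul_comm]

lemma f_br_left [Fintype τ] (hlin : M.LinearRelations) : F3 M.f (br M.f X Y) Z W = M.B4 X Y Z W := by
  rw [F3_br_left]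
  refine congrArg (fun n => Q4 n X Y Z W) ?_
  funext a b c d
  refine sum_congr rfl fun e _ => ?_
  rw [hlin.f_antisymm₁ c e d, hlin.f_antisymm₂ c d e, neg_neg]

end

section Symmetry

variable (hπ : Graded π) (X Y Z W : ι → Wick ι τ)
include hπ

lemma B4_pair [Homog X x] [Homog Y y] [Homog Z z] [Homog W t] :
    π (M.B4 X Y Z W) = (bsign x z * bsign x t * bsign y z * bsign y t) • π (M.B4 Z W X Y) := by
  rw [hπ.Q4_swap₂, hπ.Q4_swap₁, hπ.Q4_swap₃, hπ.Q4_swap₂]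
  simp only [smul_smul]
  refine congrArg₂ (· • ·) ?_ (congrArg (fun n => π (Q4 n Z W X Y)) ?_)
  · cases x <;> cases y <;> cases z <;> cases t <;> simp
  · funext a b c d
    exact sum_congr rfl fun e _ => mul_comm _ _

lemma B4_jacobi (hJ : M.Jacobi) [Homog X x] [Homog Y y] [Homog Z z] :
    π (M.B4 X Y Z W) + (bsign x y * bsign x z) • π (M.B4 Y Z X W) +
      (bsign x z * bsign y z) • π (M.B4 Z X Y W) = 0 := by
  rw [hπ.Q4_swap₂ _ Y Z X, hπ.Q4_swap₁ _ Y X Z, hπ.Q4_swap₁ _ Z X Y, hπ.Q4_swap₂ _ X Z Y]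
  simp only [smul_smul]
  have e1 : bsign x y * bsign x z * (bsign z x * bsign y x) = 1 := by
    cases x <;> cases y <;> cases z <;> simp
  have e2 : bsign x z * bsign y z * (bsign z x * bsign z y) = 1 := by
    cases x <;> cases y <;> cases z <;> simp
  rw [e1, e2, one_smul, one_smul, ← map_add, ← map_add, Q4_add, Q4_add]
  simp only [← sum_add_distrib]
  have : (fun a b c d => ∑ e, (M.f a b e * M.f c d e + M.f b c e * M.f a d e +
      M.f c a e * M.f b d e)) = fun _ _ _ _ => (0 : ℂ) := by
    funext a b c d; exact hJ a b c d
  rw [this, Q4_zero, map_zero]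

variable [Fintype τ] (hlin : M.LinearRelations)
include hlin

lemma f_br_mid [Homog Y y] [Homog Z z] [Homog W t] : π (F3 M.f X (br M.f Y Z) W) =
    -(bsign (xor y z) t • π (M.B4 X W Y Z)) := by
  rw [M.f_swap₂ hπ hlin, f_br_right]

lemma B4_swap₁ [Homog X x] [Homog Y y] :
    π (M.B4 X Y Z W) = -(bsign x y • π (M.B4 Y X Z W)) := by
  rw [← f_br_right, M.f_swap₁ hπ hlin, f_br_right]

lemma B4_swap₃ [Homog Z z] [Homog W t] :
    π (M.B4 X Y Z W) = -(bsign z t • π (M.B4 X Y W Z)) := by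
  rw [← M.f_br_left _ _ _ _ hlin, M.f_swap₂ hπ hlin, M.f_br_left _ _ _ _ hlin]

end Symmetry

end StructureForm

section YangMillsSector

variable {ι τ : Type*} [Fintype ι] [Fintype τ] {M : YangMills ι τ} {R : Type*} [Ring R] [Algebra ℂ R]
  {π : Wick ι τ →ₐ[ℂ] R} (hπ : Graded π) (hlin : M.LinearRelations) (hJ : M.Jacobi)
  {w Su Sb SΦ : ι → Wick ι τ} [Homog w true]
  {d D : Wick ι τ →ₗ[ℂ] Wick ι τ} (hd : M.IsGaugeDer d w)

variable (M) in
/-- The quadrilinear vector part of `N^{∅∅}`. -/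
def n0YM : Wick ι τ :=
  ∑ μ, ∑ ν, (-(I / 2) * (η μ * η ν)) • M.B4 (M.A μ) (M.A ν) (M.A μ) (M.A ν)

variable (M) in
/-- The vector part of `N^{[μ]∅}`. -/
def n1YM (w : ι → Wick ι τ) (μ : Fin 4) : Wick ι τ :=
  ∑ ν, (-(I * η ν)) • M.B4 w (M.A ν) (M.A μ) (M.A ν)

include hπ hlin hJ hd

lemma var_lagrYM (hD : M.IsJetDer true 1 dF (fun ν => br M.f w (M.A ν)) Su Sb SΦ D) :
    (2 : ℂ) • π (D M.lagrYM) + π (d M.n0YM) = 0 := by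
  have h1 : ∀ μ ν, π (D (F3 M.f (M.A μ) (M.A ν) (dF ν (M.A μ)))) =
      -π (M.B4 (dF ν w) (M.A μ) (M.A ν) (M.A μ)) := by
    intro μ ν
    have e1 := M.B4_jacobi hπ w (M.A μ) (M.A ν) (dF ν (M.A μ)) hJ
    have e2 := M.B4_swap₁ hπ (M.A ν) w (M.A μ) (dF ν (M.A μ)) hlin
    have e3 := M.B4_pair hπ (M.A μ) (dF ν (M.A μ)) w (M.A ν)
    have e4 := M.B4_pair hπ (M.A μ) (M.A ν) (dF ν w) (M.A μ)
    have e5 := M.B4_swap₃ hπ (dF ν w) (M.A μ) (M.A μ) (M.A ν) hlin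
    simp only [F3_der hD.der, hD.A, hD.dA, one_smul, bsign_vals, mul_one, map_add,
      br_der (isDer_wickD _), M.f_br_left _ _ _ _ hlin, M.f_br_mid hπ _ _ _ _ hlin, f_br_right] at *
    linear_combination (norm := module) e1 - e2 - e3 + e4 + e5
  have h2 : ∀ μ ν, π (d (M.B4 (M.A μ) (M.A ν) (M.A μ) (M.A ν))) =
      (2 * I * η μ) • π (M.B4 (dF μ w) (M.A ν) (M.A μ) (M.A ν)) +
      (2 * I * η ν) • π (M.B4 (dF ν w) (M.A μ) (M.A ν) (M.A μ)) := by
    intro μ ν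
    have e1 := M.B4_swap₁ hπ (M.A μ) (dF ν w) (M.A μ) (M.A ν) hlin
    have e2 := M.B4_swap₃ hπ (dF ν w) (M.A μ) (M.A μ) (M.A ν) hlin
    have e3 := M.B4_pair hπ (M.A μ) (M.A ν) (dF μ w) (M.A ν)
    have e4 := M.B4_pair hπ (M.A μ) (M.A ν) (M.A μ) (dF ν w)
    simp only [Q4_der hd.der, hd.A, map_smul, smul_apply, bsign_vals, mul_one, one_smul, map_add] at *
    linear_combination (norm := module) (2 * I * η ν) • (e1 - e2) +
      (I * η μ) • e3 + (I * η ν) • e4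
  have h3 : ∀ μ ν, -(I / 2) * (η μ * η ν) * (2 * I * η μ) = η ν := fun μ ν => by
    linear_combination (-η ν * I ^ 2) * η_mul_self μ - η ν * I_mul_I
  have h4 : ∀ μ ν, -(I / 2) * (η μ * η ν) * (2 * I * η ν) = η μ := fun μ ν => by
    linear_combination (-η μ * I ^ 2) * η_mul_self ν - η μ * I_mul_I
  simp only [lagrYM, n0YM, map_sum, map_smul, h1, h2, smul_add, smul_smul, h3, h4,
    sum_add_distrib, smul_neg, sum_neg_distrib]
  rw [sum_comm (f := fun μ ν => η ν • π (M.B4 (dF μ w) (M.A ν) (M.A μ) (M.A ν)))]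
  module

lemma var_lagr1YM (μ : Fin 4) {d1 : Wick ι τ →ₗ[ℂ] Wick ι τ} {Su' Sb' SΦ' : ι → Wick ι τ}
    {S1 : Fin 4 → ι → Wick ι τ}
    (hD : M.IsJetDer true 1 dF (fun ν => br M.f w (M.A ν)) Su Sb SΦ D)
    (hw : D.compLeft ι w = (1 / 2 : ℂ) • br M.f w w)
    (hE : M.IsJetDer false 1 dF S1 Su' Sb' SΦ' d1)
    (hS1 : ∀ ν, S1 ν = if ν = μ then (1 / 2 * η μ) • br M.f w w else 0) :
    π (D (M.lagr1YM w μ)) + π (d1 M.lagrYM) + π (d (M.n1YM w μ)) = 0 := by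
  have e : ∀ σ ν κ, π (D (F3 M.f w (M.A σ) (dF ν (M.A κ)))) =
      -(1 / 2 : ℂ) • π (M.B4 w w (M.A σ) (dF ν (M.A κ))) -
        π (M.B4 w (M.A σ) (dF ν w) (M.A κ)) := by
    intro σ ν κ
    have e1 := M.B4_jacobi hπ w w (M.A σ) (dF ν (M.A κ)) hJ
    have e2 := M.B4_swap₁ hπ (M.A σ) w w (dF ν (M.A κ)) hlin
    have e3 := M.B4_pair hπ w (dF ν (M.A κ)) w (M.A σ)
    simp only [F3_der hD.der, hD.A, hD.dA, hw, one_smul, bsign_vals, mul_one, map_add, map_smul,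
      smul_apply, Bool.xor_false, br_der (isDer_wickD _), M.f_br_left _ _ _ _ hlin,
      M.f_br_mid hπ _ _ _ _ hlin, f_br_right] at *
    linear_combination (norm := module) e1 - e2 + e3
  have e1 : π (d1 M.lagrYM) = ∑ ν, ((1 / 2 : ℂ) • π (M.B4 w w (M.A ν) (dF ν (M.A μ))) -
      (1 / 2 * η μ * η ν) • π (M.B4 w w (M.A ν) (dF μ (M.A ν))) +
      π (M.B4 w (dF ν w) (M.A μ) (M.A ν))) := by
    obtain ⟨P, hP⟩ : ∃ P : Fin 4 → R, ∀ ν, P ν = (1 / 2 : ℂ) • π (M.B4 w w (M.A ν) (dF ν (M.A μ))) +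
      π (M.B4 w (dF ν w) (M.A μ) (M.A ν)) := ⟨_, fun _ => rfl⟩
    obtain ⟨Q, hQ⟩ : ∃ Q : Fin 4 → R, ∀ σ, Q σ = -π (M.B4 w w (M.A σ) (dF μ (M.A σ))) :=
      ⟨_, fun _ => rfl⟩
    have h : ∀ σ ν, π (d1 (F3 M.f (M.A σ) (M.A ν) (dF ν (M.A σ)))) =
        (if σ = μ then η μ • P ν else 0) + if ν = μ then (1 / 2 * η μ) • Q σ else 0 := by
      intro σ ν
      have e1 := M.B4_swap₃ hπ (M.A μ) (M.A ν) (dF ν w) w hlin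
      have e2 := M.B4_pair hπ (M.A μ) (M.A ν) w (dF ν w)
      have e3 := M.B4_pair hπ (M.A σ) (dF μ (M.A σ)) w w
      have e4 := M.f_br_mid hπ (M.A σ) w w (dF μ (M.A σ)) hlin
      simp only [bsign_vals, one_smul, mul_one] at *
      simp only [F3_der hE.der, hE.A, hE.dA, hS1, one_smul, bsign_vals, mul_one, map_add]
      rw [hP, hQ]
      split_ifs with h h' h'
      · subst h h'
        simp only [map_smul, smul_apply, br_der (isDer_wickD _), map_add, M.f_br_left _ _ _ _ hlin,
          f_br_right, bsign_vals, one_smul]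
        linear_combination (norm := module) (1 / 2 * η ν) • e1 + η ν • e2 -
          (1 / 2 * η ν) • e3 + (1 / 2 * η ν) • e4
      · subst h
        simp only [map_smul, smul_apply, br_der (isDer_wickD _), map_add, map_zero, zero_apply,
          M.f_br_left _ _ _ _ hlin, f_br_right, bsign_vals, one_smul]
        linear_combination (norm := module) (1 / 2 * η σ) • e1 + η σ • e2
      · subst h'
        simp only [map_smul, smul_apply, map_zero, zero_apply]
        linear_combination (norm := module) (1 / 2 * η ν) • e4 - (1 / 2 * η ν) • e3
      · simp
    simp only [lagrYM, map_sum, map_smul, h, smul_add, sum_add_distrib, smul_ite, smul_zero,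
      sum_ite_eq', mem_univ, if_true]
    rw [sum_comm]
    simp only [sum_ite_eq', mem_univ, if_true, smul_smul, η_mul_self, one_smul]
    rw [← sum_add_distrib, ← sum_add_distrib]
    refine sum_congr rfl fun ν _ => ?_
    rw [hP, hQ]
    module
  have e2 : π (d (M.n1YM w μ)) = ∑ ν, (-π (M.B4 w (dF ν w) (M.A μ) (M.A ν)) -
      (η μ * η ν) • π (M.B4 w (M.A ν) (dF μ w) (M.A ν)) -
      π (M.B4 w (M.A ν) (M.A μ) (dF ν w))) := by
    rw [n1YM, map_sum, map_sum]
    refine sum_congr rfl fun ν _ => ?_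
    simp only [Q4_der hd.der, hd.A, hd.gh, bsign_vals, mul_one, map_zero, zero_apply, smul_apply,
      map_add, map_smul]
    match_scalars
    · linear_combination I ^ 2 * η_mul_self ν + I_mul_I
    · linear_combination η μ * η ν * I_mul_I
    · linear_combination I ^ 2 * η_mul_self ν + I_mul_I
  have e3 : ∀ ν, π (M.B4 w (M.A ν) (M.A μ) (dF ν w)) = -π (M.B4 w (M.A ν) (dF ν w) (M.A μ)) := by
    intro ν; simpa using M.B4_swap₃ hπ w (M.A ν) (M.A μ) (dF ν w) hlin
  rw [e1, e2, lagr1YM, map_sum, map_sum, ← sum_add_distrib, ← sum_add_distrib]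
  refine sum_eq_zero fun ν _ => ?_
  simp only [map_sub, map_smul, e, e3]
  module

end YangMillsSector

end YangMills

namespace YangMills

section YangMillsTotal

variable {ι τ : Type*} [Fintype ι] [Fintype τ] {M : YangMills ι τ} {R : Type*} [Ring R] [Algebra ℂ R]
  {π : Wick ι τ →ₐ[ℂ] R} (hπ : Graded π) (hlin : M.LinearRelations) (hJ : M.Jacobi)
  {w Su Sb SΦ : ι → Wick ι τ} [Homog w true] {d D : Wick ι τ →ₗ[ℂ] Wick ι τ}

section

variable (w)
include hπ hJ

lemma B4_odd_odd_odd (X : ι → Wick ι τ) : π (M.B4 w w w X) = 0 := by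
  have e := M.B4_jacobi hπ w w w X hJ
  simp only [bsign_vals, mul_neg, mul_one, neg_neg, one_smul] at e
  linear_combination (norm := module) (1 / 3 : ℂ) • e

include hlin in
lemma B4_odd_odd_right (X : ι → Wick ι τ) {x : Bool} [Homog X x] : π (M.B4 w w X w) = 0 := by
  rw [M.B4_swap₃ hπ _ _ _ _ hlin, B4_odd_odd_odd hπ hJ, smul_zero, neg_zero]

include hlin in
lemma B4_right_odd (X : ι → Wick ι τ) {x : Bool} [Homog X x] : π (M.B4 X w w w) = 0 := by
  rw [M.B4_pair hπ, B4_odd_odd_right hπ hlin hJ, smul_zero]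

include hlin in
lemma B4_odd_odd (X Y : ι → Wick ι τ) [Homog X false] :
    π (M.B4 w w X Y) = (2 : ℂ) • π (M.B4 w X w Y) := by
  have e := M.B4_jacobi hπ w w X Y hJ
  have e' := M.B4_swap₁ hπ X w w Y hlin
  simp only [bsign_vals, mul_one, one_smul] at e e'
  linear_combination (norm := module) e - e'

end

section

variable (ρ : Fin 4)
include hπ hlin

lemma tot_lagrYM (hD : M.IsJetDer true 0 (deltaF ρ) (fun ν => br M.f w (M.A ν)) Su Sb SΦ D) :
    π (D M.lagrYM) = -I • π (M.n1YM w ρ) := by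
  have h : ∀ σ ν, π (D (F3 M.f (M.A σ) (M.A ν) (dF ν (M.A σ)))) =
      if ν = ρ then -π (M.B4 w (M.A σ) (M.A ρ) (M.A σ)) else 0 := by
    intro σ ν
    have e1 := M.B4_pair hπ (M.A σ) (M.A ν) w (M.A σ)
    have e2 := M.B4_swap₃ hπ w (M.A σ) (M.A σ) (M.A ν) hlin
    simp only [bsign_vals, mul_one, one_smul] at e1 e2
    simp only [F3_der hD.der, hD.A, hD.dA, bsign_vals, mul_one, zero_smul, map_zero, zero_apply,
      zero_add, one_smul, deltaF]
    split_ifs with h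
    · subst h; rw [id_apply, f_br_right, e1, e2]
    · simp
  simp only [lagrYM, n1YM, map_sum, map_smul, h, smul_ite, smul_zero, sum_ite_eq',
    mem_univ, if_true, smul_sum]
  refine sum_congr rfl fun σ _ => ?_
  match_scalars
  linear_combination -η σ * I_mul_I

omit hlin in
lemma tot_lagr1YM (ν : Fin 4)
    (hD : M.IsJetDer true 0 (deltaF ρ) (fun ν => br M.f w (M.A ν)) Su Sb SΦ D)
    (hw : D.compLeft ι w = 0) : π (D (M.lagr1YM w ν)) = -π (M.B4 w (M.A ρ) w (M.A ν)) := by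
  have h : ∀ σ μ κ, π (D (F3 M.f w (M.A σ) (dF μ (M.A κ)))) =
      if μ = ρ then -π (M.B4 w (M.A σ) w (M.A κ)) else 0 := by
    intro σ μ κ
    simp only [F3_der hD.der, hD.A, hD.dA, hw, bsign_vals, mul_one, zero_smul, map_zero,
      zero_apply, zero_add, smul_zero, deltaF]
    split_ifs with h
    · rw [id_apply, f_br_right]; simp
    · simp
  have h0 : ∀ σ, π (M.B4 w (M.A σ) w (M.A σ)) = 0 := by
    intro σ
    have e := M.B4_pair hπ w (M.A σ) w (M.A σ)
    simp only [bsign_vals, mul_one] at e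
    linear_combination (norm := module) (1 / 2 : ℂ) • e
  simp only [lagr1YM, map_sum, map_sub, map_smul, h, h0, neg_zero, ite_self, smul_zero, sub_zero,
    sum_ite_eq', mem_univ, if_true]

end

section

variable (ρ μ : Fin 4) {S1 : Fin 4 → ι → Wick ι τ}
  (hS1 : ∀ ν, S1 ν = if ν = μ then (1 / 2 * η μ) • br M.f w w else 0)
include hπ hS1

lemma tot1_lagrYM (hD : M.IsJetDer false 0 (deltaF ρ) S1 Su Sb SΦ D) :
    π (D M.lagrYM) = (1 / 2 : ℂ) • π (M.B4 w w (M.A μ) (M.A ρ)) := by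
  have h : ∀ σ ν, π (D (F3 M.f (M.A σ) (M.A ν) (dF ν (M.A σ)))) =
      if ν = ρ then if σ = μ then (1 / 2 * η μ) • π (M.B4 w w (M.A μ) (M.A ρ)) else 0 else 0 := by
    intro σ ν
    have e1 := M.B4_pair hπ (M.A σ) (M.A ν) w w
    simp only [bsign_vals, mul_one, one_smul] at e1
    simp only [F3_der hD.der, hD.A, hD.dA, bsign_vals, mul_one, zero_smul, map_zero, zero_apply,
      zero_add, one_smul, deltaF, hS1]
    split_ifs with h h'
    · subst h h'; rw [id_apply, map_smul, map_smul, f_br_right, e1]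
    all_goals simp
  simp only [lagrYM, map_sum, map_smul, h, smul_ite, smul_zero, sum_ite_eq',
    mem_univ, if_true, smul_smul]
  congr 1
  linear_combination (1 / 2) * η_mul_self μ

include hJ

lemma tot1_lagr1YM (ν : Fin 4) (hD : M.IsJetDer false 0 (deltaF ρ) S1 Su Sb SΦ D)
    (hw : D.compLeft ι w = 0) : π (D (M.lagr1YM w ν)) = 0 := by
  have h : ∀ σ μ κ, π (D (F3 M.f w (M.A σ) (dF μ (M.A κ)))) = 0 := by
    intro σ μ κ
    have := M.B4_pair hπ w (M.A σ) w w
    rw [B4_odd_odd_odd hπ hJ, smul_zero] at this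
    simp only [F3_der hD.der, hD.A, hD.dA, hw, bsign_vals, mul_one, zero_smul, map_zero,
      zero_apply, zero_add, one_smul, deltaF, hS1]
    split_ifs <;> simp [f_br_right, this]
  simp [lagr1YM, h]

lemma tot1_lagr2N (ν κ : Fin 4) (hD : M.IsJetDer false 0 (deltaF ρ) S1 Su Sb SΦ D)
    (hw : D.compLeft ι w = 0) : π (D (M.lagr2N w ν κ)) = 0 := by
  have h : ∀ μ κ, π (D (F3 M.f w w (dF μ (M.A κ)))) = 0 := by
    intro μ κ
    simp only [F3_der hD.der, hD.dA, hw, bsign_vals, mul_one, map_zero, zero_apply, zero_add,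
      smul_zero, one_smul, deltaF, hS1]
    split_ifs <;> simp [f_br_right, B4_odd_odd_odd hπ hJ]
  simp [lagr2N, h]

include hlin

lemma var1_lagr2N (ν κ : Fin 4) (hD : M.IsJetDer false 1 dF S1 Su Sb SΦ D)
    (hw : D.compLeft ι w = 0) : π (D (M.lagr2N w ν κ)) = 0 := by
  have h : ∀ ν κ, π (D (F3 M.f w w (dF ν (M.A κ)))) = 0 := by
    intro ν κ
    simp only [F3_der hD.der, hD.dA, hw, bsign_vals, mul_one, map_zero, zero_apply, zero_add,
      smul_zero, one_smul, hS1]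
    split_ifs
    · simp only [map_smul, br_der (isDer_wickD _), map_add, f_br_right, bsign_vals, one_smul,
        B4_odd_odd_odd hπ hJ, B4_odd_odd_right hπ hlin hJ, add_zero, smul_zero]
    · simp
  simp [lagr2N, h]

lemma var1_lagr1YM (ν : Fin 4) (hν : ν ≠ μ) (hD : M.IsJetDer false 1 dF S1 Su Sb SΦ D)
    (hw : D.compLeft ι w = 0) :
    π (D (M.lagr1YM w ν)) = -(η ν • π (M.B4 w (M.A μ) w (dF ν w))) := by
  have h : ∀ σ κ ρ, π (D (F3 M.f w (M.A σ) (dF κ (M.A ρ)))) =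
      if ρ = μ then η μ • π (M.B4 w (M.A σ) w (dF κ w)) else 0 := by
    intro σ κ ρ
    have e1 := M.f_br_mid hπ w w w (dF κ (M.A ρ)) hlin
    have e2 := M.B4_pair hπ w (dF κ (M.A ρ)) w w
    have e3 := M.B4_swap₃ hπ w (M.A σ) (dF κ w) w hlin
    simp only [B4_odd_odd_odd hπ hJ, bsign_vals, Bool.xor_self, one_smul, smul_zero] at e1 e2 e3
    rw [e2, neg_zero] at e1
    simp only [F3_der hD.der, hD.A, hD.dA, hw, bsign_vals, mul_one, map_zero, zero_apply, zero_add,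
      one_smul, hS1]
    split_ifs with h1 h2
    all_goals
      simp only [map_smul, smul_apply, br_der (isDer_wickD _), map_add, f_br_right, bsign_vals,
        one_smul, e1, map_zero, zero_apply]
      try first | linear_combination (norm := module) (1 / 2 * η μ) • e3 | simp
  simp only [lagr1YM, map_sum, map_sub, map_smul, h, hν, if_false, zero_sub, smul_ite, smul_zero,
    sum_neg_distrib, sum_ite_eq', mem_univ, if_true, smul_smul,
    mul_assoc, η_mul_self, mul_one]

end

section

variable (w) in
variable (M) in
/-- `N^{[μν]∅}` in normal form. -/
def n2 (μ ν : Fin 4) : Wick ι τ := (I / 2) • M.B4 w w (M.A μ) (M.A ν)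

include hπ hJ

lemma tot_lagr2N (ρ μ ν : Fin 4)
    (hD : M.IsJetDer true 0 (deltaF ρ) (fun ν => br M.f w (M.A ν)) Su Sb SΦ D)
    (hw : D.compLeft ι w = 0) : π (D (M.lagr2N w μ ν)) = 0 := by
  have h : ∀ μ κ, π (D (F3 M.f w w (dF μ (M.A κ)))) = 0 := by
    intro μ κ
    simp only [F3_der hD.der, hD.dA, hw, map_zero, zero_apply, zero_add, smul_zero, deltaF]
    split_ifs <;> simp [f_br_right, B4_odd_odd_odd hπ hJ]
  simp [lagr2N, h]

include hlin

lemma var_lagr2N (μ ν : Fin 4) (hd : M.IsGaugeDer d w)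
    (hD : M.IsJetDer true 1 dF (fun ν => br M.f w (M.A ν)) Su Sb SΦ D)
    (hw : D.compLeft ι w = (1 / 2 : ℂ) • br M.f w w) :
    π (D (M.lagr2N w μ ν)) + π (d (M.n2 w μ ν)) = 0 := by
  have h : ∀ μ κ, π (D (F3 M.f w w (dF μ (M.A κ)))) = π (M.B4 w w (dF μ w) (M.A κ)) := by
    intro μ κ
    have e1 := M.f_br_mid hπ w w w (dF μ (M.A κ)) hlin
    have e2 := M.B4_pair hπ w (dF μ (M.A κ)) w w
    simp only [B4_odd_odd_odd hπ hJ, bsign_vals, Bool.xor_self, one_smul, smul_zero] at e1 e2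
    rw [e2, neg_zero] at e1
    simp only [F3_der hD.der, hD.dA, hw, map_smul, smul_apply, br_der (isDer_wickD _), map_add,
      M.f_br_left _ _ _ _ hlin, f_br_right, B4_odd_odd_odd hπ hJ, e1, bsign_vals, smul_zero,
      zero_add, add_zero, mul_neg, mul_one, neg_neg, one_smul]
  have e := M.B4_swap₃ hπ w w (M.A μ) (dF ν w) hlin
  simp only [bsign_vals, one_smul] at e
  simp only [lagr2N, n2, map_smul, map_sub, h, Q4_der hd.der, hd.A, hd.gh, map_zero, map_add,
    zero_apply, smul_apply, bsign_vals, smul_zero, zero_add, mul_one, mul_neg, neg_neg, one_smul,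
    e]
  match_scalars
  · linear_combination η μ / 2 * I_mul_I
  · linear_combination -η ν / 2 * I_mul_I

end

end YangMillsTotal

end YangMills

namespace YangMills

section ScalarForms

variable {ι τ : Type*} [Fintype ι] (M : YangMills ι τ)

/-- The representation property of the `f'_{abc}`, without restrictions on the indices. -/
def BoseRep : Prop := ∀ a b d e,
  ∑ c, (M.f' d c a * M.f' c e b - M.f' d c b * M.f' c e a) = -∑ c, M.f a b c * M.f' d e c

/-- The action of `w_a` on a family of scalars. -/
abbrev act : (ι → Wick ι τ) →ₗ[ℂ] (ι → Wick ι τ) →ₗ[ℂ] (ι → Wick ι τ) :=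
  br fun a c b => M.f' a b c

lemma boseRep [Fintype τ] (hlin : M.LinearRelations) (hbil : M.BilinearRelations) :
    M.BoseRep := by
  intro a b d e
  have hm : ∀ a b c, M.kind b = .massless → M.f' a b c = 0 := fun a b c h => by
    rw [hlin.f'_antisymm, hlin.f'_massless _ _ _ h, neg_zero]
  have hh : ∀ a b c, M.kind b = .higgs → M.f a b c = 0 := fun a b c h => by
    rw [← neg_neg (M.f a b c), ← hlin.f_antisymm₁, hlin.f_higgs _ _ _ h, neg_zero]
  by_cases ha : M.kind a = .higgs
  · simp [hlin.f'_higgs _ _ _ ha, hlin.f_higgs _ _ _ ha]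
  by_cases hb : M.kind b = .higgs
  · simp [hlin.f'_higgs _ _ _ hb, hh _ _ _ hb]
  by_cases hd : M.kind d = .massless
  · simp [hlin.f'_massless _ _ _ hd]
  by_cases he : M.kind e = .massless
  · simp [hm _ _ _ he]
  exact hbil.reps_bose a b d e ha hb hd he

variable {M} {R : Type*} [Ring R] [Algebra ℂ R] {π : Wick ι τ →ₐ[ℂ] R} {x y z t : Bool}
  (hπ : Graded π) (X Y Z W : ι → Wick ι τ)

lemma F3_fpm : F3 M.fpm X Y Z = F3 M.f' X (sc M.mc Y) Z := by
  rw [F3_sc_mid]; exact congrArg (fun k => F3 k X Y Z) (by funext a b c; exact mul_comm _ _)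

lemma F3_fm : F3 M.fm X Y Z = F3 M.f X Y (sc M.mc Z) := by
  rw [F3_sc_right]; exact congrArg (fun k => F3 k X Y Z) (by funext a b c; exact mul_comm _ _)

include hπ in
lemma f'_eq_dot [Homog Y y] [Homog Z z] :
    π (F3 M.f' X Y Z) = bsign y z • π (dot (M.act X Z) Y) := by
  rw [hπ.F3_swap₂, dot_br_left]

variable [Fintype τ]

lemma f'_eq_neg_dot (hlin : M.LinearRelations) : F3 M.f' X Y Z = -dot X (M.act Y Z) := by
  rw [dot_br_right, ← F3_neg]
  refine congrArg (fun k => F3 k X Y Z) ?_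
  funext a b c
  exact hlin.f'_antisymm _ _ _

include hπ

/-- Invariance of `f'` under the action of the gauge parameters. -/
lemma f'_inv (hlin : M.LinearRelations) (hR : M.BoseRep) [Homog Y y] [Homog W t] :
    bsign y t • π (F3 M.f' (M.act X Y) W Z) + π (F3 M.f' X (M.act W Y) Z) +
      π (F3 M.f' X W (br M.f Y Z)) = 0 := by
  rw [F3_br_left, F3_br_mid, F3_br_right, hπ.Q4_swap₂ _ X Y W, smul_smul, bsign_mul_self, one_smul,
    ← map_add, ← map_add, Q4_add, Q4_add]
  have : (fun a b c d => ∑ e, M.f' a e c * M.f' e b d + ∑ e, M.f' b e c * M.f' a e d +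
      ∑ e, M.f c d e * M.f' a b e) = fun _ _ _ _ => (0 : ℂ) := by
    funext a b c d
    have h := hR c d a b
    rw [← eq_neg_iff_add_eq_zero, ← h, ← sum_add_distrib]
    refine sum_congr rfl fun e _ => ?_
    rw [hlin.f'_antisymm b e c]; ring
  rw [this, Q4_zero, map_zero]

/-- Invariance of `f' m` under the action of the gauge parameters. -/
lemma fpm_inv (hlin : M.LinearRelations) (hR : M.BoseRep) [Homog X false] [Homog Y y] [Homog Z z] :
    π (F3 M.fpm (M.act X Y) Z W) + π (F3 M.fpm X (br M.f Y Z) W) +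
      bsign y z • π (F3 M.fpm X Z (br M.f Y W)) +
      π (dot (M.act (sc M.mc Y) Z) (M.act X W)) = 0 := by
  have h0 : π (dot (M.act (sc M.mc Y) Z) (M.act X W)) =
      π (Q4 (fun a b c d => M.mc b * ∑ e, M.f' b e c * M.f' a e d) X Y Z W) := by
    rw [dot_br_right, F3_br_left, Q4_sc₁, hπ.Q4_swap₂, hπ.Q4_swap₁]
    simp only [bsign_vals, one_smul]
  rw [h0, F3_br_left, F3_br_mid, F3_br_right, hπ.Q4_swap₂ _ X Z Y, smul_smul, bsign_comm z y,
    bsign_mul_self, one_smul, ← map_add, ← map_add, ← map_add, Q4_add, Q4_add, Q4_add]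
  have : (fun a b c d => ∑ e, M.f' a e b * M.fpm e c d + ∑ e, M.f b c e * M.fpm a e d +
      ∑ e, M.f b d e * M.fpm a c e + M.mc b * ∑ e, M.f' b e c * M.f' a e d) =
      fun _ _ _ _ => (0 : ℂ) := by
    funext a b c d
    have h := hR b d a c
    have e1 : ∀ e, M.f b c e * M.mc e = M.f' e b c * M.mc b - M.f' e c b * M.mc c := fun e =>
      hlin.f_f' b c e
    have e2 : ∑ e, M.f' a e b * M.fpm e c d + ∑ e, M.f b c e * M.fpm a e d +
        ∑ e, M.f b d e * M.fpm a c e + M.mc b * ∑ e, M.f' b e c * M.f' a e d =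
        M.mc c * (∑ e, (M.f' a e b * M.f' e c d - M.f' a e d * M.f' e c b) +
          ∑ e, M.f b d e * M.f' a c e) := by
      simp only [← sum_add_distrib, mul_sum]
      refine sum_congr rfl fun e _ => ?_
      simp only [fpm]
      rw [hlin.f'_antisymm b e c]
      linear_combination M.f' a e d * e1 e
    rw [e2, h]; ring
  rw [this, Q4_zero, map_zero]

lemma fpm_br (hlin : M.LinearRelations) [Homog Y true] :
    π (F3 M.fpm X (br M.f Y Y) W) = -(2 : ℂ) • π (F3 M.f' X (M.act (sc M.mc Y) Y) W) := by
  rw [F3_br_mid, F3_br_mid, Q4_sc₂, ← map_smul, Q4_smul]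
  refine hπ.Q4_congr₂ X Y W fun a b c d => ?_
  simp only [bsign_vals, neg_one_mul, mul_sum, ← sum_add_distrib]
  refine sum_congr rfl fun e _ => ?_
  have h := hlin.f_f' b c e
  simp only [fpm, mc] at *
  rw [hlin.f_antisymm₁ b c e, hlin.f'_antisymm b e c, hlin.f'_antisymm c e b]
  linear_combination 2 * M.f' a e d * h

lemma fpm_skew (hlin : M.LinearRelations) [Homog Y y] [Homog Z z] :
    π (F3 M.fpm X Y Z) - bsign y z • π (F3 M.fpm X Z Y) = π (F3 M.f (sc M.mc X) Y Z) := by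
  rw [hπ.F3_swap₂ M.fpm X Z Y, smul_smul, bsign_comm z y, bsign_mul_self, one_smul, F3_sc_left,
    ← map_sub, sub_eq_add_neg, ← F3_neg, F3_add]
  refine congrArg (fun k => π (F3 k X Y Z)) ?_
  funext a b c
  have h := hlin.f_f' b c a
  simp only [fpm, mc] at *
  rw [hlin.f_antisymm₂ b a c, hlin.f_antisymm₁ a b c, neg_neg] at h
  linear_combination -h

end ScalarForms

section ScalarSector

variable {ι τ : Type*} [Fintype ι] [Fintype τ] {M : YangMills ι τ} {R : Type*} [Ring R] [Algebra ℂ R]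
  {π : Wick ι τ →ₐ[ℂ] R} (hπ : Graded π) (hlin : M.LinearRelations) (hR : M.BoseRep)
  {w Su Sb : ι → Wick ι τ} [Homog w true] {d D : Wick ι τ →ₗ[ℂ] Wick ι τ}

variable (M) in
/-- The part of `N^{∅∅}` with two scalars. -/
def n0Sc : Wick ι τ := ∑ μ, (I * η μ) • dot (M.act M.Φ (M.A μ)) (M.act M.Φ (M.A μ))

variable (M) in
/-- The part of `N^{[μ]∅}` with two scalars. -/
def n1Sc (w : ι → Wick ι τ) (μ : Fin 4) : Wick ι τ :=
  I • dot (M.act M.Φ w) (M.act M.Φ (M.A μ))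

/-- The scalar vertices without the cubic self-interaction. -/
def lagrSc₀ (M : YangMills ι τ) : Wick ι τ :=
  ∑ μ, (F3 M.f' M.Φ (dF μ M.Φ) (M.A μ) - η μ • F3 M.fpm M.Φ (M.A μ) (M.A μ))

lemma lagrSc_eq : M.lagrSc = M.lagrSc₀ + (1 / 6 : ℂ) • F3 M.f'' M.Φ M.Φ M.Φ := rfl

include hπ

lemma tot_lagrSc (ρ : Fin 4) (hD : M.IsJetDer true 0 (deltaF ρ) (fun ν => br M.f w (M.A ν)) Su Sb
    (M.act M.Φ w) D) : π (D M.lagrSc) = -I • π (M.n1Sc w ρ) := by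
  have h : ∀ σ, π (D (F3 M.f' M.Φ (dF σ M.Φ) (M.A σ))) =
      if σ = ρ then π (dot (M.act M.Φ w) (M.act M.Φ (M.A ρ))) else 0 := by
    intro σ
    simp only [F3_der hD.der, hD.A, hD.Φ, hD.dΦ, bsign_vals, mul_one, zero_smul, map_zero,
      zero_apply, zero_add, add_zero, one_smul, deltaF]
    split_ifs with h
    · subst h
      rw [id_apply, f'_eq_dot hπ, hπ.dot_swap]
      simp
    · simp
  simp only [lagrSc_eq, lagrSc₀, n1Sc, map_add, map_sum, map_sub, map_smul, h]
  simp only [F3_der hD.der, hD.A, hD.Φ, zero_smul, map_zero, zero_apply, smul_zero, add_zero, sub_zero,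
    sum_ite_eq', mem_univ, if_true, smul_smul, neg_mul, I_mul_I, neg_neg,
    one_smul]

lemma tot_lagr1Sc (ρ ν : Fin 4) (hD : M.IsJetDer true 0 (deltaF ρ) (fun ν => br M.f w (M.A ν)) Su Sb
    (M.act M.Φ w) D) (hw : D.compLeft ι w = 0) : π (D (M.lagr1Sc w ν)) = 0 := by
  have h : π (D (F3 M.f' M.Φ (dF ν M.Φ) w)) = 0 := by
    simp only [F3_der hD.der, hD.Φ, hD.dΦ, hw, zero_smul, map_zero, zero_apply, zero_add, add_zero,
      one_smul, deltaF, bsign_vals, smul_zero]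
    split_ifs with h
    · have e := hπ.dot_swap (M.act M.Φ w) (M.act M.Φ w)
      rw [id_apply, f'_eq_dot hπ]
      simp only [Bool.false_xor, bsign_vals] at e ⊢
      linear_combination (norm := module) -(1 / 2 : ℂ) • e
    · simp
  simp only [lagr1Sc, map_sub, map_smul, h]
  simp only [F3_der hD.der, hD.A, hD.Φ, hw, zero_smul, map_zero,
    zero_apply, smul_zero, add_zero, sub_zero]

include hlin hR

lemma var_lagrSc₀ (hd : M.IsGaugeDer d w)
    (hD : M.IsJetDer true 1 dF (fun ν => br M.f w (M.A ν)) Su Sb (M.act M.Φ w) D) :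
    (2 : ℂ) • π (D M.lagrSc₀) + π (d M.n0Sc) = 0 := by
  rw [lagrSc₀, n0Sc, map_sum, map_sum, map_sum, map_sum, smul_sum, ← sum_add_distrib]
  refine sum_eq_zero fun μ _ => ?_
  have e1 := f'_inv hπ M.Φ w (M.A μ) (dF μ M.Φ) hlin hR
  have e2 := fpm_inv hπ M.Φ w (M.A μ) (M.A μ) hlin hR
  have e3 := hπ.dot_swap (M.act M.Φ (M.A μ)) (M.act (sc M.mc w) (M.A μ))
  have e4 := hπ.dot_swap (M.act M.Φ (M.A μ)) (M.act M.Φ (dF μ w))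
  have e5 := f'_eq_dot (M := M) hπ M.Φ (M.act M.Φ (dF μ w)) (M.A μ)
  simp only [map_sub, map_smul, map_add, F3_der hD.der, hD.A, hD.Φ, hD.dΦ, dot_der hd.der,
    br_der hd.der, br_der (isDer_wickD _), hd.A, hd.Φ, smul_apply, add_apply, bsign_vals, one_smul,
    mul_one, smul_add, Bool.xor_false] at *
  have h1 : I * η μ * I = -η μ := by linear_combination η μ * I_mul_I
  have h2 : I * η μ * (I * η μ) = -1 := by
    linear_combination I ^ 2 * η_mul_self μ + I_mul_I
  simp only [smul_smul, h1, h2]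
  linear_combination (norm := module) (2 : ℂ) • e1 + (2 : ℂ) • e5 - (2 * η μ) • e2 + e4 - η μ • e3

lemma var_lagr1Sc (μ : Fin 4) {d1 : Wick ι τ →ₗ[ℂ] Wick ι τ} {Su' Sb' : ι → Wick ι τ}
    {S1 : Fin 4 → ι → Wick ι τ} (hd : M.IsGaugeDer d w)
    (hD : M.IsJetDer true 1 dF (fun ν => br M.f w (M.A ν)) Su Sb (M.act M.Φ w) D)
    (hw : D.compLeft ι w = (1 / 2 : ℂ) • br M.f w w)
    (hE : M.IsJetDer false 1 dF S1 Su' Sb' 0 d1)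
    (hS1 : ∀ ν, S1 ν = if ν = μ then (1 / 2 * η μ) • br M.f w w else 0) :
    π (D (M.lagr1Sc w μ)) + π (d1 M.lagrSc) + π (d (M.n1Sc w μ)) = 0 := by
  have e0 : π (d1 M.lagrSc) = (1 / 2 * η μ) • π (F3 M.f' M.Φ (dF μ M.Φ) (br M.f w w)) -
      (1 / 2 : ℂ) • (π (F3 M.fpm M.Φ (br M.f w w) (M.A μ)) +
        π (F3 M.fpm M.Φ (M.A μ) (br M.f w w))) := by
    have h : ∀ ν, π (d1 (F3 M.f' M.Φ (dF ν M.Φ) (M.A ν) - η ν • F3 M.fpm M.Φ (M.A ν) (M.A ν))) =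
        if ν = μ then (1 / 2 * η μ) • π (F3 M.f' M.Φ (dF μ M.Φ) (br M.f w w)) -
      (1 / 2 : ℂ) • (π (F3 M.fpm M.Φ (br M.f w w) (M.A μ)) +
        π (F3 M.fpm M.Φ (M.A μ) (br M.f w w))) else 0 := by
      intro ν
      simp only [map_sub, map_smul, F3_der hE.der, hE.A, hE.Φ, hE.dΦ, hS1, map_zero, map_add,
        zero_apply, smul_zero, zero_add, bsign_vals, one_smul, mul_one]
      split_ifs with h
      · subst h
        simp only [map_smul, smul_apply]
        rcases η_eq ν with h | h <;> rw [h] <;> module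
      · simp
    simp only [lagrSc_eq, lagrSc₀, map_add, map_sum, h]
    simp only [map_smul, F3_der hE.der, hE.Φ, map_zero, zero_apply, smul_zero, add_zero,
      sum_ite_eq', mem_univ, if_true]
  have e1 := f'_inv hπ M.Φ w w (dF μ M.Φ) hlin hR
  have e2 := fpm_inv hπ M.Φ w (M.A μ) w hlin hR
  have e3 := hπ.dot_swap (M.act M.Φ w) (M.act (sc M.mc w) (M.A μ))
  have e4 := f'_eq_dot (M := M) hπ M.Φ (M.act M.Φ (dF μ w)) w
  have e5 := f'_eq_dot (M := M) hπ M.Φ (M.act (sc M.mc w) w) (M.A μ)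
  have e6 := hπ.dot_swap (M.act M.Φ (M.A μ)) (M.act (sc M.mc w) w)
  have e7 := fpm_br hπ M.Φ w (M.A μ) hlin
  rw [e0]
  simp only [lagr1Sc, n1Sc, map_sub, map_smul, map_add, F3_der hD.der, hD.A, hD.Φ, hD.dΦ, hw,
    dot_der hd.der, br_der hd.der, br_der (isDer_wickD _), hd.A, hd.Φ, hd.gh, smul_apply,
    add_apply, map_zero, smul_zero, add_zero, Bool.false_xor, bsign_vals, one_smul, mul_one,
    smul_add, Bool.xor_false, Bool.true_xor, Bool.not_true] at *
  have h1 : I * (-1 * (I * η μ)) = η μ := by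
    linear_combination (-η μ) * I_mul_I
  have h2 : I * (-1 * I) = 1 := by linear_combination -I_mul_I
  simp only [smul_smul, h1, h2, I_mul_I]
  linear_combination (norm := module) (η μ) • e1 + η μ • e4 - e2 + e3 - (1 / 2 : ℂ) • e7 + e5 + e6

end ScalarSector

section ScalarSelfInteraction

variable {ι τ : Type*} [Fintype ι] [Fintype τ] {M : YangMills ι τ} {R : Type*} [Ring R] [Algebra ℂ R]
  {π : Wick ι τ →ₐ[ℂ] R} (hπ : Graded π) (hlin : M.LinearRelations)
  {w Su Sb : ι → Wick ι τ} [Homog w true] {SA : Fin 4 → ι → Wick ι τ}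
  {d D : Wick ι τ →ₗ[ℂ] Wick ι τ} {h : ι → ι → ι → ι → ℂ}

include hπ hlin

lemma var_cubic (hh : M.IsQuarticCoupling h) (hd : M.IsGaugeDer d w)
    (hD : M.IsJetDer true 1 dF SA Su Sb (M.act M.Φ w) D) :
    (2 : ℂ) • π (D ((1 / 6 : ℂ) • F3 M.f'' M.Φ M.Φ M.Φ)) +
      π (d ((1 / 24 : ℂ) • Q4 h M.Φ M.Φ M.Φ M.Φ)) = 0 := by
  have a1 : π (F3 M.f'' M.Φ (M.act M.Φ w) M.Φ) = π (F3 M.f'' M.Φ M.Φ (M.act M.Φ w)) := by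
    rw [hπ.F3_swap₂]; simp [hlin.f''_symm₂]
  have a2 : π (F3 M.f'' (M.act M.Φ w) M.Φ M.Φ) = π (F3 M.f'' M.Φ M.Φ (M.act M.Φ w)) := by
    rw [hπ.F3_swap₁]; simp [hlin.f''_symm₁, a1]
  have b1 : π (Q4 h M.Φ M.Φ (sc M.mc w) M.Φ) = π (Q4 h M.Φ M.Φ M.Φ (sc M.mc w)) := by
    rw [hπ.Q4_swap₃]; simp [hh.symm₃]
  have b2 : π (Q4 h M.Φ (sc M.mc w) M.Φ M.Φ) = π (Q4 h M.Φ M.Φ M.Φ (sc M.mc w)) := by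
    rw [hπ.Q4_swap₂]; simp [hh.symm₂, b1]
  have b3 : π (Q4 h (sc M.mc w) M.Φ M.Φ M.Φ) = π (Q4 h M.Φ M.Φ M.Φ (sc M.mc w)) := by
    rw [hπ.Q4_swap₁]; simp [hh.symm₁, b2]
  have c : π (F3 M.f'' M.Φ M.Φ (M.act M.Φ w)) =
      -(I / 6) • π (Q4 h M.Φ M.Φ M.Φ (sc M.mc w)) := by
    rw [F3_br_right, Q4_sc₄, ← map_smul, Q4_smul]
    refine hπ.Q4_congr_cyc _ _ fun a b c d => ?_
    have h1 : h a b c d * M.mc d = -2 * I * M.cubicVariation d a b c := by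
      rw [← hh.symm₃, ← hh.symm₂, ← hh.symm₁]; exact hh.eq d a b c
    have h2 : h b c a d = h a b c d := by rw [hh.symm₂, hh.symm₁]
    have h3 : h c a b d = h a b c d := by rw [hh.symm₁, hh.symm₂]
    rw [h2, h3, mul_comm (M.mc d), h1, cubicVariation]
    simp only [mul_sum, ← sum_add_distrib]
    refine sum_congr rfl fun e _ => ?_
    have h4 : ∀ a b e, M.f'' a b e = M.f'' e a b := fun a b e => by
      rw [← hlin.f''_symm₂, hlin.f''_symm₁]
    rw [h4 a b e, h4 b c e, h4 c a e, hlin.f''_symm₂ e a c, hlin.f'_antisymm c e,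
      hlin.f'_antisymm b e, hlin.f'_antisymm a e]
    linear_combination (-(M.f' e c d * M.f'' e a b) - M.f' e a d * M.f'' e b c -
      M.f' e b d * M.f'' e a c) * I_mul_I
  simp only [map_smul, map_add, F3_der hD.der, Q4_der hd.der, hD.Φ, hd.Φ, bsign_vals, mul_one,
    one_smul, smul_apply, a1, a2, b1, b2, b3]
  linear_combination (norm := module) c

end ScalarSelfInteraction

end YangMills

namespace YangMills

section GhostTotal

variable {ι τ : Type*} [Fintype ι] [Fintype τ] {M : YangMills ι τ} {R : Type*} [Ring R] [Algebra ℂ R]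
  {π : Wick ι τ →ₐ[ℂ] R} (hπ : Graded π) (hlin : M.LinearRelations) (hJ : M.Jacobi)
  {Su Sb SΦ : ι → Wick ι τ} {SA S1 : Fin 4 → ι → Wick ι τ} {D : Wick ι τ →ₗ[ℂ] Wick ι τ}
  {ε : Bool} (ρ : Fin 4)

lemma tot_lagrGh (hD : M.IsJetDer ε 0 (deltaF ρ) SA Su Sb SΦ D) :
    D M.lagrGh = bsign ε true • F3 M.f M.u (M.A ρ) Sb := by
  have h : ∀ σ, D (F3 M.f M.u (M.A σ) (dF σ M.uBar)) =
      if σ = ρ then bsign ε true • F3 M.f M.u (M.A ρ) Sb else 0 := by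
    intro σ
    simp only [F3_der hD.der, hD.A, hD.u, hD.duBar, zero_smul, map_zero, zero_apply, zero_add,
      smul_zero, deltaF, bsign_vals, mul_one]
    split_ifs with h
    · subst h; rfl
    · simp
  simp only [lagrGh, map_add, map_sum, h, F3_der hD.der, hD.Φ, hD.u, hD.uBar, zero_smul, map_zero,
    zero_apply, smul_zero, add_zero, sum_ite_eq', mem_univ, if_true]

lemma tot_lagr1Gh (ν : Fin 4) (hD : M.IsJetDer ε 0 (deltaF ρ) SA Su 0 SΦ D) :
    D (M.lagr1Gh ν) = 0 := by
  simp only [lagr1Gh, map_smul, F3_der hD.der, hD.u, hD.duBar, zero_smul, map_zero,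
    zero_apply, smul_zero, add_zero]

include hπ hlin hJ

lemma tot_lagrAnti1Gh (ν : Fin 4) (hD : M.IsJetDer true 0 (deltaF ρ)
    (fun ν => br M.f M.uBar (M.A ν)) (br M.f M.u M.uBar) ((1 / 2 : ℂ) • br M.f M.uBar M.uBar) SΦ D) :
    π (D (M.lagrAnti1Gh ν)) = -π (M.B4 M.uBar (M.A ρ) M.uBar (M.A ν)) := by
  have h0 : D.compLeft ι M.divv = br M.f M.uBar (M.A ρ) := by
    rw [hD.divv, sum_eq_single ρ (fun b _ hb => by simp [deltaF, hb]) (by simp)]; simp [deltaF]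
  have e1 := M.f_br_mid hπ M.uBar M.uBar (M.A ρ) (M.A ν) hlin
  have e2 := M.B4_pair hπ M.uBar (M.A ν) M.uBar (M.A ρ)
  have e3 := B4_right_odd hπ hlin hJ M.uBar M.u
  simp only [bsign_vals, one_smul, mul_one] at e1 e2
  simp only [lagrAnti1Gh, map_sub, map_add, map_smul, F3_der hD.der, hD.u, hD.uBar, hD.A, hD.Φ, h0,
    hD.du, hD.duBar, zero_smul, map_zero, zero_apply, smul_zero, add_zero, zero_add, deltaF,
    bsign_vals, e1, e2]
  split_ifs with h
  · simp only [id_apply, f_br_right, M.f_br_left _ _ _ _ hlin, e3]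
    module
  · simp

lemma tot1_lagrAnti1Gh (μ ν : Fin 4) (hS1 : ∀ ν, S1 ν =
      if ν = μ then (1 / 2 * η μ) • br M.f M.uBar M.uBar else 0)
    (hD : M.IsJetDer false 0 (deltaF ρ) S1 (br M.f M.uBar (M.A μ)) 0 SΦ D) :
    π (D (M.lagrAnti1Gh ν)) = 0 := by
  have e1 := M.f_br_mid hπ M.uBar M.uBar M.uBar (M.A ν) hlin
  have e2 := M.B4_pair hπ M.uBar (M.A ν) M.uBar M.uBar
  have e2' := M.B4_pair hπ M.uBar (M.A μ) M.uBar M.uBar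
  simp only [B4_odd_odd_odd hπ hJ, smul_zero, bsign_vals, Bool.xor_self, one_smul] at e1 e2 e2'
  rw [e2, neg_zero] at e1
  have h0 : D.compLeft ι M.divv = S1 ρ := by
    rw [hD.divv, sum_eq_single ρ (fun b _ hb => by simp [deltaF, hb]) (by simp)]; simp [deltaF]
  have h1 : π (F3 M.f M.uBar (S1 ρ) (M.A ν)) = 0 := by
    rw [hS1]; split_ifs
    · simp only [map_smul, smul_apply, e1, smul_zero]
    · simp
  simp only [lagrAnti1Gh, map_sub, map_add, map_smul, F3_der hD.der, hD.u, hD.uBar, hD.A, hD.Φ,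
    h0, h1, hD.du, hD.duBar, zero_smul, map_zero, zero_apply, smul_zero,
    add_zero, zero_add, deltaF]
  split_ifs with h
  · simp [M.f_br_left _ _ _ _ hlin, e2']
  · simp

lemma var1_lagrAnti1Gh (μ ν : Fin 4) (hν : ν ≠ μ) (hS1 : ∀ ν, S1 ν =
      if ν = μ then (1 / 2 * η μ) • br M.f M.uBar M.uBar else 0)
    (hD : M.IsJetDer false 1 dF S1 (br M.f M.uBar (M.A μ)) 0 0 D) :
    π (D (M.lagrAnti1Gh ν)) = -(η μ • π (M.B4 M.uBar (M.A ν) M.uBar (dF μ M.uBar))) -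
      (2 * η ν) • π (M.B4 M.uBar (M.A μ) M.uBar (dF ν M.uBar)) := by
  have h0 : D.compLeft ι M.divv = (1 / 2 * η μ) • dF μ (br M.f M.uBar M.uBar) := by
    rw [hD.divv, sum_eq_single μ (fun b _ hb => by simp [hS1, hb]) (by simp), hS1, if_pos rfl,
      map_smul]
  have e1 := M.f_br_mid hπ M.uBar (dF μ M.uBar) M.uBar (M.A ν) hlin
  have e2 := M.f_br_mid hπ M.uBar M.uBar (dF μ M.uBar) (M.A ν) hlin
  have e3 := M.B4_swap₃ hπ M.uBar (M.A ν) (dF μ M.uBar) M.uBar hlin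
  have e4 := M.B4_pair hπ (dF ν M.uBar) (M.A μ) M.uBar M.uBar
  have e5 := M.B4_swap₃ hπ M.uBar M.uBar (dF ν M.uBar) (M.A μ) hlin
  have e6 := B4_odd_odd hπ hlin hJ M.uBar (M.A μ) (dF ν M.uBar)
  have e7 := M.B4_pair hπ M.uBar (dF ν (M.A μ)) M.uBar M.uBar
  simp only [B4_odd_odd_odd hπ hJ, bsign_vals, one_smul, mul_one, smul_zero, Bool.xor_self] at e1 e2 e3 e4 e5 e6 e7
  simp only [lagrAnti1Gh, map_sub, map_add, map_smul, F3_der hD.der, hD.u, hD.uBar, hD.A, hD.Φ, h0,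
    hD.du, hD.duBar, map_zero, zero_apply, smul_zero, add_zero, zero_add, sub_zero, one_smul,
    bsign_vals, hS1 ν, if_neg hν, mul_one, smul_apply, br_der (isDer_wickD _), add_apply,
    M.f_br_left _ _ _ _ hlin]
  linear_combination (norm := module) (1 / 2 * η μ) • (e1 + e2 - e3) +
    (1 / 2 * η ν) • (e4 + e5 - e6 + e7)

end GhostTotal

section GhostVariation

variable {ι τ : Type*} [Fintype ι] [Fintype τ] {M : YangMills ι τ} {R : Type*} [Ring R] [Algebra ℂ R]
  {π : Wick ι τ →ₐ[ℂ] R} (hπ : Graded π) (hlin : M.LinearRelations) (hJ : M.Jacobi)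
  (hR : M.BoseRep) {d D d1 : Wick ι τ →ₗ[ℂ] Wick ι τ}

include hπ hlin hJ

lemma var_brst_lagr1Gh (μ : Fin 4) {S1 : Fin 4 → ι → Wick ι τ}
    (hD : M.IsJetDer true 1 dF (fun ν => br M.f M.u (M.A ν)) ((1 / 2 : ℂ) • br M.f M.u M.u) 0
      (M.act M.Φ M.u) D)
    (hE : M.IsJetDer false 1 dF S1 0 0 0 d1)
    (hS1 : ∀ ν, S1 ν = if ν = μ then (1 / 2 * η μ) • br M.f M.u M.u else 0) :
    π (D (M.lagr1Gh μ)) + π (d1 M.lagrGh) = 0 := by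
  have e1 := M.f_br_mid hπ M.u M.u M.u (dF μ M.uBar) hlin
  have e2 := M.B4_pair hπ M.u (dF μ M.uBar) M.u M.u
  simp only [B4_odd_odd_odd hπ hJ, smul_zero, bsign_vals, Bool.xor_self, one_smul] at e1 e2
  rw [e2, neg_zero] at e1
  have h : ∀ ν, π (d1 (F3 M.f M.u (M.A ν) (dF ν M.uBar))) = 0 := by
    intro ν
    simp only [F3_der hE.der, hE.A, hE.u, hE.duBar, hS1, map_zero, zero_apply, smul_zero, zero_add,
      add_zero, one_smul, bsign_vals]
    split_ifs with h
    · subst h; simp only [map_smul, smul_apply, e1, smul_zero]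
    · simp
  simp only [lagrGh, map_add, map_sum, h, sum_const_zero]
  simp only [lagr1Gh, map_smul, F3_der hD.der, F3_der hE.der, hD.u,
    hD.duBar, hE.Φ, hE.u, hE.uBar, map_zero, zero_apply, smul_zero, add_zero, one_smul,
    smul_apply, M.f_br_left _ _ _ _ hlin, e1, B4_odd_odd_odd hπ hJ, map_add]

include hR

lemma var_brst_lagrGh (hD : M.IsJetDer true 1 dF (fun ν => br M.f M.u (M.A ν))
    ((1 / 2 : ℂ) • br M.f M.u M.u) 0 (M.act M.Φ M.u) D) : π (D M.lagrGh) = 0 := by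
  have h : ∀ μ, π (D (F3 M.f M.u (M.A μ) (dF μ M.uBar))) = 0 := by
    intro μ
    have e1 := M.f_br_mid hπ M.u M.u (M.A μ) (dF μ M.uBar) hlin
    have e2 := M.B4_pair hπ M.u (dF μ M.uBar) M.u (M.A μ)
    have e3 := B4_odd_odd hπ hlin hJ M.u (M.A μ) (dF μ M.uBar)
    simp only [F3_der hD.der, hD.A, hD.u, hD.duBar, map_zero, map_add, map_smul, smul_zero,
      add_zero, one_smul, bsign_vals, Bool.xor_false, smul_apply, mul_one,
      M.f_br_left _ _ _ _ hlin] at *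
    linear_combination (norm := module) -e1 - e2 + (1 / 2 : ℂ) • e3
  have e1 := f'_inv hπ M.Φ M.u M.u (sc M.mc M.uBar) hlin hR
  have e2 := f'_eq_dot (M := M) hπ M.Φ (M.act (sc M.mc M.uBar) M.u) M.u
  have e3 : π (F3 M.f' (M.act M.Φ M.u) (sc M.mc M.uBar) M.u) = _ :=
    congrArg π (M.f'_eq_neg_dot _ _ _ hlin)
  simp only [lagrGh, map_add, map_sum, h, sum_const_zero, zero_add]
  clear h
  simp only [F3_der hD.der, hD.Φ, hD.u, hD.uBar, smul_zero, map_zero, zero_apply,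
    add_zero]
  simp only [map_add, map_smul, F3_fpm, bsign_vals, one_smul, map_neg, Bool.xor_self] at *
  linear_combination (norm := module) -(1 / 2 : ℂ) • (e1 - e2 - e3)

omit hJ hR in
lemma br_f_swap (k : ι → ι → ι → ℂ) (X Y Z W : ι → Wick ι τ) {z t : Bool} [Homog Z z] [Homog W t] :
    π (F3 k X Y (br M.f Z W)) = -(bsign z t • π (F3 k X Y (br M.f W Z))) := by
  have : (fun a b p q => ∑ c, M.f q p c * k a b c) = fun a b p q =>
      -1 * ∑ c, M.f p q c * k a b c := by
    funext a b p q
    rw [neg_one_mul, ← sum_neg_distrib]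
    exact sum_congr rfl fun c _ => by rw [hlin.f_antisymm₁ p q c, neg_mul]
  rw [F3_br_right, F3_br_right, hπ.Q4_swap₃, this, ← Q4_smul, map_smul]
  module

lemma var_antiBrst_lagrGh (hD : M.IsJetDer true 1 dF (fun ν => br M.f M.uBar (M.A ν))
    (br M.f M.u M.uBar) ((1 / 2 : ℂ) • br M.f M.uBar M.uBar) (M.act M.Φ M.uBar) D) :
    π (D M.lagrGh) = 0 := by
  have h : ∀ μ, π (D (F3 M.f M.u (M.A μ) (dF μ M.uBar))) = 0 := by
    intro μ
    have e1 := M.f_br_mid hπ M.u M.uBar (M.A μ) (dF μ M.uBar) hlin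
    have e2 := M.B4_pair hπ M.u (dF μ M.uBar) M.uBar (M.A μ)
    have e3 := M.B4_swap₃ hπ M.u (M.A μ) (dF μ M.uBar) M.uBar hlin
    have e4 := M.B4_jacobi hπ M.u M.uBar (M.A μ) (dF μ M.uBar) hJ
    have e5 := M.B4_swap₁ hπ (M.A μ) M.u M.uBar (dF μ M.uBar) hlin
    simp only [F3_der hD.der, hD.A, hD.u, hD.duBar, map_add, map_smul, br_der (isDer_wickD _),
      one_smul, bsign_vals, Bool.xor_false, smul_apply, mul_one, M.f_br_left _ _ _ _ hlin,
      f_br_right] at *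
    linear_combination (norm := module) -e1 - e2 - (1 / 2 : ℂ) • e3 + e4 - e5
  have e1 := fpm_inv hπ M.Φ M.uBar M.uBar M.u hlin hR
  have e2 := br_f_swap hπ hlin M.fpm M.Φ M.uBar M.uBar M.u
  have e3 := f'_eq_dot (M := M) hπ M.Φ (M.act (sc M.mc M.uBar) M.uBar) M.u
  have e4 := hπ.dot_swap (M.act M.Φ M.u) (M.act (sc M.mc M.uBar) M.uBar)
  have e5 := fpm_br hπ M.Φ M.uBar M.u hlin
  simp only [lagrGh, map_add, map_sum, h, sum_const_zero, zero_add]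
  clear h
  simp only [F3_der hD.der, hD.Φ, hD.u, hD.uBar, map_add, map_smul, smul_apply, bsign_vals,
    one_smul, mul_one, Bool.xor_self, Bool.false_xor] at *
  linear_combination (norm := module) e1 + e2 - (1 / 2 : ℂ) • e5 + e3 + e4

omit hJ in
lemma antiBrst_mass_mixing (μ : Fin 4) :
    -(1 / 2 : ℂ) • π (M.B4 M.uBar M.uBar (M.A μ) (sc M.mc M.Φ)) +
      π (F3 M.f M.uBar (br M.f M.uBar (M.A μ)) (sc M.mc M.Φ)) +
      π (F3 M.f M.uBar (M.A μ) (sc M.mc (M.act M.Φ M.uBar))) +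
      π (F3 M.fpm M.Φ M.uBar (br M.f M.uBar (M.A μ))) +
      (1 / 2 : ℂ) • π (M.B4 (sc M.mc M.Φ) (M.A μ) M.uBar M.uBar) = 0 := by
  have a1 := fpm_inv hπ M.Φ M.uBar M.uBar (M.A μ) hlin hR
  have a2 := fpm_inv hπ M.Φ M.uBar (M.A μ) M.uBar hlin hR
  have a4 := f'_inv hπ M.Φ M.uBar (M.A μ) (sc M.mc M.uBar) hlin hR
  have a5 := f'_eq_dot (M := M) hπ M.Φ (M.act (sc M.mc M.uBar) M.uBar) (M.A μ)
  have a6 : π (F3 M.f' (M.act M.Φ M.uBar) (sc M.mc M.uBar) (M.A μ)) = _ :=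
    congrArg π (M.f'_eq_neg_dot _ _ _ hlin)
  have a7 := hπ.dot_swap (M.act M.Φ M.uBar) (M.act (sc M.mc M.uBar) (M.A μ))
  have a8 := hπ.dot_swap (M.act M.Φ (M.A μ)) (M.act (sc M.mc M.uBar) M.uBar)
  have b1 := fpm_skew hπ (M.act M.Φ M.uBar) M.uBar (M.A μ) hlin
  have b2 := fpm_skew hπ M.Φ M.uBar (br M.f M.uBar (M.A μ)) hlin
  have b3 := fpm_skew hπ M.Φ (M.A μ) (br M.f M.uBar M.uBar) hlin
  have c1 := M.f_swap₂ hπ hlin M.uBar (br M.f M.uBar (M.A μ)) (sc M.mc M.Φ)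
  have c2 := M.f_swap₁ hπ hlin M.uBar (sc M.mc M.Φ) (br M.f M.uBar (M.A μ))
  have c3 := M.f_swap₂ hπ hlin M.uBar (M.A μ) (sc M.mc (M.act M.Φ M.uBar))
  have c4 := M.f_swap₁ hπ hlin M.uBar (sc M.mc (M.act M.Φ M.uBar)) (M.A μ)
  have c5 := M.B4_pair hπ M.uBar M.uBar (M.A μ) (sc M.mc M.Φ)
  have c6 := M.B4_swap₁ hπ (M.A μ) (sc M.mc M.Φ) M.uBar M.uBar hlin
  have c7 := congrArg π (M.f_br_right (sc M.mc M.Φ) (M.A μ) M.uBar M.uBar)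
  rw [← M.F3_fpm M.Φ] at a4
  simp only [map_neg, bsign_vals, one_smul, mul_one, Bool.xor_self, Bool.false_xor, Bool.xor_false] at *
  linear_combination (norm := module) c1 - c2 + c3 - c4 + b1 - b2 -
    (1 / 2 : ℂ) • (c5 + c6) - c7 - b3 - a1 + a2 + a4 - a5 + a6 - a7 - a8

variable (M) in
/-- The ghost part of `N^{[μ]∅}`. -/
def n1Gh (μ : Fin 4) : Wick ι τ := (-(I / 2)) • M.B4 M.u (M.A μ) M.uBar M.uBar

lemma var_antiBrst_lagr1Gh (hdiv : ∀ a, π (M.divv a) = π (M.divA a)) (μ : Fin 4)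
    {S1 : Fin 4 → ι → Wick ι τ} (hd : M.IsGaugeDer d M.uBar)
    (hdu : d.compLeft ι M.u = I • (M.divv + sc M.mc M.Φ))
    (hD : M.IsJetDer true 1 dF (fun ν => br M.f M.uBar (M.A ν))
      (br M.f M.u M.uBar) ((1 / 2 : ℂ) • br M.f M.uBar M.uBar) (M.act M.Φ M.uBar) D)
    (hE : M.IsJetDer false 1 dF S1 (br M.f M.uBar (M.A μ)) 0 0 d1)
    (hS1 : ∀ ν, S1 ν = if ν = μ then (1 / 2 * η μ) • br M.f M.uBar M.uBar else 0) :
    π (D (M.lagrAnti1Gh μ)) + π (d1 M.lagrGh) + π (d (M.n1Gh μ)) = 0 := by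
  have e0 : π (d1 M.lagrGh) = ∑ σ, π (M.B4 M.uBar (M.A μ) (M.A σ) (dF σ M.uBar)) -
      (1 / 2 * η μ) • π (M.B4 M.u (dF μ M.uBar) M.uBar M.uBar) +
      π (F3 M.fpm M.Φ M.uBar (br M.f M.uBar (M.A μ))) := by
    have h : ∀ σ, π (d1 (F3 M.f M.u (M.A σ) (dF σ M.uBar))) =
        π (M.B4 M.uBar (M.A μ) (M.A σ) (dF σ M.uBar)) -
        if σ = μ then (1 / 2 * η μ) • π (M.B4 M.u (dF μ M.uBar) M.uBar M.uBar) else 0 := by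
      intro σ
      have e1 := M.f_br_mid hπ M.u M.uBar M.uBar (dF σ M.uBar) hlin
      simp only [bsign_vals, Bool.xor_self, one_smul] at e1
      simp only [F3_der hE.der, hE.A, hE.u, hE.duBar, map_add, one_smul, bsign_vals, hS1,
        M.f_br_left _ _ _ _ hlin, map_zero, smul_zero, add_zero]
      split_ifs with h
      · subst h
        simp only [map_smul, smul_apply, e1]
        module
      · simp
    simp only [lagrGh, map_add, map_sum, h, sum_sub_distrib, sum_ite_eq',
      mem_univ, if_true]
    simp only [F3_der hE.der, hE.Φ, hE.u, hE.uBar, map_zero, mul_one, zero_apply, smul_zero,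
      one_smul, zero_add, bsign_vals]
  have e1 : π (D (F3 M.f M.uBar M.divv (M.A μ))) =
      -(1 / 2 : ℂ) • π (M.B4 M.divv (M.A μ) M.uBar M.uBar) -
        ∑ σ, π (M.B4 M.uBar (M.A μ) (M.A σ) (dF σ M.uBar)) := by
    have a0 : D.compLeft ι M.divv = ∑ σ, br M.f (dF σ M.uBar) (M.A σ) + br M.f M.uBar M.divA := by
      rw [hD.divv, divA, map_sum, ← sum_add_distrib]
      refine sum_congr rfl fun σ _ => ?_
      rw [br_der (isDer_wickD _), bsign_false_left, one_smul]
    have a1 : ∀ σ, π (F3 M.f M.uBar (br M.f (dF σ M.uBar) (M.A σ)) (M.A μ)) =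
        π (M.B4 M.uBar (M.A μ) (M.A σ) (dF σ M.uBar)) := by
      intro σ
      have e1 := M.f_br_mid hπ M.uBar (dF σ M.uBar) (M.A σ) (M.A μ) hlin
      have e2 := M.B4_swap₃ hπ M.uBar (M.A μ) (dF σ M.uBar) (M.A σ) hlin
      simp only [bsign_vals, one_smul] at e1 e2
      rw [e1, e2, neg_neg]
    have a2 : π (F3 M.f M.uBar (br M.f M.uBar M.divA) (M.A μ)) =
        π (F3 M.f M.uBar (br M.f M.uBar M.divv) (M.A μ)) := by
      simp only [F3_apply, br_apply, map_sum, map_smul, map_mul, hdiv]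
    have a3 := M.f_br_mid hπ M.uBar M.uBar M.divv (M.A μ) hlin
    have a4 := M.B4_pair hπ M.uBar (M.A μ) M.uBar M.divv
    have a5 := B4_odd_odd hπ hlin hJ M.uBar M.divv (M.A μ)
    have a6 := M.B4_pair hπ M.uBar M.uBar M.divv (M.A μ)
    simp only [F3_der hD.der, hD.A, hD.uBar, a0, map_add, map_sum, add_apply, sum_apply, a1, a2,
      map_smul, smul_apply, one_smul, bsign_vals, mul_one, M.f_br_left _ _ _ _ hlin, f_br_right] at *
    linear_combination (norm := module) -a3 + a4 + a5 - (1 / 2 : ℂ) • a6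
  have e2 : π (D (F3 M.f M.u M.uBar (dF μ M.uBar))) =
      -(1 / 2 : ℂ) • π (M.B4 M.u (dF μ M.uBar) M.uBar M.uBar) := by
    have a1 := M.f_br_mid hπ M.u M.uBar M.uBar (dF μ M.uBar) hlin
    have a2 := M.B4_swap₃ hπ M.u M.uBar (dF μ M.uBar) M.uBar hlin
    have a3 := M.B4_jacobi hπ M.uBar M.uBar (dF μ M.uBar) M.u hJ
    have a4 := M.B4_swap₁ hπ (dF μ M.uBar) M.uBar M.uBar M.u hlin
    have a5 := M.B4_pair hπ M.uBar M.uBar (dF μ M.uBar) M.u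
    have a6 := M.B4_swap₁ hπ (dF μ M.uBar) M.u M.uBar M.uBar hlin
    have a7 := M.B4_pair hπ M.uBar (dF μ M.uBar) M.uBar M.u
    have a8 := M.B4_swap₁ hπ M.uBar M.u M.uBar (dF μ M.uBar) hlin
    simp only [F3_der hD.der, hD.u, hD.uBar, hD.duBar, map_add, map_smul, smul_apply, one_smul,
      bsign_vals, br_der (isDer_wickD _), Bool.xor_self, mul_neg, mul_one, neg_neg,
      M.f_br_left _ _ _ _ hlin, f_br_right] at *
    linear_combination (norm := module) -(1 / 2 : ℂ) • a1 + (1 / 2 : ℂ) • a2 + a3 - a4 - a5 - a6 -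
      (2 : ℂ) • a7 - (2 : ℂ) • a8
  have e3 : π (D (F3 M.f (dF μ M.u) M.uBar M.uBar)) =
      π (M.B4 M.u (dF μ M.uBar) M.uBar M.uBar) := by
    have a1 := M.f_br_mid hπ (dF μ M.u) M.uBar M.uBar M.uBar hlin
    have a2 := B4_right_odd hπ hlin hJ M.uBar (dF μ M.u)
    simp only [F3_der hD.der, hD.du, hD.uBar, map_add, map_smul, smul_apply, one_smul, bsign_vals,
      br_der (isDer_wickD _), Bool.xor_self, mul_neg, mul_one, neg_neg, add_apply,
      M.f_br_left _ _ _ _ hlin, f_br_right, a2, smul_zero, neg_zero] at *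
    linear_combination (norm := module) -(1 / 2 : ℂ) • a1
  have e4 : π (D (F3 M.fm M.uBar (M.A μ) M.Φ)) =
      (1 / 2 : ℂ) • π (M.B4 M.uBar M.uBar (M.A μ) (sc M.mc M.Φ)) -
      π (F3 M.f M.uBar (br M.f M.uBar (M.A μ)) (sc M.mc M.Φ)) -
      π (F3 M.f M.uBar (M.A μ) (sc M.mc (M.act M.Φ M.uBar))) := by
    simp only [F3_der hD.der, hD.A, hD.uBar, hD.Φ]
    simp only [map_add, map_smul, smul_apply, one_smul, bsign_vals, mul_one, F3_fm,
      M.f_br_left _ _ _ _ hlin]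
    module
  have e5 : π (d (M.n1Gh μ)) = (1 / 2 : ℂ) • (π (M.B4 M.divv (M.A μ) M.uBar M.uBar) +
      π (M.B4 (sc M.mc M.Φ) (M.A μ) M.uBar M.uBar) -
      η μ • π (M.B4 M.u (dF μ M.uBar) M.uBar M.uBar)) := by
    simp only [n1Gh, map_smul, Q4_der hd.der, hd.A, hd.gh, hdu, map_add, add_apply, smul_apply,
      bsign_vals, map_zero, smul_zero, add_zero, zero_apply]
    match_scalars
    · linear_combination -(1 / 2) * I_mul_I
    · linear_combination -(1 / 2) * I_mul_I
    · linear_combination (1 / 2 * η μ) * I_mul_I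
  have e6 := antiBrst_mass_mixing hπ hlin hR μ
  rw [e0, e5]
  simp only [lagrAnti1Gh, map_add, map_sub, map_smul, e1, e2, e3, e4]
  linear_combination (norm := module) e6

end GhostVariation

end YangMills

namespace YangMills

section DiracSector

variable {ι τ : Type*} [Fintype ι] [Fintype τ] [DecidableEq τ] {M : YangMills ι τ} {R : Type*}
  [Ring R] [Algebra ℂ R] {π : Wick ι τ →ₐ[ℂ] R} (hπ : Graded π) (hbil : M.BilinearRelations)
  {w Su Sb : ι → Wick ι τ} [hw : Homog w true] {D d1 : Wick ι τ →ₗ[ℂ] Wick ι τ}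

include hπ in
lemma der_mdot (hD : IsDer true D) (hψ : ∀ i, D (psiF i) = -I • M.repPsi w i)
    (hψ' : ∀ i, D (psiBarF i) = I • M.repPsiBar w i)
    (k : Matrix (τ × Fin 4) (τ × Fin 4) ℂ) :
    π (D (mdot k psiBarF psiF)) =
      I • ∑ a, π (w a * mdot (M.ΓBar a * k - k * M.Γ a) psiBarF psiF) := by
  have e1 : mdot k (M.repPsiBar w) psiF = ∑ a, w a * mdot (M.ΓBar a * k) psiBarF psiF := by
    simp only [← mdot_vm]
    simp only [mdot_apply, repPsiBar, sum_mul, mul_sum, smul_sum,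
      mul_smul_comm, mul_assoc]
    rw [sum_congr rfl fun i _ => sum_comm, sum_comm]
  have e2 : π (mdot k psiBarF (M.repPsi w)) =
      -∑ a, π (w a * mdot (k * M.Γ a) psiBarF psiF) := by
    have h : ∀ i a, π (psiBarF i) * π (w a) = -(π (w a) * π (psiBarF i)) := fun i a => by
      rw [← map_mul, hπ.comm (psiBarF_parity i) (hw.parity a), map_mul, bsign_true_true,
        neg_one_smul]
    simp only [← mdot_mv]
    simp only [mdot_apply, repPsi, mul_sum, smul_sum, map_sum, map_smul, map_mul,
      mul_smul_comm, ← mul_assoc, h, neg_mul, smul_neg, sum_neg_distrib]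
    rw [sum_congr rfl fun i _ => sum_comm, sum_comm]
  have h1 : D.compLeft _ psiF = -I • M.repPsi w := funext hψ
  have h2 : D.compLeft _ psiBarF = I • M.repPsiBar w := funext hψ'
  rw [mdot_der hD _ psiBarF_parity, h1, h2]
  simp only [map_smul, smul_apply, map_add, e1, e2, mdot_sub, mul_sub, map_sub, map_sum,
    sum_sub_distrib, bsign_vals]
  module

include hπ hbil

lemma der_jV (hD : IsDer true D) (hψ : ∀ i, D (psiF i) = -I • M.repPsi w i)
    (hψ' : ∀ i, D (psiBarF i) = I • M.repPsiBar w i) (μ : Fin 4) (b : ι) :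
    π (D (M.jV μ b)) = -π (br (fun a c b => M.f a b c) w (M.jV μ) b) := by
  have h : ∀ a, M.ΓBar a * (M.γK μ * M.Γ b) - M.γK μ * M.Γ b * M.Γ a =
      ∑ c, (I * M.f a b c) • (M.γK μ * M.Γ c) := by
    intro a
    rw [← mul_assoc, ← γK_mul_Γ, mul_assoc, mul_assoc, ← mul_sub, M.Γ_commutator hbil,
      mul_sum]
    simp only [mul_smul_comm]
  rw [jV_eq, der_mdot hπ hD hψ hψ']
  simp only [h, mdot_sum, mdot_smul, ← jV_eq]
  simp only [br_apply, mul_sum, mul_smul_comm, map_sum, map_smul, smul_sum, smul_smul, ← mul_assoc, I_mul_I, neg_mul, one_mul, neg_smul,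
    sum_neg_distrib]

lemma der_jScal (hD : IsDer true D) (hψ : ∀ i, D (psiF i) = -I • M.repPsi w i)
    (hψ' : ∀ i, D (psiBarF i) = I • M.repPsiBar w i) (b : ι) :
    π (D (M.jScal b)) = -π (br (fun a c b => M.f' b c a) w M.jScal b) := by
  rw [jScal_eq, der_mdot hπ hD hψ hψ']
  simp only [M.sK_tensor hbil, mdot_sum, mdot_smul, ← jScal_eq, br_apply, mul_sum,
    mul_smul_comm, map_sum, map_smul, smul_sum, smul_smul, ← mul_assoc, I_mul_I,
    neg_mul, one_mul, neg_smul, sum_neg_distrib]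

variable (hD : M.IsJetDer true 1 dF (fun ν => br M.f w (M.A ν)) Su Sb (M.act M.Φ w) D)
  (hψ : ∀ i, D (psiF i) = -I • M.repPsi w i)
  (hψ' : ∀ i, D (psiBarF i) = I • M.repPsiBar w i)
include hD hψ hψ'

lemma der_dot_jV (μ : Fin 4) (X : ι → Wick ι τ) : π (dot (D.compLeft ι (M.jV μ)) X) =
    -π (F3 (fun a c b => M.f a b c) w (M.jV μ) X) := by
  rw [← dot_br_left]
  simp only [dot_apply, map_sum, map_mul, compLeft_apply, Function.comp_apply,
    der_jV hπ hbil hD.der hψ hψ', neg_mul, sum_neg_distrib]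

lemma var_lagrDi : π (D M.lagrDi) = 0 := by
  have h1 : ∀ μ, π (D (dot (M.jV μ) (M.A μ))) = 0 := by
    intro μ
    rw [dot_der hD.der, hD.A, map_add, der_dot_jV hπ hbil hD hψ hψ', one_smul, bsign_false_right,
      one_smul, dot_br_right, hπ.F3_swap₁ _ (M.jV μ), bsign_false_left, one_smul,
      neg_add_cancel]
  have h2 : π (D (dot M.jScal M.Φ)) = 0 := by
    have h : π (dot (D.compLeft ι M.jScal) M.Φ) =
        -π (F3 (fun a c b => M.f' b c a) w M.jScal M.Φ) := by
      rw [← dot_br_left]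
      simp only [dot_apply, map_sum, map_mul, compLeft_apply, Function.comp_apply,
        der_jScal hπ hbil hD.der hψ hψ', neg_mul, sum_neg_distrib]
    rw [dot_der hD.der, hD.Φ, map_add, h, one_smul, bsign_false_right, one_smul, dot_br_right,
      hπ.F3_swap₂ _ M.jScal, hπ.F3_swap₁ _ M.jScal, bsign_false_left, one_smul, one_smul,
      neg_add_cancel]
  simp only [lagrDi, map_add, map_sum, map_smul, h1, h2, smul_zero, sum_const_zero, add_zero]

lemma var_dot_jV (hDw : D.compLeft ι w = (1 / 2 : ℂ) • br M.f w w) (μ : Fin 4)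
    {S1 : Fin 4 → ι → Wick ι τ} {Su' Sb' : ι → Wick ι τ} (hE : M.IsJetDer false 1 dF S1 Su' Sb' 0 d1)
    (hS1 : ∀ ν, S1 ν = if ν = μ then (1 / 2 * η μ) • br M.f w w else 0)
    (hj : ∀ ν, d1.compLeft ι (M.jV ν) = 0) (hj' : d1.compLeft ι M.jScal = 0) :
    π (D (dot (M.jV μ) w)) + π (d1 M.lagrDi) = 0 := by
  have h : ∀ ν, η ν • π (d1 (dot (M.jV ν) (M.A ν))) =
      if ν = μ then (1 / 2 : ℂ) • π (dot (M.jV μ) (br M.f w w)) else 0 := by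
    intro ν
    rw [dot_der hE.der, hj, hE.A, hS1]
    split_ifs with h
    · subst h
      simp only [map_zero, zero_apply, one_smul, map_smul, zero_add, bsign_vals, smul_smul]
      congr 1
      linear_combination (1 / 2) * η_mul_self ν
    · simp
  have e1 := hπ.F3_swap₂ (fun a c b => M.f a b c) w (M.jV μ) w
  have e2 := hπ.dot_swap (M.jV μ) (br M.f w w)
  rw [dot_br_left] at e2
  simp only [bsign_vals, one_smul] at e1 e2
  change _ = π (F3 M.f w w (M.jV μ)) at e1
  simp only [lagrDi, map_add, map_sum, map_smul, h, sum_ite_eq', mem_univ, if_true]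
  simp only [map_add, map_smul, dot_der hE.der, hj', hE.Φ, dot_der hD.der, hDw,
    der_dot_jV hπ hbil hD hψ hψ', e1, map_zero, zero_apply, smul_zero, bsign_vals, one_smul, e2]
  module

end DiracSector

end YangMills

namespace YangMills

section Sector

variable {ι τ : Type*} [Fintype ι] [Fintype τ] (M : YangMills ι τ)

/-- The chain of the Lagrangian for the ghosts `w`, with the ghost part `Gh` of `T^μ`. -/
def chain (w : ι → Wick ι τ) (Gh : Fin 4 → Wick ι τ) : List (Fin 4) → Wick ι τ
  | [] => M.lagrYM + M.lagrGh + M.lagrSc + M.lagrDi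
  | [μ] => M.lagr1YM w μ + Gh μ + M.lagr1Sc w μ + dot (M.jV μ) w
  | [μ, ν] => M.lagr2N w μ ν
  | _ => 0

/-- The renormalizations, with the ghost part `nGh` of `N^{μ}`. -/
def chainN (h : ι → ι → ι → ι → ℂ) (w : ι → Wick ι τ) (nGh : Fin 4 → Wick ι τ) (c : ℂ) :
    List (Fin 4) → List (Fin 4) → Wick ι τ
  | [], [] => M.n0YM + M.n0Sc + (1 / 24 : ℂ) • Q4 h M.Φ M.Φ M.Φ M.Φ
  | [μ], [] => M.n1YM w μ + nGh μ + M.n1Sc w μ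
  | [], [μ] => M.n1YM w μ + nGh μ + M.n1Sc w μ
  | [μ], [ν] => (-c) • M.n2 w μ ν
  | [μ, ν], [] => M.n2 w μ ν
  | [], [μ, ν] => M.n2 w μ ν
  | _, _ => 0

/-- The variations which belong to a chain. -/
def chainVar (w G G' : ι → Wick ι τ) (K : Fin 4 → ι → Wick ι τ) :
    List (Fin 4) → BasicField ι τ → Wick ι τ
  | [] => M.gaugeVar w G G'
  | [μ] => M.gaugeVar1 w (K μ) μ
  | _ => 0

/-- The first variation of the vector fields. -/
def var1 (w : ι → Wick ι τ) (μ ν : Fin 4) : ι → Wick ι τ :=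
  if ν = μ then (1 / 2 * η μ) • br M.f w w else 0

/-- The properties of the ghost parts of a chain, used in the proof of gauge invariance. -/
structure IsSector {R : Type*} [Ring R] [Algebra ℂ R] (π : Wick ι τ →ₐ[ℂ] R)
    (d : Wick ι τ →ₗ[ℂ] Wick ι τ) (w G G' : ι → Wick ι τ) (K : Fin 4 → ι → Wick ι τ)
    (Gh nGh : Fin 4 → Wick ι τ) (c : ℂ) : Prop where
  gauge : M.IsGaugeDer d w
  higgs : ∀ a, M.kind a = .higgs → G a = 0
  higgs' : ∀ a, M.kind a = .higgs → G' a = 0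
  higgs₁ : ∀ μ a, M.kind a = .higgs → K μ a = 0
  gh : ∀ {ε c P SA SΦ D}, M.IsJetDer ε c P SA G G' SΦ D →
    D.compLeft ι w = c • (1 / 2 : ℂ) • br M.f w w
  gh1 : ∀ {ε c P SA SΦ D} (μ), M.IsJetDer ε c P SA (K μ) 0 SΦ D → D.compLeft ι w = 0
  tot : ∀ ρ D, M.IsJetDer true 0 (deltaF ρ) (fun ν => br M.f w (M.A ν)) G G' (M.act M.Φ w) D →
    π (D M.lagrGh) = -I • π (nGh ρ)
  tot' : ∀ ρ ν D, M.IsJetDer true 0 (deltaF ρ) (fun ν => br M.f w (M.A ν)) G G' (M.act M.Φ w) D →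
    π (D (Gh ν)) = (1 - c) • π (M.B4 w (M.A ρ) w (M.A ν))
  tot1 : ∀ ρ μ D, M.IsJetDer false 0 (deltaF ρ) (M.var1 w μ) (K μ) 0 0 D → π (D M.lagrGh) = 0
  tot1' : ∀ ρ μ ν D, M.IsJetDer false 0 (deltaF ρ) (M.var1 w μ) (K μ) 0 0 D → π (D (Gh ν)) = 0
  var : ∀ D, M.IsJetDer true 1 dF (fun ν => br M.f w (M.A ν)) G G' (M.act M.Φ w) D →
    π (D M.lagrGh) = 0
  var' : ∀ μ D d1, M.IsJetDer true 1 dF (fun ν => br M.f w (M.A ν)) G G' (M.act M.Φ w) D →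
    M.IsJetDer false 1 dF (M.var1 w μ) (K μ) 0 0 d1 →
    π (D (Gh μ)) + π (d1 M.lagrGh) + π (d (nGh μ)) = 0
  var1' : ∀ μ ν D, ν ≠ μ → M.IsJetDer false 1 dF (M.var1 w μ) (K μ) 0 0 D → π (D (Gh ν)) =
    (1 - c) • (η μ • π (M.B4 w (M.A ν) w (dF μ w)) + (2 * η ν) • π (M.B4 w (M.A μ) w (dF ν w)))

variable {M} {R : Type*} [Ring R] [Algebra ℂ R] {π : Wick ι τ →ₐ[ℂ] R} (hπ : Graded π)

section Instances

variable [DecidableEq ι] [DecidableEq τ] (hlin : M.LinearRelations) (hJ : M.Jacobi)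
  (hR : M.BoseRep)
include hπ hlin hJ hR

lemma isSector_brst : M.IsSector π (derExt paritySign (jetDer M.brstField)) M.u
    ((1 / 2 : ℂ) • br M.f M.u M.u) 0 0 M.lagr1Gh 0 1 where
  gauge := M.brst_isGaugeDer
  higgs a h := by rw [Pi.smul_apply, M.br_f_higgs hlin _ _ h, smul_zero]
  higgs' _ _ := rfl
  higgs₁ _ _ _ := rfl
  gh h := h.u
  gh1 μ h := by rw [h.u]; simp
  tot ρ D h := by rw [tot_lagrGh ρ h]; simp
  tot' ρ ν D h := by rw [tot_lagr1Gh ρ ν h]; simp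
  tot1 ρ μ D h := by rw [tot_lagrGh ρ h]; simp
  tot1' ρ μ ν D h := by rw [tot_lagr1Gh ρ ν h]; simp
  var D h := var_brst_lagrGh hπ hlin hJ hR h
  var' μ D d1 h h1 := by
    simpa using var_brst_lagr1Gh hπ hlin hJ μ h h1 fun _ => rfl
  var1' μ ν D hν h := by
    simp only [lagr1Gh, map_smul, F3_der h.der, h.u, h.duBar]; simp

lemma isSector_antiBrst (hdiv : ∀ a, π (M.divv a) = π (M.divA a)) :
    M.IsSector π (derExt paritySign (jetDer M.antiBrstField)) M.uBar (br M.f M.u M.uBar)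
      ((1 / 2 : ℂ) • br M.f M.uBar M.uBar) (fun μ => br M.f M.uBar (M.A μ)) M.lagrAnti1Gh
      M.n1Gh 2 where
  gauge := M.antiBrst_isGaugeDer
  higgs a h := M.br_f_higgs hlin _ _ h
  higgs' a h := by rw [Pi.smul_apply, M.br_f_higgs hlin _ _ h, smul_zero]
  higgs₁ _ a h := M.br_f_higgs hlin _ _ h
  gh h := h.uBar
  gh1 μ h := by rw [h.uBar]; simp
  tot ρ D h := by
    rw [tot_lagrGh ρ h, n1Gh, map_smul (F3 _ _ _), f_br_right]
    simp only [map_smul, bsign_vals]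
    match_scalars
    linear_combination -(1 / 2 : ℂ) * I_mul_I
  tot' ρ ν D h := by rw [tot_lagrAnti1Gh hπ hlin hJ ρ ν h]; module
  tot1 ρ μ D h := by rw [tot_lagrGh ρ h]; simp
  tot1' ρ μ ν D h := tot1_lagrAnti1Gh hπ hlin hJ ρ μ ν (fun _ => rfl) h
  var D h := var_antiBrst_lagrGh hπ hlin hJ hR h
  var' μ D d1 h h1 := var_antiBrst_lagr1Gh hπ hlin hJ hR hdiv μ M.antiBrst_isGaugeDer M.antiBrst_u
    h h1 fun _ => rfl
  var1' μ ν D hν h := by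
    rw [var1_lagrAnti1Gh hπ hlin hJ μ ν hν (fun _ => rfl) h]; module

end Instances

variable {d : Wick ι τ →ₗ[ℂ] Wick ι τ} {w G G' : ι → Wick ι τ} [Homog w true]
  {K : Fin 4 → ι → Wick ι τ} {Gh nGh : Fin 4 → Wick ι τ} {c : ℂ}
  (hS : M.IsSector π d w G G' K Gh nGh c) (hlin : M.LinearRelations)

lemma compLeft_currents {ε : Bool} {D : Wick ι τ →ₗ[ℂ] Wick ι τ} (hD : IsDer ε D)
    (h : ∀ i, D (psiF i) = 0) (h' : ∀ i, D (psiBarF i) = 0) :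
    (∀ μ, D.compLeft ι (M.jV μ) = 0) ∧ D.compLeft ι M.jScal = 0 := by
  have hb : ∀ (x : Matrix τ τ ℂ) G, D (bilin x G) = 0 := fun x G => by
    have e : ∀ A r q B, D (fieldWick (.psiBar A r) * fieldWick (.psi B q)) = 0 := fun A r q B => by
      rw [hD.mul]
      change D (psiBarF (A, r)) * _ + _ * D (psiF (B, q)) = 0
      rw [h, h', zero_mul, mul_zero, add_zero]
    simp [bilin, e]
  exact ⟨fun μ => funext fun a => by simp [jV, jVec, hb], funext fun a => by simp [jScal, hb]⟩

include hlin hS in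
lemma IsSector.jetDers :
    M.IsJetDer true 1 dF (fun ν => br M.f w (M.A ν)) G G' (M.act M.Φ w)
      (derExt (gsign true) (jetVar (M.gaugeVar w G G'))) ∧
    (∀ ρ, M.IsJetDer true 0 (deltaF ρ) (fun ν => br M.f w (M.A ν)) G G' (M.act M.Φ w)
      (derExt (gsign true) (jetTot (M.gaugeVar w G G') ρ))) ∧
    (∀ μ, M.IsJetDer false 1 dF (M.var1 w μ) (K μ) 0 0
      (derExt (gsign false) (jetVar (M.gaugeVar1 w (K μ) μ)))) ∧
    ∀ μ ρ, M.IsJetDer false 0 (deltaF ρ) (M.var1 w μ) (K μ) 0 0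
      (derExt (gsign false) (jetTot (M.gaugeVar1 w (K μ) μ) ρ)) := by
  have e : ∀ μ, (fun ν a => M.gaugeVar1 w (K μ) μ (.vec a ν)) = M.var1 w μ := fun μ => by
    funext ν a; simp only [gaugeVar1, var1]; split_ifs <;> rfl
  have h0 := fun a ν (h : M.kind a = .higgs) =>
    (M.br_f_higgs hlin w (M.A ν) h : M.gaugeVar w G G' (.vec a ν) = 0)
  have h1 := fun μ a ν (h : M.kind a = .higgs) =>
    (by simp [gaugeVar1, M.br_f_higgs hlin w w h] : M.gaugeVar1 w (K μ) μ (.vec a ν) = 0)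
  have h2 := fun a h => M.varΦ_massless hlin w (c := a) h
  refine ⟨isJetDer_jetVar (M := M) (S := M.gaugeVar w G G') true h0 hS.higgs hS.higgs' h2,
    
    fun ρ => isJetDer_jetTot (M := M) (S := M.gaugeVar w G G') true ρ h0 hS.higgs hS.higgs' h2, fun μ => ?_, fun μ ρ => ?_⟩
  · rw [← e μ]
    exact isJetDer_jetVar false (h1 μ) (hS.higgs₁ μ) (fun _ _ => rfl) (fun _ _ => rfl)
  · rw [← e μ]
    exact isJetDer_jetTot false ρ (h1 μ) (hS.higgs₁ μ) (fun _ _ => rfl) (fun _ _ => rfl)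

end Sector

end YangMills

namespace YangMills

section Local

variable {ι τ : Type*} [Fintype ι] [Fintype τ] {M : YangMills ι τ} {R : Type*} [Ring R]
  [Algebra ℂ R] {π : Wick ι τ →ₐ[ℂ] R} (hπ : Graded π)
  {d : Wick ι τ →ₗ[ℂ] Wick ι τ} {w G G' : ι → Wick ι τ} [Homog w true]
  {K : Fin 4 → ι → Wick ι τ} {Gh nGh : Fin 4 → Wick ι τ} {c : ℂ}
  (hS : M.IsSector π d w G G' K Gh nGh c) (hlin : M.LinearRelations) (hJ : M.Jacobi)

include hπ hlin hJ in
lemma B4_ghosts (X Y : ι → Wick ι τ) [Homog X false] :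
    π (M.B4 w X w Y) = (1 / 2 : ℂ) • π (M.B4 w w X Y) := by
  have e1 := M.B4_jacobi hπ w w X Y hJ
  have e2 := M.B4_swap₁ hπ X w w Y hlin
  simp only [bsign_vals] at e1 e2
  rw [e2] at e1
  linear_combination (norm := module) (-1 / 2 : ℂ) • e1

include hπ hS hlin hJ

lemma IsSector.tot₀ (h : ι → ι → ι → ι → ℂ) (J : List (Fin 4)) (ρ : Fin 4)
    {D : Wick ι τ →ₗ[ℂ] Wick ι τ}
    (h0 : M.IsJetDer true 0 (deltaF ρ) (fun ν => br M.f w (M.A ν)) G G' (M.act M.Φ w) D)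
    (j1 : ∀ μ, D.compLeft ι (M.jV μ) = 0) (j2 : D.compLeft ι M.jScal = 0) :
    π (D (M.chain w Gh J)) = -(I • π (M.chainN h w nGh c [ρ] J)) := by
  have hw := hS.gh h0
  rw [zero_smul] at hw
  match J with
  | [] =>
    have e : D M.lagrDi = 0 := by simp [lagrDi, dot_der h0.der, j1, j2, h0.A, h0.Φ]
    simp only [chain, chainN, map_add, e, tot_lagrYM hπ hlin ρ h0, hS.tot ρ D h0,
      tot_lagrSc hπ ρ h0, map_zero]
    module
  | [ν] =>
    have e : D (dot (M.jV ν) w) = 0 := by simp [dot_der h0.der, j1, hw]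
    simp only [chain, chainN, map_add, e, tot_lagr1YM hπ ρ ν h0 hw, hS.tot' ρ ν D h0,
      tot_lagr1Sc hπ ρ ν h0 hw, map_zero, map_smul, n2, B4_ghosts hπ hlin hJ]
    match_scalars
    linear_combination (-c / 2) * I_mul_I
  | [μ, ν] => simp [chain, chainN, tot_lagr2N hπ hJ ρ μ ν h0 hw]
  | _ :: _ :: _ :: _ => simp [chain, chainN]

lemma IsSector.tot₁ (h : ι → ι → ι → ι → ℂ) (J : List (Fin 4)) (μ ρ : Fin 4)
    {D : Wick ι τ →ₗ[ℂ] Wick ι τ}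
    (h0 : M.IsJetDer false 0 (deltaF ρ) (M.var1 w μ) (K μ) 0 0 D)
    (j1 : ∀ μ, D.compLeft ι (M.jV μ) = 0) (j2 : D.compLeft ι M.jScal = 0) :
    π (D (M.chain w Gh J)) = -(I • π (M.chainN h w nGh c [μ, ρ] J)) := by
  have hw := hS.gh1 μ h0
  match J with
  | [] =>
    have e : D M.lagrDi = 0 := by simp [lagrDi, dot_der h0.der, j1, j2, h0.A, h0.Φ]
    have e' : D M.lagrSc = 0 := by simp [lagrSc, F3_der h0.der, h0.A, h0.Φ, h0.dΦ]
    simp only [chain, chainN, map_add, e, e', tot1_lagrYM hπ ρ μ (fun _ => rfl) h0,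
      hS.tot1 ρ μ D h0, map_zero, map_smul, n2]
    match_scalars
    linear_combination (1 / 2) * I_mul_I
  | [ν] =>
    have e : D (dot (M.jV ν) w) = 0 := by simp [dot_der h0.der, j1, hw]
    have e' : D (M.lagr1Sc w ν) = 0 := by
      simp [lagr1Sc, F3_der h0.der, h0.A, h0.Φ, h0.dΦ, hw]
    simp [chain, chainN, e, e', tot1_lagr1YM hπ hJ ρ μ (fun _ => rfl) ν h0 hw,
      hS.tot1' ρ μ ν D h0]
  | [ν, κ] =>
    simp [chain, chainN, tot1_lagr2N hπ hJ ρ μ (fun _ => rfl) ν κ h0 hw]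
  | _ :: _ :: _ :: _ => simp [chain, chainN]

lemma IsSector.tot_chain (h : ι → ι → ι → ι → ℂ) (I J : List (Fin 4)) (ρ : Fin 4) :
    π (derExt (gsign (!I.length.bodd)) (jetTot (M.chainVar w G G' K I) ρ) (M.chain w Gh J)) =
      -(Complex.I • π (M.chainN h w nGh c (I ++ [ρ]) J)) := by
  obtain ⟨-, h0, -, h1⟩ := hS.jetDers hlin
  match I with
  | [] =>
    obtain ⟨j1, j2⟩ := compLeft_currents (M := M) (h0 ρ).der
      (fun i => by rw [psiF, fieldWick, derExt_ι, jetTot_zero]; rfl)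
      (fun i => by rw [psiBarF, fieldWick, derExt_ι, jetTot_zero]; rfl)
    exact hS.tot₀ hπ hlin hJ h J ρ (h0 ρ) j1 j2
  | [μ] =>
    obtain ⟨j1, j2⟩ := compLeft_currents (M := M) (h1 μ ρ).der
      (fun i => by rw [psiF, fieldWick, derExt_ι, jetTot_zero]; rfl)
      (fun i => by rw [psiBarF, fieldWick, derExt_ι, jetTot_zero]; rfl)
    rw [List.length_singleton, Nat.bodd_one, Bool.not_true]
    exact hS.tot₁ hπ hlin hJ h J μ ρ (h1 μ ρ) j1 j2
  | μ :: ν :: I =>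
    have e : jetTot (M.chainVar w G G' K (μ :: ν :: I)) ρ = fun _ => 0 := by
      funext j; obtain ⟨φ, i⟩ := j; cases φ <;> simp [jetTot, chainVar, undiffTot]
    rw [e, derExt_zero_fun]
    cases I <;> simp [chainN]

end Local

end YangMills

namespace YangMills

section Local

variable {ι τ : Type*} [Fintype ι] [Fintype τ] [DecidableEq τ] {M : YangMills ι τ} {R : Type*}
  [Ring R] [Algebra ℂ R] {π : Wick ι τ →ₐ[ℂ] R} (hπ : Graded π)
  {d : BasicField ι τ → Wick ι τ} (hdp : ∀ φ, d φ ∈ plets (!φ.odd))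
  {w G G' : ι → Wick ι τ} [Homog w true]
  {K : Fin 4 → ι → Wick ι τ} {Gh nGh : Fin 4 → Wick ι τ} {c : ℂ}
  (hS : M.IsSector π (derExt paritySign (jetDer d)) w G G' K Gh nGh c) (hlin : M.LinearRelations)
  (hbil : M.BilinearRelations)
include hπ hS hlin hbil

omit hS in
lemma n2_swap (μ ν : Fin 4) : π (M.n2 w ν μ) = -π (M.n2 w μ ν) := by
  rw [n2, map_smul, M.B4_swap₃ hπ w w (M.A ν) (M.A μ) hlin]
  simp [n2]

lemma IsSector.var₀ {D : Wick ι τ →ₗ[ℂ] Wick ι τ}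
    (h0 : M.IsJetDer true 1 dF (fun ν => br M.f w (M.A ν)) G G' (M.act M.Φ w) D)
    (hψ : ∀ i, D (psiF i) = -I • M.repPsi w i)
    (hψ' : ∀ i, D (psiBarF i) = I • M.repPsiBar w i) {h : ι → ι → ι → ι → ℂ}
    (hh : M.IsQuarticCoupling h) : (2 : ℂ) • π (D (M.chain w Gh [])) +
      π (derExt paritySign (jetDer d) (M.chainN h w nGh c [] [])) = 0 := by
  have e1 := var_lagrYM hπ hlin hbil.jacobi hS.gauge h0
  have e2 := var_lagrSc₀ hπ hlin (M.boseRep hlin hbil) hS.gauge h0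
  have e3 := var_cubic hπ hlin hh hS.gauge h0
  simp only [chain, chainN, map_add, lagrSc_eq, hS.var D h0, var_lagrDi hπ hbil h0 hψ hψ']
  linear_combination (norm := module) e1 + e2 + e3

lemma IsSector.var₀₁ (h : ι → ι → ι → ι → ℂ) {D d1 : Wick ι τ →ₗ[ℂ] Wick ι τ} (μ : Fin 4)
    (h0 : M.IsJetDer true 1 dF (fun ν => br M.f w (M.A ν)) G G' (M.act M.Φ w) D)
    (hψ : ∀ i, D (psiF i) = -I • M.repPsi w i)
    (hψ' : ∀ i, D (psiBarF i) = I • M.repPsiBar w i)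
    (h1 : M.IsJetDer false 1 dF (M.var1 w μ) (K μ) 0 0 d1)
    (j1 : ∀ μ, d1.compLeft ι (M.jV μ) = 0) (j2 : d1.compLeft ι M.jScal = 0) :
    π (D (M.chain w Gh [μ])) + π (d1 (M.chain w Gh [])) +
      π (derExt paritySign (jetDer d) (M.chainN h w nGh c [] [μ])) = 0 := by
  have hw := hS.gh h0
  rw [one_smul] at hw
  have e1 := var_lagr1YM hπ hlin hbil.jacobi hS.gauge μ h0 hw h1 fun _ => rfl
  have e2 := var_lagr1Sc hπ hlin (M.boseRep hlin hbil) μ hS.gauge h0 hw h1 fun _ => rfl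
  have e3 := var_dot_jV hπ hbil h0 hψ hψ' hw μ h1 (fun _ => rfl) j1 j2
  simp only [chain, chainN, map_add]
  linear_combination (norm := module) e1 + e2 + e3 + hS.var' μ D d1 h0 h1

include hdp in
lemma IsSector.var₁₁ (h : ι → ι → ι → ι → ℂ) {D : Fin 4 → Wick ι τ →ₗ[ℂ] Wick ι τ}
    (h1 : ∀ μ, M.IsJetDer false 1 dF (M.var1 w μ) (K μ) 0 0 (D μ))
    (j1 : ∀ μ ν, (D μ).compLeft ι (M.jV ν) = 0) (μ ν : Fin 4) :
    π (D μ (M.chain w Gh [ν])) - π (D ν (M.chain w Gh [μ])) +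
      π (derExt paritySign (jetDer d) (M.chainN h w nGh c [μ] [ν])) = 0 := by
  by_cases hν : ν = μ
  · subst hν
    have e : toRel (exchRel ι τ) (M.n2 w ν ν) = toRel (exchRel ι τ) 0 := by
      have := M.n2_swap (graded_toRel ι τ) hlin hbil (w := w) ν ν
      rw [map_zero]
      linear_combination (norm := module) (1 / 2 : ℂ) • this
    have := hπ.der_congr (jetDer_parity hdp) e
    rw [gsign_true] at this
    simp [chainN, this]
  · have e : ∀ μ ν, ν ≠ μ → π (D μ (M.chain w Gh [ν])) =
        -(η ν • π (M.B4 w (M.A μ) w (dF ν w))) + (1 - c) • (η μ • π (M.B4 w (M.A ν) w (dF μ w)) +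
          (2 * η ν) • π (M.B4 w (M.A μ) w (dF ν w))) := by
      intro μ ν hν
      have hw := hS.gh1 μ (h1 μ)
      have e : D μ (dot (M.jV ν) w) = 0 := by simp [dot_der (h1 μ).der, j1, hw]
      have e' : D μ (M.lagr1Sc w ν) = 0 := by
        simp [lagr1Sc, F3_der (h1 μ).der, (h1 μ).A, (h1 μ).Φ, (h1 μ).dΦ, hw, var1, hν]
      simp only [chain, map_add, e, e', map_zero, hS.var1' μ ν (D μ) hν (h1 μ),
        var1_lagr1YM hπ hlin hbil.jacobi μ (fun _ => rfl) ν hν (h1 μ) hw]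
      module
    have e2 := M.B4_swap₃ hπ w w (dF μ w) (M.A ν) hlin
    rw [e μ ν hν, e ν μ (Ne.symm hν)]
    simp only [chainN, n2, map_smul, Q4_der hS.gauge.der, hS.gauge.gh, hS.gauge.A, map_zero,
      zero_apply, map_add, smul_apply, e2, B4_ghosts hπ hlin hbil.jacobi, bsign_vals, smul_zero,
      map_neg]
    match_scalars
    · linear_combination (-c * η ν / 2) * I_mul_I
    · linear_combination (c * η μ / 2) * I_mul_I

include hdp in
lemma IsSector.var_chain {h : ι → ι → ι → ι → ℂ} (I J : List (Fin 4))
    (hh : I ≠ [] ∨ J ≠ [] ∨ M.IsQuarticCoupling h) :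
    π (derExt (gsign (!I.length.bodd)) (jetVar (M.chainVar w G G' K I)) (M.chain w Gh J)) +
      bsign I.length.bodd J.length.bodd •
        π (derExt (gsign (!J.length.bodd)) (jetVar (M.chainVar w G G' K J)) (M.chain w Gh I)) +
      π (derExt paritySign (jetDer d) (M.chainN h w nGh c I J)) = 0 := by
  obtain ⟨h0, -, h1, -⟩ := hS.jetDers hlin
  have hψ : ∀ i, derExt (gsign true) (jetVar (M.gaugeVar w G G')) (psiF i) =
      -Complex.I • M.repPsi w i := fun i => by rw [psiF, fieldWick, derExt_ι, jetVar_zero]; rfl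
  have hψ' : ∀ i, derExt (gsign true) (jetVar (M.gaugeVar w G G')) (psiBarF i) =
      Complex.I • M.repPsiBar w i := fun i => by rw [psiBarF, fieldWick, derExt_ι, jetVar_zero]; rfl
  have j := fun μ => compLeft_currents (M := M) (h1 μ).der
      (fun i => by rw [psiF, fieldWick, derExt_ι, jetVar_zero]; rfl)
      (fun i => by rw [psiBarF, fieldWick, derExt_ι, jetVar_zero]; rfl)
  have hn : ∀ (I : List (Fin 4)) (ε p) (μ ν), π (derExt (gsign ε) (jetVar (M.chainVar w G G' K (μ :: ν :: I))) p) = 0 := by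
    intro I ε p μ ν
    have e : jetVar (M.chainVar w G G' K (μ :: ν :: I)) = fun _ => 0 := by
      funext j; obtain ⟨φ, i⟩ := j; cases φ <;> simp [jetVar, chainVar, undiffVar]
    rw [e, derExt_zero_fun, map_zero]
  have b1 : ∀ μ : Fin 4, [μ].length.bodd = true := fun μ => by
    rw [List.length_singleton, Nat.bodd_one]
  have b2 : ∀ μ ν : Fin 4, [μ, ν].length.bodd = false := fun _ _ => by simp
  have b0 : ([] : List (Fin 4)).length.bodd = false := by simp
  have hw := hS.gh h0
  rw [one_smul] at hw
  have e2 := fun μ ν => var_lagr2N hπ hlin hbil.jacobi μ ν hS.gauge h0 hw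
  have e12 := fun ρ μ ν => var1_lagr2N hπ hlin hbil.jacobi ρ (fun _ => rfl) μ ν (h1 ρ) (hS.gh1 ρ (h1 ρ))
  match I, J with
  | [], [] =>
    have := hS.var₀ hπ hlin hbil h0 hψ hψ' (by simpa using hh)
    rw [two_smul] at this
    rw [b0, bsign_false_left, one_smul]
    exact this
  | [], [μ] =>
    rw [b0, b1, bsign_false_left, one_smul]
    exact hS.var₀₁ hπ hlin hbil h μ h0 hψ hψ' (h1 μ) (j μ).1 (j μ).2
  | [μ], [] =>
    rw [add_comm (π _), b0, b1, bsign_false_right, one_smul]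
    exact hS.var₀₁ hπ hlin hbil h μ h0 hψ hψ' (h1 μ) (j μ).1 (j μ).2
  | [μ], [ν] =>
    have := hS.var₁₁ hπ hdp hlin hbil h h1 (fun μ => (j μ).1) μ ν
    rw [b1, b1, bsign_true_true, neg_one_smul, ← sub_eq_add_neg]
    exact this
  | [], [μ, ν] =>
    rw [hn, smul_zero, add_zero]
    exact e2 μ ν
  | [μ, ν], [] =>
    rw [hn, zero_add, b2, bsign_false_left, one_smul]
    exact e2 μ ν
  | [ρ], [μ, ν] =>
    rw [hn, b1, smul_zero, add_zero, show M.chainN h w nGh c [ρ] [μ, ν] = 0 from rfl, map_zero,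
      map_zero, add_zero]
    exact e12 ρ μ ν
  | [μ, ν], [ρ] =>
    rw [hn, b1, b2, show M.chainN h w nGh c [μ, ν] [ρ] = 0 from rfl, map_zero, map_zero, add_zero,
      bsign_false_left, one_smul, zero_add]
    exact e12 ρ μ ν
  | [μ, ν], [ρ, κ] => simp [hn, chainN]
  | [], _ :: _ :: _ :: _ => simp [hn, chainN, chain]
  | [_], _ :: _ :: _ :: _ => simp [hn, chainN, chain]
  | [_, _], _ :: _ :: _ :: _ => simp [hn, chainN, chain]
  | _ :: _ :: _ :: _, _ => simp [hn, chainN, chain]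

end Local

end YangMills

namespace YangMills

section Feynman

variable {ι τ : Type*} [DecidableEq ι]

/-- The difference of the contractions with and without d'Alembertian. -/
def deltaContr : BasicField ι τ → BasicField ι τ → Distr
  | .divVec a, .divVec b => if a = b then I • dirac else 0
  | _, _ => 0

/-- The jets of the fields other than `∂_μ v^μ`. -/
def noDiv (ι τ : Type*) : Subalgebra ℂ (Wick ι τ) :=
  Algebra.adjoin ℂ (ιℂ '' {j | ∀ c, j.field ≠ .divVec c})

lemma contract_zero_fun (ε : Bool) (B : Wick ι τ) : contract ε 0 B = 0 := by
  have h := contract_smul_fun ε 0 (0 : Jet ι τ → Distr) B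
  rwa [zero_smul, show (0 : ℂ) • (0 : Jet ι τ → Distr) = 0 from
    funext fun _ => Distr.zero_smul' 0] at h

lemma jetContr_deltaContr_left {x : Jet ι τ} (h : ∀ c, x.field ≠ .divVec c) :
    jetContr deltaContr x = 0 := by
  funext y
  obtain ⟨φ, i⟩ := x
  cases φ <;> first | exact absurd rfl (h _) | simp [jetContr, deltaContr]

lemma treeC_deltaContr_left {A : Wick ι τ} (hA : A ∈ noDiv ι τ) (B : Wick ι τ) :
    treeC (jetContr deltaContr) A B = 0 := by
  refine adjoin_letters_induction (P := fun A => treeC (jetContr deltaContr) A B = 0) (by simp)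
    (fun x hx p ih => ?_) (fun p q h h' => ?_) (fun c p h => ?_) hA
  · rw [treeC_ι_mul, ih, jetContr_deltaContr_left hx, contract_zero_fun, map_zero, map_zero,
      add_zero]
  · rw [map_add, add_apply, h, h', add_zero]
  · rw [map_smul, smul_apply, h, smul_zero]

lemma contract_deltaContr {B : Wick ι τ} (hB : B ∈ noDiv ι τ) (ε : Bool) (x : Jet ι τ) :
    contract ε (jetContr deltaContr x) B = 0 := by
  refine adjoin_letters_induction (P := fun B => contract ε (jetContr deltaContr x) B = 0) (by simp)
    (fun y hy p ih => ?_) (fun p q h h' => ?_) (fun c p h => ?_) hB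
  · have : jetContr deltaContr x y = 0 := by
      obtain ⟨φ, i⟩ := x; obtain ⟨χ, j⟩ := y
      cases χ <;> first | exact absurd rfl (hy _) | (cases φ <;> simp [jetContr, deltaContr])
    rw [contract_ι_mul, ih, this]; simp
  · rw [map_add, h, h', add_zero]
  · rw [map_smul, h, smul_zero]

lemma treeC_deltaContr_right (A : Wick ι τ) {B : Wick ι τ} (hB : B ∈ noDiv ι τ) :
    treeC (jetContr deltaContr) A B = 0 := by
  induction A using freeAlgebra_induction with
  | h1 => simp
  | hmul x p ih => rw [treeC_ι_mul, ih, contract_deltaContr hB, map_zero, map_zero, add_zero]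
  | hadd p q h h' => rw [map_add, add_apply, h, h', add_zero]
  | hsmul c p h => rw [map_smul, smul_apply, h, smul_zero]

variable [DecidableEq τ] (M : YangMills ι τ)

lemma T₀_eq (A B : Wick ι τ) :
    M.T₀ A B = treeC M.regC A B + treeC (jetContr deltaContr) A B := by
  have h : M.contr feynman = M.regC + jetContr deltaContr := by
    have e : ∀ φ χ, M.fieldContr feynman φ χ = M.regContr φ χ + deltaContr φ χ := by
      intro φ χ
      cases φ <;> cases χ <;> try simp [regContr, deltaContr]
      rename_i a b
      split_ifs with hab
      · subst hab
        rw [fieldContr, if_pos rfl, ← kleinGordon_feynman (M.m a), kleinGordon_apply]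
        module
      · simp [fieldContr, hab]
    funext x y
    simp only [contr, e, Pi.add_apply, jetContr, map_add, smul_add]
  rw [T₀, tree_eq_treeC, h, treeC_add_fun]
  exact jetContr_parity (M.fieldContr_parity feynman)

lemma treeC_divv (a a' c c' b b' : ι) (μ ν : Fin 4) :
    treeC (jetContr deltaContr) (M.uBar a * M.divv b * M.v c μ) (M.uBar a' * M.divv b' * M.v c' ν) =
      dirac ⊗ₜ ((if b = b' ∧ M.kind b ≠ .higgs then I else 0) •
        (at₂ 0 (M.uBar a * M.v c μ) * at₂ 1 (M.uBar a' * M.v c' ν))) := by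
  have hn : ∀ c ν, (M.v c ν : Wick ι τ) ∈ noDiv ι τ := fun c ν => by
    unfold v; split_ifs
    exacts [zero_mem _, Algebra.subset_adjoin ⟨⟨.vec c ν, 0⟩, fun _ => nofun, rfl⟩]
  have hu : ctr (jetContr deltaContr) (M.uBar a) = 0 := by
    unfold uBar; split_ifs
    · funext y; simp [ctr]
    · rw [fieldWick, ctr_ι]; exact jetContr_deltaContr_left fun _ => nofun
  have e1 := contract_plets_mul (pair (jetContr deltaContr) (M.divv b)) (ε := false)
    (M.uBar_mem a') (M.divv b' * M.v c' ν)
  have e2 := contract_plets_mul (pair (jetContr deltaContr) (M.divv b)) (ε := false)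
    (M.divv_mem b') (M.v c' ν)
  have e3 : pair (jetContr deltaContr) (M.divv b) (M.uBar a') = 0 := by
    unfold divv uBar; split_ifs <;> simp [deltaContr]
  have e4 : pair (jetContr deltaContr) (M.divv b) (M.divv b') =
      (if b = b' ∧ M.kind b ≠ .higgs then I else 0) • dirac := by
    by_cases h : M.kind b = .higgs
    · simp [divv, h]
    · by_cases hb : b = b'
      · subst hb; simp [divv, h, deltaContr]
      · unfold divv; split_ifs <;> simp_all [deltaContr]
  have e5 : contract false (fun y => pair (jetContr deltaContr) (M.divv b) (ιℂ y))
      (M.v c' ν) = 0 := by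
    unfold divv; split_ifs
    · simp only [map_zero, zero_apply]; exact contract_zero_fun false (M.v c' ν)
    · simp only [fieldWick, pair_ι]; exact contract_deltaContr (hn _ _) _ _
  rw [mul_assoc, mul_assoc, treeC_plets_mul _ (M.uBar_mem a), hu, contract_zero_fun, map_zero,
    add_zero, treeC_plets_mul _ (M.divv_mem b), treeC_deltaContr_left (hn _ _), map_zero, zero_add]
  change lm _ (lm _ (contract false (fun y => pair _ _ _) _)) = _
  rw [e1, e2, e3, e4, e5, ← smul_tmul]
  generalize (if b = b' ∧ M.kind b ≠ .higgs then I else 0) = z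
  simp [gsign_false, twist_one_fun, mul_assoc]

end Feynman

end YangMills

namespace YangMills

section Membership

variable {ι τ : Type*} [Fintype ι] {S : Subalgebra ℂ (Wick ι τ)}

lemma F3_mem (k : ι → ι → ι → ℂ) {X Y Z : ι → Wick ι τ} (hX : ∀ a, X a ∈ S) (hY : ∀ a, Y a ∈ S)
    (hZ : ∀ a, Z a ∈ S) : F3 k X Y Z ∈ S := by
  rw [F3_apply]
  exact sum_mem fun a _ => sum_mem fun b _ => sum_mem fun c _ =>
    S.smul_mem (mul_mem (mul_mem (hX a) (hY b)) (hZ c)) _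

lemma dot_mem {X Y : ι → Wick ι τ} (hX : ∀ a, X a ∈ S) (hY : ∀ a, Y a ∈ S) : dot X Y ∈ S :=
  sum_mem fun a _ => mul_mem (hX a) (hY a)

lemma F3_parity {ε₁ ε₂ ε₃ ε : Bool} (k : ι → ι → ι → ℂ) (X Y Z : ι → Wick ι τ) [h₁ : Homog X ε₁]
    [h₂ : Homog Y ε₂] [h₃ : Homog Z ε₃]
    (hε : xor (xor ε₁ ε₂) ε₃ = ε) : HasParity ε (F3 k X Y Z) := by
  rw [F3_apply, ← hε]
  exact .sum fun a _ => .sum fun b _ => .sum fun c _ =>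
    (((h₁.parity a).mul (h₂.parity b)).mul (h₃.parity c)).smul _

lemma dot_parity {ε₁ ε₂ ε : Bool} (X Y : ι → Wick ι τ) [h₁ : Homog X ε₁] [h₂ : Homog Y ε₂]
    (hε : xor ε₁ ε₂ = ε) : HasParity ε (dot X Y) :=
  hε ▸ .sum fun a _ => (h₁.parity a).mul (h₂.parity a)

lemma _root_.CausalYM.HasParity.sub {ε : Bool} {p q : Wick ι τ} (hp : HasParity ε p) (hq : HasParity ε q) :
    HasParity ε (p - q) := by
  rw [sub_eq_add_neg, ← neg_one_smul ℂ]; exact hp.add (hq.smul _)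

instance (X Y : ι → Wick ι τ) {ε : Bool} [h : Homog X ε] [h' : Homog Y ε] : Homog (X - Y) ε :=
  ⟨fun a => (h.parity a).sub (h'.parity a)⟩

variable [Fintype τ] (M : YangMills ι τ)

lemma chain_parity (w : ι → Wick ι τ) [Homog w true] {Gh : Wick ι τ} (hG : HasParity true Gh)
    (μ ν : Fin 4) :
    HasParity true (M.lagr1YM w μ + Gh + M.lagr1Sc w μ + dot (M.jV μ) w) ∧
      HasParity false (M.lagr2N w μ ν) := by
  constructor
  all_goals
    simp only [lagr1YM, lagr1Sc, lagr2N]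
    repeat' first
      | exact hG
      | exact F3_parity _ _ _ _ rfl
      | exact dot_parity _ _ rfl
      | refine HasParity.sum fun _ _ => ?_
      | refine HasParity.add ?_ ?_
      | refine HasParity.sub ?_ ?_
      | refine HasParity.smul ?_ _

lemma TI_parity : ∀ I, HasParity I.length.bodd (M.TI I)
  | [] => by
    rw [TI, lagr_expand, List.length_nil, Nat.bodd_zero]
    repeat' first
      | exact F3_parity _ _ _ _ rfl
      | exact dot_parity _ _ rfl
      | refine HasParity.sum fun _ _ => ?_
      | refine HasParity.add ?_ ?_
      | refine HasParity.sub ?_ ?_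
      | refine HasParity.smul ?_ _
  | [μ] => by
    rw [TI, lagr1_eq, List.length_singleton, Nat.bodd_one]
    refine (M.chain_parity M.u (Gh := M.lagr1Gh μ) ?_ μ μ).1
    refine .smul ?_ _
    exact F3_parity _ _ _ _ rfl
  | [μ, ν] => by
    rw [TI, lagr2_eq, show [μ, ν].length.bodd = false by simp]
    exact (M.chain_parity M.u .zero μ ν).2
  | _ :: _ :: _ :: _ => HasParity.zero

lemma TAnti_parity : ∀ I, HasParity I.length.bodd (M.TAnti I)
  | [] => M.TI_parity []
  | [μ] => by
    rw [TAnti, lagrAnti1_eq, List.length_singleton, Nat.bodd_one]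
    refine (M.chain_parity M.uBar (Gh := M.lagrAnti1Gh μ) ?_ μ μ).1
    refine .sub (.add (.sub ?_ (.smul ?_ _)) (.smul ?_ _)) ?_ <;> exact F3_parity _ _ _ _ rfl
  | [μ, ν] => by
    rw [TAnti, lagrAnti2_eq, show [μ, ν].length.bodd = false by simp]
    exact (M.chain_parity M.uBar .zero μ ν).2
  | _ :: _ :: _ :: _ => HasParity.zero

variable (h : ∀ φ : BasicField ι τ, (∀ c, φ ≠ .divVec c) →
  fieldWick φ ∈ S ∧ ∀ μ, wickD μ (fieldWick φ) ∈ S)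
include h

lemma fields_mem : (∀ μ a, M.A μ a ∈ S) ∧ (∀ a, M.u a ∈ S) ∧ (∀ a, M.uBar a ∈ S) ∧
    (∀ a, M.Φ a ∈ S) ∧ (∀ μ a, M.jV μ a ∈ S) ∧ ∀ a, M.jScal a ∈ S := by
  have hb : ∀ (x : Matrix τ τ ℂ) G, bilin x G ∈ S := fun x G =>
    sum_mem fun A _ => sum_mem fun B _ => sum_mem fun r _ => sum_mem fun q _ => S.smul_mem
      (mul_mem (h (.psiBar A r) fun _ => nofun).1 (h (.psi B q) fun _ => nofun).1) _
  refine ⟨fun μ a => ?_, fun a => ?_, fun a => ?_, fun a => ?_,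
    fun μ a => by unfold jV jVec; exact sum_mem fun _ _ => hb _ _, fun a => sum_mem fun _ _ => hb _ _⟩
  all_goals first | unfold A v | unfold u | unfold uBar | unfold Φ
  all_goals split_ifs
  all_goals first | exact zero_mem _ | (refine (h _ ?_).1; exact fun _ => nofun)

lemma derivs_mem : (∀ ν μ a, dF ν (M.A μ) a ∈ S) ∧ (∀ ν a, dF ν M.u a ∈ S) ∧
    (∀ ν a, dF ν M.uBar a ∈ S) ∧ ∀ ν a, dF ν M.Φ a ∈ S := by
  refine ⟨fun ν μ a => ?_, fun ν a => ?_, fun ν a => ?_, fun ν a => ?_⟩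
  all_goals rw [compLeft_apply, Function.comp_apply]
  all_goals first | unfold A v | unfold u | unfold uBar | unfold Φ
  all_goals split_ifs
  all_goals first | (rw [map_zero]; exact zero_mem _) | (refine (h _ ?_).2 ν; exact fun _ => nofun)

lemma TI_mem (I : List (Fin 4)) : M.TI I ∈ S := by
  obtain ⟨hA, hu, hb, hΦ, hj, hs⟩ := M.fields_mem h
  obtain ⟨dA, du, db, dΦ⟩ := M.derivs_mem h
  have sm : ∀ (c : ℂ) {X : ι → Wick ι τ}, (∀ a, X a ∈ S) → ∀ a, (c • X) a ∈ S :=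
    fun c X hX a => S.smul_mem (hX a) c
  match I with
  | [] =>
    rw [TI, lagr_expand]
    refine add_mem (add_mem (add_mem (add_mem (add_mem (S.smul_mem (sum_mem fun μ _ => sum_mem
      fun ν _ => F3_mem _ (sm _ (hA μ)) (sm _ (hA ν)) fun a => sub_mem (sm _ (dA _ _) a)
      (sm _ (dA _ _) a)) _)
      (sum_mem fun μ _ => F3_mem _ hu (hA μ) (db μ))) (add_mem (sub_mem (sum_mem fun μ _ =>
      F3_mem _ hΦ (dΦ μ) (hA μ)) (sum_mem fun μ _ => F3_mem _ hΦ (hA μ) (sm _ (hA μ))))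
      (F3_mem _ hΦ hb hu))) (S.smul_mem (F3_mem _ hΦ hΦ hΦ) _)) (sum_mem fun μ _ =>
      dot_mem (hj μ) (sm _ (hA μ)))) (dot_mem hs hΦ)
  | [μ] =>
    rw [TI, lagr1_eq]
    exact add_mem (add_mem (add_mem (sum_mem fun ν _ => sub_mem (F3_mem _ hu (hA ν) (dA _ _))
      (S.smul_mem (F3_mem _ hu (hA ν) (dA _ _)) _)) (S.smul_mem (F3_mem _ hu hu (db μ)) _))
      (sub_mem (S.smul_mem (F3_mem _ hΦ (dΦ μ) hu) _) (F3_mem _ hΦ (hA μ) hu)))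
      (dot_mem (hj μ) hu)
  | [μ, ν] =>
    rw [TI, lagr2_eq]
    exact S.smul_mem (sub_mem (S.smul_mem (F3_mem _ hu hu (dA _ _)) _)
      (S.smul_mem (F3_mem _ hu hu (dA _ _)) _)) _
  | _ :: _ :: _ :: _ => exact zero_mem _

lemma lagrAnti1_mem (μ : Fin 4) : M.lagrAnti1 μ - F3 M.f M.uBar M.divv (M.A μ) ∈ S := by
  obtain ⟨hA, hu, hb, hΦ, hj, hs⟩ := M.fields_mem h
  obtain ⟨dA, du, db, dΦ⟩ := M.derivs_mem h
  have : M.lagrAnti1 μ - F3 M.f M.uBar M.divv (M.A μ) = M.lagr1YM M.uBar μ +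
      ((1 / 2 * η μ) • F3 M.f (dF μ M.u) M.uBar M.uBar - η μ • F3 M.f M.u M.uBar (dF μ M.uBar) -
      F3 M.fm M.uBar (M.A μ) M.Φ) + M.lagr1Sc M.uBar μ + dot (M.jV μ) M.uBar := by
    rw [lagrAnti1_eq, lagrAnti1Gh]; abel
  rw [this]
  exact add_mem (add_mem (add_mem (sum_mem fun ν _ => sub_mem (F3_mem _ hb (hA ν) (dA _ _))
    (S.smul_mem (F3_mem _ hb (hA ν) (dA _ _)) _)) (sub_mem (sub_mem
    (S.smul_mem (F3_mem _ (du μ) hb hb) _) (S.smul_mem (F3_mem _ hu hb (db μ)) _))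
    (F3_mem _ hb (hA μ) hΦ))) (sub_mem (S.smul_mem (F3_mem _ hΦ (dΦ μ) hb) _)
    (F3_mem _ hΦ (hA μ) hb))) (dot_mem (hj μ) hb)

lemma TAnti_mem {I : List (Fin 4)} (hI : ∀ μ, I ≠ [μ]) : M.TAnti I ∈ S := by
  obtain ⟨hA, hu, hb, hΦ, hj, hs⟩ := M.fields_mem h
  obtain ⟨dA, du, db, dΦ⟩ := M.derivs_mem h
  match I with
  | [] => exact M.TI_mem h []
  | [μ] => exact absurd rfl (hI μ)
  | [μ, ν] =>
    rw [TAnti, lagrAnti2_eq]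
    exact S.smul_mem (sub_mem (S.smul_mem (F3_mem _ hb hb (dA _ _)) _)
      (S.smul_mem (F3_mem _ hb hb (dA _ _)) _)) _
  | _ :: _ :: _ :: _ => exact zero_mem _

end Membership

end YangMills

namespace YangMills

section Renormalization

variable {ι τ : Type*} [Fintype ι] [Fintype τ] (M : YangMills ι τ) {R : Type*}
  [Ring R] [Algebra ℂ R] {π : Wick ι τ →ₐ[ℂ] R} (hπ : Graded π) (hlin : M.LinearRelations)
  (w : ι → Wick ι τ) [Homog w true]

lemma N2_eq (μ ν : Fin 4) : M.N2 w μ ν = M.n2 w μ ν := by rw [n2, Q4_apply]; rfl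

include hπ

lemma dot_act {ε : Bool} (X : ι → Wick ι τ) [Homog X ε] (Y : ι → Wick ι τ) [Homog Y false] :
    π (dot (M.act M.Φ X) (M.act M.Φ Y)) =
      π (Q4 (fun a b c d => ∑ e, M.f' d e b * M.f' c e a) X Y M.Φ M.Φ) := by
  rw [dot_br_left, F3_br_right, hπ.Q4_swap₁, hπ.Q4_swap₃, hπ.Q4_swap₂]
  simp only [bsign_vals, one_smul]

lemma renormalization₁ (hlin : M.LinearRelations) (μ : Fin 4) :
    π (M.N1 w μ) = π (M.n1YM w μ) + π (M.n1Sc w μ) := by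
  have e : M.N1 w μ = (∑ ν, η ν • Q4 M.g1 w (M.A μ) (M.A ν) (M.A ν)) +
      Q4 M.g3 w (M.A μ) M.Φ M.Φ := by
    simp only [N1, Q4_apply, smul_sum, smul_comm (η _)]
    refine congrArg₂ _ ?_ rfl
    · simp only [sum_comm (s := (Finset.univ : Finset (Fin 4))) (t := (Finset.univ : Finset ι)),
        vLow, mul_smul_comm]
      rfl
  rw [e, map_add, n1Sc, map_smul, M.dot_act hπ, n1YM, map_sum, map_sum]
  congr 1
  · refine sum_congr rfl fun ν _ => ?_
    rw [map_smul, map_smul, hπ.Q4_swap₂ _ w (M.A ν) (M.A μ), bsign_false_left, one_smul,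
      show -(I * η ν) = η ν * -I by ring, mul_smul (η ν)]
    congr 1
    rw [← map_smul, Q4_smul]
    apply hπ.Q4_congr₃ (ε := false)
    intro a b c d
    simp only [g1, bsign_vals, mul_sum, ← sum_add_distrib]
    exact sum_congr rfl fun _ _ => by ring
  · rw [← map_smul, Q4_smul]
    apply hπ.Q4_congr₃ (ε := false)
    intro a b c d
    simp only [g3, bsign_vals, mul_sum, ← sum_add_distrib]
    refine sum_congr rfl fun e _ => ?_
    rw [hlin.f'_antisymm e d, hlin.f'_antisymm e c]; ring

lemma renormalization_ghost (μ : Fin 4) : π (M.N1Ghost μ) = π (M.n1Gh μ) := by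
  have e : M.N1Ghost μ = Q4 M.g2 M.u M.uBar M.uBar (M.A μ) := by rw [Q4_apply]; rfl
  rw [e, n1Gh, map_smul, hπ.Q4_swap₂ _ M.u (M.A μ), hπ.Q4_swap₃ _ M.u M.uBar (M.A μ)]
  simp only [bsign_vals, one_smul]
  rw [← map_smul, Q4_smul]
  rfl

lemma renormalization₀ (hlin : M.LinearRelations) (h : ι → ι → ι → ι → ℂ) :
    π (M.N0 h) = π (M.n0YM + M.n0Sc + (1 / 24 : ℂ) • Q4 h M.Φ M.Φ M.Φ M.Φ) := by
  have e : M.N0 h = (∑ μ, ∑ ν, (η μ * η ν) • Q4 M.h1 (M.A μ) (M.A μ) (M.A ν) (M.A ν)) +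
      (∑ μ, η μ • Q4 M.h2 (M.A μ) (M.A μ) M.Φ M.Φ) +
      (1 / 24 : ℂ) • Q4 h M.Φ M.Φ M.Φ M.Φ := by
    simp only [N0, Q4_apply, smul_sum]
    congr 2
    · simp only [sum_comm (s := (Finset.univ : Finset (Fin 4))) (t := (Finset.univ : Finset ι)),
        vLow, mul_smul_comm, smul_mul_assoc, smul_smul]
      refine sum_congr rfl fun a _ => sum_congr rfl fun b _ => sum_congr rfl
        fun c _ => sum_congr rfl fun d _ => sum_congr rfl fun μ _ =>
        sum_congr rfl fun ν _ => ?_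
      rw [show M.h1 a b c d * (η ν * η μ) = η μ * η ν * M.h1 a b c d by ring]; rfl
    · simp only [sum_comm (s := (Finset.univ : Finset (Fin 4))) (t := (Finset.univ : Finset ι)),
        vLow, mul_smul_comm, smul_mul_assoc, smul_comm (η _)]
      rfl
  rw [e]
  simp only [map_add, n0Sc, n0YM, map_sum, map_smul]
  congr 2
  · refine sum_congr rfl fun μ _ => sum_congr rfl fun ν _ => ?_
    rw [hπ.Q4_swap₂ _ (M.A μ) (M.A ν) (M.A μ), bsign_false_left, one_smul,
      mul_comm (-_), mul_smul (η μ * η ν)]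
    congr 1
    rw [← map_smul, Q4_smul]
    apply hπ.Q4_congr₃ (ε := false)
    intro a b c d
    simp only [h1, bsign_vals, mul_sum, ← sum_add_distrib]
    exact sum_congr rfl fun _ _ => by ring
  · refine sum_congr rfl fun μ _ => ?_
    rw [M.dot_act hπ, mul_comm, mul_smul]
    congr 1
    rw [← map_smul, Q4_smul]
    apply hπ.Q4_congr₃ (ε := false)
    intro a b c d
    simp only [h2, bsign_vals, mul_sum, ← sum_add_distrib]
    refine sum_congr rfl fun e _ => ?_
    rw [hlin.f'_antisymm e d, hlin.f'_antisymm e c]; ring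

end Renormalization

end YangMills

namespace YangMills

section Parity

variable {ι τ : Type*} {ε : Bool} {S : BasicField ι τ → Wick ι τ}
  (hS : ∀ φ, HasParity (xor ε φ.odd) (S φ))
include hS

lemma jetVar_parity (x : Jet ι τ) : HasParity (xor ε x.field.odd) (jetVar S x) := by
  obtain ⟨φ, i⟩ := x
  refine .add ?_ (.sum fun ρ _ => ?_)
  · split_ifs
    · cases φ
      case divVec c _ => exact .sum fun ρ _ => (hS (.vec c ρ)).wickD ρ
      all_goals exact hS _
    · exact .zero
  · split_ifs
    exacts [(hS φ).wickD ρ, .zero]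

lemma jetTot_parity (ρ : Fin 4) (x : Jet ι τ) :
    HasParity (xor ε x.field.odd) (jetTot S ρ x) := by
  obtain ⟨φ, i⟩ := x
  refine .add ?_ ?_
  · split_ifs
    · cases φ
      case divVec c _ => exact hS (.vec c ρ)
      all_goals exact .zero
    · exact .zero
  · split_ifs
    exacts [hS φ, .zero]

end Parity

section Relations

variable {ι τ : Type*} (M : YangMills ι τ)

/-- The exchange relations and the field equations. -/
def localRel : Set (Wick ι τ) := exchRel ι τ ∪ {e | M.FieldEq e}

lemma graded_localRel : Graded (toRel M.localRel) := fun _ hx => toRel_eq_zero _ (.inl hx)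

lemma loc_localRel_congr {p q : Wick ι τ} (h : toRel M.localRel p = toRel M.localRel q) :
    M.loc p = M.loc q :=
  toRel_factor M.loc (fun a b _ hx => hx.elim (M.loc_exch a b) fun hx => M.loc_fieldEq hx a b) h

lemma localRel_congr {p q : Wick ι τ}
    (h : toRel (exchRel ι τ) p = toRel (exchRel ι τ) q) :
    toRel M.localRel p = toRel M.localRel q :=
  toRel_factor (toRel M.localRel).toLinearMap
    (fun a b x hx => by simp [M.graded_localRel x hx]) h

lemma localRel_divv (a : ι) : toRel M.localRel (M.divv a) = toRel M.localRel (M.divA a) := by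
  rw [divA, Finset.sum_apply]
  by_cases h : M.kind a = .higgs
  · simp [divv, A, v, h]
  · have := toRel_eq_zero M.localRel (.inr (.divVec a) : _ ∈ M.localRel)
    rw [map_sub, sub_eq_zero] at this
    simpa [divv, A, v, h] using this

end Relations

section Identity

variable {ι τ : Type*} [Fintype ι] [Fintype τ] [DecidableEq ι] [DecidableEq τ] {M : YangMills ι τ}
  {d : BasicField ι τ → Wick ι τ} (hdp : ∀ φ, d φ ∈ plets (!φ.odd))
  (hd : DerivInvariant M.regC (jetDer d))
  {w G G' : ι → Wick ι τ} [hw : Homog w true] [hG : Homog G false] [hG' : Homog G' false]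
  {K : Fin 4 → ι → Wick ι τ} [hK : ∀ μ, Homog (K μ) true] {Gh nGh : Fin 4 → Wick ι τ} {c : ℂ}
  (hS : M.IsSector (toRel M.localRel) (derExt paritySign (jetDer d)) w G G' K Gh nGh c)
  (hlin : M.LinearRelations) (hbil : M.BilinearRelations)

omit hw hG hG' hK in
lemma chainVar_parity [hw : Homog w true] [hG : Homog G false] [hG' : Homog G' false]
    [hK : ∀ μ, Homog (K μ) true] (I : List (Fin 4)) (φ : BasicField ι τ) :
    HasParity (xor (!I.length.bodd) φ.odd) (M.chainVar w G G' K I φ) := by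
  match I with
  | [] =>
    cases φ with
    | vec a μ => exact (inferInstance : Homog (br M.f w (M.A μ)) (xor true false)).parity a
    | divVec a => exact .zero
    | ghost a => exact hG.parity a
    | anti a => exact hG'.parity a
    | scal a => exact (inferInstance : Homog (M.varΦ w) true).parity a
    | psi A r => exact (M.repPsi_parity w _).smul _
    | psiBar A r => exact (M.repPsiBar_parity w _).smul _
  | [μ] =>
    rw [List.length_singleton, Nat.bodd_one, Bool.not_true]
    cases φ with
    | vec a ν =>
      simp only [chainVar, gaugeVar1]
      split_ifs
      exacts [((inferInstance : Homog (br M.f w w) (xor true true)).parity a).smul _, .zero]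
    | ghost a => exact (hK μ).parity a
    | _ => exact .zero
  | _ :: _ :: _ => exact .zero

omit hG hG' hK in
include hw hlin hbil in
lemma chainN_symm (h : ι → ι → ι → ι → ℂ) : ∀ I J : List (Fin 4),
    toRel M.localRel (M.chainN h w nGh c J I) =
      bsign I.length.bodd J.length.bodd • toRel M.localRel (M.chainN h w nGh c I J)
  | [], [] => by simp [bsign]
  | [μ], [] => by simp [bsign, chainN]
  | [], [μ] => by simp [bsign, chainN]
  | [μ], [ν] => by
    simp [bsign, chainN, n2_swap M.graded_localRel hlin hbil μ ν]
  | [μ, ν], [] => by simp [bsign, chainN]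
  | [], [μ, ν] => by simp [bsign, chainN]
  | [], _ :: _ :: _ :: _ | [_], _ :: _ :: _ | _ :: _ :: _, _ :: _ => by simp [chainN]
  | _ :: _ :: _ :: _, [] => by simp [chainN]

include hdp hd hS hlin hbil hw hG hG' hK in
/-- Second order gauge invariance in one sector. -/
theorem IsSector.gaugeIdentity {T : List (Fin 4) → Wick ι τ}
    (hT : ∀ I, HasParity I.length.bodd (T I))
    (hA : ∀ I, T I ∈ Algebra.adjoin ℂ (ιℂ '' lowJets ι τ))
    (hc : ∀ I, toRel (exchRel ι τ) (T I) = toRel (exchRel ι τ) (M.chain w Gh I))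
    (hV : ∀ I, M.IsFieldVariation (!I.length.bodd)
      (derExt paritySign (jetDer d) (T I) - Complex.I • ∑ μ, wickD μ (T (I ++ [μ])))
      (M.chainVar w G G' K I))
    {N : List (Fin 4) → List (Fin 4) → Wick ι τ} (Z : List (Fin 4) → List (Fin 4) → Wick₂ ι τ)
    (hZ : ∀ I J, M.T₀ (T I) (T J) = treeC M.regC (T I) (T J) + dirac ⊗ₜ Z I J)
    {h : ι → ι → ι → ι → ℂ} (hN : ∀ I J, toRel (exchRel ι τ) (N I J - fold (Z I J)) =
      toRel (exchRel ι τ) (M.chainN h w nGh c I J))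
    (I J : List (Fin 4)) (hh : I ≠ [] ∨ J ≠ [] ∨ M.IsQuarticCoupling h) :
    M.GaugeIdentity (oddDer₂ (jetDer d)) (fun I J => M.T₀ (T I) (T J) - quasiLocal (N I J)) I J := by
  have hπ := M.graded_localRel
  have hN' := fun I J => M.localRel_congr (hN I J)
  have hp := chainVar_parity (M := M) (w := w) (G := G) (G' := G') (K := K)
  have hJ := hbil.jacobi
  refine M.gauge_of_local hd hT hA hV Z hZ (fun _ _ => rfl) (fun I J => ?_) (fun I J ρ => ?_) I J ?_
  · rw [← map_smul]
    refine M.loc_localRel_congr ?_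
    rw [map_smul, hN', hN', chainN_symm hlin hbil]
  · rw [← map_smul, ← map_neg]
    refine M.loc_localRel_congr ?_
    rw [map_neg, map_smul, hN', hπ.der_congr (jetTot_parity (hp I) ρ) (hc J),
      hS.tot_chain hπ hlin hJ h]
  · rw [← map_smul, ← map_add, ← map_add, ← map_zero M.loc]
    refine M.loc_localRel_congr ?_
    have e := hS.var_chain hπ hdp hlin hbil I J hh
    rw [map_add, map_add, map_smul, hπ.der_congr (jetVar_parity (hp I)) (hc J),
      hπ.der_congr (jetVar_parity (hp J)) (hc I), map_zero, ← e, ← gsign_true,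
      hπ.der_congr (jetDer_parity hdp) (hN I J)]

end Identity

end YangMills

namespace YangMills

section Quartic

variable {ι τ : Type*} [Fintype ι] {M : YangMills ι τ} (hlin : M.LinearRelations)
include hlin

lemma cubicVariation_swap (hR : M.BoseRep) (a b c d : ι) :
    M.m b * M.cubicVariation a b c d = M.m a * M.cubicVariation b a c d := by
  have e1 : ∀ e x y, M.f'' e x y * M.m y =
      M.f' e x y * ((M.higgsMass e : ℂ) ^ 2 - (M.higgsMass x : ℂ) ^ 2) := fun e x y =>
    hlin.f'_f'' e x y
  have e2 : ∑ e, (M.f' e c a * M.f' e d b - M.f' e d a * M.f' e c b - M.f a b e * M.f' c d e) = 0 := by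
    have := hR a b c d
    rw [← add_eq_zero_iff_eq_neg, ← sum_add_distrib] at this
    rw [← neg_eq_zero, ← this, ← sum_neg_distrib]
    refine sum_congr rfl fun e _ => ?_
    rw [hlin.f'_antisymm c e a, hlin.f'_antisymm c e b]; ring
  rw [← sub_eq_zero, cubicVariation, cubicVariation, mul_sum, mul_sum,
    ← sum_sub_distrib]
  rw [← mul_zero ((M.higgsMass c : ℂ) ^ 2 - (M.higgsMass d : ℂ) ^ 2), ← e2, mul_sum]
  refine sum_congr rfl fun e _ => ?_
  have s1 : M.f'' e c d = M.f'' c d e := by rw [hlin.f''_symm₁, hlin.f''_symm₂]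
  have s2 := hlin.f''_symm₂ e
  linear_combination M.f' e c a * (e1 e d b) + M.f' e d a * e1 e c b - M.f' e c b * e1 e d a -
    M.f' e d b * e1 e c a + M.f'' c d e * hlin.f_f' a b e - M.f a b e * e1 c d e +
    (M.m b * M.f' e b a - M.m a * M.f' e a b) * s1 -
    M.f' e c a * M.m b * s2 b d - M.f' e d a * M.m b * s2 b c +
    M.f' e c b * M.m a * s2 a d + M.f' e d b * M.m a * s2 a c

/-- The criterion for the existence of the quartic couplings. -/
theorem exists_isQuarticCoupling (hR : M.BoseRep) : (∃ h, M.IsQuarticCoupling h) ↔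
    ∀ a b c d, M.kind a = .massless → M.cubicVariation a b c d = 0 := by
  constructor
  · rintro ⟨h, hh⟩ a b c d ha
    have := hh.eq a b c d
    rw [M.m_zero a (by rw [ha]; decide)] at this
    simpa using this
  · intro h
    have h0 : ∀ a b c d, M.m a = 0 → M.cubicVariation a b c d = 0 := fun a b c d ha => by
      cases hk : M.kind a with
      | massless => exact h a b c d hk
      | massive => exact absurd ha (M.m_pos a hk).ne'
      | higgs => simp [cubicVariation, hlin.f'_higgs _ _ a hk]
    have s1 : ∀ a b c d, M.cubicVariation a c b d = M.cubicVariation a b c d :=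
      fun a b c d => sum_congr rfl fun e _ => by rw [hlin.f''_symm₂ e c b]; ring
    have s2 : ∀ a b c d, M.cubicVariation a b d c = M.cubicVariation a b c d :=
      fun a b c d => sum_congr rfl fun e _ => by rw [hlin.f''_symm₂ e d c]; ring
    refine ⟨fun a b c d => -2 * I * ((M.m a * M.cubicVariation a b c d +
      M.m b * M.cubicVariation b a c d + M.m c * M.cubicVariation c a b d +
      M.m d * M.cubicVariation d a b c) / (M.m a ^ 2 + M.m b ^ 2 + M.m c ^ 2 + M.m d ^ 2)),
      fun a b c d => ?_, fun a b c d => ?_, fun a b c d => ?_, fun a b c d => ?_⟩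
    · rw [s1 c a b d, s1 d a b c]; ring_nf
    · rw [s1 a b c d, s2 d a b c]; ring_nf
    · rw [s2 a b c d, s2 b a c d]; ring_nf
    · have k1 := cubicVariation_swap hlin hR a b c d
      have k2 := cubicVariation_swap hlin hR a c b d
      have k3 := cubicVariation_swap hlin hR a d b c
      rw [s1] at k2
      rw [s1, s2] at k3
      by_cases hs : M.m a ^ 2 + M.m b ^ 2 + M.m c ^ 2 + M.m d ^ 2 = 0
      · have : M.m a = 0 := by
          nlinarith [sq_nonneg (M.m a), sq_nonneg (M.m b), sq_nonneg (M.m c), sq_nonneg (M.m d)]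
        simp [h0 a b c d this, this]
      · have hs' : (M.m a ^ 2 + M.m b ^ 2 + M.m c ^ 2 + M.m d ^ 2 : ℂ) ≠ 0 := by exact_mod_cast hs
        rw [mul_assoc, div_mul_eq_mul_div]
        congr 1
        rw [div_eq_iff hs']
        linear_combination -(M.m b : ℂ) * k1 - (M.m c : ℂ) * k2 - (M.m d : ℂ) * k3

end Quartic

section Membership

variable {ι τ : Type*}

lemma noDiv_fields (φ : BasicField ι τ) (h : ∀ c, φ ≠ .divVec c) :
    fieldWick φ ∈ noDiv ι τ ∧ ∀ μ, wickD μ (fieldWick φ) ∈ noDiv ι τ := by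
  refine ⟨Algebra.subset_adjoin ⟨⟨φ, 0⟩, h, rfl⟩, fun μ => ?_⟩
  rw [fieldWick, wickD_ι]
  exact Algebra.subset_adjoin ⟨Jet.shift μ ⟨φ, 0⟩, h, rfl⟩

lemma lowJets_fields (φ : BasicField ι τ) (h : ∀ c, φ ≠ .divVec c) :
    fieldWick φ ∈ Algebra.adjoin ℂ (ιℂ '' lowJets ι τ) ∧
      ∀ μ, wickD μ (fieldWick φ) ∈ Algebra.adjoin ℂ (ιℂ '' lowJets ι τ) := by
  refine ⟨Algebra.subset_adjoin ⟨_, .inl rfl, rfl⟩, fun μ => ?_⟩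
  rw [fieldWick, wickD_ι]
  exact Algebra.subset_adjoin ⟨_, .inr ⟨⟨μ, zero_add _⟩, h⟩, rfl⟩

variable [Fintype ι] [Fintype τ] (M : YangMills ι τ)

lemma TAnti_mem_lowJets (I : List (Fin 4)) :
    M.TAnti I ∈ Algebra.adjoin ℂ (ιℂ '' lowJets ι τ) := by
  by_cases hI : ∀ μ, I ≠ [μ]
  · exact M.TAnti_mem lowJets_fields hI
  · push Not at hI
    obtain ⟨μ, rfl⟩ := hI
    obtain ⟨hA, -, hb, -⟩ := M.fields_mem lowJets_fields
    have hd : ∀ a, M.divv a ∈ Algebra.adjoin ℂ (ιℂ '' lowJets ι τ) := fun a => by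
      unfold divv; split_ifs
      exacts [zero_mem _, Algebra.subset_adjoin ⟨⟨.divVec a, 0⟩, .inl rfl, rfl⟩]
    have := add_mem (M.lagrAnti1_mem lowJets_fields μ) (F3_mem M.f hb hd (hA μ))
    rwa [sub_add_cancel] at this

end Membership

section DeltaTerm

variable {ι τ : Type*} [Fintype ι] (M : YangMills ι τ)

/-- `∑ f_{abc} ũ_a v_c^μ`. -/
def antiBr (μ : Fin 4) : ι → Wick ι τ := br (fun a c b => M.f a b c) M.uBar (M.A μ)

/-- The local terms of the tree products in which `∂_μ v^μ` is contracted with itself. -/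
def deltaTerm : List (Fin 4) → List (Fin 4) → Wick₂ ι τ
  | [μ], [ν] => I • ∑ b, at₂ 0 (M.antiBr μ b) * at₂ 1 (M.antiBr ν b)
  | _, _ => 0

lemma fold_deltaTerm [Fintype τ] (hlin : M.LinearRelations) (μ ν : Fin 4) :
    fold (M.deltaTerm [μ] [ν]) = I • M.B4 M.uBar (M.A μ) M.uBar (M.A ν) := by
  have : fold (M.deltaTerm [μ] [ν]) = I • dot (M.antiBr μ) (M.antiBr ν) := by
    simp [deltaTerm, dot_apply]
  rw [this, antiBr, antiBr, dot_br_left, F3_br_right]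
  congr 6
  funext a b c d
  refine sum_congr rfl fun e _ => ?_
  rw [hlin.f_antisymm₂ a b e, hlin.f_antisymm₂ c d e, neg_mul_neg, mul_comm]

variable [Fintype τ] [DecidableEq ι] [DecidableEq τ] (hlin : M.LinearRelations)

include hlin in
lemma treeC_F3_divv (μ ν : Fin 4) : treeC (jetContr deltaContr) (F3 M.f M.uBar M.divv (M.A μ))
    (F3 M.f M.uBar M.divv (M.A ν)) = dirac ⊗ₜ M.deltaTerm [μ] [ν] := by
  have hF : ∀ μ, F3 M.f M.uBar M.divv (M.A μ) =
      ∑ b, ∑ a, ∑ c, M.f a b c • (M.uBar a * M.divv b * M.v c μ) := fun μ => by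
    rw [F3_apply, sum_comm]; rfl
  have hE : ∀ b b', treeC (jetContr deltaContr)
      (∑ a, ∑ c, M.f a b c • (M.uBar a * M.divv b * M.v c μ))
      (∑ a, ∑ c, M.f a b' c • (M.uBar a * M.divv b' * M.v c ν)) =
      if b = b' then dirac ⊗ₜ (I • (at₂ 0 (M.antiBr μ b) * at₂ 1 (M.antiBr ν b'))) else 0 := by
    intro b b'
    by_cases hb : b = b'
    · subst hb
      by_cases hk : M.kind b = .higgs
      · have : ∀ a c, M.f a b c = 0 := fun a c => by
          rw [hlin.f_antisymm₁, hlin.f_higgs _ _ _ hk, neg_zero]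
        simp [this, antiBr, br_apply]
      · simp only [map_sum, map_smul, sum_apply, smul_apply, treeC_divv,
          tmul_smul, antiBr, br_apply, hk, if_true, sum_mul, mul_sum,
          ne_eq, not_false_eq_true, and_self, tmul_sum, smul_mul_assoc, mul_smul_comm,
          smul_sum, smul_comm I]
        rfl
    · simp only [map_sum, map_smul, sum_apply, smul_apply, treeC_divv, hb,
        if_false, false_and, zero_smul, tmul_zero, smul_zero, sum_const_zero]
  rw [hF, hF]
  simp only [map_sum _ (fun b => ∑ a, ∑ c, M.f a b c • (M.uBar a * M.divv b * M.v c _)),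
    sum_apply, hE, sum_ite_eq, mem_univ, if_true, deltaTerm,
    tmul_smul, smul_sum, tmul_sum]
  exact sum_congr rfl fun b _ => by rw [sum_ite_eq' Finset.univ b, if_pos (mem_univ b)]

include hlin in
lemma T₀_TAnti (I J : List (Fin 4)) : M.T₀ (M.TAnti I) (M.TAnti J) =
    treeC M.regC (M.TAnti I) (M.TAnti J) + dirac ⊗ₜ M.deltaTerm I J := by
  rw [T₀_eq]
  congr 1
  by_cases hI : ∀ μ, I ≠ [μ]
  · rw [treeC_deltaContr_left (M.TAnti_mem noDiv_fields hI), show M.deltaTerm I J = 0 from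
      match I, hI with
      | [], _ => rfl
      | [μ], h => absurd rfl (h μ)
      | _ :: _ :: _, _ => rfl, tmul_zero]
  by_cases hJ : ∀ μ, J ≠ [μ]
  · rw [treeC_deltaContr_right _ (M.TAnti_mem noDiv_fields hJ), show M.deltaTerm I J = 0 from
      match I, J, hJ with
      | [], _, _ => rfl
      | [_], [], _ => rfl
      | [_], [ν], h => absurd rfl (h ν)
      | [_], _ :: _ :: _, _ => rfl
      | _ :: _ :: _, _, _ => rfl, tmul_zero]
  push Not at hI hJ
  obtain ⟨μ, rfl⟩ := hI
  obtain ⟨ν, rfl⟩ := hJ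
  have e := M.treeC_F3_divv hlin μ ν
  have e1 := treeC_deltaContr_left (M.lagrAnti1_mem noDiv_fields μ)
    (F3 M.f M.uBar M.divv (M.A ν))
  have e2 := treeC_deltaContr_right (M.lagrAnti1 μ) (M.lagrAnti1_mem noDiv_fields ν)
  rw [map_sub, sub_apply, sub_eq_zero] at e1
  rw [map_sub, sub_eq_zero] at e2
  rw [← e, ← e1, ← e2]; rfl

end DeltaTerm

section Identities

variable {ι τ : Type*} [Fintype ι] [Fintype τ] [DecidableEq ι] [DecidableEq τ] {M : YangMills ι τ}
  (hlin : M.LinearRelations) (hcur : M.CurrentRelation) (hbil : M.BilinearRelations)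
  {h : ι → ι → ι → ι → ℂ} (I J : List (Fin 4)) (hh : I ≠ [] ∨ J ≠ [] ∨ M.IsQuarticCoupling h)
include hlin hcur hbil hh

theorem gaugeIdentity_brst : M.GaugeIdentity M.dQ (M.renBrst h) I J := by
  have hπ := graded_toRel ι τ
  have : Homog (0 : ι → Wick ι τ) false := ⟨fun _ => .zero⟩
  have : ∀ μ, Homog ((0 : Fin 4 → ι → Wick ι τ) μ) true := fun μ => ⟨fun _ => .zero⟩
  have hS := isSector_brst M.graded_localRel hlin hbil.jacobi (M.boseRep hlin hbil)
  refine hS.gaugeIdentity M.brstField_mem M.brst_derivInvariant hlin hbil M.TI_parity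
    (M.TI_mem lowJets_fields) (fun I => ?_) (fun I => ?_) (fun _ _ => 0) (fun I J => ?_)
    (h := h) (fun I J => ?_) I J hh
  · match I with
    | [] => exact M.lagr_eq hπ hlin
    | [μ] => rw [TI, lagr1_eq]; rfl
    | [μ, ν] => rw [TI, lagr2_eq]; rfl
    | _ :: _ :: _ :: _ => rfl
  · have e : M.chainVar M.u ((1 / 2 : ℂ) • br M.f M.u M.u) 0 0 I = M.brstVar I :=
      match I with
      | [] | [_] | _ :: _ :: _ => rfl
    rw [e]
    exact isFieldVariation_brst hlin hcur I
  · rw [T₀_eq, treeC_deltaContr_left (M.TI_mem noDiv_fields I), tmul_zero]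
  · rw [map_zero, sub_zero]
    match I, J with
    | [], [] => exact M.renormalization₀ hπ hlin h
    | [μ], [] | [], [μ] =>
      simp [NBrst, chainN, M.renormalization₁ hπ M.u hlin]
    | [μ, ν], [] | [], [μ, ν] => rw [NBrst, N2_eq]; rfl
    | [μ], [ν] => simp [NBrst, N2_eq, chainN]
    | [], _ :: _ :: _ :: _ | [_], _ :: _ :: _ | _ :: _ :: _, _ :: _ => simp [NBrst, chainN]
    | _ :: _ :: _ :: _, [] => simp [NBrst, chainN]

theorem gaugeIdentity_antiBrst : M.GaugeIdentity M.dQAnti (M.renAnti h) I J := by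
  have hπ := graded_toRel ι τ
  have hK : ∀ μ, Homog (br M.f M.uBar (M.A μ)) (xor true false) := fun μ => inferInstance
  have hG : Homog (br M.f M.u M.uBar) (xor true true) := inferInstance
  have hG' : Homog ((1 / 2 : ℂ) • br M.f M.uBar M.uBar) (xor true true) := inferInstance
  have hS := isSector_antiBrst M.graded_localRel hlin hbil.jacobi (M.boseRep hlin hbil)
    M.localRel_divv
  refine hS.gaugeIdentity (hG := hG) (hG' := hG') (hK := hK) M.antiBrstField_mem
    M.antiBrst_derivInvariant hlin hbil M.TAnti_parity
    M.TAnti_mem_lowJets (fun I => ?_) (fun I => ?_) M.deltaTerm (M.T₀_TAnti hlin)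
    (h := h) (fun I J => ?_) I J hh
  · match I with
    | [] => exact M.lagr_eq hπ hlin
    | [μ] => rw [TAnti, lagrAnti1_eq]; rfl
    | [μ, ν] => rw [TAnti, lagrAnti2_eq]; rfl
    | _ :: _ :: _ :: _ => rfl
  · have e : M.chainVar M.uBar (br M.f M.u M.uBar) ((1 / 2 : ℂ) • br M.f M.uBar M.uBar)
        (fun μ => br M.f M.uBar (M.A μ)) I = M.antiBrstVar I :=
      match I with
      | [] | [_] | _ :: _ :: _ => rfl
    rw [e]
    exact isFieldVariation_antiBrst hlin hcur I
  · match I, J with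
    | [], [] =>
      rw [show M.deltaTerm [] [] = 0 from rfl, map_zero, sub_zero]
      exact M.renormalization₀ hπ hlin h
    | [μ], [] | [], [μ] =>
      simp [NAnti, chainN, deltaTerm, M.renormalization₁ hπ M.uBar hlin, M.renormalization_ghost hπ]
      abel
    | [μ, ν], [] | [], [μ, ν] => simp [NAnti, N2_eq, chainN, deltaTerm]
    | [μ], [ν] =>
      rw [M.fold_deltaTerm hlin]
      simp only [NAnti, N2_eq, chainN, n2, map_sub, map_neg, map_smul,
        B4_ghosts hπ hlin hbil.jacobi]
      module
    | [], _ :: _ :: _ :: _ | [_], _ :: _ :: _ | _ :: _ :: _, _ :: _ =>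
      simp [NAnti, chainN, deltaTerm]
    | _ :: _ :: _ :: _, [] => simp [NAnti, chainN, deltaTerm]

end Identities

end YangMills

end CausalYM

end

theorem mainTheorem2 {ι τ : Type*} [Fintype ι] [DecidableEq ι] [Fintype τ] [DecidableEq τ]
    (M : CausalYM.YangMills ι τ) (hlin : M.LinearRelations) (hcur : M.CurrentRelation)
    (hbil : M.BilinearRelations) :
    (∀ (h : ι → ι → ι → ι → ℂ) (I J : List (Fin 4)), (I ≠ [] ∨ J ≠ []) →
      M.GaugeIdentity M.dQAnti (M.renAnti h) I J ∧ M.GaugeIdentity M.dQ (M.renBrst h) I J) ∧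
    (∀ h : ι → ι → ι → ι → ℂ, M.IsQuarticCoupling h →
      M.GaugeIdentity M.dQAnti (M.renAnti h) [] [] ∧
        M.GaugeIdentity M.dQ (M.renBrst h) [] [] ∧ M.NBrst h [] [] = M.NAnti h [] []) ∧
    ((∃ h : ι → ι → ι → ι → ℂ, M.IsQuarticCoupling h) ↔
      ∀ a b c d, M.kind a = CausalYM.Kind.massless → M.cubicVariation a b c d = 0) := by
  refine ⟨fun h I J hIJ => ?_, fun h hh => ?_, ?_⟩
  · have hh : I ≠ [] ∨ J ≠ [] ∨ M.IsQuarticCoupling h := hIJ.imp_right .inl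
    exact ⟨CausalYM.YangMills.gaugeIdentity_antiBrst hlin hcur hbil I J hh,
      CausalYM.YangMills.gaugeIdentity_brst hlin hcur hbil I J hh⟩
  · exact ⟨CausalYM.YangMills.gaugeIdentity_antiBrst hlin hcur hbil [] [] (.inr (.inr hh)),
      CausalYM.YangMills.gaugeIdentity_brst hlin hcur hbil [] [] (.inr (.inr hh)), rfl⟩
  · exact CausalYM.YangMills.exists_isQuarticCoupling hlin (M.boseRep hlin hbil)
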